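/- Let $\mathbf{k}$ be a field of characteristic zero. All operads are symmetric operads in cochain complexes over $\mathbf{k}$ (differential of degree $+1$), with arities $n\ge 0$. An operad $P$ is *unitary* if $P(0)=\mathbf{k}\cdot 1$ in degree $0$; morphisms of unitary operads preserve $1$, and $\delta_i\omega=\omega\circ_i 1$ are the restriction operations. For $n\ge 2$, a *unitary arity $n$ principal extension* $P\to P\sqcup_d^\delta\Gamma(E)$ is the unitary operad obtained from $P$ by freely adjoining (i.e. it is universal for maps out of $P$ and compatible maps out of $E$) a graded $\Sigma_n$-module $E$ of generators in arity $n$ with $\partial|_E=d$ and with prescribed restriction operations $\delta_i:E\to P(n-1)$, where $d:E\to ZP(n)$ is $\Sigma_n$-equivariant of degree $+1$ and $d$, $\delta_i$ are compatible with the differential, the symmetric group actions and the restriction operations of $P$. A *unitary Sullivan minimal operad* is a colimit of a sequence $I_+\to P_2\to P_3\to\cdots$ starting at the initial unitary operad $I_+$, in which $P_{n-1}\to P_n$ is a unitary arity $n$ principal extension. A *Sullivan minimal model* of a unitary operad $Q$ is a unitary Sullivan minimal operad $P$ with a quasi-isomorphism of unitary operads $\rho:P\to Q$. Let $\mathrm{Ass}_+$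 be the operad of associative algebras with unit, $\mathrm{Ass}_+(n)=\mathbf{k}[\Sigma_n]$ for $n\ge 0$. An *$A_\infty$-algebra with strict unit* is a cochain complex $A$ with operations $\mu_n:A^{\otimes n}\to A$ of degree $2-n$, $n\ge 2$, such that $$\partial(\mu_n)=\sum_{\substack{p+q+r=n,\ m=p+1+r\\ m,q\ge 2}}(-1)^{qr+p+1}\,\mu_m\circ_{p+1}\mu_q ,$$ together with an element $1\in A$ of degree $0$ such that $\mu_2(1,a)=a=\mu_2(a,1)$ for all $a \in A$, $\partial 1=0$, and $\mu_n(a_1,\dots,1,\dots,a_n)=0$ for all $n>2$ and any position of $1$. **Theorem** ($A_\infty$-algebras with strict unit are the same as $\mathrm{Ass}_{+\infty}$-algebras). The operad $\mathrm{Ass}_+$ has a Sullivan minimal model. Let $\rho:\mathrm{Ass}_{+\infty}\to\mathrm{Ass}_+$ be any Sullivan minimal model. Then there are operations $\mu_n\in\mathrm{Ass}_{+\infty}(n)$ of degree $2-n$, $n\ge 2$, such that $\rho(\mu_2)$ is the associative product, $\partial\mu_n=\sum(-1)^{qr+p+1}\mu_m\circ_{p+1}\mu_q$ (same sum as above), $\mu_2\circ_1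 1=\mathrm{id}=\mu_2\circ_2 1$, and $\mu_n\circ_i 1=0$ for all $n>2$ and $1\le i\le n$; and for every cochain complex $A$, sending an $\mathrm{Ass}_{+\infty}$-algebra structure on $A$ to the actions on $A$ of $1\in\mathrm{Ass}_{+\infty}(0)$ and of the $\mu_n$ is a bijection from the set of $\mathrm{Ass}_{+\infty}$-algebra structures on $A$ to the set of structures of $A_\infty$-algebra with strict unit on $A$. Under these bijections, a morphism of complexes $f:A\to B$ is a morphism of $\mathrm{Ass}_{+\infty}$-algebras if and only if it preserves the unit and commutes with all the operations $\mu_n$. -/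

import Mathlib

open Equiv

universe u v w

namespace StrictUnits

/-! ### Graded vector spaces and cochain complexes

A graded vector space is presented by its total space together with its homogeneous pieces. -/

/-- A `ℤ`-graded vector space: the total space `carrier`, which is the internal direct sum of
its homogeneous pieces `gr p`. -/
structure GrMod (k : Type u) [Field k] where
  carrier : Type v
  [addCommGroup : AddCommGroup carrier]
  [module : Module k carrier]
  gr : ℤ → Submodule k carrier
  isInternal : DirectSum.IsInternal gr

attribute [instance] GrMod.addCommGroup GrMod.module

instance (k : Type u) [Field k] : CoeSort (GrMod.{u, v} k) (Type v) := ⟨GrMod.carrier⟩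

/-- A dg vector space: a cochain complex, with differential of degree `+1`. -/
structure DGMod (k : Type u) [Field k] extends GrMod.{u, v} k where
  d : carrier →ₗ[k] carrier
  d_mem : ∀ {p : ℤ} {x : carrier}, x ∈ gr p → d x ∈ gr (p + 1)
  d_d : ∀ x : carrier, d (d x) = 0

instance (k : Type u) [Field k] : CoeSort (DGMod.{u, v} k) (Type v) :=
  ⟨fun A => A.carrier⟩

/-- A morphism of dg vector spaces: a linear map of degree `0` that commutes with the
differentials. -/
structure DGHom {k : Type u} [Field k] (A : DGMod.{u, v} k) (B : DGMod.{u, w} k) where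
  toFun : A →ₗ[k] B
  map_mem : ∀ {p : ℤ} {x : A}, x ∈ A.gr p → toFun x ∈ B.gr p
  map_d : ∀ x : A, toFun (A.d x) = B.d (toFun x)

/-! ### Inputs of a partial composition

For operations `x` of arity `l` and `y` of arity `m`, the partial composite `x ∘ᵢ y` has arity
`n = l + m - 1`, recorded by an equation `n + 1 = l + m`. Inputs are numbered from `0`. -/

/-- The position, among the inputs of `x ∘ᵢ y`, of the input `b` of `y`. -/
def inner {l m n : ℕ} (h : n + 1 = l + m) (i : Fin l) (b : Fin m) : Fin n :=
  ⟨i.1 + b.1, by omega⟩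

/-- The position, among the inputs of `x ∘ᵢ y`, of the input `c ≠ i` of `x`. -/
def outer {l m n : ℕ} (h : n + 1 = l + m) (i : Fin l) (c : Fin l) (hc : c ≠ i) : Fin n :=
  if hlt : c.1 < i.1 then ⟨c.1, by omega⟩
  else ⟨c.1 + m - 1, by
    have : c.1 ≠ i.1 := fun e => hc (Fin.ext e)
    omega⟩

theorem inner_val {l m n : ℕ} (h : n + 1 = l + m) (i : Fin l) (b : Fin m) :
    (inner h i b).1 = i.1 + b.1 := rfl

theorem outer_val {l m n : ℕ} (h : n + 1 = l + m) (i c : Fin l) (hc : c ≠ i) :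
    (outer h i c hc).1 = if c.1 < i.1 then c.1 else c.1 + m - 1 := by
  unfold outer; split_ifs <;> rfl

theorem val_ne {l : ℕ} {i c : Fin l} (hc : c ≠ i) : c.1 ≠ i.1 := fun e => hc (Fin.ext e)

theorem slot_bijective {l m n : ℕ} (h : n + 1 = l + m) (i : Fin l) :
    Function.Bijective
      (Sum.elim (fun c : {c : Fin l // c ≠ i} => outer h i c.1 c.2) (inner h i)) := by
  constructor
  · rintro (⟨c, hc⟩ | b) (⟨c', hc'⟩ | b') e <;>
      simp only [Sum.elim_inl, Sum.elim_inr, Fin.ext_iff, inner_val, outer_val] at e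
    · have h1 := val_ne hc
      have h2 := val_ne hc'
      have : c = c' := by
        apply Fin.ext
        split_ifs at e <;> omega
      subst this; rfl
    · have h1 := val_ne hc
      split_ifs at e <;> omega
    · have h1 := val_ne hc'
      split_ifs at e <;> omega
    · have : b = b' := Fin.ext (by omega)
      rw [this]
  · intro x
    by_cases h1 : x.1 < i.1
    · refine ⟨Sum.inl ⟨⟨x.1, by omega⟩, fun e => ?_⟩, ?_⟩
      · rw [← e] at h1; simp at h1
      · apply Fin.ext
        simp [outer_val, h1]
    · by_cases h2 : x.1 < i.1 + m
      · exact ⟨Sum.inr ⟨x.1 - i.1, by omega⟩, Fin.ext (by simp [inner_val]; omega)⟩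
      · refine ⟨Sum.inl ⟨⟨x.1 + 1 - m, by omega⟩, fun e => ?_⟩, ?_⟩
        · have := congrArg Fin.val e
          simp only at this
          omega
        · apply Fin.ext
          simp only [Sum.elim_inl, outer_val]
          split_ifs <;> omega

/-- The inputs of `x ∘ᵢ y` are the inputs of `x` other than `i`, and the inputs of `y`. -/
noncomputable def slotEquiv {l m n : ℕ} (h : n + 1 = l + m) (i : Fin l) :
    {c : Fin l // c ≠ i} ⊕ Fin m ≃ Fin n :=
  Equiv.ofBijective _ (slot_bijective h i)

/-- The block permutation `σ ∘ᵢ τ`, which sends the inputs of `x ∘ᵢ y` to those of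
`x ∘_{σ i} y`: it acts through `σ` on the inputs of `x` and through `τ` on the inputs of `y`. -/
noncomputable def blockPerm {l m n : ℕ} (h : n + 1 = l + m) (i : Fin l)
    (σ : Perm (Fin l)) (τ : Perm (Fin m)) : Perm (Fin n) :=
  (slotEquiv h i).symm.trans
    ((Equiv.sumCongr (σ.subtypeEquiv (fun c => (σ.injective.ne_iff (x := c) (y := i)).symm)) τ).trans
      (slotEquiv h (σ i)))

theorem blockPerm_inner {l m n : ℕ} (h : n + 1 = l + m) (i : Fin l)
    (σ : Perm (Fin l)) (τ : Perm (Fin m)) (b : Fin m) :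
    blockPerm h i σ τ (inner h i b) = inner h (σ i) (τ b) := by
  have : inner h i b = slotEquiv h i (Sum.inr b) := rfl
  rw [this]
  simp [blockPerm]
  rfl

theorem blockPerm_outer {l m n : ℕ} (h : n + 1 = l + m) (i : Fin l)
    (σ : Perm (Fin l)) (τ : Perm (Fin m)) (c : Fin l) (hc : c ≠ i) :
    blockPerm h i σ τ (outer h i c hc) = outer h (σ i) (σ c) (σ.injective.ne hc) := by
  have : outer h i c hc = slotEquiv h i (Sum.inl ⟨c, hc⟩) := rfl
  rw [this]
  simp [blockPerm]
  rfl

theorem slot_cases {l m n : ℕ} (h : n + 1 = l + m) (i : Fin l) (x : Fin n) :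
    (∃ c, ∃ hc : c ≠ i, x = outer h i c hc) ∨ ∃ b, x = inner h i b := by
  obtain ⟨(c | b), hs⟩ := (slot_bijective h i).2 x
  · exact Or.inl ⟨c.1, c.2, hs.symm⟩
  · exact Or.inr ⟨b, hs.symm⟩

theorem outer_ne_inner {l m n : ℕ} (h : n + 1 = l + m) (i c : Fin l) (hc : c ≠ i) (b : Fin m) :
    outer h i c hc ≠ inner h i b := by
  intro e
  have h1 := val_ne hc
  simp only [Fin.ext_iff, inner_val, outer_val] at e
  split_ifs at e <;> omega

/-! ### dg operads -/

/-- A symmetric operad in dg vector spaces, with arities `n ≥ 0`, presented by its partial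
compositions `comp h i x y = x ∘ᵢ y`, its right actions `act n σ x = x · σ` of the symmetric
groups and its identity operation `one`. The signs are those of the Koszul rule. -/
structure DGOperad (k : Type u) [Field k] where
  obj : ℕ → DGMod.{u, u} k
  act : ∀ n, Perm (Fin n) → (obj n →ₗ[k] obj n)
  act_one : ∀ n (x : obj n), act n 1 x = x
  act_mul : ∀ n (σ τ : Perm (Fin n)) (x : obj n), act n (σ * τ) x = act n τ (act n σ x)
  act_mem : ∀ n (σ : Perm (Fin n)) {p : ℤ} {x : obj n}, x ∈ (obj n).gr p →
    act n σ x ∈ (obj n).gr p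
  act_d : ∀ n (σ : Perm (Fin n)) (x : obj n), act n σ ((obj n).d x) = (obj n).d (act n σ x)
  comp : ∀ {l m n : ℕ}, n + 1 = l + m → Fin l → (obj l →ₗ[k] obj m →ₗ[k] obj n)
  comp_mem : ∀ {l m n : ℕ} (h : n + 1 = l + m) (i : Fin l) {p q : ℤ} {x : obj l} {y : obj m},
    x ∈ (obj l).gr p → y ∈ (obj m).gr q → comp h i x y ∈ (obj n).gr (p + q)
  comp_d : ∀ {l m n : ℕ} (h : n + 1 = l + m) (i : Fin l) {p : ℤ} {x : obj l} (y : obj m),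
    x ∈ (obj l).gr p →
      (obj n).d (comp h i x y) = comp h i ((obj l).d x) y + p.negOnePow • comp h i x ((obj m).d y)
  one : obj 1
  one_mem : one ∈ (obj 1).gr 0
  one_d : (obj 1).d one = 0
  one_comp : ∀ {n : ℕ} (h : n + 1 = 1 + n) (x : obj n), comp h 0 one x = x
  comp_one : ∀ {n : ℕ} (h : n + 1 = n + 1) (i : Fin n) (x : obj n), comp h i x one = x
  /-- Sequential associativity: `(x ∘ᵢ y) ∘_{i+j} z = x ∘ᵢ (y ∘ⱼ z)`. -/
  assoc_seq : ∀ {l m r n s t : ℕ} (h₁ : n + 1 = l + m) (h₂ : t + 1 = n + r)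
    (h₃ : s + 1 = m + r) (h₄ : t + 1 = l + s) (i : Fin l) (j : Fin m)
    (x : obj l) (y : obj m) (z : obj r),
      comp h₂ (inner h₁ i j) (comp h₁ i x y) z = comp h₄ i x (comp h₃ j y z)
  /-- Parallel associativity: composing `y` and `z` into different inputs `i`, `c` of `x`. -/
  assoc_par : ∀ {l m r n s t : ℕ} (h₁ : n + 1 = l + m) (h₂ : t + 1 = n + r)
    (h₃ : s + 1 = l + r) (h₄ : t + 1 = s + m) (i c : Fin l) (hci : c ≠ i) {p q : ℤ}
    (x : obj l) {y : obj m} {z : obj r}, y ∈ (obj m).gr p → z ∈ (obj r).gr q →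
      comp h₂ (outer h₁ i c hci) (comp h₁ i x y) z
        = (p * q).negOnePow • comp h₄ (outer h₃ c i hci.symm) (comp h₃ c x z) y
  /-- Equivariance: `(x · σ) ∘ᵢ (y · τ) = (x ∘_{σ i} y) · (σ ∘ᵢ τ)`. -/
  equivariance : ∀ {l m n : ℕ} (h : n + 1 = l + m) (i : Fin l) (σ : Perm (Fin l))
    (τ : Perm (Fin m)) (x : obj l) (y : obj m),
      comp h i (act l σ x) (act m τ y) = act n (blockPerm h i σ τ) (comp h (σ i) x y)

/-- A unitary dg operad: `P(0)` is the ground field (in degree `0`), spanned by `unit`. -/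
structure UOperad (k : Type u) [Field k] extends DGOperad.{u} k where
  unit : obj 0
  unit_mem : unit ∈ (obj 0).gr 0
  unit_basis : Function.Bijective (fun c : k => c • unit)

/-- The restriction operation `δᵢ x = x ∘ᵢ 1`. -/
def UOperad.res {k : Type u} [Field k] (P : UOperad.{u} k) {m n : ℕ} (h : m + 1 = n)
    (i : Fin n) (x : P.obj n) : P.obj m :=
  P.comp (l := n) (m := 0) (by omega) i x P.unit

/-- A morphism of unitary dg operads. -/
structure UHom {k : Type u} [Field k] (P Q : UOperad.{u} k) where
  toFun : ∀ n, P.obj n →ₗ[k] Q.obj n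
  map_mem : ∀ n {p : ℤ} {x : P.obj n}, x ∈ (P.obj n).gr p → toFun n x ∈ (Q.obj n).gr p
  map_d : ∀ n (x : P.obj n), toFun n ((P.obj n).d x) = (Q.obj n).d (toFun n x)
  map_act : ∀ n (σ : Perm (Fin n)) (x : P.obj n), toFun n (P.act n σ x) = Q.act n σ (toFun n x)
  map_comp : ∀ {l m n : ℕ} (h : n + 1 = l + m) (i : Fin l) (x : P.obj l) (y : P.obj m),
    toFun n (P.comp h i x y) = Q.comp h i (toFun l x) (toFun m y)
  map_one : toFun 1 P.one = Q.one
  map_unit : toFun 0 P.unit = Q.unit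

/-- A quasi-isomorphism of operads: in every arity, the induced map in cohomology is surjective
and injective. -/
def UHom.IsQuasiIso {k : Type u} [Field k] {P Q : UOperad.{u} k} (f : UHom P Q) : Prop :=
  ∀ n,
    (∀ y : Q.obj n, (Q.obj n).d y = 0 →
      ∃ x : P.obj n, (P.obj n).d x = 0 ∧ ∃ z, y = f.toFun n x + (Q.obj n).d z) ∧
    (∀ x : P.obj n, (P.obj n).d x = 0 → (∃ z, f.toFun n x = (Q.obj n).d z) →
      ∃ w, x = (P.obj n).d w)

/-! ### Sullivan minimal operads, in the unitary setting -/

/-- A graded `Σₙ`-module. -/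
structure SigmaMod (k : Type u) [Field k] (n : ℕ) extends GrMod.{u, u} k where
  act : Perm (Fin n) → (carrier →ₗ[k] carrier)
  act_one : ∀ x, act 1 x = x
  act_mul : ∀ (σ τ : Perm (Fin n)) x, act (σ * τ) x = act τ (act σ x)
  act_mem : ∀ (σ : Perm (Fin n)) {p : ℤ} {x : carrier}, x ∈ gr p → act σ x ∈ gr p

instance (k : Type u) [Field k] (n : ℕ) : CoeSort (SigmaMod.{u} k n) (Type u) :=
  ⟨fun E => E.carrier⟩

/-- Attaching data for a unitary principal extension of `P` by a `Σ`-module `E` concentrated in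
arity `n = m + 1`, with zero differential: an equivariant map `d` of degree `1` from `E` to the
cocycles of `P(n)` and restriction operations `δᵢ : E → P(n - 1)`, compatible with the
differentials, the symmetric group actions and the restriction operations of `P`. -/
structure AttachData {k : Type u} [Field k] (P : UOperad.{u} k) (m : ℕ)
    (E : SigmaMod.{u} k (m + 1)) where
  d : E →ₗ[k] P.obj (m + 1)
  d_mem : ∀ {p : ℤ} {e : E}, e ∈ E.gr p → d e ∈ (P.obj (m + 1)).gr (p + 1)
  d_cocycle : ∀ e : E, (P.obj (m + 1)).d (d e) = 0
  d_act : ∀ (σ : Perm (Fin (m + 1))) (e : E), d (E.act σ e) = P.act (m + 1) σ (d e)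
  δ : Fin (m + 1) → (E →ₗ[k] P.obj m)
  δ_mem : ∀ (i : Fin (m + 1)) {p : ℤ} {e : E}, e ∈ E.gr p → δ i e ∈ (P.obj m).gr p
  δ_d : ∀ (i : Fin (m + 1)) (e : E), (P.obj m).d (δ i e) = P.res rfl i (d e)
  δ_act : ∀ (i : Fin (m + 1)) (σ : Perm (Fin (m + 1))) (e : E),
    δ i (E.act σ e)
      = P.act m (blockPerm (l := m + 1) (m := 0) rfl i σ 1) (δ (σ i) e)
  /-- `δᵢ δⱼ = δⱼ₋₁ δᵢ` for `i < j`. -/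
  δ_δ : ∀ {s : ℕ} (hs : s + 1 = m) (i j : Fin (m + 1)) (hij : i.1 < j.1) (e : E),
    P.res hs ⟨i.1, by omega⟩ (δ j e) = P.res hs ⟨j.1 - 1, by omega⟩ (δ i e)

/-- A pair of maps `φ : P → Q`, `f : E → Q(n)` that is compatible with the attaching data, that
is, with `∂ f = φ d` and `δᵢ f = φ δᵢ`. -/
structure AttachData.Compatible {k : Type u} [Field k] {P : UOperad.{u} k} {m : ℕ}
    {E : SigmaMod.{u} k (m + 1)} (a : AttachData P m E) {Q : UOperad.{u} k} (φ : UHom P Q)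
    (f : E →ₗ[k] Q.obj (m + 1)) : Prop where
  mem : ∀ {p : ℤ} {e : E}, e ∈ E.gr p → f e ∈ (Q.obj (m + 1)).gr p
  act : ∀ (σ : Perm (Fin (m + 1))) (e : E), f (E.act σ e) = Q.act (m + 1) σ (f e)
  d : ∀ e : E, (Q.obj (m + 1)).d (f e) = φ.toFun (m + 1) (a.d e)
  res : ∀ (i : Fin (m + 1)) (e : E), Q.res rfl i (f e) = φ.toFun m (a.δ i e)

/-- `ι : P → P'` together with `j : E → P'(n)` is the unitary principal extension of `P` freely
generated by `E` subject to the attaching data `a`: it is universal among the unitary dg operads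
under `P` that receive a compatible map from `E`. -/
structure IsPrincipalExtension {k : Type u} [Field k] {P P' : UOperad.{u} k} (ι : UHom P P')
    {m : ℕ} {E : SigmaMod.{u} k (m + 1)} (a : AttachData P m E)
    (j : E →ₗ[k] P'.obj (m + 1)) : Prop where
  compatible : a.Compatible ι j
  universal : ∀ (Q : UOperad.{u} k) (φ : UHom P Q) (f : E →ₗ[k] Q.obj (m + 1)),
    a.Compatible φ f →
      ∃! ψ : UHom P' Q, (∀ n x, ψ.toFun n (ι.toFun n x) = φ.toFun n x) ∧
        ∀ e, ψ.toFun (m + 1) (j e) = f e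

/-- A unitary Sullivan minimal operad: the colimit of a sequence of unitary principal extensions
`I₊ → P₂ → P₃ → ⋯` that starts with the initial unitary operad `I₊` and where `Pₙ₋₁ → Pₙ` adds
generators of arity `n`. Here `stage r` is `Pᵣ₊₁`. -/
def IsSullivanMinimal {k : Type u} [Field k] (P : UOperad.{u} k) : Prop :=
  ∃ (stage : ℕ → UOperad.{u} k) (ι : ∀ r, UHom (stage r) (stage (r + 1)))
    (κ : ∀ r, UHom (stage r) P),
    (∀ Q : UOperad.{u} k, ∃! _φ : UHom (stage 0) Q, True) ∧
    (∀ r, ∃ (E : SigmaMod.{u} k (r + 1 + 1)) (a : AttachData (stage r) (r + 1) E)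
      (j : E →ₗ[k] (stage (r + 1)).obj (r + 1 + 1)), IsPrincipalExtension (ι r) a j) ∧
    (∀ r n x, (κ (r + 1)).toFun n ((ι r).toFun n x) = (κ r).toFun n x) ∧
    (∀ (Q : UOperad.{u} k) (g : ∀ r, UHom (stage r) Q),
      (∀ r n x, (g (r + 1)).toFun n ((ι r).toFun n x) = (g r).toFun n x) →
        ∃! ψ : UHom P Q, ∀ r n x, ψ.toFun n ((κ r).toFun n x) = (g r).toFun n x)

/-- A Sullivan minimal model of `Q`, in the unitary setting: a Sullivan minimal operad `P` with a
quasi-isomorphism `ρ : P → Q`. -/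
def IsMinimalModel {k : Type u} [Field k] {P Q : UOperad.{u} k} (ρ : UHom P Q) : Prop :=
  IsSullivanMinimal P ∧ ρ.IsQuasiIso

/-! ### Algebras over an operad -/

section Evaluation

variable {k : Type u} [Field k] (A : DGMod.{u, v} k)

/-- The degree of the inputs that stand before position `i`. -/
def degBefore {n : ℕ} (p : Fin n → ℤ) (i : ℕ) : ℤ :=
  ∑ c : Fin n, if c.1 < i then p c else 0

/-- The Koszul sign of the permutation of inputs of degrees `p` that moves input `i` to
position `σ i`. -/
def koszulSign {n : ℕ} (σ : Perm (Fin n)) (p : Fin n → ℤ) : ℤˣ :=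
  ∏ i : Fin n, ∏ j : Fin n, if i < j ∧ σ j < σ i then (p i * p j).negOnePow else 1

/-- The partial composite `f ∘ᵢ g` of multilinear operations, where `g` has degree `D`, on inputs
`a` of degrees `p`: the operation `g` jumps over the inputs before position `i`. -/
def evalComp {l m n : ℕ} (h : n + 1 = l + m) (i : Fin l)
    (f : MultilinearMap k (fun _ : Fin l => A.carrier) A.carrier)
    (g : MultilinearMap k (fun _ : Fin m => A.carrier) A.carrier) (D : ℤ)
    (p : Fin n → ℤ) (a : Fin n → A) : A :=
  (D * degBefore p i.1).negOnePow •
    f (fun c => if hc : c = i then g (fun b => a (inner h i b)) else a (outer h i c hc))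

/-- The differential `∂ f = d f - (-1)^D f d` of a multilinear operation `f` of degree `D`, on
inputs `a` of degrees `p`. -/
def evalDiff {n : ℕ} (f : MultilinearMap k (fun _ : Fin n => A.carrier) A.carrier) (D : ℤ)
    (p : Fin n → ℤ) (a : Fin n → A) : A :=
  A.d (f a) -
    D.negOnePow •
      ∑ i : Fin n, (degBefore p i.1).negOnePow • f (Function.update a i (A.d (a i)))

end Evaluation

/-- An algebra structure on the dg vector space `A` over the operad `P`, that is, a morphism of dg
operads from `P` to the endomorphism operad of `A`. -/
structure OperadAlgebra {k : Type u} [Field k] (P : DGOperad.{u} k) (A : DGMod.{u, v} k) where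
  θ : ∀ n, P.obj n →ₗ[k] MultilinearMap k (fun _ : Fin n => A.carrier) A.carrier
  θ_mem : ∀ n {D : ℤ} {x : P.obj n} (p : Fin n → ℤ) (a : Fin n → A), x ∈ (P.obj n).gr D →
    (∀ i, a i ∈ A.gr (p i)) → θ n x a ∈ A.gr (D + ∑ i, p i)
  θ_d : ∀ n {D : ℤ} {x : P.obj n} (p : Fin n → ℤ) (a : Fin n → A), x ∈ (P.obj n).gr D →
    (∀ i, a i ∈ A.gr (p i)) → θ n ((P.obj n).d x) a = evalDiff A (θ n x) D p a
  θ_act : ∀ n (σ : Perm (Fin n)) (x : P.obj n) (p : Fin n → ℤ) (a : Fin n → A),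
    (∀ i, a i ∈ A.gr (p i)) →
      θ n (P.act n σ x) a = koszulSign σ p • θ n x (fun j => a (σ.symm j))
  θ_comp : ∀ {l m n : ℕ} (h : n + 1 = l + m) (i : Fin l) {D : ℤ} (x : P.obj l) {y : P.obj m}
    (p : Fin n → ℤ) (a : Fin n → A), y ∈ (P.obj m).gr D → (∀ i, a i ∈ A.gr (p i)) →
      θ n (P.comp h i x y) a = evalComp A h i (θ l x) (θ m y) D p a
  θ_one : ∀ a : Fin 1 → A, θ 1 P.one a = a 0

/-- `f` is a morphism of `P`-algebras. -/
def IsAlgebraHom {k : Type u} [Field k] {P : DGOperad.{u} k} {A : DGMod.{u, v} k}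
    {B : DGMod.{u, w} k} (α : OperadAlgebra P A) (β : OperadAlgebra P B) (f : DGHom A B) : Prop :=
  ∀ n (x : P.obj n) (a : Fin n → A),
    f.toFun (α.θ n x a) = β.θ n x (fun i => f.toFun (a i))

/-! ### `A_∞`-algebras with strict unit -/

/-- The pairs `(m, q)` with `m, q ≥ 2` and `m + q - 1 = n`: the arities of the operations in the
terms `μ_m ∘_{p+1} μ_q` of the `n`-th `A_∞`-relation. -/
abbrev Splitting (n : ℕ) : Type :=
  ↥((Finset.HasAntidiagonal.antidiagonal (n + 1)).filter (fun s : ℕ × ℕ => 2 ≤ s.1 ∧ 2 ≤ s.2))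

theorem Splitting.eq {n : ℕ} (s : Splitting n) : n + 1 = s.1.1 + s.1.2 :=
  (Finset.HasAntidiagonal.mem_antidiagonal.mp (Finset.mem_filter.mp s.2).1).symm

theorem Splitting.le_left {n : ℕ} (s : Splitting n) : 2 ≤ s.1.1 := (Finset.mem_filter.mp s.2).2.1

theorem Splitting.le_right {n : ℕ} (s : Splitting n) : 2 ≤ s.1.2 := (Finset.mem_filter.mp s.2).2.2

/-- The sign `(-1)^{qr + p + 1}` of the term `μ_m ∘_{p+1} μ_q`, where `r = m - 1 - p`. -/
def Splitting.sign {n : ℕ} (s : Splitting n) (p : Fin s.1.1) : ℤˣ :=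
  (-1) ^ (s.1.2 * (s.1.1 - 1 - p.1) + p.1 + 1)

/-- An `A_∞`-algebra structure with strict unit on the dg vector space `A`: operations
`μ n` of degree `2 - n`, for `n ≥ 2`, with
`∂ μ_n = ∑ (-1)^{qr+p+1} μ_m ∘_{p+1} μ_q` over `p + q + r = n`, `m = p + 1 + r`, `m, q ≥ 2`, and
an element `unit` of degree `0` that is a two-sided unit for `μ_2`, is killed by the differential
`μ_1`, and such that `μ_n`, `n > 2`, vanishes as soon as one argument is `unit`. -/
structure StrictlyUnitalAInfinity {k : Type u} [Field k] (A : DGMod.{u, v} k) where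
  μ : ∀ n : ℕ, 2 ≤ n → MultilinearMap k (fun _ : Fin n => A.carrier) A.carrier
  μ_mem : ∀ n (hn : 2 ≤ n) (p : Fin n → ℤ) (a : Fin n → A), (∀ i, a i ∈ A.gr (p i)) →
    μ n hn a ∈ A.gr (2 - (n : ℤ) + ∑ i, p i)
  relation : ∀ n (hn : 2 ≤ n) (p : Fin n → ℤ) (a : Fin n → A), (∀ i, a i ∈ A.gr (p i)) →
    evalDiff A (μ n hn) (2 - (n : ℤ)) p a
      = ∑ s : Splitting n, ∑ i : Fin s.1.1, s.sign i •
          evalComp A s.eq i (μ s.1.1 s.le_left) (μ s.1.2 s.le_right) (2 - (s.1.2 : ℤ)) p a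
  unit : A
  unit_mem : unit ∈ A.gr 0
  d_unit : A.d unit = 0
  unit_left : ∀ a : A, μ 2 le_rfl ![unit, a] = a
  unit_right : ∀ a : A, μ 2 le_rfl ![a, unit] = a
  unit_higher : ∀ n (hn : 2 < n) (a : Fin n → A) (i : Fin n), a i = unit → μ n hn.le a = 0

/-- `f` is a (strict) morphism of `A_∞`-algebras with strict unit: it preserves the unit and
commutes with all operations. -/
def IsStrictHom {k : Type u} [Field k] {A : DGMod.{u, v} k} {B : DGMod.{u, w} k}
    (α : StrictlyUnitalAInfinity A) (β : StrictlyUnitalAInfinity B) (f : DGHom A B) : Prop :=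
  f.toFun α.unit = β.unit ∧
    ∀ n (hn : 2 ≤ n) (a : Fin n → A), f.toFun (α.μ n hn a) = β.μ n hn (fun i => f.toFun (a i))

/-! ### The unitary associative operad -/

section Ass

variable (k : Type u) [Field k]

theorem isInternal_zero (M : Type v) [AddCommGroup M] [Module k M] :
    DirectSum.IsInternal (fun p : ℤ => if p = 0 then (⊤ : Submodule k M) else ⊥) := by
  rw [DirectSum.isInternal_submodule_iff_iSupIndep_and_iSup_eq_top]
  constructor
  · intro p
    by_cases hp : p = 0
    · subst hp
      have : (⨆ j : ℤ, ⨆ _ : j ≠ 0, if j = 0 then (⊤ : Submodule k M) else ⊥) = ⊥ := by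
        simp +contextual
      rw [this]
      exact disjoint_bot_right
    · simp [hp]
  · refine eq_top_iff.mpr ?_
    refine le_trans ?_ (le_iSup _ (0 : ℤ))
    simp

/-- The group algebra `k[Σₙ]`, in degree `0`. -/
noncomputable def assObj (n : ℕ) : DGMod.{u, u} k where
  carrier := Perm (Fin n) →₀ k
  gr p := if p = 0 then ⊤ else ⊥
  isInternal := isInternal_zero k _
  d := 0
  d_mem _ := by simp
  d_d _ := rfl

/-- The right action of `Σₙ` on `k[Σₙ]` by multiplication. -/
noncomputable def assAct (n : ℕ) (σ : Perm (Fin n)) :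
    (Perm (Fin n) →₀ k) →ₗ[k] (Perm (Fin n) →₀ k) :=
  Finsupp.lmapDomain k k (fun π => π * σ)

/-- The bilinear extension of the composition of permutations `(σ, τ) ↦ σ ∘ᵢ τ`. -/
noncomputable def assComp {l m n : ℕ} (h : n + 1 = l + m) (i : Fin l) :
    (Perm (Fin l) →₀ k) →ₗ[k] (Perm (Fin m) →₀ k) →ₗ[k] (Perm (Fin n) →₀ k) :=
  Finsupp.linearCombination k
    (fun π : Perm (Fin l) => Finsupp.lmapDomain k k (fun τ => blockPerm h i π τ))

theorem assAct_single (n : ℕ) (σ π : Perm (Fin n)) (c : k) :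
    assAct k n σ (Finsupp.single π c) = Finsupp.single (π * σ) c := by
  simp [assAct]

theorem assComp_single {l m n : ℕ} (h : n + 1 = l + m) (i : Fin l) (σ : Perm (Fin l))
    (τ : Perm (Fin m)) (c d : k) :
    assComp k h i (Finsupp.single σ c) (Finsupp.single τ d)
      = Finsupp.single (blockPerm h i σ τ) (c * d) := by
  simp [assComp, Finsupp.linearCombination_single]

theorem blockPerm_one_left {n : ℕ} (h : n + 1 = 1 + n) (σ : Perm (Fin 1)) (τ : Perm (Fin n)) :
    blockPerm h 0 σ τ = τ := by
  ext x
  rcases slot_cases h 0 x with ⟨c, hc, rfl⟩ | ⟨b, rfl⟩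
  · exact absurd (Subsingleton.elim c 0) hc
  · have e : ∀ (z : Fin 1) (y : Fin n), inner h z y = y := fun z y =>
      Fin.ext (by simp [inner_val])
    rw [blockPerm_inner, e, e]

theorem blockPerm_one_right {n : ℕ} (h : n + 1 = n + 1) (i : Fin n) (σ : Perm (Fin n))
    (τ : Perm (Fin 1)) : blockPerm h i σ τ = σ := by
  have e : ∀ (z : Fin n) (y : Fin 1), inner h z y = z := fun z y =>
    Fin.ext (by simp [inner_val])
  have e' : ∀ (z c : Fin n) (hc : c ≠ z), outer h z c hc = c := fun z c hc =>
    Fin.ext (by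
      have := val_ne hc
      rw [outer_val]
      split_ifs <;> omega)
  ext x
  rcases slot_cases h i x with ⟨c, hc, rfl⟩ | ⟨b, rfl⟩
  · rw [blockPerm_outer, e', e']
  · rw [blockPerm_inner, e, e]

theorem blockPerm_mul {l m n : ℕ} (h : n + 1 = l + m) (i : Fin l) (σ σ' : Perm (Fin l))
    (τ τ' : Perm (Fin m)) :
    blockPerm h i (σ * σ') (τ * τ') = blockPerm h (σ' i) σ τ * blockPerm h i σ' τ' := by
  ext x
  rcases slot_cases h i x with ⟨c, hc, rfl⟩ | ⟨b, rfl⟩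
  · simp [blockPerm_outer]
  · simp [blockPerm_inner]

section Assoc

variable {l m r n s t : ℕ}

theorem inner_inner (h₁ : n + 1 = l + m) (h₂ : t + 1 = n + r)
    (h₃ : s + 1 = m + r) (h₄ : t + 1 = l + s) (i : Fin l) (j : Fin m) (b : Fin r) :
    inner h₂ (inner h₁ i j) b = inner h₄ i (inner h₃ j b) :=
  Fin.ext (by simp only [inner_val]; omega)

theorem outer_inner_inner (h₁ : n + 1 = l + m) (h₂ : t + 1 = n + r)
    (h₃ : s + 1 = m + r) (h₄ : t + 1 = l + s) (i : Fin l) (j b : Fin m) (hb : b ≠ j)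
    (hb' : inner h₁ i b ≠ inner h₁ i j) :
    outer h₂ (inner h₁ i j) (inner h₁ i b) hb' = inner h₄ i (outer h₃ j b hb) := by
  have := val_ne hb
  apply Fin.ext
  rw [outer_val, inner_val, inner_val, inner_val, outer_val]
  by_cases hlt : b.1 < j.1
  · rw [if_pos hlt, if_pos (by omega)]
  · rw [if_neg hlt, if_neg (by omega)]
    omega

theorem outer_inner_outer (h₁ : n + 1 = l + m) (h₂ : t + 1 = n + r)
    (h₃ : s + 1 = m + r) (h₄ : t + 1 = l + s) (i : Fin l) (j : Fin m) (c : Fin l) (hc : c ≠ i)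
    (hc' : outer h₁ i c hc ≠ inner h₁ i j) :
    outer h₂ (inner h₁ i j) (outer h₁ i c hc) hc' = outer h₄ i c hc := by
  have := val_ne hc
  apply Fin.ext
  simp only [inner_val, outer_val]
  split_ifs <;> omega

theorem inner_outer (h₁ : n + 1 = l + m) (h₂ : t + 1 = n + r)
    (h₃ : s + 1 = l + r) (h₄ : t + 1 = s + m) (i c : Fin l) (hc : c ≠ i) (b : Fin r)
    (hb : inner h₃ c b ≠ outer h₃ c i hc.symm) :
    inner h₂ (outer h₁ i c hc) b = outer h₄ (outer h₃ c i hc.symm) (inner h₃ c b) hb := by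
  have := val_ne hc
  apply Fin.ext
  simp only [inner_val, outer_val]
  split_ifs <;> omega

theorem outer_outer_inner (h₁ : n + 1 = l + m) (h₂ : t + 1 = n + r)
    (h₃ : s + 1 = l + r) (h₄ : t + 1 = s + m) (i c : Fin l) (hc : c ≠ i) (b : Fin m)
    (hb : inner h₁ i b ≠ outer h₁ i c hc) :
    outer h₂ (outer h₁ i c hc) (inner h₁ i b) hb = inner h₄ (outer h₃ c i hc.symm) b :=
  (inner_outer h₃ h₄ h₁ h₂ c i hc.symm b hb).symm

theorem outer_outer_outer (h₁ : n + 1 = l + m) (h₂ : t + 1 = n + r)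
    (h₃ : s + 1 = l + r) (h₄ : t + 1 = s + m) (i c e : Fin l) (hc : c ≠ i) (hi : e ≠ i)
    (he : e ≠ c) (h : outer h₁ i e hi ≠ outer h₁ i c hc)
    (h' : outer h₃ c e he ≠ outer h₃ c i hc.symm) :
    outer h₂ (outer h₁ i c hc) (outer h₁ i e hi) h
      = outer h₄ (outer h₃ c i hc.symm) (outer h₃ c e he) h' := by
  have h1 := val_ne hc
  have h2 := val_ne hi
  have h3 := val_ne he
  have h4 := val_ne h
  have h5 := val_ne h'
  apply Fin.ext
  simp only [outer_val] at *
  split_ifs at * <;> omega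

theorem outer_injective {h : n + 1 = l + m} {i c e : Fin l} {hc : c ≠ i} {he : e ≠ i}
    (hce : outer h i c hc = outer h i e he) : c = e := by
  have := (slot_bijective h i).1 (a₁ := Sum.inl ⟨c, hc⟩) (a₂ := Sum.inl ⟨e, he⟩) hce
  simpa using this

theorem outer_congr (h : n + 1 = l + m) {i i' c c' : Fin l} (hi : i = i') (hc : c = c')
    (h1 : c ≠ i) (h2 : c' ≠ i') : outer h i c h1 = outer h i' c' h2 := by
  subst hi hc; rfl

theorem blockPerm_assoc_seq (h₁ : n + 1 = l + m) (h₂ : t + 1 = n + r)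
    (h₃ : s + 1 = m + r) (h₄ : t + 1 = l + s) (i : Fin l) (j : Fin m) (σ : Perm (Fin l))
    (τ : Perm (Fin m)) (υ : Perm (Fin r)) :
    blockPerm h₂ (inner h₁ i j) (blockPerm h₁ i σ τ) υ
      = blockPerm h₄ i σ (blockPerm h₃ j τ υ) := by
  apply Equiv.ext
  intro x
  rcases slot_cases h₂ (inner h₁ i j) x with ⟨c, hc, rfl⟩ | ⟨b, rfl⟩
  · rcases slot_cases h₁ i c with ⟨c, hci, rfl⟩ | ⟨b, rfl⟩
    · rw [blockPerm_outer, outer_inner_outer h₁ h₂ h₃ h₄, blockPerm_outer h₄]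
      exact (outer_congr h₂ (blockPerm_inner h₁ i σ τ j) (blockPerm_outer h₁ i σ τ c hci) _
        (outer_ne_inner _ _ _ _ _)).trans (outer_inner_outer h₁ h₂ h₃ h₄ _ _ _ _ _)
    · have hb : b ≠ j := fun e => hc (by rw [e])
      rw [blockPerm_outer, outer_inner_inner h₁ h₂ h₃ h₄ _ _ _ hb, blockPerm_inner h₄,
        blockPerm_outer h₃]
      have h5 : inner h₁ (σ i) (τ b) ≠ inner h₁ (σ i) (τ j) := by
        intro e
        rw [← blockPerm_inner, ← blockPerm_inner] at e
        exact hc ((blockPerm h₁ i σ τ).injective e)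
      exact (outer_congr _ (blockPerm_inner _ _ _ _ _) (blockPerm_inner _ _ _ _ _) _ h5).trans
        (outer_inner_inner h₁ h₂ h₃ h₄ _ _ _ _ _)
  · rw [blockPerm_inner, blockPerm_inner, inner_inner h₁ h₂ h₃ h₄, inner_inner h₁ h₂ h₃ h₄,
      blockPerm_inner, blockPerm_inner]

theorem blockPerm_assoc_par (h₁ : n + 1 = l + m) (h₂ : t + 1 = n + r)
    (h₃ : s + 1 = l + r) (h₄ : t + 1 = s + m) (i c : Fin l) (hc : c ≠ i) (σ : Perm (Fin l))
    (τ : Perm (Fin m)) (υ : Perm (Fin r)) :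
    blockPerm h₂ (outer h₁ i c hc) (blockPerm h₁ i σ τ) υ
      = blockPerm h₄ (outer h₃ c i hc.symm) (blockPerm h₃ c σ υ) τ := by
  have hσ := σ.injective.ne hc
  apply Equiv.ext
  intro x
  rcases slot_cases h₂ (outer h₁ i c hc) x with ⟨e, he, rfl⟩ | ⟨b, rfl⟩
  · rcases slot_cases h₁ i e with ⟨e, hei, rfl⟩ | ⟨b, rfl⟩
    · have hec : e ≠ c := by rintro rfl; exact he rfl
      have h5 : outer h₃ c e hec ≠ outer h₃ c i hc.symm := fun z => hei (outer_injective z)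
      rw [blockPerm_outer, outer_outer_outer h₁ h₂ h₃ h₄ i c e hc hei hec he h5,
        blockPerm_outer h₄]
      have h6 : outer h₁ (σ i) (σ e) (σ.injective.ne hei) ≠ outer h₁ (σ i) (σ c) hσ :=
        fun z => hec (σ.injective (outer_injective z))
      have h7 : outer h₃ (σ c) (σ e) (σ.injective.ne hec) ≠ outer h₃ (σ c) (σ i) hσ.symm :=
        fun z => hei (σ.injective (outer_injective z))
      refine (outer_congr h₂ (blockPerm_outer h₁ i σ τ c hc) (blockPerm_outer h₁ i σ τ e hei) _
        h6).trans (Eq.trans ?_ (outer_congr h₄ (blockPerm_outer h₃ c σ υ i hc.symm)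
          (blockPerm_outer h₃ c σ υ e hec) _ h7).symm)
      exact outer_outer_outer h₁ h₂ h₃ h₄ _ _ _ _ _ _ _ _
    · rw [blockPerm_outer, outer_outer_inner h₁ h₂ h₃ h₄, blockPerm_inner h₄,
        blockPerm_outer h₃]
      exact (outer_congr h₂ (blockPerm_outer h₁ i σ τ c hc) (blockPerm_inner h₁ i σ τ b) _
          (outer_ne_inner _ _ _ _ _).symm).trans (outer_outer_inner h₁ h₂ h₃ h₄ _ _ _ _ _)
  · have hb : inner h₃ c b ≠ outer h₃ c i hc.symm := (outer_ne_inner _ _ _ _ _).symm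
    rw [blockPerm_inner, inner_outer h₁ h₂ h₃ h₄ i c hc b hb, blockPerm_outer h₄,
      blockPerm_outer h₁]
    exact Eq.trans (inner_outer h₁ h₂ h₃ h₄ _ _ hσ _ (outer_ne_inner _ _ _ _ _).symm)
      (outer_congr h₄ (blockPerm_outer h₃ c σ υ i hc.symm) (blockPerm_inner h₃ c σ υ b) _ _).symm

end Assoc

theorem mem_ass_gr {n : ℕ} {p : ℤ} {x : assObj k n} (hx : x ∈ (assObj k n).gr p) :
    p = 0 ∨ x = 0 := by
  by_cases hp : p = 0
  · exact Or.inl hp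
  · have h : (assObj k n).gr p = ⊥ := if_neg hp
    rw [h] at hx
    exact Or.inr ((Submodule.mem_bot k).mp hx)

theorem mem_ass_zero {n : ℕ} (x : assObj k n) : x ∈ (assObj k n).gr 0 := by
  have h : (assObj k n).gr 0 = ⊤ := by
    simp only [assObj, if_true]
    rfl
  rw [h]
  exact Submodule.mem_top

theorem assAct_one (n : ℕ) (x : Perm (Fin n) →₀ k) : assAct k n 1 x = x := by
  induction x using Finsupp.induction_linear with
  | zero => exact map_zero _
  | add f g hf hg => rw [map_add, hf, hg]
  | single τ c => rw [assAct_single, mul_one]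

theorem assAct_mul (n : ℕ) (σ τ : Perm (Fin n)) (x : Perm (Fin n) →₀ k) :
    assAct k n (σ * τ) x = assAct k n τ (assAct k n σ x) := by
  induction x using Finsupp.induction_linear with
  | zero => simp only [map_zero]
  | add f g hf hg => simp only [map_add, hf, hg]
  | single τ c => simp only [assAct_single, mul_assoc]

theorem assComp_one_left {n : ℕ} (h : n + 1 = 1 + n) (x : Perm (Fin n) →₀ k) :
    assComp k h 0 (Finsupp.single 1 1) x = x := by
  induction x using Finsupp.induction_linear with
  | zero => exact map_zero _
  | add f g hf hg => rw [map_add, hf, hg]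
  | single τ c => rw [assComp_single, blockPerm_one_left, one_mul]

theorem assComp_one_right {n : ℕ} (h : n + 1 = n + 1) (i : Fin n) (x : Perm (Fin n) →₀ k) :
    assComp k h i x (Finsupp.single 1 1) = x := by
  induction x using Finsupp.induction_linear with
  | zero => rw [map_zero, LinearMap.zero_apply]
  | add f g hf hg => rw [map_add, LinearMap.add_apply, hf, hg]
  | single τ c => rw [assComp_single, blockPerm_one_right, mul_one]

theorem assComp_assoc_seq {l m r n s t : ℕ} (h₁ : n + 1 = l + m) (h₂ : t + 1 = n + r)
    (h₃ : s + 1 = m + r) (h₄ : t + 1 = l + s) (i : Fin l) (j : Fin m)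
    (x : Perm (Fin l) →₀ k) (y : Perm (Fin m) →₀ k) (z : Perm (Fin r) →₀ k) :
    assComp k h₂ (inner h₁ i j) (assComp k h₁ i x y) z = assComp k h₄ i x (assComp k h₃ j y z) := by
  induction x using Finsupp.induction_linear with
  | zero => simp only [map_zero, LinearMap.zero_apply]
  | add f g hf hg => simp only [map_add, LinearMap.add_apply, hf, hg]
  | single σ a =>
    induction y using Finsupp.induction_linear with
    | zero => simp only [map_zero, LinearMap.zero_apply]
    | add f g hf hg => simp only [map_add, LinearMap.add_apply, hf, hg]
    | single τ b =>
      induction z using Finsupp.induction_linear with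
      | zero => simp only [map_zero]
      | add f g hf hg => simp only [map_add, hf, hg]
      | single υ c => simp only [assComp_single, mul_assoc, blockPerm_assoc_seq h₁ h₂ h₃ h₄]

theorem assComp_assoc_par {l m r n s t : ℕ} (h₁ : n + 1 = l + m) (h₂ : t + 1 = n + r)
    (h₃ : s + 1 = l + r) (h₄ : t + 1 = s + m) (i c : Fin l) (hc : c ≠ i)
    (x : Perm (Fin l) →₀ k) (y : Perm (Fin m) →₀ k) (z : Perm (Fin r) →₀ k) :
    assComp k h₂ (outer h₁ i c hc) (assComp k h₁ i x y) z
      = assComp k h₄ (outer h₃ c i hc.symm) (assComp k h₃ c x z) y := by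
  induction x using Finsupp.induction_linear with
  | zero => simp only [map_zero, LinearMap.zero_apply]
  | add f g hf hg => simp only [map_add, LinearMap.add_apply, hf, hg]
  | single σ a =>
    induction y using Finsupp.induction_linear with
    | zero => simp only [map_zero, LinearMap.zero_apply]
    | add f g hf hg => simp only [map_add, LinearMap.add_apply, hf, hg]
    | single τ b =>
      induction z using Finsupp.induction_linear with
      | zero => simp only [map_zero, LinearMap.zero_apply]
      | add f g hf hg => simp only [map_add, LinearMap.add_apply, hf, hg]
      | single υ d =>
        simp only [assComp_single, blockPerm_assoc_par h₁ h₂ h₃ h₄, mul_right_comm]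

theorem assComp_equivariance {l m n : ℕ} (h : n + 1 = l + m) (i : Fin l) (σ : Perm (Fin l))
    (τ : Perm (Fin m)) (x : Perm (Fin l) →₀ k) (y : Perm (Fin m) →₀ k) :
    assComp k h i (assAct k l σ x) (assAct k m τ y)
      = assAct k n (blockPerm h i σ τ) (assComp k h (σ i) x y) := by
  induction x using Finsupp.induction_linear with
  | zero => simp only [map_zero, LinearMap.zero_apply]
  | add f g hf hg => simp only [map_add, LinearMap.add_apply, hf, hg]
  | single σ a =>
    induction y using Finsupp.induction_linear with
    | zero => simp only [map_zero]
    | add f g hf hg => simp only [map_add, hf, hg]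
    | single τ b => simp only [assAct_single, assComp_single, blockPerm_mul]

theorem ass_zero_mem {n : ℕ} (p : ℤ) {x : Perm (Fin n) →₀ k} (hx : x = 0) :
    (show assObj k n from x) ∈ (assObj k n).gr p := by
  subst hx
  exact Submodule.zero_mem _

theorem ass_unit_basis :
    Function.Bijective (fun c : k => c • (Finsupp.single 1 1 : Perm (Fin 0) →₀ k)) := by
  constructor
  · intro a b hab
    simpa using DFunLike.congr_fun hab (1 : Perm (Fin 0))
  · intro x
    refine ⟨x 1, ?_⟩
    refine Finsupp.ext fun π => ?_
    rw [Subsingleton.elim π 1]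
    simp

/-- The operad `Ass₊` of associative algebras with unit: `Ass₊(n) = k[Σₙ]` for all `n ≥ 0`, in
degree `0`, where the permutation `σ` stands for the operation
`(x₁, …, xₙ) ↦ x_{σ⁻¹(1)} ⋯ x_{σ⁻¹(n)}`. -/
noncomputable def assPlus : UOperad.{u} k where
  obj := assObj k
  act := assAct k
  act_one := assAct_one k
  act_mul := assAct_mul k
  act_mem n σ {p x} hx := by
    rcases mem_ass_gr k hx with hp | hx0
    · rw [hp]; exact mem_ass_zero k _
    · exact ass_zero_mem k _ ((congrArg (assAct k n σ) hx0).trans (map_zero _))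
  act_d n σ x := map_zero (assAct k n σ)
  comp h i := assComp k h i
  comp_mem {l m n} h i p q x y hx hy := by
    rcases mem_ass_gr k hx with hp | hx0
    · rcases mem_ass_gr k hy with hq | hy0
      · rw [hp, hq]; exact mem_ass_zero k _
      · exact ass_zero_mem k _ ((congrArg (assComp k h i x) hy0).trans (map_zero _))
    · exact ass_zero_mem k _ ((congrArg (fun z => assComp k h i z y) hx0).trans
        (LinearMap.map_zero₂ (assComp k h i) y))
  comp_d {l m n} h i p x y _ := by
    have h1 : ∀ (x : Perm (Fin l) →₀ k) (y : Perm (Fin m) →₀ k),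
        assComp k h i 0 y + p.negOnePow • assComp k h i x 0 = 0 := fun x y => by
      rw [map_zero, map_zero, LinearMap.zero_apply, smul_zero, add_zero]
    exact (h1 x y).symm
  one := (Finsupp.single 1 1 : Perm (Fin 1) →₀ k)
  one_mem := mem_ass_zero k _
  one_d := rfl
  one_comp := assComp_one_left k
  comp_one := assComp_one_right k
  assoc_seq := assComp_assoc_seq k
  assoc_par {l m r n s t} h₁ h₂ h₃ h₄ i c hci p q x y z hy hz := by
    refine (assComp_assoc_par k h₁ h₂ h₃ h₄ i c hci x y z).trans ?_
    rcases mem_ass_gr k hy with hp | hy0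
    · rw [hp, zero_mul, Int.negOnePow_zero, one_smul]
      rfl
    · have h1 : assComp k h₄ (outer h₃ c i hci.symm) (assComp k h₃ c x z) y = 0 :=
        (congrArg _ hy0).trans (map_zero _)
      exact h1.trans ((congrArg _ h1).trans (smul_zero _)).symm
  equivariance := assComp_equivariance k
  unit := (Finsupp.single 1 1 : Perm (Fin 0) →₀ k)
  unit_mem := mem_ass_zero k _
  unit_basis := ass_unit_basis k

/-- The product `(x₁, x₂) ↦ x₁ x₂` of `Ass₊(2)`. -/
noncomputable def assMul : (assPlus k).obj 2 :=
  (Finsupp.single 1 1 : Perm (Fin 2) →₀ k)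

end Ass

end StrictUnits

namespace StrictUnits

/-! ### Signs -/

section Signs

variable {k : Type u} [Field k]

theorem map_sign {M : Type v} {M' : Type w} [AddCommGroup M] [AddCommGroup M'] [Module k M]
    [Module k M'] (f : M →ₗ[k] M') (e : ℤˣ) (x : M) : f (e • x) = e • f x := by
  rw [Units.smul_def, Units.smul_def, map_zsmul]

theorem map_sign₂ {M : Type*} {M' : Type*} {M'' : Type*} [AddCommGroup M] [AddCommGroup M']
    [AddCommGroup M''] [Module k M] [Module k M'] [Module k M'']
    (f : M →ₗ[k] M' →ₗ[k] M'') (e : ℤˣ) (x : M) (y : M') : f (e • x) y = e • f x y := by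
  rw [map_sign, Units.smul_def, Units.smul_def, LinearMap.smul_apply]

theorem sign_smul_mem {M : Type*} [AddCommGroup M] [Module k M] (S : Submodule k M) (e : ℤˣ)
    {x : M} (hx : x ∈ S) : e • x ∈ S := by
  rw [Units.smul_def]
  exact zsmul_mem hx _

theorem sign_self_smul {M : Type*} [AddCommGroup M] (e : ℤˣ) (x : M) : e • e • x = x := by
  rw [smul_smul, Int.units_mul_self, one_smul]

theorem sign_smul_comm {M : Type*} [AddCommGroup M] (e e' : ℤˣ) (x : M) :
    e • e' • x = e' • e • x := by
  rw [smul_smul, smul_smul, mul_comm]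

theorem sign_comm_field {M : Type*} [AddCommGroup M] [Module k M] (e : ℤˣ) (c : k) (x : M) :
    e • c • x = c • e • x := by
  rw [Units.smul_def, Units.smul_def, smul_comm]

theorem negOnePow_congr {a b : ℤ} (h : (a : ZMod 2) = b) : a.negOnePow = b.negOnePow := by
  rw [Int.negOnePow_eq_iff, even_iff_two_dvd, ← Int.modEq_iff_dvd]
  exact ((ZMod.intCast_eq_intCast_iff a b 2).mp h).symm

theorem neg_negOnePow_smul {M : Type*} [AddCommGroup M] (a : ℤ) (x : M) :
    (a + 1).negOnePow • x = -(a.negOnePow • x) := by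
  rw [Int.negOnePow_succ, Units.neg_smul]

end Signs

/-! ### Intervals -/

/-- `I` comes after `J` in the prefix order of intervals. -/
def After (I J : ℕ × ℕ) : Prop := J.1 < I.1 ∨ (J.1 = I.1 ∧ I.2 < J.2)

instance (I J : ℕ × ℕ) : Decidable (After I J) := by unfold After; infer_instance

/-- The half-open intervals `I` and `J` do not cross. -/
def NonCrossing (I J : ℕ × ℕ) : Prop :=
  I.2 ≤ J.1 ∨ J.2 ≤ I.1 ∨ (I.1 ≤ J.1 ∧ J.2 ≤ I.2) ∨ (J.1 ≤ I.1 ∧ I.2 ≤ J.2)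

/-- The number of pairs in `S × T` that are in the wrong order. -/
def inversions (S T : Finset (ℕ × ℕ)) : ℤ := ∑ I ∈ S, ∑ J ∈ T, if After I J then 1 else 0

theorem inversions_union_left {S S' : Finset (ℕ × ℕ)} (h : Disjoint S S') (T : Finset (ℕ × ℕ)) :
    inversions (S ∪ S') T = inversions S T + inversions S' T :=
  Finset.sum_union h

theorem inversions_union_right (S : Finset (ℕ × ℕ)) {T T' : Finset (ℕ × ℕ)} (h : Disjoint T T') :
    inversions S (T ∪ T') = inversions S T + inversions S T' := by
  simp only [inversions, Finset.sum_union h, Finset.sum_add_distrib]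

theorem inversions_image {f : ℕ → ℕ} (hf : StrictMono f) (S T : Finset (ℕ × ℕ)) :
    inversions (S.image (Prod.map f f)) (T.image (Prod.map f f)) = inversions S T := by
  have hi : Function.Injective (Prod.map f f) := hf.injective.prodMap hf.injective
  unfold inversions
  rw [Finset.sum_image hi.injOn]
  refine Finset.sum_congr rfl fun I _ => ?_
  rw [Finset.sum_image hi.injOn]
  refine Finset.sum_congr rfl fun J _ => ?_
  simp only [After, Prod.map_fst, Prod.map_snd, hf.lt_iff_lt, hf.injective.eq_iff]

theorem inversions_swap {S T : Finset (ℕ × ℕ)} (h : Disjoint S T) :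
    inversions S T + inversions T S = S.card * T.card := by
  have h1 : inversions T S = ∑ I ∈ S, ∑ J ∈ T, if After J I then 1 else 0 := Finset.sum_comm
  rw [h1, inversions, ← Finset.sum_add_distrib]
  have h2 : ∀ I ∈ S, ((∑ J ∈ T, if After I J then (1 : ℤ) else 0) +
      ∑ J ∈ T, if After J I then 1 else 0) = T.card := by
    intro I hI
    rw [← Finset.sum_add_distrib]
    have : ∀ J ∈ T, ((if After I J then (1 : ℤ) else 0) + if After J I then 1 else 0) = 1 := by
      intro J hJ
      have hne : I ≠ J := fun e => Finset.disjoint_left.mp h hI (e ▸ hJ)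
      have hne' : ¬(I.1 = J.1 ∧ I.2 = J.2) := fun e => hne (Prod.ext e.1 e.2)
      unfold After
      split_ifs <;> omega
    rw [Finset.sum_congr rfl this]
    simp
  rw [Finset.sum_congr rfl h2]
  simp

theorem inversions_empty_left (T : Finset (ℕ × ℕ)) : inversions ∅ T = 0 := by simp [inversions]

theorem inversions_empty_right (T : Finset (ℕ × ℕ)) : inversions T ∅ = 0 := by simp [inversions]

/-- The reindexing of endpoints of intervals when input `i` is replaced by `m` inputs. -/
def stretch (i m x : ℕ) : ℕ := if x ≤ i then x else x + m - 1

theorem stretch_strictMono {i m : ℕ} (hm : 1 ≤ m) : StrictMono (stretch i m) := by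
  intro a b h
  unfold stretch
  split_ifs <;> omega

theorem shift_strictMono (i : ℕ) : StrictMono (fun x : ℕ => x + i) := fun _ _ h =>
  Nat.add_lt_add_right h i

/-- The images of intervals when input `i` is replaced by `m` inputs. -/
def expand (i m : ℕ) (S : Finset (ℕ × ℕ)) : Finset (ℕ × ℕ) :=
  S.image (Prod.map (stretch i m) (stretch i m))

/-- Translation of intervals. -/
def shift (i : ℕ) (S : Finset (ℕ × ℕ)) : Finset (ℕ × ℕ) :=
  S.image (Prod.map (fun x => x + i) (fun x => x + i))

theorem nonCrossing_symm {I J : ℕ × ℕ} (h : NonCrossing I J) : NonCrossing J I := by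
  unfold NonCrossing at *; omega

theorem nonCrossing_map {f : ℕ → ℕ} (hf : StrictMono f) {I J : ℕ × ℕ} :
    NonCrossing (Prod.map f f I) (Prod.map f f J) ↔ NonCrossing I J := by
  simp only [NonCrossing, Prod.map_fst, Prod.map_snd, hf.le_iff_le]

/-! ### Planar trees -/

/-- The finite set `S` of intervals is the set of vertices of a planar tree with `n` leaves whose
vertices have arity at least `2`: a vertex is recorded as the interval of the leaves above it. -/
structure IsTree (n : ℕ) (S : Finset (ℕ × ℕ)) : Prop where
  bounds : ∀ I ∈ S, I.1 + 2 ≤ I.2 ∧ I.2 ≤ n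
  root : 2 ≤ n → (0, n) ∈ S
  nonCrossing : ∀ I ∈ S, ∀ J ∈ S, NonCrossing I J

theorem IsTree.eq_empty {n : ℕ} (hn : n ≤ 1) {S : Finset (ℕ × ℕ)} (h : IsTree n S) : S = ∅ :=
  Finset.eq_empty_of_forall_notMem fun I hI => by have := h.bounds I hI; omega

theorem isTree_empty {n : ℕ} (hn : n ≤ 1) : IsTree n ∅ :=
  ⟨by simp, fun h => by omega, by simp⟩

/-- The set of planar trees with `n` leaves. -/
abbrev Tree (n : ℕ) : Type := {S : Finset (ℕ × ℕ) // IsTree n S}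

theorem isTree_corolla {n : ℕ} (hn : 2 ≤ n) : IsTree n {(0, n)} := by
  refine ⟨?_, fun _ => Finset.mem_singleton_self _, ?_⟩
  · intro I hI; rw [Finset.mem_singleton] at hI; subst hI; simpa using hn
  · intro I hI J hJ
    rw [Finset.mem_singleton] at hI hJ; subst hI hJ
    unfold NonCrossing; simp

theorem mem_expand {i m : ℕ} {S : Finset (ℕ × ℕ)} {I : ℕ × ℕ} :
    I ∈ expand i m S ↔ ∃ J ∈ S, (stretch i m J.1, stretch i m J.2) = I := by
  simp only [expand, Finset.mem_image]; rfl

theorem mem_shift {i : ℕ} {S : Finset (ℕ × ℕ)} {I : ℕ × ℕ} :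
    I ∈ shift i S ↔ ∃ J ∈ S, (J.1 + i, J.2 + i) = I := by
  simp only [shift, Finset.mem_image]; rfl

theorem disjoint_expand_shift {m : ℕ} (i : ℕ) {S T : Finset (ℕ × ℕ)}
    (hS : ∀ I ∈ S, I.1 + 2 ≤ I.2) (hT : ∀ I ∈ T, I.1 + 2 ≤ I.2 ∧ I.2 ≤ m) :
    Disjoint (expand i m S) (shift i T) := by
  rw [Finset.disjoint_left]
  intro I hI hI'
  obtain ⟨J, hJ, rfl⟩ := mem_expand.mp hI
  obtain ⟨K, hK, e⟩ := mem_shift.mp hI'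
  have h1 := hS J hJ
  have h2 := hT K hK
  simp only [stretch, Prod.mk.injEq] at e
  split_ifs at e <;> omega

/-- The set of vertices of a composite of trees. -/
def graft (i m : ℕ) (S T : Finset (ℕ × ℕ)) : Finset (ℕ × ℕ) := expand i m S ∪ shift i T

theorem IsTree.comp {l m n : ℕ} (h : n + 1 = l + m) (hm : 1 ≤ m) {i : ℕ} (hi : i < l)
    {S T : Finset (ℕ × ℕ)} (hS : IsTree l S) (hT : IsTree m T) : IsTree n (graft i m S T) := by
  refine ⟨?_, ?_, ?_⟩
  · intro I hI
    rcases Finset.mem_union.mp hI with hI | hI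
    · obtain ⟨J, hJ, rfl⟩ := mem_expand.mp hI
      have := hS.bounds J hJ
      simp only [stretch]
      split_ifs <;> omega
    · obtain ⟨J, hJ, rfl⟩ := mem_shift.mp hI
      have := hT.bounds J hJ
      simp only; omega
  · intro hn
    by_cases hl : 2 ≤ l
    · refine Finset.mem_union_left _ (mem_expand.mpr ⟨_, hS.root hl, ?_⟩)
      simp only [stretch, Prod.mk.injEq]
      split_ifs <;> omega
    · refine Finset.mem_union_right _ (mem_shift.mpr ⟨_, hT.root (by omega), ?_⟩)
      simp only [Prod.mk.injEq]; omega
  · have key : ∀ I ∈ expand i m S, ∀ J ∈ shift i T, NonCrossing I J := by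
      intro I hI J hJ
      obtain ⟨I, hI', rfl⟩ := mem_expand.mp hI
      obtain ⟨J, hJ', rfl⟩ := mem_shift.mp hJ
      have h1 := hS.bounds I hI'
      have h2 := hT.bounds J hJ'
      simp only [NonCrossing, stretch]
      split_ifs <;> omega
    intro I hI J hJ
    rcases Finset.mem_union.mp hI with hI | hI <;> rcases Finset.mem_union.mp hJ with hJ | hJ
    · obtain ⟨I, hI', rfl⟩ := Finset.mem_image.mp hI
      obtain ⟨J, hJ', rfl⟩ := Finset.mem_image.mp hJ
      exact (nonCrossing_map (stretch_strictMono hm)).mpr (hS.nonCrossing I hI' J hJ')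
    · exact key I hI J hJ
    · exact nonCrossing_symm (key J hJ I hI)
    · obtain ⟨I, hI', rfl⟩ := Finset.mem_image.mp hI
      obtain ⟨J, hJ', rfl⟩ := Finset.mem_image.mp hJ
      exact (nonCrossing_map (shift_strictMono i)).mpr (hT.nonCrossing I hI' J hJ')

theorem card_expand {i m : ℕ} (hm : 1 ≤ m) (S : Finset (ℕ × ℕ)) : (expand i m S).card = S.card :=
  Finset.card_image_of_injective _
    ((stretch_strictMono hm).injective.prodMap (stretch_strictMono hm).injective)

theorem card_shift (i : ℕ) (S : Finset (ℕ × ℕ)) : (shift i S).card = S.card :=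
  Finset.card_image_of_injective _
    ((shift_strictMono i).injective.prodMap (shift_strictMono i).injective)

theorem card_graft {i m : ℕ} (hm : 1 ≤ m) {S T : Finset (ℕ × ℕ)}
    (hS : ∀ I ∈ S, I.1 + 2 ≤ I.2) (hT : ∀ I ∈ T, I.1 + 2 ≤ I.2 ∧ I.2 ≤ m) :
    (graft i m S T).card = S.card + T.card := by
  rw [graft, Finset.card_union_of_disjoint (disjoint_expand_shift i hS hT), card_expand hm,
    card_shift]

theorem IsTree.two_le {n : ℕ} {S : Finset (ℕ × ℕ)} (h : IsTree n S) : ∀ I ∈ S, I.1 + 2 ≤ I.2 :=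
  fun I hI => (h.bounds I hI).1

section GraftAssoc

theorem expand_expand_inner {i j m r s : ℕ} (hm : 1 ≤ m) (hr : 1 ≤ r) (hj : j < m)
    (hs : s + 1 = m + r) (S : Finset (ℕ × ℕ)) :
    expand (i + j) r (expand i m S) = expand i s S := by
  unfold expand
  rw [Finset.image_image]
  refine congrArg (fun f => Finset.image f S) (funext fun I => ?_)
  simp only [Function.comp, Prod.map, stretch, Prod.mk.injEq]
  constructor <;> split_ifs <;> omega

theorem expand_shift_inner (i j r : ℕ) (T : Finset (ℕ × ℕ)) :
    expand (i + j) r (shift i T) = shift i (expand j r T) := by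
  unfold expand shift
  rw [Finset.image_image, Finset.image_image]
  refine congrArg (fun f => Finset.image f T) (funext fun I => ?_)
  simp only [Function.comp, Prod.map, stretch, Prod.mk.injEq]
  constructor <;> split_ifs <;> omega

theorem shift_shift (i j : ℕ) (U : Finset (ℕ × ℕ)) : shift (i + j) U = shift i (shift j U) := by
  unfold shift
  rw [Finset.image_image]
  refine congrArg (fun f => Finset.image f U) (funext fun I => ?_)
  simp only [Function.comp, Prod.map, Prod.mk.injEq]
  constructor <;> omega

theorem expand_union (i m : ℕ) (S T : Finset (ℕ × ℕ)) :
    expand i m (S ∪ T) = expand i m S ∪ expand i m T := Finset.image_union _ _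

theorem shift_union (i : ℕ) (S T : Finset (ℕ × ℕ)) : shift i (S ∪ T) = shift i S ∪ shift i T :=
  Finset.image_union _ _

theorem graft_assoc_seq {i j m r s : ℕ} (hm : 1 ≤ m) (hr : 1 ≤ r) (hj : j < m)
    (hs : s + 1 = m + r) (S T U : Finset (ℕ × ℕ)) :
    graft (i + j) r (graft i m S T) U = graft i s S (graft j r T U) := by
  simp only [graft, expand_union, shift_union, expand_expand_inner hm hr hj hs,
    expand_shift_inner, shift_shift, Finset.union_assoc]

theorem expand_expand_outer {i c m r : ℕ} (hm : 1 ≤ m) (hr : 1 ≤ r) (hic : i < c)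
    (S : Finset (ℕ × ℕ)) :
    expand (c + m - 1) r (expand i m S) = expand i m (expand c r S) := by
  unfold expand
  rw [Finset.image_image, Finset.image_image]
  refine congrArg (fun f => Finset.image f S) (funext fun I => ?_)
  simp only [Function.comp, Prod.map, stretch, Prod.mk.injEq]
  constructor <;> split_ifs <;> omega

theorem expand_shift_outer {i c m r : ℕ} (hic : i < c) {T : Finset (ℕ × ℕ)}
    (hT : ∀ I ∈ T, I.1 + 2 ≤ I.2 ∧ I.2 ≤ m) :
    expand (c + m - 1) r (shift i T) = shift i T := by
  unfold expand shift
  rw [Finset.image_image]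
  refine Finset.image_congr fun I hI => ?_
  have := hT I hI
  simp only [Function.comp, Prod.map, stretch, Prod.mk.injEq]
  constructor <;> split_ifs <;> omega

theorem expand_shift_outer' {i c m : ℕ} (hm : 1 ≤ m) (hic : i < c) {U : Finset (ℕ × ℕ)}
    (hU : ∀ I ∈ U, I.1 + 2 ≤ I.2) :
    expand i m (shift c U) = shift (c + m - 1) U := by
  unfold expand shift
  rw [Finset.image_image]
  refine Finset.image_congr fun I hI => ?_
  have := hU I hI
  simp only [Function.comp, Prod.map, stretch, Prod.mk.injEq]
  constructor <;> split_ifs <;> omega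

theorem graft_assoc_par {i c m r : ℕ} (hm : 1 ≤ m) (hr : 1 ≤ r) (hic : i < c)
    {S T U : Finset (ℕ × ℕ)} (hT : ∀ I ∈ T, I.1 + 2 ≤ I.2 ∧ I.2 ≤ m)
    (hU : ∀ I ∈ U, I.1 + 2 ≤ I.2) :
    graft (c + m - 1) r (graft i m S T) U = graft i m (graft c r S U) T := by
  simp only [graft, expand_union, expand_expand_outer hm hr hic, expand_shift_outer hic hT,
    expand_shift_outer' hm hic hU, Finset.union_assoc]
  rw [Finset.union_comm (shift i T)]

end GraftAssoc

/-! ### The graded vector spaces spanned by trees -/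

section TreeMod

variable (k : Type u) [Field k]

/-- The vector space with basis the set of planar trees with `n` leaves. -/
abbrev TreeMod (n : ℕ) : Type u := Tree n →₀ k

open Classical in
/-- The basis element of a tree `S`, or `0` if `S` is not a tree. -/
noncomputable def tree (n : ℕ) (S : Finset (ℕ × ℕ)) : TreeMod k n :=
  if h : IsTree n S then Finsupp.single ⟨S, h⟩ 1 else 0

variable {k}

theorem tree_of {n : ℕ} {S : Finset (ℕ × ℕ)} (h : IsTree n S) :
    tree k n S = Finsupp.single ⟨S, h⟩ 1 := dif_pos h

theorem tree_of_not {n : ℕ} {S : Finset (ℕ × ℕ)} (h : ¬IsTree n S) : tree k n S = 0 := dif_neg h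

@[elab_as_elim]
theorem treeMod_induction {n : ℕ} {C : TreeMod k n → Prop} (x : TreeMod k n) (zero : C 0)
    (add : ∀ x y, C x → C y → C (x + y)) (smul : ∀ (c : k) x, C x → C (c • x))
    (basis : ∀ S, IsTree n S → C (tree k n S)) : C x := by
  induction x using Finsupp.induction_linear with
  | zero => exact zero
  | add f g hf hg => exact add f g hf hg
  | single S c =>
    have := smul c _ (basis S.1 S.2)
    rwa [tree_of S.2, Finsupp.smul_single, smul_eq_mul, mul_one] at this

/-- The linear map with prescribed values on trees. -/
noncomputable def treeLift {n : ℕ} {M : Type*} [AddCommGroup M] [Module k M] (f : Tree n → M) :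
    TreeMod k n →ₗ[k] M := Finsupp.linearCombination k f

theorem treeLift_tree {n : ℕ} {M : Type*} [AddCommGroup M] [Module k M] (f : Tree n → M)
    {S : Finset (ℕ × ℕ)} (h : IsTree n S) : treeLift f (tree k n S) = f ⟨S, h⟩ := by
  rw [tree_of h, treeLift, Finsupp.linearCombination_single, one_smul]

/-- The exponent of the sign of the operadic desuspension. -/
def twist (l m i : ℕ) (t : ℤ) : ℤ := (l + 1) * t + (l + 1 + i) * (m + 1)

/-- Partial composition of trees, for `m ≥ 1`. -/
noncomputable def treeComp {l m n : ℕ} (_h : n + 1 = l + m) (i : Fin l) :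
    TreeMod k l →ₗ[k] TreeMod k m →ₗ[k] TreeMod k n :=
  treeLift fun S => treeLift fun T =>
    (twist l m i T.1.card + inversions (expand i m S.1) (shift i T.1)).negOnePow •
      tree k n (graft i m S.1 T.1)

theorem treeComp_tree {l m n : ℕ} (h : n + 1 = l + m) (i : Fin l) {S T : Finset (ℕ × ℕ)}
    (hS : IsTree l S) (hT : IsTree m T) :
    treeComp h i (tree k l S) (tree k m T)
      = (twist l m i T.card + inversions (expand i m S) (shift i T)).negOnePow •
        tree k n (graft i m S T) := by
  rw [treeComp, treeLift_tree _ hS, treeLift_tree _ hT]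

theorem treeComp_assoc_seq {l m r n s t : ℕ} (h₁ : n + 1 = l + m) (h₂ : t + 1 = n + r)
    (h₃ : s + 1 = m + r) (h₄ : t + 1 = l + s) (hr : 1 ≤ r) (i : Fin l) (j : Fin m)
    (x : TreeMod k l) (y : TreeMod k m) (z : TreeMod k r) :
    treeComp h₂ (inner h₁ i j) (treeComp h₁ i x y) z
      = treeComp h₄ i x (treeComp h₃ j y z) := by
  have hm : 1 ≤ m := by have := j.2; omega
  induction x using treeMod_induction with
  | zero => simp only [map_zero, LinearMap.zero_apply]
  | add f g hf hg => simp only [map_add, LinearMap.add_apply, hf, hg]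
  | smul c f hf => simp only [map_smul, LinearMap.smul_apply, hf]
  | basis S hS =>
    induction y using treeMod_induction with
    | zero => simp only [map_zero, LinearMap.zero_apply]
    | add f g hf hg => simp only [map_add, LinearMap.add_apply, hf, hg]
    | smul c f hf => simp only [map_smul, LinearMap.smul_apply, hf]
    | basis T hT =>
      induction z using treeMod_induction with
      | zero => simp only [map_zero]
      | add f g hf hg => simp only [map_add, hf, hg]
      | smul c f hf => simp only [map_smul, hf]
      | basis U hU =>
        have e2 : graft (i + j) r (graft i m S T) U = graft i s S (graft j r T U) :=
          graft_assoc_seq hm hr j.2 h₃ S T U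
        rw [treeComp_tree h₁ i hS hT, map_sign₂,
          treeComp_tree h₂ _ (hS.comp h₁ hm i.2 hT) hU, treeComp_tree h₃ j hT hU, map_sign,
          treeComp_tree h₄ i hS (hT.comp h₃ hr j.2 hU), inner_val, e2, smul_smul, smul_smul,
          ← Int.negOnePow_add, ← Int.negOnePow_add]
        congr 1
        apply negOnePow_congr
        have d1 : Disjoint (expand (i + j) r (expand i m S)) (expand (i + j) r (shift i T)) := by
          unfold expand
          rw [Finset.disjoint_image
            ((stretch_strictMono hr).injective.prodMap (stretch_strictMono hr).injective)]
          exact disjoint_expand_shift i hS.two_le hT.bounds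
        have d2 : Disjoint (shift i (expand j r T)) (shift i (shift j U)) := by
          unfold shift
          rw [Finset.disjoint_image
            ((shift_strictMono i).injective.prodMap (shift_strictMono i).injective)]
          exact disjoint_expand_shift j hT.two_le hU.bounds
        have e3 : inversions (expand (i + j) r (expand i m S)) (expand (i + j) r (shift i T))
            = inversions (expand i m S) (shift i T) := inversions_image (stretch_strictMono hr) _ _
        have e4 : inversions (shift i (expand j r T)) (shift i (shift j U))
            = inversions (expand j r T) (shift j U) := inversions_image (shift_strictMono i) _ _
        have e5 : inversions (expand (↑i + ↑j) r (graft i m S T)) (shift (i + j) U)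
            = inversions (expand (i + j) r (expand i m S)) (shift (i + j) U)
              + inversions (expand (i + j) r (shift i T)) (shift (i + j) U) := by
          rw [graft, expand_union, inversions_union_left d1]
        have e6 : inversions (expand i s S) (shift i (graft j r T U))
            = inversions (expand i s S) (shift i (expand j r T))
              + inversions (expand i s S) (shift i (shift j U)) := by
          rw [graft, shift_union, inversions_union_right _ d2]
        rw [e5, e6, ← e3, ← e4, shift_shift, expand_shift_inner, expand_expand_inner hm hr j.2 h₃,
          card_graft hr hT.two_le hU.bounds]
        have c1 : (n : ZMod 2) + 1 = l + m := by exact_mod_cast congrArg (Nat.cast (R := ZMod 2)) h₁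
        have c2 : (s : ZMod 2) + 1 = m + r := by exact_mod_cast congrArg (Nat.cast (R := ZMod 2)) h₃
        unfold twist
        push_cast
        grind

end TreeMod

end StrictUnits

namespace StrictUnits

section TreeMod

variable {k : Type u} [Field k]

theorem treeComp_assoc_par_tree {l m r n s t : ℕ} (h₁ : n + 1 = l + m) (h₂ : t + 1 = n + r)
    (h₃ : s + 1 = l + r) (h₄ : t + 1 = s + m) (hm : 1 ≤ m) (hr : 1 ≤ r) (i c : Fin l)
    (hci : c ≠ i) (hic : i.1 < c.1) {S T U : Finset (ℕ × ℕ)} (hS : IsTree l S) (hT : IsTree m T)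
    (hU : IsTree r U) :
    treeComp h₂ (outer h₁ i c hci) (treeComp h₁ i (tree k l S) (tree k m T)) (tree k r U)
      = ((T.card + 1 - m) * (U.card + 1 - r) : ℤ).negOnePow •
        treeComp h₄ (outer h₃ c i hci.symm) (treeComp h₃ c (tree k l S) (tree k r U))
          (tree k m T) := by
  have o1 : (outer h₁ i c hci).1 = c.1 + m - 1 := by rw [outer_val, if_neg (by omega)]
  have o2 : (outer h₃ c i hci.symm).1 = i.1 := by rw [outer_val, if_pos hic]
  have e2 : graft (c + m - 1) r (graft i m S T) U = graft i m (graft c r S U) T :=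
    graft_assoc_par hm hr hic hT.bounds hU.two_le
  rw [treeComp_tree h₁ i hS hT, map_sign₂, treeComp_tree h₂ _ (hS.comp h₁ hm i.2 hT) hU,
    treeComp_tree h₃ c hS hU, map_sign₂, treeComp_tree h₄ _ (hS.comp h₃ hr c.2 hU) hT, o1, o2,
    e2, smul_smul, smul_smul, smul_smul, ← Int.negOnePow_add, ← Int.negOnePow_add,
    ← Int.negOnePow_add]
  congr 1
  apply negOnePow_congr
  have d1 : Disjoint (expand (c + m - 1) r (expand i m S))
      (expand (c + m - 1) r (shift i T)) := by
    unfold expand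
    rw [Finset.disjoint_image
      ((stretch_strictMono hr).injective.prodMap (stretch_strictMono hr).injective)]
    exact disjoint_expand_shift i hS.two_le hT.bounds
  have d2 : Disjoint (expand i m (expand c r S)) (expand i m (shift c U)) := by
    unfold expand
    rw [Finset.disjoint_image
      ((stretch_strictMono hm).injective.prodMap (stretch_strictMono hm).injective)]
    exact disjoint_expand_shift c hS.two_le hU.bounds
  have e3 : inversions (expand (c + m - 1) r (expand i m S)) (expand (c + m - 1) r (shift i T))
      = inversions (expand i m S) (shift i T) := inversions_image (stretch_strictMono hr) _ _
  have e4 : inversions (expand i m (expand c r S)) (expand i m (shift c U))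
      = inversions (expand c r S) (shift c U) := inversions_image (stretch_strictMono hm) _ _
  have e5 : inversions (expand (c + m - 1) r (graft i m S T)) (shift (c + m - 1) U)
      = inversions (expand (c + m - 1) r (expand i m S)) (shift (c + m - 1) U)
        + inversions (expand (c + m - 1) r (shift i T)) (shift (c + m - 1) U) := by
    rw [graft, expand_union, inversions_union_left d1]
  have e6 : inversions (expand i m (graft c r S U)) (shift i T)
      = inversions (expand i m (expand c r S)) (shift i T)
        + inversions (expand i m (shift c U)) (shift i T) := by
    rw [graft, expand_union, inversions_union_left d2]
  have d3 : Disjoint (shift i.1 T) (shift (c.1 + m - 1) U) := by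
    rw [Finset.disjoint_left]
    intro I hI hI'
    obtain ⟨J, hJ, rfl⟩ := mem_shift.mp hI
    obtain ⟨K, hK, e⟩ := mem_shift.mp hI'
    have h1 := hT.bounds J hJ
    simp only [Prod.mk.injEq] at e
    omega
  have e7 := inversions_swap d3
  rw [card_shift, card_shift] at e7
  rw [e5, e6, ← e3, ← e4, expand_expand_outer hm hr hic, expand_shift_outer hic hT.bounds,
    expand_shift_outer' hm hic hU.two_le]
  have e8 := congrArg (Int.cast (R := ZMod 2)) e7
  have c1 : (n : ZMod 2) + 1 = l + m := by exact_mod_cast congrArg (Nat.cast (R := ZMod 2)) h₁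
  have c2 : (s : ZMod 2) + 1 = l + r := by exact_mod_cast congrArg (Nat.cast (R := ZMod 2)) h₃
  have c3 : ((c.1 + m - 1 : ℕ) : ZMod 2) + 1 = (c.1 : ZMod 2) + m := by
    exact_mod_cast congrArg (Nat.cast (R := ZMod 2)) (show (c.1 + m - 1) + 1 = c.1 + m by omega)
  unfold twist
  push_cast at e8 ⊢
  grind

/-- Trees of cohomological degree `p`. -/
def treeDeg {n : ℕ} (S : Finset (ℕ × ℕ)) : ℤ := S.card - (n - 1 : ℕ)

theorem treeDeg_of_pos {n : ℕ} (hn : 1 ≤ n) (S : Finset (ℕ × ℕ)) :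
    treeDeg (n := n) S = S.card + 1 - n := by
  unfold treeDeg; omega

/-- The homogeneous pieces of the graded vector space of trees. -/
noncomputable def treeGr (k : Type u) [Field k] (n : ℕ) (p : ℤ) : Submodule k (TreeMod k n) :=
  Finsupp.supported k k {S : Tree n | treeDeg (n := n) S.1 = p}

theorem tree_mem {n : ℕ} {S : Finset (ℕ × ℕ)} {p : ℤ}
    (hp : IsTree n S → treeDeg (n := n) S = p) : tree k n S ∈ treeGr k n p := by
  by_cases h : IsTree n S
  · rw [tree_of h]
    exact Finsupp.single_mem_supported k _ (hp h)
  · rw [tree_of_not h]; exact Submodule.zero_mem _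

/-- Induction on homogeneous elements. -/
@[elab_as_elim]
theorem treeGr_induction {n : ℕ} {p : ℤ} {C : ∀ x : TreeMod k n, x ∈ treeGr k n p → Prop}
    {x : TreeMod k n} (hx : x ∈ treeGr k n p) (zero : C 0 (Submodule.zero_mem _))
    (add : ∀ x y hx hy, C x hx → C y hy → C (x + y) (Submodule.add_mem _ hx hy))
    (smul : ∀ (c : k) x hx, C x hx → C (c • x) (Submodule.smul_mem _ c hx))
    (basis : ∀ S, IsTree n S → ∀ hp : treeDeg (n := n) S = p,
      C (tree k n S) (tree_mem fun _ => hp)) : C x hx := by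
  have hx' := hx
  rw [treeGr, Finsupp.supported_eq_span_single] at hx'
  suffices h : ∃ h, C x h from h.2
  clear hx
  induction hx' using Submodule.span_induction with
  | mem x hx =>
    obtain ⟨S, hS, rfl⟩ := hx
    have := basis _ S.2 hS
    simp only [tree_of S.2] at this
    exact ⟨_, this⟩
  | zero => exact ⟨_, zero⟩
  | add x y _ _ h h' => exact ⟨_, add x y _ _ h.2 h'.2⟩
  | smul c x _ h => exact ⟨_, smul c x _ h.2⟩

theorem treeComp_mem {l m n : ℕ} (h : n + 1 = l + m) (hm : 1 ≤ m) (i : Fin l) {p q : ℤ}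
    {x : TreeMod k l} {y : TreeMod k m} (hx : x ∈ treeGr k l p) (hy : y ∈ treeGr k m q) :
    treeComp h i x y ∈ treeGr k n (p + q) := by
  induction hx using treeGr_induction with
  | zero => rw [map_zero]; exact Submodule.zero_mem _
  | add x y _ _ hx hy => rw [map_add]; exact Submodule.add_mem _ hx hy
  | smul c x _ hx => rw [map_smul]; exact Submodule.smul_mem _ _ hx
  | basis S hS hp =>
    induction hy using treeGr_induction with
    | zero => rw [map_zero]; exact Submodule.zero_mem _
    | add x y _ _ hx hy => rw [map_add]; exact Submodule.add_mem _ hx hy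
    | smul c x _ hx => rw [map_smul]; exact Submodule.smul_mem _ _ hx
    | basis T hT hq =>
      rw [treeComp_tree h i hS hT]
      refine sign_smul_mem _ _ (tree_mem fun _ => ?_)
      have hl := i.2
      rw [treeDeg_of_pos (by omega)] at hp hq ⊢
      rw [card_graft hm hS.two_le hT.bounds]
      push_cast
      omega

theorem treeComp_assoc_par {l m r n s t : ℕ} (h₁ : n + 1 = l + m) (h₂ : t + 1 = n + r)
    (h₃ : s + 1 = l + r) (h₄ : t + 1 = s + m) (hm : 1 ≤ m) (hr : 1 ≤ r) (i c : Fin l)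
    (hci : c ≠ i) {p q : ℤ} (x : TreeMod k l) {y : TreeMod k m} {z : TreeMod k r}
    (hy : y ∈ treeGr k m p) (hz : z ∈ treeGr k r q) :
    treeComp h₂ (outer h₁ i c hci) (treeComp h₁ i x y) z
      = (p * q).negOnePow •
        treeComp h₄ (outer h₃ c i hci.symm) (treeComp h₃ c x z) y := by
  induction x using treeMod_induction with
  | zero => simp only [map_zero, LinearMap.zero_apply, smul_zero]
  | add f g hf hg => simp only [map_add, LinearMap.add_apply, hf, hg, smul_add]
  | smul c f hf => simp only [map_smul, LinearMap.smul_apply, hf, sign_comm_field]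
  | basis S hS =>
    induction hy using treeGr_induction with
    | zero => simp only [map_zero, LinearMap.zero_apply, smul_zero]
    | add f g _ _ hf hg => simp only [map_add, LinearMap.add_apply, hf, hg, smul_add]
    | smul c f _ hf => simp only [map_smul, LinearMap.smul_apply, hf, sign_comm_field]
    | basis T hT hp =>
      induction hz using treeGr_induction with
      | zero => simp only [map_zero, LinearMap.zero_apply, smul_zero]
      | add f g _ _ hf hg => simp only [map_add, LinearMap.add_apply, hf, hg, smul_add]
      | smul c f _ hf => simp only [map_smul, LinearMap.smul_apply, hf, sign_comm_field]
      | basis U hU hq =>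
        rw [treeDeg_of_pos (by omega)] at hp hq
        subst hp hq
        rcases lt_or_gt_of_ne (val_ne hci) with hlt | hlt
        · rw [treeComp_assoc_par_tree h₃ h₄ h₁ h₂ hr hm c i hci.symm hlt hS hU hT, smul_smul,
            mul_comm (U.card + 1 - (r : ℤ)), Int.units_mul_self, one_smul]
        · exact treeComp_assoc_par_tree h₁ h₂ h₃ h₄ hm hr i c hci hlt hS hT hU

theorem treeComp_one_left {n : ℕ} (h : n + 1 = 1 + n) (x : TreeMod k n) :
    treeComp h 0 (tree k 1 ∅) x = x := by
  induction x using treeMod_induction with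
  | zero => exact map_zero _
  | add f g hf hg => rw [map_add, hf, hg]
  | smul c f hf => rw [map_smul, hf]
  | basis S hS =>
    have h1 : (expand (0 : Fin 1) n ∅) = ∅ := rfl
    have h2 : shift (0 : Fin 1) S = S := by
      simp only [shift, Fin.val_zero, add_zero, Prod.map_id']
      exact Finset.image_id
    rw [treeComp_tree h 0 (isTree_empty le_rfl) hS, graft, h1, h2, Finset.empty_union,
      inversions_empty_left, Int.negOnePow_even, one_smul]
    exact ⟨S.card + n + 1, by unfold twist; push_cast; simp; ring⟩

theorem treeComp_one_right {n : ℕ} (h : n + 1 = n + 1) (i : Fin n) (x : TreeMod k n) :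
    treeComp h i x (tree k 1 ∅) = x := by
  induction x using treeMod_induction with
  | zero => rw [map_zero]; rfl
  | add f g hf hg => rw [map_add, LinearMap.add_apply, hf, hg]
  | smul c f hf => rw [map_smul, LinearMap.smul_apply, hf]
  | basis S hS =>
    have h1 : shift i ∅ = ∅ := rfl
    have h2 : expand i 1 S = S := by
      have : ∀ x, stretch i 1 x = x := fun x => by unfold stretch; split_ifs <;> omega
      simp only [expand, funext this, Prod.map_id']
      exact Finset.image_id
    rw [treeComp_tree h i hS (isTree_empty le_rfl), graft, h1, h2, Finset.union_empty,
      inversions_empty_right, Int.negOnePow_even, one_smul]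
    exact ⟨n + 1 + i, by unfold twist; push_cast; simp; ring⟩

/-! ### The differential of trees -/

/-- The intervals that may occur in a tree with `n` leaves. -/
def intervals (n : ℕ) : Finset (ℕ × ℕ) :=
  (Finset.range (n + 1) ×ˢ Finset.range (n + 1)).filter fun I => I.1 + 2 ≤ I.2

theorem mem_intervals {n : ℕ} {I : ℕ × ℕ} : I ∈ intervals n ↔ I.1 + 2 ≤ I.2 ∧ I.2 ≤ n := by
  simp only [intervals, Finset.mem_filter, Finset.mem_product, Finset.mem_range]
  omega

/-- The term of the differential of `S` that inserts the interval `I`. -/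
noncomputable def treeInsert (k : Type u) [Field k] (n : ℕ) (I : ℕ × ℕ) (S : Finset (ℕ × ℕ)) :
    TreeMod k n :=
  if I ∈ S then 0 else (inversions {I} S).negOnePow • tree k n (insert I S)

/-- The differential of trees: it is the sum over all ways to insert a vertex. -/
noncomputable def treeD (k : Type u) [Field k] (n : ℕ) : TreeMod k n →ₗ[k] TreeMod k n :=
  treeLift fun S => ∑ I ∈ intervals n, treeInsert k n I S.1

theorem treeD_tree {n : ℕ} {S : Finset (ℕ × ℕ)} (hS : IsTree n S) :
    treeD k n (tree k n S) = ∑ I ∈ intervals n, treeInsert k n I S :=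
  treeLift_tree _ hS

theorem treeInsert_of_not {n : ℕ} {I : ℕ × ℕ} {S : Finset (ℕ × ℕ)}
    (h : ¬IsTree n (insert I S)) : treeInsert k n I S = 0 := by
  unfold treeInsert
  split_ifs
  · rfl
  · rw [tree_of_not h, smul_zero]

theorem treeInsert_of_notMem {n : ℕ} {I : ℕ × ℕ} {S : Finset (ℕ × ℕ)} (h : I ∉ S) :
    treeInsert k n I S = (inversions {I} S).negOnePow • tree k n (insert I S) := if_neg h

theorem IsTree.of_subset {n : ℕ} {S T : Finset (ℕ × ℕ)} (hT : IsTree n T) (hST : S ⊆ T)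
    (hS : 2 ≤ n → (0, n) ∈ S) : IsTree n S :=
  ⟨fun I hI => hT.bounds I (hST hI), hS, fun I hI J hJ => hT.nonCrossing I (hST hI) J (hST hJ)⟩

theorem IsTree.of_insert {n : ℕ} {S : Finset (ℕ × ℕ)} {I J : ℕ × ℕ} (hS : IsTree n S)
    (h : IsTree n (insert I (insert J S))) : IsTree n (insert J S) :=
  h.of_subset (Finset.subset_insert _ _) fun hn => Finset.mem_insert_of_mem (hS.root hn)

theorem inversions_insert_right (S : Finset (ℕ × ℕ)) {J : ℕ × ℕ} {T : Finset (ℕ × ℕ)}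
    (h : J ∉ T) : inversions S (insert J T) = inversions S {J} + inversions S T := by
  rw [Finset.insert_eq, inversions_union_right _ (Finset.disjoint_singleton_left.mpr h)]

theorem inversions_insert_left (S : Finset (ℕ × ℕ)) {J : ℕ × ℕ} {T : Finset (ℕ × ℕ)}
    (h : J ∉ T) : inversions (insert J T) S = inversions {J} S + inversions T S := by
  rw [Finset.insert_eq, inversions_union_left (Finset.disjoint_singleton_left.mpr h)]

theorem inversions_singleton_swap {I J : ℕ × ℕ} (h : I ≠ J) :
    inversions {I} {J} + inversions {J} {I} = 1 := by
  have := inversions_swap (S := {I}) (T := {J}) (by simpa using h)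
  simpa using this

theorem treeD_treeD [CharZero k] {n : ℕ} (x : TreeMod k n) : treeD k n (treeD k n x) = 0 := by
  induction x using treeMod_induction with
  | zero => simp only [map_zero]
  | add f g hf hg => simp only [map_add, hf, hg, add_zero]
  | smul c f hf => simp only [map_smul, hf, smul_zero]
  | basis S hS =>
    let g : ℕ × ℕ → ℕ × ℕ → TreeMod k n := fun I J =>
      if I ∈ S ∨ J ∈ S ∨ I = J then 0
      else (inversions {I} S + inversions {J} (insert I S)).negOnePow •
        tree k n (insert J (insert I S))
    have h1 : ∀ I, treeD k n (treeInsert k n I S) = ∑ J ∈ intervals n, g I J := by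
      intro I
      by_cases hI : I ∈ S
      · simp [g, treeInsert, hI]
      · by_cases hT : IsTree n (insert I S)
        · rw [treeInsert_of_notMem hI, map_sign, treeD_tree hT, Finset.smul_sum]
          refine Finset.sum_congr rfl fun J _ => ?_
          simp only [g, treeInsert]
          by_cases hJ : J ∈ insert I S
          · have : I ∈ S ∨ J ∈ S ∨ I = J := by
              rcases Finset.mem_insert.mp hJ with e | e
              · exact Or.inr (Or.inr e.symm)
              · exact Or.inr (Or.inl e)
            rw [if_pos hJ, if_pos this, smul_zero]
          · have : ¬(I ∈ S ∨ J ∈ S ∨ I = J) := by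
              rintro (e | e | e)
              · exact hI e
              · exact hJ (Finset.mem_insert_of_mem e)
              · exact hJ (e ▸ Finset.mem_insert_self _ _)
            rw [if_neg hJ, if_neg this, smul_smul, ← Int.negOnePow_add]
        · rw [treeInsert_of_not hT, map_zero]
          refine (Finset.sum_eq_zero fun J _ => ?_).symm
          simp only [g]
          rw [tree_of_not fun h => hT (hS.of_insert h), smul_zero, ite_self]
    have h2 : ∀ I J, g I J = -g J I := by
      intro I J
      simp only [g]
      by_cases h : I ∈ S ∨ J ∈ S ∨ I = J
      · rw [if_pos h, if_pos (by tauto), neg_zero]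
      · rw [if_neg h, if_neg (by tauto), Finset.insert_comm, ← neg_negOnePow_smul]
        congr 1
        apply negOnePow_congr
        push Not at h
        rw [inversions_insert_right _ h.1, inversions_insert_right _ h.2.1]
        have := congrArg (Int.cast (R := ZMod 2)) (inversions_singleton_swap h.2.2)
        push_cast at this ⊢
        grind
    have h3 : treeD k n (treeD k n (tree k n S)) = ∑ I ∈ intervals n, ∑ J ∈ intervals n, g I J := by
      rw [treeD_tree hS, map_sum]
      exact Finset.sum_congr rfl fun I _ => h1 I
    have h4 : treeD k n (treeD k n (tree k n S)) = -treeD k n (treeD k n (tree k n S)) := by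
      conv_lhs => rw [h3, Finset.sum_comm]
      rw [h3, ← Finset.sum_neg_distrib]
      refine Finset.sum_congr rfl fun I _ => ?_
      rw [← Finset.sum_neg_distrib]
      exact Finset.sum_congr rfl fun J _ => h2 _ _
    exact self_eq_neg.mp h4

theorem treeD_mem {n : ℕ} {p : ℤ} {x : TreeMod k n} (hx : x ∈ treeGr k n p) :
    treeD k n x ∈ treeGr k n (p + 1) := by
  induction hx using treeGr_induction with
  | zero => rw [map_zero]; exact Submodule.zero_mem _
  | add x y _ _ hx hy => rw [map_add]; exact Submodule.add_mem _ hx hy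
  | smul c x _ hx => rw [map_smul]; exact Submodule.smul_mem _ _ hx
  | basis S hS hp =>
    rw [treeD_tree hS]
    refine Submodule.sum_mem _ fun I _ => ?_
    unfold treeInsert
    split_ifs with h
    · exact Submodule.zero_mem _
    · refine sign_smul_mem _ _ (tree_mem fun _ => ?_)
      unfold treeDeg at *
      rw [Finset.card_insert_of_notMem h]
      push_cast; omega

end TreeMod

end StrictUnits

namespace StrictUnits

section TreeMod

variable {k : Type u} [Field k]

theorem treeD_one : treeD k 1 (tree k 1 ∅) = 0 := by
  rw [treeD_tree (isTree_empty le_rfl)]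
  refine Finset.sum_eq_zero fun I hI => treeInsert_of_not fun h => ?_
  exact absurd (h.eq_empty le_rfl) (Finset.insert_ne_empty _ _)

theorem expand_insert (i m : ℕ) (I : ℕ × ℕ) (S : Finset (ℕ × ℕ)) :
    expand i m (insert I S) = insert (stretch i m I.1, stretch i m I.2) (expand i m S) :=
  Finset.image_insert _ _ _

theorem shift_insert (i : ℕ) (I : ℕ × ℕ) (S : Finset (ℕ × ℕ)) :
    shift i (insert I S) = insert (I.1 + i, I.2 + i) (shift i S) :=
  Finset.image_insert _ _ _

theorem graft_insert_left (i m : ℕ) (I : ℕ × ℕ) (S T : Finset (ℕ × ℕ)) :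
    graft i m (insert I S) T = insert (stretch i m I.1, stretch i m I.2) (graft i m S T) := by
  rw [graft, expand_insert, Finset.insert_union, graft]

theorem graft_insert_right (i m : ℕ) (I : ℕ × ℕ) (S T : Finset (ℕ × ℕ)) :
    graft i m S (insert I T) = insert (I.1 + i, I.2 + i) (graft i m S T) := by
  rw [graft, shift_insert, Finset.union_insert, graft]

theorem expand_mem_iff {i m : ℕ} (hm : 1 ≤ m) {I : ℕ × ℕ} {S : Finset (ℕ × ℕ)} :
    (stretch i m I.1, stretch i m I.2) ∈ expand i m S ↔ I ∈ S :=
  ((stretch_strictMono hm).injective.prodMap (stretch_strictMono hm).injective).mem_finset_image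

theorem shift_mem_iff {i : ℕ} {I : ℕ × ℕ} {S : Finset (ℕ × ℕ)} :
    (I.1 + i, I.2 + i) ∈ shift i S ↔ I ∈ S :=
  ((shift_strictMono i).injective.prodMap (shift_strictMono i).injective).mem_finset_image

theorem expand_mem_graft {i m l : ℕ} (hm : 1 ≤ m) {I : ℕ × ℕ} (hI : I.1 + 2 ≤ I.2)
    {S T : Finset (ℕ × ℕ)} (hT : IsTree m T) (hS : IsTree l S) :
    (stretch i m I.1, stretch i m I.2) ∈ graft i m S T ↔ I ∈ S := by
  have hd := disjoint_expand_shift i (S := insert I S) (T := T) (m := m)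
    (by intro J hJ; rcases Finset.mem_insert.mp hJ with rfl | hJ
        · exact hI
        · exact hS.two_le J hJ) hT.bounds
  rw [graft, Finset.mem_union, expand_mem_iff hm]
  refine or_iff_left fun h => Finset.disjoint_left.mp hd ?_ h
  rw [expand_insert]
  exact Finset.mem_insert_self _ _

theorem shift_mem_graft {i m l : ℕ} {J : ℕ × ℕ} (hJ : J.1 + 2 ≤ J.2 ∧ J.2 ≤ m)
    {S T : Finset (ℕ × ℕ)} (hT : IsTree m T) (hS : IsTree l S) :
    (J.1 + i, J.2 + i) ∈ graft i m S T ↔ J ∈ T := by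
  have hd := disjoint_expand_shift i (S := S) (T := insert J T) (m := m) hS.two_le
    (by intro K hK; rcases Finset.mem_insert.mp hK with rfl | hK
        · exact hJ
        · exact hT.bounds K hK)
  rw [graft, Finset.mem_union, shift_mem_iff]
  refine or_iff_right fun h => Finset.disjoint_left.mp hd h ?_
  rw [shift_insert]
  exact Finset.mem_insert_self _ _

theorem IsTree.of_graft_left {l m n : ℕ} (hm : 1 ≤ m) {i : ℕ}
    {S T : Finset (ℕ × ℕ)} {I : ℕ × ℕ} (hI : I ∈ intervals l) (hS : IsTree l S)
    (h : IsTree n (graft i m (insert I S) T)) : IsTree l (insert I S) := by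
  refine ⟨?_, fun hl => Finset.mem_insert_of_mem (hS.root hl), fun J hJ K hK => ?_⟩
  · intro J hJ
    rcases Finset.mem_insert.mp hJ with rfl | hJ
    · exact mem_intervals.mp hI
    · exact hS.bounds J hJ
  · exact (nonCrossing_map (stretch_strictMono hm)).mp (h.nonCrossing _
      (Finset.mem_union_left _ (Finset.mem_image_of_mem _ hJ)) _
      (Finset.mem_union_left _ (Finset.mem_image_of_mem _ hK)))

theorem IsTree.of_graft_right {m n i l : ℕ} {S T : Finset (ℕ × ℕ)} {I : ℕ × ℕ}
    (hI : I ∈ intervals m) (hT : IsTree m T)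
    (h : IsTree n (graft i l S (insert I T))) : IsTree m (insert I T) := by
  refine ⟨?_, fun hl => Finset.mem_insert_of_mem (hT.root hl), fun J hJ K hK => ?_⟩
  · intro J hJ
    rcases Finset.mem_insert.mp hJ with rfl | hJ
    · exact mem_intervals.mp hI
    · exact hT.bounds J hJ
  · exact (nonCrossing_map (shift_strictMono i)).mp (h.nonCrossing _
      (Finset.mem_union_right _ (Finset.mem_image_of_mem _ hJ)) _
      (Finset.mem_union_right _ (Finset.mem_image_of_mem _ hK)))

theorem treeInsert_expand {l m n : ℕ} (h : n + 1 = l + m) (hm : 1 ≤ m) (i : Fin l)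
    {S T : Finset (ℕ × ℕ)} (hS : IsTree l S) (hT : IsTree m T) {I : ℕ × ℕ}
    (hI : I ∈ intervals l) :
    (twist l m i T.card + inversions (expand i m S) (shift i T)).negOnePow •
        treeInsert k n (stretch i m I.1, stretch i m I.2) (graft i m S T)
      = treeComp h i (treeInsert k l I S) (tree k m T) := by
  by_cases hIS : I ∈ S
  · rw [treeInsert, if_pos ((expand_mem_graft hm (mem_intervals.mp hI).1 hT hS).mpr hIS),
      treeInsert, if_pos hIS, smul_zero, map_zero, LinearMap.zero_apply]
  · rw [treeInsert_of_notMem fun e => hIS ((expand_mem_graft hm (mem_intervals.mp hI).1 hT hS).mp e),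
      treeInsert_of_notMem hIS, ← graft_insert_left, map_sign₂]
    by_cases hIT : IsTree l (insert I S)
    · rw [treeComp_tree h i hIT hT, smul_smul, smul_smul, ← Int.negOnePow_add,
        ← Int.negOnePow_add]
      congr 2
      have e1 : inversions {(stretch i m I.1, stretch i m I.2)} (graft i m S T)
          = inversions {I} S + inversions {(stretch i m I.1, stretch i m I.2)} (shift i T) := by
        rw [graft, inversions_union_right _ (disjoint_expand_shift _ hS.two_le hT.bounds)]
        congr 1
        exact inversions_image (stretch_strictMono hm) {I} S
      rw [e1, expand_insert, inversions_insert_left _ fun e => hIS ((expand_mem_iff hm).mp e)]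
      ring
    · rw [tree_of_not hIT, tree_of_not fun e => hIT (IsTree.of_graft_left hm hI hS e), smul_zero,
        smul_zero, map_zero, LinearMap.zero_apply, smul_zero]

theorem treeInsert_shift {l m n : ℕ} (h : n + 1 = l + m) (hm : 1 ≤ m) (i : Fin l)
    {S T : Finset (ℕ × ℕ)} (hS : IsTree l S) (hT : IsTree m T) {I : ℕ × ℕ}
    (hI : I ∈ intervals m) :
    (twist l m i T.card + inversions (expand i m S) (shift i T)).negOnePow •
        treeInsert k n (I.1 + i, I.2 + i) (graft i m S T)
      = (S.card + 1 - l : ℤ).negOnePow • treeComp h i (tree k l S) (treeInsert k m I T) := by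
  by_cases hIT : I ∈ T
  · rw [treeInsert, if_pos ((shift_mem_graft (mem_intervals.mp hI) hT hS).mpr hIT),
      treeInsert, if_pos hIT, smul_zero, map_zero, smul_zero]
  · rw [treeInsert_of_notMem fun e => hIT ((shift_mem_graft (mem_intervals.mp hI) hT hS).mp e),
      treeInsert_of_notMem hIT, ← graft_insert_right, map_sign]
    by_cases hT' : IsTree m (insert I T)
    · rw [treeComp_tree h i hS hT', smul_smul, smul_smul, smul_smul, ← Int.negOnePow_add,
        ← Int.negOnePow_add, ← Int.negOnePow_add]
      congr 1
      apply negOnePow_congr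
      have hd := disjoint_expand_shift i.1 hS.two_le hT'.bounds
      rw [shift_insert, Finset.disjoint_insert_right] at hd
      have e1 : inversions {(I.1 + i.1, I.2 + i.1)} (graft i m S T)
          = inversions {(I.1 + i.1, I.2 + i.1)} (expand i m S) + inversions {I} T := by
        rw [graft, inversions_union_right _ (disjoint_expand_shift _ hS.two_le hT.bounds)]
        congr 1
        exact inversions_image (shift_strictMono i) {I} T
      have e2 := inversions_swap (Finset.disjoint_singleton_left.mpr hd.1)
      rw [card_expand hm, Finset.card_singleton] at e2
      have e3 := congrArg (Int.cast (R := ZMod 2)) e2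
      rw [e1, shift_insert, inversions_insert_right _ fun e => hIT (shift_mem_iff.mp e),
        Finset.card_insert_of_notMem hIT]
      unfold twist
      push_cast at e3 ⊢
      grind
    · rw [tree_of_not hT', tree_of_not fun e => hT' (IsTree.of_graft_right hI hT e), smul_zero,
        smul_zero, map_zero, smul_zero, smul_zero]

theorem mem_expand_or_shift {l m n : ℕ} (h : n + 1 = l + m) (hm : 2 ≤ m) (i : Fin l)
    {S T : Finset (ℕ × ℕ)} (hT : IsTree m T) {K : ℕ × ℕ}
    (hK : IsTree n (insert K (graft i m S T))) (hK' : K ∉ graft i m S T) :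
    K ∈ expand i m (intervals l) ∪ shift i (intervals m) := by
  have h1 := hK.nonCrossing K (Finset.mem_insert_self _ _) (0 + i.1, m + i.1)
    (Finset.mem_insert_of_mem (Finset.mem_union_right _ (mem_shift.mpr ⟨_, hT.root hm, rfl⟩)))
  have h2 := hK.bounds K (Finset.mem_insert_self _ _)
  have h3 : K ≠ (0 + i.1, m + i.1) := by
    rintro rfl
    exact hK' (Finset.mem_union_right _ (mem_shift.mpr ⟨_, hT.root hm, rfl⟩))
  have h3' : ¬(K.1 = 0 + i.1 ∧ K.2 = m + i.1) := fun e => h3 (Prod.ext e.1 e.2)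
  have hi := i.2
  unfold NonCrossing at h1
  simp only at h1
  by_cases hin : i.1 ≤ K.1 ∧ K.2 ≤ m + i.1
  · refine Finset.mem_union_right _ (mem_shift.mpr ⟨(K.1 - i.1, K.2 - i.1), ?_, ?_⟩)
    · rw [mem_intervals]; simp only; omega
    · refine Prod.ext ?_ ?_ <;> simp only <;> omega
  · refine Finset.mem_union_left _ (mem_expand.mpr
      ⟨(if K.1 ≤ i.1 then K.1 else K.1 - (m - 1), if K.2 ≤ i.1 then K.2 else K.2 - (m - 1)), ?_, ?_⟩)
    · rw [mem_intervals]; simp only; split_ifs <;> omega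
    · refine Prod.ext ?_ ?_ <;> simp only [stretch] <;> split_ifs <;> omega

theorem sum_expand {M : Type*} [AddCommMonoid M] {i m : ℕ} (hm : 1 ≤ m) (S : Finset (ℕ × ℕ))
    (f : ℕ × ℕ → M) :
    ∑ I ∈ expand i m S, f I = ∑ I ∈ S, f (stretch i m I.1, stretch i m I.2) :=
  Finset.sum_image
    ((stretch_strictMono hm).injective.prodMap (stretch_strictMono hm).injective).injOn

theorem sum_shift {M : Type*} [AddCommMonoid M] (i : ℕ) (S : Finset (ℕ × ℕ)) (f : ℕ × ℕ → M) :
    ∑ I ∈ shift i S, f I = ∑ I ∈ S, f (I.1 + i, I.2 + i) :=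
  Finset.sum_image ((shift_strictMono i).injective.prodMap (shift_strictMono i).injective).injOn

theorem treeD_treeComp_tree {l m n : ℕ} (h : n + 1 = l + m) (hm : 2 ≤ m) (i : Fin l)
    {S T : Finset (ℕ × ℕ)} (hS : IsTree l S) (hT : IsTree m T) :
    treeD k n (treeComp h i (tree k l S) (tree k m T))
      = treeComp h i (treeD k l (tree k l S)) (tree k m T)
        + (S.card + 1 - l : ℤ).negOnePow • treeComp h i (tree k l S) (treeD k m (tree k m T)) := by
  have hm1 : 1 ≤ m := by omega
  rw [treeComp_tree h i hS hT, map_sign, treeD_tree (hS.comp h hm1 i.2 hT), treeD_tree hS,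
    treeD_tree hT, map_sum, map_sum, LinearMap.sum_apply, Finset.smul_sum]
  have h1 : ∑ K ∈ intervals n, treeInsert k n K (graft i m S T)
      = ∑ K ∈ expand i m (intervals l) ∪ shift i (intervals m),
          treeInsert k n K (graft i m S T) := by
    refine (Finset.sum_subset ?_ ?_).symm
    · intro K hK
      rw [mem_intervals]
      have hi := i.2
      rcases Finset.mem_union.mp hK with hK | hK
      · obtain ⟨J, hJ, rfl⟩ := mem_expand.mp hK
        rw [mem_intervals] at hJ
        simp only [stretch]; split_ifs <;> omega
      · obtain ⟨J, hJ, rfl⟩ := mem_shift.mp hK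
        rw [mem_intervals] at hJ
        simp only; omega
    · intro K _ hK
      by_cases hK' : K ∈ graft i m S T
      · exact if_pos hK'
      · exact treeInsert_of_not fun e => hK (mem_expand_or_shift h hm i hT e hK')
  have hd : Disjoint (expand i m (intervals l)) (shift i.1 (intervals m)) :=
    disjoint_expand_shift _ (fun I hI => (mem_intervals.mp hI).1)
      fun I hI => mem_intervals.mp hI
  rw [← Finset.smul_sum, h1, Finset.sum_union hd, smul_add, sum_expand hm1, sum_shift, Finset.smul_sum, Finset.smul_sum, Finset.smul_sum]
  congr 1
  · exact Finset.sum_congr rfl fun I hI => treeInsert_expand h hm1 i hS hT hI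
  · exact Finset.sum_congr rfl fun I hI => treeInsert_shift h hm1 i hS hT hI

theorem treeMod_one_eq (x : TreeMod k 1) : ∃ c : k, x = c • tree k 1 ∅ := by
  induction x using treeMod_induction with
  | zero => exact ⟨0, by simp⟩
  | add f g hf hg =>
    obtain ⟨c, rfl⟩ := hf
    obtain ⟨d, rfl⟩ := hg
    exact ⟨c + d, (add_smul _ _ _).symm⟩
  | smul c f hf =>
    obtain ⟨d, rfl⟩ := hf
    exact ⟨c * d, smul_smul _ _ _⟩
  | basis S hS => rw [hS.eq_empty le_rfl]; exact ⟨1, (one_smul _ _).symm⟩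

theorem treeD_treeComp {l m n : ℕ} (h : n + 1 = l + m) (hm : 1 ≤ m) (i : Fin l) {p : ℤ}
    {x : TreeMod k l} (y : TreeMod k m) (hx : x ∈ treeGr k l p) :
    treeD k n (treeComp h i x y)
      = treeComp h i (treeD k l x) y + p.negOnePow • treeComp h i x (treeD k m y) := by
  rcases Nat.lt_or_ge m 2 with hm2 | hm2
  · obtain rfl : m = 1 := by omega
    obtain rfl : n = l := by omega
    obtain ⟨c, rfl⟩ := treeMod_one_eq y
    simp only [map_smul, treeComp_one_right, treeD_one, map_zero, smul_zero, add_zero]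
  · induction hx using treeGr_induction with
    | zero => simp only [map_zero, LinearMap.zero_apply, smul_zero, add_zero]
    | add x y _ _ hx hy => simp only [map_add, LinearMap.add_apply, hx, hy, smul_add]; abel
    | smul c x _ hx => simp only [map_smul, LinearMap.smul_apply, hx, smul_add, sign_comm_field]
    | basis S hS hp =>
      rw [treeDeg_of_pos (by have := i.2; omega)] at hp
      subst hp
      induction y using treeMod_induction with
      | zero => simp only [map_zero, smul_zero, add_zero]
      | add f g hf hg => simp only [map_add, hf, hg, smul_add]; abel
      | smul c f hf => simp only [map_smul, hf, smul_add, sign_comm_field]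
      | basis T hT => exact treeD_treeComp_tree h hm2 i hS hT

/-! ### Trees as iterated graftings of corollas -/

/-- The generating operation: the tree with a single vertex, of arity `m`. -/
noncomputable def corolla (k : Type u) [Field k] (m : ℕ) : TreeMod k m := tree k m {(0, m)}

theorem corolla_mem {m : ℕ} (hm : 2 ≤ m) : corolla k m ∈ treeGr k m (2 - m) := by
  refine tree_mem fun _ => ?_
  rw [treeDeg_of_pos (by omega), Finset.card_singleton]
  push_cast; ring

/-- A presentation of the tree `S` as the result of grafting a corolla onto a smaller tree, such
that the new vertex is the last one in prefix order. -/
structure LastVertex (n : ℕ) (S : Finset (ℕ × ℕ)) where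
  l : ℕ
  m : ℕ
  c : ℕ
  S' : Finset (ℕ × ℕ)
  arity : n + 1 = l + m
  two_le : 2 ≤ m
  lt : c < l
  isTree : IsTree l S'
  eq : S = graft c m S' {(0, m)}
  le : ∀ I ∈ S', I.1 ≤ c

theorem shift_singleton (c m : ℕ) : shift c {(0, m)} = {(c, m + c)} := by
  simp [shift]

theorem LastVertex.mem {n : ℕ} {S : Finset (ℕ × ℕ)} (d : LastVertex n S) :
    (d.c, d.m + d.c) ∈ S := by
  have h : (d.c, d.m + d.c) ∈ graft d.c d.m d.S' {(0, d.m)} := by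
    rw [graft, shift_singleton]
    exact Finset.mem_union_right _ (Finset.mem_singleton_self _)
  rwa [← d.eq] at h

theorem LastVertex.last {n : ℕ} {S : Finset (ℕ × ℕ)} (d : LastVertex n S) {I : ℕ × ℕ}
    (hI : I ∈ S) : I.1 ≤ d.c ∧ (I.1 = d.c → d.m + d.c ≤ I.2) := by
  rw [d.eq, graft, shift_singleton] at hI
  have := d.two_le
  rcases Finset.mem_union.mp hI with hI | hI
  · obtain ⟨J, hJ, rfl⟩ := mem_expand.mp hI
    have h1 := d.le J hJ
    have h2 := d.isTree.bounds J hJ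
    simp only [stretch]
    split_ifs <;> omega
  · rw [Finset.mem_singleton] at hI
    subst hI
    simp

theorem LastVertex.expand_eq {n : ℕ} {S : Finset (ℕ × ℕ)} (d : LastVertex n S) :
    expand d.c d.m d.S' = S.erase (d.c, d.m + d.c) := by
  have hd := disjoint_expand_shift d.c d.isTree.two_le (isTree_corolla d.two_le).bounds
  rw [shift_singleton, Finset.disjoint_singleton_right] at hd
  have h : S = insert (d.c, d.m + d.c) (expand d.c d.m d.S') := by
    rw [Finset.insert_eq, Finset.union_comm, ← shift_singleton]
    exact d.eq
  exact (Finset.erase_insert hd).symm.trans (congrArg (fun U => U.erase (d.c, d.m + d.c)) h.symm)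

instance (n : ℕ) (S : Finset (ℕ × ℕ)) : Subsingleton (LastVertex n S) := by
  constructor
  intro d d'
  have h1 := d.last d'.mem
  have h2 := d'.last d.mem
  simp only at h1 h2
  have hc : d.c = d'.c := by omega
  have hm : d.m = d'.m := by omega
  have hl : d.l = d'.l := by have := d.arity; have := d'.arity; omega
  have hS : d.S' = d'.S' := by
    have e1 := d.expand_eq
    have e2 := d'.expand_eq
    rw [← hc, ← hm, ← e1] at e2
    have hm1 : 1 ≤ d.m := by have := d.two_le; omega
    exact (Finset.image_injective
      ((stretch_strictMono hm1).injective.prodMap (stretch_strictMono hm1).injective) e2).symm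
  cases d; cases d'
  simp only at hc hm hl hS
  subst hc hm hl hS
  rfl

theorem IsTree.nonempty_lastVertex {n : ℕ} (hn : 2 ≤ n) {S : Finset (ℕ × ℕ)} (hS : IsTree n S) :
    Nonempty (LastVertex n S) := by
  obtain ⟨K0, hK0, hmax⟩ := Finset.exists_max_image S Prod.fst ⟨_, hS.root hn⟩
  obtain ⟨K, hK, hmin⟩ := Finset.exists_min_image (S.filter fun I => I.1 = K0.1) Prod.snd
    ⟨K0, Finset.mem_filter.mpr ⟨hK0, rfl⟩⟩
  obtain ⟨hKS, hK1⟩ := Finset.mem_filter.mp hK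
  obtain ⟨c, e⟩ := K
  have hb := hS.bounds _ hKS
  simp only at hb hK1 hmin
  have key : ∀ I ∈ S.erase (c, e), I.1 ≤ c ∧ (I.2 ≤ c ∨ e ≤ I.2 ∧ (I.1 = c → e < I.2)) := by
    intro I hI
    obtain ⟨hne, hIS⟩ := Finset.mem_erase.mp hI
    have h1 := hmax I hIS
    have h2 := hS.nonCrossing I hIS _ hKS
    have h3 : I.1 = c → e ≤ I.2 := fun e' =>
      hmin I (Finset.mem_filter.mpr ⟨hIS, by omega⟩)
    have h4 : ¬(I.1 = c ∧ I.2 = e) := fun e' => hne (Prod.ext e'.1 e'.2)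
    unfold NonCrossing at h2
    simp only at h2
    omega
  let g : ℕ → ℕ := fun x => if x ≤ c then x else x - (e - c - 1)
  have hg : ∀ I ∈ S.erase (c, e), stretch c (e - c) (g I.1) = I.1 ∧
      stretch c (e - c) (g I.2) = I.2 := by
    intro I hI
    have h1 := key I hI
    simp only [g, stretch]
    constructor <;> split_ifs <;> omega
  have hm1 : 1 ≤ e - c := by omega
  have hE : expand c (e - c) ((S.erase (c, e)).image (Prod.map g g)) = S.erase (c, e) := by
    unfold expand
    rw [Finset.image_image]
    conv_rhs => rw [← Finset.image_id (s := S.erase (c, e))]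
    refine Finset.image_congr fun I hI => ?_
    have := hg I hI
    exact Prod.ext this.1 this.2
  refine ⟨⟨n + 1 - (e - c), e - c, c, (S.erase (c, e)).image (Prod.map g g), by omega, by omega,
    by omega, ⟨?_, ?_, ?_⟩, ?_, ?_⟩⟩
  · intro J hJ
    obtain ⟨I, hI, rfl⟩ := Finset.mem_image.mp hJ
    have h1 := key I hI
    have h2 := hS.bounds I (Finset.mem_of_mem_erase hI)
    simp only [g, Prod.map]
    split_ifs <;> omega
  · intro hl
    refine Finset.mem_image.mpr ⟨(0, n), Finset.mem_erase.mpr ⟨?_, hS.root hn⟩, ?_⟩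
    · simp only [ne_eq, Prod.mk.injEq]; omega
    · simp only [g, Prod.map, Prod.mk.injEq]
      constructor <;> split_ifs <;> omega
  · intro I hI J hJ
    rw [← nonCrossing_map (stretch_strictMono (i := c) hm1)]
    have hI' := Finset.mem_image_of_mem (Prod.map (stretch c (e - c)) (stretch c (e - c))) hI
    have hJ' := Finset.mem_image_of_mem (Prod.map (stretch c (e - c)) (stretch c (e - c))) hJ
    change _ ∈ expand _ _ _ at hI' hJ'
    rw [hE] at hI' hJ'
    exact hS.nonCrossing _ (Finset.mem_of_mem_erase hI') _ (Finset.mem_of_mem_erase hJ')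
  · rw [graft, hE, shift_singleton, Nat.sub_add_cancel (by omega), Finset.union_comm,
      ← Finset.insert_eq, Finset.insert_erase hKS]
  · intro J hJ
    obtain ⟨I, hI, rfl⟩ := Finset.mem_image.mp hJ
    have h1 := key I hI
    simp only [g, Prod.map]
    split_ifs <;> omega

theorem LastVertex.inversions_eq {n : ℕ} {S : Finset (ℕ × ℕ)} (d : LastVertex n S) :
    inversions (expand d.c d.m d.S') (shift d.c {(0, d.m)}) = 0 := by
  rw [shift_singleton]
  refine Finset.sum_eq_zero fun I hI => ?_
  rw [Finset.sum_singleton, if_neg]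
  obtain ⟨J, hJ, rfl⟩ := mem_expand.mp hI
  have h1 := d.le J hJ
  have h2 := d.isTree.bounds J hJ
  have h3 := d.two_le
  simp only [After, stretch]
  split_ifs <;> omega

theorem LastVertex.treeComp_eq {n : ℕ} {S : Finset (ℕ × ℕ)} (d : LastVertex n S) :
    treeComp d.arity ⟨d.c, d.lt⟩ (tree k d.l d.S') (corolla k d.m)
      = (twist d.l d.m d.c 1).negOnePow • tree k n S := by
  rw [corolla, treeComp_tree d.arity _ d.isTree (isTree_corolla d.two_le), ← d.eq,
    d.inversions_eq, Finset.card_singleton, add_zero]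
  rfl

/-- Every element of positive arity is obtained from the identity by linear combinations and by
grafting corollas. -/
@[elab_as_elim]
theorem word_induction {C : ∀ n, 1 ≤ n → TreeMod k n → Prop} (zero : ∀ n hn, C n hn 0)
    (add : ∀ n hn x y, C n hn x → C n hn y → C n hn (x + y))
    (smul : ∀ n hn (c : k) x, C n hn x → C n hn (c • x))
    (one : C 1 le_rfl (tree k 1 ∅))
    (comp : ∀ {l m n : ℕ} (_ : 2 ≤ m) (h : n + 1 = l + m) (c : Fin l) (hl : 1 ≤ l) (hn : 1 ≤ n)
      (p : ℤ) (x : TreeMod k l), x ∈ treeGr k l p → C l hl x →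
        C n hn (treeComp h c x (corolla k m)))
    {n : ℕ} (hn : 1 ≤ n) (x : TreeMod k n) : C n hn x := by
  induction n using Nat.strong_induction_on with
  | _ n ih =>
    induction x using treeMod_induction with
    | zero => exact zero n hn
    | add f g hf hg => exact add n hn f g hf hg
    | smul c f hf => exact smul n hn c f hf
    | basis S hS =>
      rcases Nat.lt_or_ge n 2 with h2 | h2
      · obtain rfl : n = 1 := by omega
        rw [hS.eq_empty le_rfl]; exact one
      · obtain ⟨d⟩ := hS.nonempty_lastVertex h2
        have hl : 1 ≤ d.l := by have := d.lt; omega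
        have h1 := comp d.two_le d.arity ⟨d.c, d.lt⟩ hl hn _ _ (tree_mem fun _ => rfl)
          (ih d.l (by have := d.arity; have := d.two_le; omega) hl
            (tree k d.l d.S'))
        rw [d.treeComp_eq] at h1
        have h3 := smul n hn (((twist d.l d.m d.c 1).negOnePow : ℤ) : k) _ h1
        rwa [Int.cast_smul_eq_zsmul, ← Units.smul_def, sign_self_smul] at h3

end TreeMod

end StrictUnits

namespace StrictUnits

section TreeMod

variable {k : Type u} [Field k]

/-- A family of vector spaces with operations that behave like grafting corollas on inputs. -/
structure WordModule (k : Type u) [Field k] where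
  X : ℕ → Type w
  [addCommGroup : ∀ n, AddCommGroup (X n)]
  [module : ∀ n, Module k (X n)]
  one : X 1
  op : ∀ {l m n : ℕ}, 2 ≤ m → n + 1 = l + m → Fin l → (X l →ₗ[k] X n)
  exchange : ∀ {l m r n s t : ℕ} (hm : 2 ≤ m) (hr : 2 ≤ r) (h₁ : n + 1 = l + m)
    (h₂ : t + 1 = n + r) (h₃ : s + 1 = l + r) (h₄ : t + 1 = s + m) (i c : Fin l) (hci : c ≠ i),
    i.1 < c.1 → ∀ x : X l,
      op hr h₂ (outer h₁ i c hci) (op hm h₁ i x)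
        = ((2 - m) * (2 - r) : ℤ).negOnePow •
          op hm h₄ (outer h₃ c i hci.symm) (op hr h₃ c x)

attribute [instance] WordModule.addCommGroup WordModule.module

open Classical in
/-- The value on a tree of the map from trees to a word module. -/
noncomputable def WordModule.eval (W : WordModule.{u, w} k) (n : ℕ) (S : Finset (ℕ × ℕ)) : W.X n :=
  if h : Nonempty (LastVertex n S) then
    (twist h.some.l h.some.m h.some.c 1).negOnePow •
      W.op h.some.two_le h.some.arity ⟨h.some.c, h.some.lt⟩ (W.eval h.some.l h.some.S')
  else if h1 : n = 1 then cast (congrArg W.X h1.symm) W.one else 0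
termination_by n
decreasing_by
  have h1 := h.some.two_le
  have h2 := h.some.arity
  omega

theorem WordModule.eval_eq (W : WordModule.{u, w} k) {n : ℕ} {S : Finset (ℕ × ℕ)}
    (d : LastVertex n S) :
    W.eval n S = (twist d.l d.m d.c 1).negOnePow •
      W.op d.two_le d.arity ⟨d.c, d.lt⟩ (W.eval d.l d.S') := by
  have h : Nonempty (LastVertex n S) := ⟨d⟩
  rw [WordModule.eval, dif_pos h]
  have key : ∀ e : LastVertex n S, e = d →
      (twist e.l e.m e.c 1).negOnePow • W.op e.two_le e.arity ⟨e.c, e.lt⟩ (W.eval e.l e.S')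
        = (twist d.l d.m d.c 1).negOnePow • W.op d.two_le d.arity ⟨d.c, d.lt⟩ (W.eval d.l d.S') := by
    rintro e rfl
    rfl
  exact key _ (Subsingleton.elim _ _)

theorem WordModule.eval_one (W : WordModule.{u, w} k) : W.eval 1 ∅ = W.one := by
  have h : ¬Nonempty (LastVertex 1 ∅) := by
    rintro ⟨d⟩
    exact absurd d.mem (Finset.notMem_empty _)
  rw [WordModule.eval, dif_neg h, dif_pos rfl]
  rfl

/-- The map from trees to a word module. -/
noncomputable def WordModule.lift (W : WordModule.{u, w} k) (n : ℕ) : TreeMod k n →ₗ[k] W.X n :=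
  treeLift fun S => W.eval n S.1

theorem WordModule.lift_tree (W : WordModule.{u, w} k) {n : ℕ} {S : Finset (ℕ × ℕ)}
    (hS : IsTree n S) : W.lift n (tree k n S) = W.eval n S := treeLift_tree _ hS

theorem WordModule.lift_one (W : WordModule.{u, w} k) : W.lift 1 (tree k 1 ∅) = W.one := by
  rw [W.lift_tree (isTree_empty le_rfl), W.eval_one]

theorem WordModule.lift_comp_last (W : WordModule.{u, w} k) {n : ℕ} {S : Finset (ℕ × ℕ)}
    (d : LastVertex n S) (hS : IsTree n S) :
    W.lift n (treeComp d.arity ⟨d.c, d.lt⟩ (tree k d.l d.S') (corolla k d.m))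
      = W.op d.two_le d.arity ⟨d.c, d.lt⟩ (W.lift d.l (tree k d.l d.S')) := by
  rw [d.treeComp_eq, map_sign, W.lift_tree hS, W.eval_eq d, sign_self_smul, W.lift_tree d.isTree]

theorem WordModule.lift_comp (W : WordModule.{u, w} k) {l m n : ℕ} (hm : 2 ≤ m)
    (h : n + 1 = l + m) (c : Fin l) (x : TreeMod k l) :
    W.lift n (treeComp h c x (corolla k m)) = W.op hm h c (W.lift l x) := by
  induction l using Nat.strong_induction_on generalizing m n with
  | _ l ih =>
    induction x using treeMod_induction with
    | zero => simp only [map_zero, LinearMap.zero_apply]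
    | add f g hf hg => simp only [map_add, LinearMap.add_apply, hf, hg]
    | smul c f hf => simp only [map_smul, LinearMap.smul_apply, hf]
    | basis S hS =>
      by_cases hlast : ∀ I ∈ S, I.1 ≤ c.1
      · exact W.lift_comp_last (S := graft c m S {(0, m)})
          ⟨l, m, c, S, h, hm, c.2, hS, rfl, hlast⟩
          (hS.comp h (by omega) c.2 (isTree_corolla hm))
      · have hl : 2 ≤ l := by
          by_contra hl
          rw [hS.eq_empty (by omega)] at hlast
          simp at hlast
        obtain ⟨d⟩ := hS.nonempty_lastVertex hl
        obtain ⟨l', r, a, S', arity, hr, lt, isTree, eq, le⟩ := d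
        have hca : c.1 < a := by
          by_contra hca
          push Not at hlast hca
          obtain ⟨I, hI, hI'⟩ := hlast
          have := (LastVertex.last ⟨l', r, a, S', arity, hr, lt, isTree, eq, le⟩ hI).1
          simp only at this
          omega
        let i' : Fin l' := ⟨c.1, by omega⟩
        let a' : Fin l' := ⟨a, lt⟩
        have hai : a' ≠ i' := by intro e; have := congrArg Fin.val e; simp only [a', i'] at this; omega
        have hs : (l' + m - 1) + 1 = l' + m := by omega
        have h4 : n + 1 = (l' + m - 1) + r := by omega
        have hc : c = outer arity a' i' hai.symm := by
          apply Fin.ext; rw [outer_val, if_pos hca]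
        have h5 : tree k l S = (twist l' r a 1).negOnePow •
            treeComp arity a' (tree k l' S') (corolla k r) := by
          rw [LastVertex.treeComp_eq ⟨l', r, a, S', arity, hr, lt, isTree, eq, le⟩, sign_self_smul]
        have h6 : treeComp h c (treeComp arity a' (tree k l' S') (corolla k r)) (corolla k m)
            = ((2 - r) * (2 - m) : ℤ).negOnePow • treeComp h4 (outer hs i' a' hai)
              (treeComp hs i' (tree k l' S') (corolla k m)) (corolla k r) := by
          rw [hc]
          exact treeComp_assoc_par arity h hs h4 (by omega) (by omega) a' i' hai.symm _
            (corolla_mem hr) (corolla_mem hm)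
        have h7 : W.op hm h c (W.op hr arity a' (W.lift l' (tree k l' S')))
            = ((2 - r) * (2 - m) : ℤ).negOnePow • W.op hr h4 (outer hs i' a' hai)
              (W.op hm hs i' (W.lift l' (tree k l' S'))) := by
          rw [W.exchange hm hr hs h4 arity h i' a' hai hca, smul_smul, mul_comm (2 - (r : ℤ)),
            Int.units_mul_self, one_smul, hc]
        have h8 : W.lift n (treeComp h4 (outer hs i' a' hai)
              (treeComp hs i' (tree k l' S') (corolla k m)) (corolla k r))
            = W.op hr h4 (outer hs i' a' hai)
              (W.lift _ (treeComp hs i' (tree k l' S') (corolla k m))) := by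
          have ht := isTree.comp hs (by omega : 1 ≤ m) i'.2 (isTree_corolla hm)
          rw [corolla, treeComp_tree hs i' isTree (isTree_corolla hm), map_sign₂, map_sign, map_sign,
            map_sign]
          congr 1
          refine W.lift_comp_last (S := graft (outer hs i' a' hai) r (graft i' m S' {(0, m)}) {(0, r)})
            ⟨_, r, _, _, h4, hr, (outer hs i' a' hai).2, ht, rfl, ?_⟩
            (ht.comp h4 (by omega) (outer hs i' a' hai).2 (isTree_corolla hr))
          intro I hI
          have ho : (outer hs i' a' hai).1 = a + m - 1 := by
            rw [outer_val, if_neg (by simp only [a', i']; omega)]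
          rw [ho]
          rw [graft, shift_singleton] at hI
          rcases Finset.mem_union.mp hI with hI | hI
          · obtain ⟨J, hJ, rfl⟩ := mem_expand.mp hI
            have := le J hJ
            simp only [stretch, i']
            split_ifs <;> omega
          · rw [Finset.mem_singleton] at hI
            subst hI
            simp only [i']
            omega
        rw [h5, map_sign₂, map_sign, map_sign, map_sign, h6, map_sign, h8,
          ih l' (by omega) hm hs i', ih l' (by omega) hr arity a', h7]

/-! ### Restriction operations -/

/-- The corolla of arity `m`, restricted to one input less. -/
noncomputable def corollaRes (k : Type u) [Field k] (m n : ℕ) : TreeMod k n :=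
  if m = 2 ∧ n = 1 then tree k n ∅ else 0

theorem corollaRes_two : corollaRes k 2 1 = tree k 1 ∅ := if_pos ⟨rfl, rfl⟩

theorem corollaRes_of_ne {m n : ℕ} (h : m ≠ 2) : corollaRes k m n = 0 := if_neg fun e => h e.1

theorem corollaRes_mem {m n : ℕ} : corollaRes k m n ∈ treeGr k n (2 - m) := by
  unfold corollaRes
  split_ifs with h
  · obtain ⟨rfl, rfl⟩ := h
    exact tree_mem fun _ => by simp [treeDeg]
  · exact Submodule.zero_mem _

/-- The operation on pairs `(x, (δᵢ x)ᵢ)` that describes the grafting of a corolla. -/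
noncomputable def resOp {l m n : ℕ} (hm : 2 ≤ m) (h : n + 1 = l + m) (c : Fin l) :
    (TreeMod k l × (Fin l → TreeMod k (l - 1))) →ₗ[k]
      (TreeMod k n × (Fin n → TreeMod k (n - 1))) :=
  LinearMap.prod ((treeComp h c).flip (corolla k m) ∘ₗ LinearMap.fst k _ _)
    (LinearMap.pi fun i =>
      if h₁ : i.1 < c.1 then
        (treeComp (n := n - 1) (l := l - 1) (m := m) (by omega) ⟨c.1 - 1, by omega⟩).flip
          (corolla k m) ∘ₗ LinearMap.proj ⟨i.1, by omega⟩ ∘ₗ LinearMap.snd k _ _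
      else if h₂ : i.1 < c.1 + m then
        (treeComp (n := n - 1) (l := l) (m := m - 1) (by omega) c).flip
          (corollaRes k m (m - 1)) ∘ₗ LinearMap.fst k _ _
      else
        (treeComp (n := n - 1) (l := l - 1) (m := m) (by omega) ⟨c.1, by omega⟩).flip
          (corolla k m) ∘ₗ LinearMap.proj ⟨i.1 - (m - 1), by omega⟩ ∘ₗ LinearMap.snd k _ _)

theorem resOp_fst {l m n : ℕ} (hm : 2 ≤ m) (h : n + 1 = l + m) (c : Fin l)
    (x : TreeMod k l × (Fin l → TreeMod k (l - 1))) :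
    (resOp hm h c x).1 = treeComp h c x.1 (corolla k m) := rfl

theorem resOp_lt {l m n : ℕ} (hm : 2 ≤ m) (h : n + 1 = l + m) (c : Fin l)
    (x : TreeMod k l × (Fin l → TreeMod k (l - 1))) (i : Fin n) (b : Fin l)
    (c' : Fin (l - 1)) (h' : n - 1 + 1 = l - 1 + m) (hi : i.1 < c.1) (hb : b.1 = i.1)
    (hc : c'.1 + 1 = c.1) :
    (resOp hm h c x).2 i = treeComp h' c' (x.2 b) (corolla k m) := by
  have h1 : c.1 - 1 < l - 1 := by omega
  obtain rfl : c' = ⟨c.1 - 1, h1⟩ := Fin.ext (by simp only; omega)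
  have h2 : i.1 < l := by omega
  obtain rfl : b = ⟨i.1, h2⟩ := Fin.ext hb
  simp [resOp, hi]

theorem resOp_mid {l m n : ℕ} (hm : 2 ≤ m) (h : n + 1 = l + m) (c : Fin l)
    (x : TreeMod k l × (Fin l → TreeMod k (l - 1))) (i : Fin n)
    (h' : n - 1 + 1 = l + (m - 1)) (hi : c.1 ≤ i.1) (hi' : i.1 < c.1 + m) :
    (resOp hm h c x).2 i = treeComp h' c x.1 (corollaRes k m (m - 1)) := by
  simp [resOp, hi.not_gt, hi']

theorem resOp_gt {l m n : ℕ} (hm : 2 ≤ m) (h : n + 1 = l + m) (c : Fin l)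
    (x : TreeMod k l × (Fin l → TreeMod k (l - 1))) (i : Fin n) (b : Fin l)
    (c' : Fin (l - 1)) (h' : n - 1 + 1 = l - 1 + m) (hi : c.1 + m ≤ i.1)
    (hb : b.1 + m = i.1 + 1) (hc : c'.1 = c.1) :
    (resOp hm h c x).2 i = treeComp h' c' (x.2 b) (corolla k m) := by
  have h2 : c.1 < l - 1 := by omega
  obtain rfl : c' = ⟨c.1, h2⟩ := Fin.ext hc
  have h3 : i.1 - (m - 1) < l := by omega
  obtain rfl : b = ⟨i.1 - (m - 1), h3⟩ := Fin.ext (by simp only; omega)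
  have h1 : ¬ i.1 < c.1 := by omega
  simp [resOp, h1, hi.not_gt]

theorem treeComp_par {l m r n s t : ℕ} (h₁ : n + 1 = l + m) (h₂ : t + 1 = n + r)
    (h₃ : s + 1 = l + r) (h₄ : t + 1 = s + m) (hm : 1 ≤ m) (hr : 1 ≤ r) (i c : Fin l)
    (a : Fin n) (b : Fin s) (hic : i.1 < c.1) (ha : a.1 + 1 = c.1 + m) (hb : b.1 = i.1) {p q : ℤ}
    (x : TreeMod k l) {y : TreeMod k m} {z : TreeMod k r}
    (hy : y ∈ treeGr k m p) (hz : z ∈ treeGr k r q) :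
    treeComp h₂ a (treeComp h₁ i x y) z
      = (p * q).negOnePow • treeComp h₄ b (treeComp h₃ c x z) y := by
  have hci : c ≠ i := fun e => by rw [e] at hic; omega
  have e1 : a = outer h₁ i c hci := Fin.ext (by rw [outer_val, if_neg (by omega)]; omega)
  have e2 : b = outer h₃ c i hci.symm := Fin.ext (by rw [outer_val, if_pos hic]; omega)
  rw [e1, e2]
  exact treeComp_assoc_par h₁ h₂ h₃ h₄ hm hr i c hci x hy hz

set_option maxHeartbeats 1000000 in
theorem resOp_exchange {l m r n s t : ℕ} (hm : 2 ≤ m) (hr : 2 ≤ r) (h₁ : n + 1 = l + m)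
    (h₂ : t + 1 = n + r) (h₃ : s + 1 = l + r) (h₄ : t + 1 = s + m) (i c : Fin l) (hci : c ≠ i)
    (hic : i.1 < c.1) (x : TreeMod k l × (Fin l → TreeMod k (l - 1))) :
    resOp hr h₂ (outer h₁ i c hci) (resOp hm h₁ i x)
      = ((2 - m) * (2 - r) : ℤ).negOnePow •
        resOp hm h₄ (outer h₃ c i hci.symm) (resOp hr h₃ c x) := by
  have o1 : (outer h₁ i c hci).1 = c.1 + m - 1 := by rw [outer_val, if_neg (by omega)]
  have o2 : (outer h₃ c i hci.symm).1 = i.1 := by rw [outer_val, if_pos hic]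
  have hm1 : 1 ≤ m := by omega
  have hr1 : 1 ≤ r := by omega
  refine Prod.ext ?_ (funext fun j => ?_)
  · exact treeComp_assoc_par h₁ h₂ h₃ h₄ hm1 hr1 i c hci _ (corolla_mem hm) (corolla_mem hr)
  · change (resOp hr h₂ _ (resOp hm h₁ i x)).2 j
      = ((2 - m) * (2 - r) : ℤ).negOnePow • (resOp hm h₄ _ (resOp hr h₃ c x)).2 j
    have hc := c.2
    have hj := j.2
    have n1 : n - 1 + 1 = n := by omega
    have s1 : s - 1 + 1 = s := by omega
    have t1 : t - 1 + 1 = t := by omega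
    have a1 : n - 1 + 1 = l - 1 + m := by omega
    have a2 : t - 1 + 1 = n - 1 + r := by omega
    have a3 : s - 1 + 1 = l - 1 + r := by omega
    have a4 : t - 1 + 1 = s - 1 + m := by omega
    by_cases j1 : j.1 < i.1
    · have b1 : j.1 < l := by omega
      have b2 : j.1 < n := by omega
      have b3 : j.1 < s := by omega
      have b4 : c.1 + m - 1 - 1 < n - 1 := by omega
      have b5 : i.1 - 1 < s - 1 := by omega
      have b6 : i.1 - 1 < l - 1 := by omega
      have b7 : c.1 - 1 < l - 1 := by omega
      rw [resOp_lt hr h₂ _ _ j ⟨j.1, b2⟩ ⟨c.1 + m - 1 - 1, b4⟩ a2 (by omega) rfl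
          (by simp only; omega),
        resOp_lt hm h₁ _ _ ⟨j.1, b2⟩ ⟨j.1, b1⟩ ⟨i.1 - 1, b6⟩ a1 j1 rfl (by simp only; omega),
        resOp_lt hm h₄ _ _ j ⟨j.1, b3⟩ ⟨i.1 - 1, b5⟩ a4 (by omega) rfl (by simp only; omega),
        resOp_lt hr h₃ _ _ ⟨j.1, b3⟩ ⟨j.1, b1⟩ ⟨c.1 - 1, b7⟩ a3 (by simp only; omega) rfl
          (by simp only; omega)]
      exact treeComp_par a1 a2 a3 a4 hm1 hr1 _ _ _ _ (by simp only; omega)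
        (by simp only; omega) rfl _ (corolla_mem hm) (corolla_mem hr)
    by_cases j2 : j.1 < i.1 + m
    · have a1' : n - 1 + 1 = l + (m - 1) := by omega
      have a4' : t - 1 + 1 = s + (m - 1) := by omega
      have b2 : j.1 < n := by omega
      have b4 : c.1 + m - 1 - 1 < n - 1 := by omega
      rw [resOp_lt hr h₂ _ _ j ⟨j.1, b2⟩ ⟨c.1 + m - 1 - 1, b4⟩ a2 (by omega) rfl
          (by simp only; omega),
        resOp_mid hm h₁ _ _ ⟨j.1, b2⟩ a1' (by simp only; omega) (by simp only; omega),
        resOp_mid hm h₄ _ _ j a4' (by omega) (by omega), resOp_fst]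
      exact treeComp_par a1' a2 h₃ a4' (by omega) hr1 i c _ _ hic (by simp only; omega) o2 _
        corollaRes_mem (corolla_mem hr)
    by_cases j3 : j.1 < c.1 + m - 1
    · have b1 : j.1 + 1 - m < l := by omega
      have b2 : j.1 < n := by omega
      have b3 : j.1 + 1 - m < s := by omega
      have b4 : c.1 + m - 1 - 1 < n - 1 := by omega
      have b5 : i.1 < s - 1 := by omega
      have b6 : i.1 < l - 1 := by omega
      have b7 : c.1 - 1 < l - 1 := by omega
      rw [resOp_lt hr h₂ _ _ j ⟨j.1, b2⟩ ⟨c.1 + m - 1 - 1, b4⟩ a2 (by omega) rfl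
          (by simp only; omega),
        resOp_gt hm h₁ _ _ ⟨j.1, b2⟩ ⟨j.1 + 1 - m, b1⟩ ⟨i.1, b6⟩ a1 (by simp only; omega)
          (by simp only; omega) rfl,
        resOp_gt hm h₄ _ _ j ⟨j.1 + 1 - m, b3⟩ ⟨i.1, b5⟩ a4 (by omega) (by simp only; omega)
          o2.symm,
        resOp_lt hr h₃ _ _ ⟨j.1 + 1 - m, b3⟩ ⟨j.1 + 1 - m, b1⟩ ⟨c.1 - 1, b7⟩ a3
          (by simp only; omega) rfl (by simp only; omega)]
      exact treeComp_par a1 a2 a3 a4 hm1 hr1 _ _ _ _ (by simp only; omega)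
        (by simp only; omega) rfl _ (corolla_mem hm) (corolla_mem hr)
    by_cases j4 : j.1 < c.1 + m - 1 + r
    · have a2' : t - 1 + 1 = n + (r - 1) := by omega
      have a3' : s - 1 + 1 = l + (r - 1) := by omega
      have b3 : j.1 + 1 - m < s := by omega
      have b5 : i.1 < s - 1 := by omega
      rw [resOp_mid hr h₂ _ _ j a2' (by omega) (by omega),
        resOp_gt hm h₄ _ _ j ⟨j.1 + 1 - m, b3⟩ ⟨i.1, b5⟩ a4 (by omega) (by simp only; omega)
          o2.symm,
        resOp_mid hr h₃ _ _ ⟨j.1 + 1 - m, b3⟩ a3' (by simp only; omega) (by simp only; omega),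
        resOp_fst]
      exact treeComp_par h₁ a2' a3' a4 hm1 (by omega) i c _ _ hic (by omega)
        rfl _ (corolla_mem hm) corollaRes_mem
    · have b1 : j.1 + 2 - m - r < l := by omega
      have b2 : j.1 + 1 - r < n := by omega
      have b3 : j.1 + 1 - m < s := by omega
      have b4 : c.1 + m - 1 < n - 1 := by omega
      have b5 : i.1 < s - 1 := by omega
      have b6 : i.1 < l - 1 := by omega
      have b7 : c.1 < l - 1 := by omega
      rw [resOp_gt hr h₂ _ _ j ⟨j.1 + 1 - r, b2⟩ ⟨c.1 + m - 1, b4⟩ a2 (by omega)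
          (by simp only; omega) o1.symm,
        resOp_gt hm h₁ _ _ ⟨j.1 + 1 - r, b2⟩ ⟨j.1 + 2 - m - r, b1⟩ ⟨i.1, b6⟩ a1
          (by simp only; omega) (by simp only; omega) rfl,
        resOp_gt hm h₄ _ _ j ⟨j.1 + 1 - m, b3⟩ ⟨i.1, b5⟩ a4 (by omega) (by simp only; omega)
          o2.symm,
        resOp_gt hr h₃ _ _ ⟨j.1 + 1 - m, b3⟩ ⟨j.1 + 2 - m - r, b1⟩ ⟨c.1, b7⟩ a3
          (by simp only; omega) (by simp only; omega) rfl]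
      exact treeComp_par a1 a2 a3 a4 hm1 hr1 _ _ _ _ hic (by simp only; omega) rfl _
        (corolla_mem hm) (corolla_mem hr)

/-- The word module that computes the restriction operations. -/
noncomputable def resModule (k : Type u) [Field k] : WordModule.{u, u} k where
  X n := TreeMod k n × (Fin n → TreeMod k (n - 1))
  one := (tree k 1 ∅, fun _ => tree k 0 ∅)
  op hm h c := resOp hm h c
  exchange hm hr h₁ h₂ h₃ h₄ i c hci hic x := resOp_exchange hm hr h₁ h₂ h₃ h₄ i c hci hic x

/-- The restriction operation `δᵢ`, which removes the leaf `i`. -/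
noncomputable def treeRes {m n : ℕ} (h : m + 1 = n) (i : Fin n) : TreeMod k n →ₗ[k] TreeMod k m :=
  match n, h, i with
  | _, rfl, i => LinearMap.proj i ∘ₗ LinearMap.snd k _ _ ∘ₗ (resModule k).lift (m + 1)

theorem treeRes_eq {n : ℕ} (i : Fin (n + 1)) (x : TreeMod k (n + 1)) :
    treeRes rfl i x = ((resModule k).lift (n + 1) x).2 i := rfl

theorem resModule_lift_fst {n : ℕ} (hn : 1 ≤ n) (x : TreeMod k n) :
    ((resModule k).lift n x).1 = x := by
  induction hn, x using word_induction with
  | zero n => rw [map_zero]; rfl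
  | add n _ x y hx hy => rw [map_add]; exact congrArg₂ (· + ·) hx hy
  | smul n _ c x hx => rw [map_smul]; exact congrArg (c • ·) hx
  | one => rw [WordModule.lift_one]; rfl
  | comp hm h c _ _ p x _ hx =>
    rw [WordModule.lift_comp _ hm h c]
    exact (resOp_fst hm h c _).trans (by rw [hx])

theorem treeRes_one (i : Fin 1) : treeRes rfl i (tree k 1 ∅) = tree k 0 ∅ := by
  rw [treeRes_eq, WordModule.lift_one]; rfl

theorem treeRes_comp_corolla_lt {l l' m n n' : ℕ} (hm : 2 ≤ m) (h : n + 1 = l + m)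
    (h' : n' + 1 = l' + m) (hn : n' + 1 = n) (hl : l' + 1 = l) (c : Fin l) (c' : Fin l') (i : Fin n)
    (b : Fin l) (hi : i.1 < c.1) (hb : b.1 = i.1) (hc : c'.1 + 1 = c.1) (x : TreeMod k l) :
    treeRes hn i (treeComp h c x (corolla k m))
      = treeComp h' c' (treeRes hl b x) (corolla k m) := by
  subst hn hl
  rw [treeRes_eq, treeRes_eq, WordModule.lift_comp _ hm h c]
  exact resOp_lt hm h c _ i b c' h' hi hb hc

theorem treeRes_comp_corolla_gt {l l' m n n' : ℕ} (hm : 2 ≤ m) (h : n + 1 = l + m)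
    (h' : n' + 1 = l' + m) (hn : n' + 1 = n) (hl : l' + 1 = l) (c : Fin l) (c' : Fin l') (i : Fin n)
    (b : Fin l) (hi : c.1 + m ≤ i.1) (hb : b.1 + m = i.1 + 1) (hc : c'.1 = c.1)
    (x : TreeMod k l) :
    treeRes hn i (treeComp h c x (corolla k m))
      = treeComp h' c' (treeRes hl b x) (corolla k m) := by
  subst hn hl
  rw [treeRes_eq, treeRes_eq, WordModule.lift_comp _ hm h c]
  exact resOp_gt hm h c _ i b c' h' hi hb hc

theorem treeRes_comp_corolla_mid {l m m' n n' : ℕ} (hm : 2 ≤ m) (hm' : m' + 1 = m)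
    (h : n + 1 = l + m) (h' : n' + 1 = l + m') (hn : n' + 1 = n) (c : Fin l) (i : Fin n)
    (hi : c.1 ≤ i.1) (hi' : i.1 < c.1 + m) (x : TreeMod k l) :
    treeRes hn i (treeComp h c x (corolla k m)) = treeComp h' c x (corollaRes k m m') := by
  subst hn hm'
  rw [treeRes_eq, WordModule.lift_comp _ hm h c]
  refine (resOp_mid hm h c _ i h' hi hi').trans ?_
  rw [resModule_lift_fst (by have := c.2; omega)]
  rfl

theorem treeRes_corolla {m m' : ℕ} (hm : 2 ≤ m) (hm' : m' + 1 = m) (i : Fin m) :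
    treeRes hm' i (corolla k m) = corollaRes k m m' := by
  have h1 := treeRes_comp_corolla_mid (k := k) hm hm' (Nat.add_comm m 1) (Nat.add_comm m' 1) hm'
    (0 : Fin 1) i (Nat.zero_le _) (by have := i.2; simp) (tree k 1 ∅)
  rwa [treeComp_one_left, treeComp_one_left] at h1

/-- Restriction to the inputs of a composite `x ∘ᵢ y` that come from `y`. -/
theorem treeRes_comp_inner {l m m' n n' : ℕ} (hm : 1 ≤ m') (hm' : m' + 1 = m)
    (h : n + 1 = l + m) (h' : n' + 1 = l + m') (hn : n' + 1 = n) (c : Fin l) (j : Fin m) (i : Fin n)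
    (hi : i.1 = c.1 + j.1) (x : TreeMod k l) (y : TreeMod k m) :
    treeRes hn i (treeComp h c x y) = treeComp h' c x (treeRes hm' j y) := by
  have hm1 : 1 ≤ m := by omega
  induction hm1, y using word_induction generalizing m' n n' with
  | zero n => simp only [map_zero]
  | add n _ x y hx hy =>
    simp only [map_add]; rw [hx hm hm' h h' hn j i hi, hy hm hm' h h' hn j i hi]
  | smul n _ a x hx => simp only [map_smul]; rw [hx hm hm' h h' hn j i hi]
  | one => omega
  | @comp q r m hr hq e _ _ p y _ ih =>
    have hl := c.2
    have hj := j.2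
    have he := e.2
    obtain ⟨N, hN⟩ : ∃ N, N + 1 = l + q := ⟨l + q - 1, by omega⟩
    have h2 : n + 1 = N + r := by omega
    rw [← treeComp_assoc_seq hN h2 hq h (by omega)]
    by_cases j1 : j.1 < e.1
    · obtain ⟨q', rfl⟩ : ∃ q', q = q' + 1 := ⟨q - 1, by omega⟩
      obtain ⟨N', rfl⟩ : ∃ N', N = N' + 1 := ⟨N - 1, by omega⟩
      have b1 : c.1 + e.1 - 1 < N' := by omega
      have b2 : i.1 < N' + 1 := by omega
      have b3 : e.1 - 1 < q' := by omega
      have b4 : j.1 < q' + 1 := by omega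
      rw [treeRes_comp_corolla_lt hr h2 (by omega) hn rfl _ ⟨c.1 + e.1 - 1, b1⟩ i ⟨i.1, b2⟩
          (by rw [inner_val]; omega) rfl (by rw [inner_val]; simp only; omega),
        treeRes_comp_corolla_lt hr hq (by omega) hm' rfl e ⟨e.1 - 1, b3⟩ j ⟨j.1, b4⟩ j1 rfl
          (by simp only; omega),
        ih (m' := q') (n' := N') (by omega) rfl hN (by omega) rfl ⟨j.1, b4⟩ ⟨i.1, b2⟩ hi,
        ← treeComp_assoc_seq (n := N') (by omega) (by omega) (by omega) h' (by omega)]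
      congr 3
      apply Fin.ext
      rw [inner_val]; simp only; omega
    by_cases j2 : j.1 < e.1 + r
    · obtain ⟨r', rfl⟩ : ∃ r', r = r' + 1 := ⟨r - 1, by omega⟩
      rw [treeRes_comp_corolla_mid hr rfl h2 (by omega) hn _ i (by rw [inner_val]; omega)
          (by rw [inner_val]; omega),
        treeRes_comp_corolla_mid hr rfl hq (by omega) hm' e j (by omega) (by omega),
        ← treeComp_assoc_seq hN (by omega) (by omega) h' (by omega)]
    · obtain ⟨q', rfl⟩ : ∃ q', q = q' + 1 := ⟨q - 1, by omega⟩
      obtain ⟨N', rfl⟩ : ∃ N', N = N' + 1 := ⟨N - 1, by omega⟩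
      have b1 : c.1 + e.1 < N' := by omega
      have b2 : i.1 + 1 - r < N' + 1 := by omega
      have b3 : e.1 < q' := by omega
      have b4 : j.1 + 1 - r < q' + 1 := by omega
      rw [treeRes_comp_corolla_gt hr h2 (by omega) hn rfl _ ⟨c.1 + e.1, b1⟩ i ⟨i.1 + 1 - r, b2⟩
          (by rw [inner_val]; omega) (by simp only; omega) (by rw [inner_val]),
        treeRes_comp_corolla_gt hr hq (by omega) hm' rfl e ⟨e.1, b3⟩ j ⟨j.1 + 1 - r, b4⟩
          (by omega) (by simp only; omega) rfl,
        ih (m' := q') (n' := N') (by omega) rfl hN (by omega) rfl ⟨j.1 + 1 - r, b4⟩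
          ⟨i.1 + 1 - r, b2⟩ (by simp only; omega),
        ← treeComp_assoc_seq (n := N') (by omega) (by omega) (by omega) h' (by omega)]
      rfl

/-- Restriction to the inputs of a composite `x ∘ᵢ y` that come from `x`. -/
theorem treeRes_comp_outer {l l' m n n' : ℕ} (hm : 1 ≤ m) (h : n + 1 = l + m)
    (h' : n' + 1 = l' + m) (hn : n' + 1 = n) (hl : l' + 1 = l) (c : Fin l) (c' : Fin l') (i : Fin n)
    (b : Fin l) (hb : b.1 < c.1 ∧ i.1 = b.1 ∧ c'.1 + 1 = c.1 ∨
      c.1 < b.1 ∧ i.1 + 1 = b.1 + m ∧ c'.1 = c.1) (x : TreeMod k l) (y : TreeMod k m) :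
    treeRes hn i (treeComp h c x y) = treeComp h' c' (treeRes hl b x) y := by
  induction hm, y using word_induction generalizing n n' with
  | zero n => simp only [map_zero]
  | add n _ x y hx hy => simp only [map_add]; rw [hx h h' hn i hb, hy h h' hn i hb]
  | smul n _ a x hx => simp only [map_smul]; rw [hx h h' hn i hb]
  | one =>
    obtain rfl : n = l := by omega
    obtain rfl : n' = l' := by omega
    obtain rfl : i = b := Fin.ext (by omega)
    rw [treeComp_one_right, treeComp_one_right]
  | @comp q r m hr hq e _ _ p y _ ih =>
    have hc := c.2
    have he := e.2
    have hi := i.2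
    have hc' := c'.2
    have hb' := b.2
    obtain ⟨N, hN⟩ : ∃ N, N + 1 = l + q := ⟨l + q - 1, by omega⟩
    obtain ⟨N', rfl⟩ : ∃ N', N = N' + 1 := ⟨N - 1, by omega⟩
    have h2 : n + 1 = N' + 1 + r := by omega
    rw [← treeComp_assoc_seq hN h2 hq h (by omega),
      ← treeComp_assoc_seq (n := N') (by omega) (by omega) hq h' (by omega)]
    rcases hb with ⟨h3, h4, h5⟩ | ⟨h3, h4, h5⟩
    · have b1 : i.1 < N' + 1 := by omega
      have b2 : c'.1 + e.1 < N' := by omega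
      rw [treeRes_comp_corolla_lt hr h2 (by omega) hn rfl _ ⟨c'.1 + e.1, b2⟩ i ⟨i.1, b1⟩
          (by rw [inner_val]; omega) rfl (by rw [inner_val]; simp only; omega),
        ih (n' := N') hN (by omega) rfl ⟨i.1, b1⟩ (Or.inl ⟨h3, h4, h5⟩)]
      rfl
    · have b1 : b.1 + q - 1 < N' + 1 := by omega
      have b2 : c'.1 + e.1 < N' := by omega
      rw [treeRes_comp_corolla_gt hr h2 (by omega) hn rfl _ ⟨c'.1 + e.1, b2⟩ i ⟨b.1 + q - 1, b1⟩
          (by rw [inner_val]; omega) (by simp only; omega) (by rw [inner_val]; simp only; omega),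
        ih (n' := N') hN (by omega) rfl ⟨b.1 + q - 1, b1⟩
          (Or.inr ⟨h3, by simp only; omega, h5⟩)]
      rfl

end TreeMod

end StrictUnits

namespace StrictUnits

section TreeMod

variable {k : Type u} [Field k]

theorem corolla_comp_corolla {a b n : ℕ} (h : n + 1 = a + b) (ha : 2 ≤ a) (hb : 2 ≤ b)
    (p : Fin a) :
    treeComp h p (corolla k a) (corolla k b)
      = (twist a b p 1).negOnePow • tree k n {(0, n), (p.1, b + p.1)} := by
  have hp := p.2
  have e1 : expand p.1 b {(0, a)} = {(0, n)} := by
    simp only [expand, Finset.image_singleton, Prod.map, stretch]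
    congr 2
    split_ifs <;> omega
  rw [corolla, corolla, treeComp_tree h p (isTree_corolla ha) (isTree_corolla hb), graft, e1,
    shift_singleton, Finset.card_singleton]
  have e2 : inversions {(0, n)} {(p.1, b + p.1)} = 0 := by
    simp only [inversions, Finset.sum_singleton]
    rw [if_neg]
    unfold After; simp only; omega
  rw [e2, add_zero]
  rfl

theorem treeInsert_corolla {a b n : ℕ} (h : n + 1 = a + b) (ha : 2 ≤ a) (hb : 2 ≤ b)
    (p : Fin a) :
    treeInsert k n (p.1, b + p.1) {(0, n)}
      = (twist a b p 1 + 1).negOnePow • treeComp h p (corolla k a) (corolla k b) := by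
  have hp := p.2
  have h1 : (p.1, b + p.1) ∉ ({(0, n)} : Finset (ℕ × ℕ)) := by
    simp only [Finset.mem_singleton, Prod.mk.injEq]; omega
  have e2 : inversions {(p.1, b + p.1)} {(0, n)} = 1 := by
    simp only [inversions, Finset.sum_singleton]
    rw [if_pos]
    unfold After; simp only; omega
  rw [treeInsert_of_notMem h1, e2, corolla_comp_corolla h ha hb, smul_smul, ← Int.negOnePow_add,
    Finset.pair_comm]
  congr 1
  apply negOnePow_congr
  push_cast
  grind

theorem treeD_corolla_two : treeD k 2 (corolla k 2) = 0 := by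
  rw [corolla, treeD_tree (isTree_corolla le_rfl)]
  refine Finset.sum_eq_zero fun I hI => if_pos ?_
  rw [mem_intervals] at hI
  rw [Finset.mem_singleton]
  refine Prod.ext ?_ ?_ <;> simp only <;> omega

theorem interval_eq {n : ℕ} {I : ℕ × ℕ} (hI : I ∈ intervals n) (hne : I ≠ (0, n)) :
    ∃ (a b : ℕ) (p : Fin a), n + 1 = a + b ∧ 2 ≤ a ∧ 2 ≤ b ∧ I = (p.1, b + p.1) := by
  rw [mem_intervals] at hI
  have h : ¬(I.1 = 0 ∧ I.2 = n) := fun e => hne (Prod.ext e.1 e.2)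
  exact ⟨n + 1 - (I.2 - I.1), I.2 - I.1, ⟨I.1, by omega⟩, by omega, by omega, by omega,
    Prod.ext rfl (by simp only; omega)⟩

theorem treeRes_corolla_comp {a b n n' : ℕ} (h : n + 1 = a + b) (hn : n' + 1 = n) (ha : 2 ≤ a)
    (hb : 2 ≤ b) (p : Fin a) (j : Fin n) :
    treeRes hn j (treeComp h p (corolla k a) (corolla k b))
      = if (p.1 ≤ j.1 ∧ j.1 < p.1 + b ∧ b = 2) ∨ (j.1 < p.1 ∧ a = 2) ∨ (p.1 + b ≤ j.1 ∧ a = 2)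
        then corolla k n' else 0 := by
  have hp := p.2
  have hj := j.2
  obtain ⟨a', rfl⟩ : ∃ a', a = a' + 1 := ⟨a - 1, by omega⟩
  obtain ⟨b', rfl⟩ : ∃ b', b = b' + 1 := ⟨b - 1, by omega⟩
  by_cases j1 : j.1 < p.1
  · have b2 : j.1 < a' + 1 := by omega
    have b1 : p.1 - 1 < a' := by omega
    rw [treeRes_comp_corolla_lt hb h (by omega) hn rfl p ⟨p.1 - 1, b1⟩ j ⟨j.1, b2⟩ j1 rfl
      (by simp only; omega), treeRes_corolla ha rfl]
    by_cases h2 : a' + 1 = 2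
    · obtain rfl : a' = 1 := by omega
      obtain rfl : n' = b' + 1 := by omega
      rw [corollaRes_two, if_pos (Or.inr (Or.inl ⟨j1, rfl⟩)),
        Subsingleton.elim (⟨p.1 - 1, b1⟩ : Fin 1) 0, treeComp_one_left]
    · rw [corollaRes_of_ne h2, map_zero, LinearMap.zero_apply, if_neg (by omega)]
  by_cases j2 : j.1 < p.1 + (b' + 1)
  · rw [treeRes_comp_corolla_mid hb rfl h (by omega) hn p j (by omega) j2]
    by_cases h2 : b' + 1 = 2
    · obtain rfl : b' = 1 := by omega
      obtain rfl : n' = a' + 1 := by omega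
      rw [corollaRes_two, if_pos (by omega), treeComp_one_right]
    · rw [corollaRes_of_ne h2, map_zero, if_neg (by omega)]
  · have b2 : j.1 - b' < a' + 1 := by omega
    have b1 : p.1 < a' := by omega
    rw [treeRes_comp_corolla_gt hb h (by omega) hn rfl p ⟨p.1, b1⟩ j ⟨j.1 - b', b2⟩ (by omega)
      (by simp only; omega) rfl, treeRes_corolla ha rfl]
    by_cases h2 : a' + 1 = 2
    · obtain rfl : a' = 1 := by omega
      obtain rfl : n' = b' + 1 := by omega
      rw [corollaRes_two, if_pos (by omega),
        Subsingleton.elim (⟨p.1, b1⟩ : Fin 1) 0, treeComp_one_left]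
    · rw [corollaRes_of_ne h2, map_zero, LinearMap.zero_apply, if_neg (by omega)]

theorem treeRes_treeInsert_corolla {a b n n' : ℕ} (h : n + 1 = a + b) (hn : n' + 1 = n)
    (ha : 2 ≤ a) (hb : 2 ≤ b) (p : Fin a) (j : Fin n) :
    treeRes hn j (treeInsert k n (p.1, b + p.1) {(0, n)})
      = if (p.1 ≤ j.1 ∧ j.1 < p.1 + b ∧ b = 2) ∨ (j.1 < p.1 ∧ a = 2) ∨ (p.1 + b ≤ j.1 ∧ a = 2)
        then (twist a b p 1 + 1).negOnePow • corolla k n' else 0 := by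
  rw [treeInsert_corolla h ha hb, map_sign, treeRes_corolla_comp h hn ha hb]
  split_ifs
  · rfl
  · exact smul_zero _

theorem treeRes_treeD_corolla {n n' : ℕ} (hn2 : 2 ≤ n) (hn : n' + 1 = n) (j : Fin n) :
    treeRes hn j (treeD k n (corolla k n)) = 0 := by
  rcases Nat.lt_or_ge n 3 with h3 | h3
  · obtain rfl : n = 2 := by omega
    rw [treeD_corolla_two, map_zero]
  have hj := j.2
  let L : ℕ × ℕ := if j.1 = 0 then (1, n) else (j.1 - 1, j.1 + 1)
  let R : ℕ × ℕ := if j.1 + 1 = n then (0, n - 1) else (j.1, j.1 + 2)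
  have hL : ∃ (a b : ℕ) (p : Fin a), n + 1 = a + b ∧ 2 ≤ a ∧ 2 ≤ b ∧ L = (p.1, b + p.1) ∧
      ((p.1 ≤ j.1 ∧ j.1 < p.1 + b ∧ b = 2) ∨ (j.1 < p.1 ∧ a = 2) ∨ (p.1 + b ≤ j.1 ∧ a = 2)) ∧
      (twist a b p 1 + 1).negOnePow = (j.1 : ℤ).negOnePow := by
    by_cases h0 : j.1 = 0
    · have b1 : 1 < 2 := by omega
      refine ⟨2, n - 1, ⟨1, b1⟩, by omega, by omega, by omega, ?_, by simp [h0], ?_⟩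
      · exact (if_pos h0).trans (Prod.ext (by simp only) (by simp only; omega))
      · apply negOnePow_congr
        rw [h0]
        unfold twist
        push_cast
        grind
    · have e : ((j.1 - 1 : ℕ) : ZMod 2) + 1 = j.1 := by
        exact_mod_cast congrArg (Nat.cast (R := ZMod 2)) (show j.1 - 1 + 1 = j.1 by omega)
      have b1 : j.1 - 1 < n - 1 := by omega
      refine ⟨n - 1, 2, ⟨j.1 - 1, b1⟩, by omega, by omega, by omega, ?_,
        Or.inl ⟨by simp only; omega, by simp only; omega, rfl⟩, ?_⟩
      · exact (if_neg h0).trans (Prod.ext (by simp only) (by simp only; omega))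
      · apply negOnePow_congr
        unfold twist
        push_cast
        grind
  have hR : ∃ (a b : ℕ) (p : Fin a), n + 1 = a + b ∧ 2 ≤ a ∧ 2 ≤ b ∧ R = (p.1, b + p.1) ∧
      ((p.1 ≤ j.1 ∧ j.1 < p.1 + b ∧ b = 2) ∨ (j.1 < p.1 ∧ a = 2) ∨ (p.1 + b ≤ j.1 ∧ a = 2)) ∧
      (twist a b p 1 + 1).negOnePow = (j.1 + 1 : ℤ).negOnePow := by
    by_cases h0 : j.1 + 1 = n
    · have e : ((n - 1 : ℕ) : ZMod 2) + 1 = n := by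
        exact_mod_cast congrArg (Nat.cast (R := ZMod 2)) (show n - 1 + 1 = n by omega)
      have e' : (j.1 : ZMod 2) + 1 = n := by
        exact_mod_cast congrArg (Nat.cast (R := ZMod 2)) h0
      have b1 : 0 < 2 := by omega
      refine ⟨2, n - 1, ⟨0, b1⟩, by omega, by omega, by omega, ?_,
        Or.inr (Or.inr ⟨by simp only; omega, rfl⟩), ?_⟩
      · exact (if_pos h0).trans (Prod.ext (by simp only) (by simp only; omega))
      · apply negOnePow_congr
        unfold twist
        push_cast
        grind
    · have b1 : j.1 < n - 1 := by omega
      refine ⟨n - 1, 2, ⟨j.1, b1⟩, by omega, by omega, by omega, ?_,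
        Or.inl ⟨by simp only; omega, by simp only; omega, rfl⟩, ?_⟩
      · exact (if_neg h0).trans (Prod.ext (by simp only) (by simp only; omega))
      · apply negOnePow_congr
        unfold twist
        push_cast
        grind
  have hLR : L ≠ R := by
    simp only [L, R]
    split_ifs <;> simp only [ne_eq, Prod.mk.injEq] <;> omega
  have mem : ∀ I : ℕ × ℕ, (∃ (a b : ℕ) (p : Fin a), n + 1 = a + b ∧ 2 ≤ a ∧ 2 ≤ b ∧
      I = (p.1, b + p.1)) → I ∈ intervals n := by
    rintro I ⟨a, b, p, h, ha, hb, rfl⟩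
    have := p.2
    rw [mem_intervals]; simp only; omega
  rw [corolla, treeD_tree (isTree_corolla hn2), map_sum, Finset.sum_eq_add L R hLR]
  · obtain ⟨a, b, p, h, ha, hb, e, hc, hs⟩ := hL
    obtain ⟨a', b', p', h', ha', hb', e', hc', hs'⟩ := hR
    rw [e, e', treeRes_treeInsert_corolla h hn ha hb, treeRes_treeInsert_corolla h' hn ha' hb',
      if_pos hc, if_pos hc', hs, hs', neg_negOnePow_smul, add_neg_cancel]
  · intro I hI hne
    by_cases h0 : I = (0, n)
    · rw [h0, treeInsert, if_pos (Finset.mem_singleton_self _), map_zero]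
    · obtain ⟨a, b, p, h, ha, hb, rfl⟩ := interval_eq hI h0
      have hp := p.2
      rw [treeRes_treeInsert_corolla h hn ha hb, if_neg]
      intro hc
      have h1 : ¬(L.1 = p.1 ∧ L.2 = b + p.1) := fun e => hne.1 (Prod.ext e.1.symm e.2.symm)
      have h2 : ¬(R.1 = p.1 ∧ R.2 = b + p.1) := fun e => hne.2 (Prod.ext e.1.symm e.2.symm)
      simp only [L, R] at h1 h2
      split_ifs at h1 h2 <;> simp only at h1 h2 <;> omega
  · intro hI
    obtain ⟨a, b, p, h, ha, hb, e, _⟩ := hL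
    exact absurd (mem L ⟨a, b, p, h, ha, hb, e⟩) hI
  · intro hI
    obtain ⟨a, b, p, h, ha, hb, e, _⟩ := hR
    exact absurd (mem R ⟨a, b, p, h, ha, hb, e⟩) hI

/-- Induction on homogeneous elements of positive arity. -/
theorem homogeneous_word_induction {C : ∀ n, ℤ → TreeMod k n → Prop} (zero : ∀ n p, C n p 0)
    (add : ∀ n p x y, C n p x → C n p y → C n p (x + y))
    (smul : ∀ n p (c : k) x, C n p x → C n p (c • x)) (one : C 1 0 (tree k 1 ∅))
    (comp : ∀ {l m n : ℕ} (_ : 2 ≤ m) (h : n + 1 = l + m) (c : Fin l) (p : ℤ) (x : TreeMod k l),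
      x ∈ treeGr k l p → C l p x → C n (p + (2 - m)) (treeComp h c x (corolla k m)))
    {n : ℕ} (hn : 1 ≤ n) {p : ℤ} {x : TreeMod k n} (hx : x ∈ treeGr k n p) : C n p x := by
  induction n using Nat.strong_induction_on generalizing p with
  | _ n ih =>
    induction hx using treeGr_induction with
    | zero => exact zero n p
    | add f g _ _ hf hg => exact add n p f g hf hg
    | smul c f _ hf => exact smul n p c f hf
    | basis S hS hp =>
      rcases Nat.lt_or_ge n 2 with h2 | h2
      · obtain rfl : n = 1 := by omega
        rw [hS.eq_empty le_rfl] at hp ⊢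
        obtain rfl : p = 0 := by rw [← hp]; simp [treeDeg]
        exact one
      · obtain ⟨d⟩ := hS.nonempty_lastVertex h2
        have hl := d.lt
        have ha := d.arity
        have hm := d.two_le
        have hS' : tree k d.l d.S' ∈ treeGr k d.l (p - (2 - d.m)) := tree_mem fun _ => by
          rw [d.eq, treeDeg_of_pos (by omega), card_graft (by omega) d.isTree.two_le
            (isTree_corolla hm).bounds, Finset.card_singleton] at hp
          rw [treeDeg_of_pos (by omega)]
          push_cast at hp
          omega
        have h1 := comp hm d.arity ⟨d.c, d.lt⟩ _ _ hS' (ih d.l (by omega) (by omega) hS')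
        rw [d.treeComp_eq, sub_add_cancel] at h1
        have h3 := smul n p (((twist d.l d.m d.c 1).negOnePow : ℤ) : k) _ h1
        rwa [Int.cast_smul_eq_zsmul, ← Units.smul_def, sign_self_smul] at h3

theorem treeRes_mem {n n' : ℕ} (hn : n' + 1 = n) (i : Fin n) {p : ℤ} {x : TreeMod k n}
    (hx : x ∈ treeGr k n p) : treeRes hn i x ∈ treeGr k n' p := by
  have hn1 : 1 ≤ n := by omega
  refine homogeneous_word_induction (C := fun n p x => ∀ (n' : ℕ) (hn : n' + 1 = n) (i : Fin n),
    treeRes hn i x ∈ treeGr k n' p) ?_ ?_ ?_ ?_ ?_ hn1 hx n' hn i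
  · intros; rw [map_zero]; exact Submodule.zero_mem _
  · intro n p x y hx hy n' hn i
    rw [map_add]; exact Submodule.add_mem _ (hx n' hn i) (hy n' hn i)
  · intro n p c x hx n' hn i
    rw [map_smul]; exact Submodule.smul_mem _ c (hx n' hn i)
  · rintro n' hn i
    obtain rfl : n' = 0 := by omega
    rw [treeRes_one]
    exact tree_mem fun _ => by simp [treeDeg]
  · intro l m n hm h c p x hx ih n' hn i
    have hc := c.2
    have hi := i.2
    obtain ⟨l', rfl⟩ : ∃ l', l = l' + 1 := ⟨l - 1, by omega⟩
    obtain ⟨m', rfl⟩ : ∃ m', m = m' + 1 := ⟨m - 1, by omega⟩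
    by_cases i1 : i.1 < c.1
    · have b1 : i.1 < l' + 1 := by omega
      have b2 : c.1 - 1 < l' := by omega
      rw [treeRes_comp_corolla_lt hm h (by omega) hn rfl c ⟨c.1 - 1, b2⟩ i ⟨i.1, b1⟩ i1 rfl
        (by simp only; omega)]
      exact treeComp_mem _ (by omega) _ (ih _ rfl _) (corolla_mem hm)
    by_cases i2 : i.1 < c.1 + (m' + 1)
    · rw [treeRes_comp_corolla_mid hm rfl h (by omega) hn c i (by omega) i2]
      exact treeComp_mem _ (by omega) _ hx corollaRes_mem
    · have b1 : i.1 - m' < l' + 1 := by omega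
      have b2 : c.1 < l' := by omega
      rw [treeRes_comp_corolla_gt hm h (by omega) hn rfl c ⟨c.1, b2⟩ i ⟨i.1 - m', b1⟩ (by omega)
        (by simp only; omega) rfl]
      exact treeComp_mem _ (by omega) _ (ih _ rfl _) (corolla_mem hm)

theorem treeD_corollaRes {m n : ℕ} : treeD k n (corollaRes k m n) = 0 := by
  unfold corollaRes
  split_ifs with h
  · obtain ⟨_, rfl⟩ := h; exact treeD_one
  · exact map_zero _

theorem treeD_zero (x : TreeMod k 0) : treeD k 0 x = 0 := by
  induction x using treeMod_induction with
  | zero => exact map_zero _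
  | add x y hx hy => rw [map_add, hx, hy, add_zero]
  | smul c x hx => rw [map_smul, hx, smul_zero]
  | basis S hS =>
    rw [treeD_tree hS]
    refine Finset.sum_eq_zero fun I hI => ?_
    rw [mem_intervals] at hI
    omega

/-- Restriction operations are cochain maps. -/
theorem treeD_treeRes {n n' : ℕ} (hn : n' + 1 = n) (i : Fin n) (x : TreeMod k n) :
    treeD k n' (treeRes hn i x) = treeRes hn i (treeD k n x) := by
  have hn1 : 1 ≤ n := by omega
  induction hn1, x using word_induction generalizing n' with
  | zero n => simp only [map_zero]
  | add n _ x y hx hy => simp only [map_add, hx hn i, hy hn i]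
  | smul n _ c x hx => simp only [map_smul, hx hn i]
  | one =>
    obtain rfl : n' = 0 := by omega
    rw [treeD_one, map_zero, treeD_zero]
  | @comp l m n hm h c hl _ p x hx ih =>
    have hc := c.2
    have hi := i.2
    have hm1 : 1 ≤ m := by omega
    obtain ⟨l', rfl⟩ : ∃ l', l = l' + 1 := ⟨l - 1, by omega⟩
    obtain ⟨m', rfl⟩ : ∃ m', m = m' + 1 := ⟨m - 1, by omega⟩
    rw [treeD_treeComp h hm1 c _ hx, map_add, map_sign]
    by_cases i2 : c.1 ≤ i.1 ∧ i.1 < c.1 + (m' + 1)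
    · have b1 : i.1 - c.1 < m' + 1 := by omega
      have h' : n' + 1 = l' + 1 + m' := by omega
      rw [treeRes_comp_corolla_mid hm rfl h h' hn c i i2.1 i2.2,
        treeRes_comp_corolla_mid hm rfl h h' hn c i i2.1 i2.2,
        treeRes_comp_inner (by omega) rfl h h' hn c ⟨i.1 - c.1, b1⟩ i (by simp only; omega),
        treeRes_treeD_corolla hm rfl, treeD_treeComp h' (by omega) c _ hx, treeD_corollaRes,
        map_zero, smul_zero]
    · have h' : n' + 1 = l' + (m' + 1) := by omega
      obtain ⟨b, c', hb⟩ : ∃ (b : Fin (l' + 1)) (c' : Fin l'),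
          b.1 < c.1 ∧ i.1 = b.1 ∧ c'.1 + 1 = c.1 ∨
            c.1 < b.1 ∧ i.1 + 1 = b.1 + (m' + 1) ∧ c'.1 = c.1 := by
        by_cases i1 : i.1 < c.1
        · exact ⟨⟨i.1, by omega⟩, ⟨c.1 - 1, by omega⟩, Or.inl ⟨i1, rfl, by simp only; omega⟩⟩
        · exact ⟨⟨i.1 - m', by omega⟩, ⟨c.1, by omega⟩,
            Or.inr ⟨by simp only; omega, by simp only; omega, rfl⟩⟩
      have hx' : treeRes rfl b x ∈ treeGr k l' p := treeRes_mem rfl b hx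
      rw [treeRes_comp_outer hm1 h h' hn rfl c c' i b hb,
        treeRes_comp_outer hm1 h h' hn rfl c c' i b hb,
        treeRes_comp_outer hm1 h h' hn rfl c c' i b hb, treeD_treeComp h' hm1 c' _ hx', ih rfl b]

/-- `δᵢ δⱼ = δⱼ₋₁ δᵢ` for `i < j`. -/
theorem treeRes_treeRes {n n₁ n₂ : ℕ} (h₁ : n₁ + 1 = n) (h₂ : n₂ + 1 = n₁) (i j : Fin n)
    (i' j' : Fin n₁) (hij : i.1 < j.1) (hi : i'.1 = i.1) (hj : j'.1 + 1 = j.1)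
    (x : TreeMod k n) :
    treeRes h₂ i' (treeRes h₁ j x) = treeRes h₂ j' (treeRes h₁ i x) := by
  have hn1 : 1 ≤ n := by omega
  induction hn1, x using word_induction generalizing n₁ n₂ with
  | zero n => simp only [map_zero]
  | add n _ x y hx hy =>
    simp only [map_add, hx h₁ h₂ i j i' j' hij hi hj, hy h₁ h₂ i j i' j' hij hi hj]
  | smul n _ c x hx => simp only [map_smul, hx h₁ h₂ i j i' j' hij hi hj]
  | one => omega
  | @comp l m n hm h c hl _ p x hx ih =>
    have hc := c.2
    have hi2 := i.2
    have hj2 := j.2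
    have hm1 : 1 ≤ m := by omega
    obtain ⟨l', rfl⟩ : ∃ l', l = l' + 1 := ⟨l - 1, by omega⟩
    obtain ⟨m', rfl⟩ : ∃ m', m = m' + 1 := ⟨m - 1, by omega⟩
    by_cases j1 : j.1 < c.1
    · obtain ⟨l'', rfl⟩ : ∃ l'', l' = l'' + 1 := ⟨l' - 1, by omega⟩
      have b1 : j.1 < l'' + 1 + 1 := by omega
      have b2 : i.1 < l'' + 1 + 1 := by omega
      have b3 : j'.1 < l'' + 1 := by omega
      have b4 : i'.1 < l'' + 1 := by omega
      have b5 : c.1 - 1 < l'' + 1 := by omega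
      have b6 : c.1 - 2 < l'' := by omega
      have a1 : n₁ + 1 = l'' + 1 + (m' + 1) := by omega
      have a2 : n₂ + 1 = l'' + (m' + 1) := by omega
      rw [treeRes_comp_outer hm1 h a1 h₁ rfl c ⟨c.1 - 1, b5⟩ j ⟨j.1, b1⟩
          (Or.inl ⟨j1, rfl, by simp only; omega⟩),
        treeRes_comp_outer hm1 h a1 h₁ rfl c ⟨c.1 - 1, b5⟩ i ⟨i.1, b2⟩
          (Or.inl ⟨by simp only; omega, rfl, by simp only; omega⟩),
        treeRes_comp_outer hm1 a1 a2 h₂ rfl ⟨c.1 - 1, b5⟩ ⟨c.1 - 2, b6⟩ j' ⟨j'.1, b3⟩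
          (Or.inl ⟨by simp only; omega, rfl, by simp only; omega⟩),
        treeRes_comp_outer hm1 a1 a2 h₂ rfl ⟨c.1 - 1, b5⟩ ⟨c.1 - 2, b6⟩ i' ⟨i'.1, b4⟩
          (Or.inl ⟨by simp only; omega, rfl, by simp only; omega⟩),
        ih rfl rfl ⟨i.1, b2⟩ ⟨j.1, b1⟩ ⟨i'.1, b4⟩ ⟨j'.1, b3⟩ hij hi hj]
    by_cases j2 : j.1 < c.1 + (m' + 1)
    · have a1 : n₁ + 1 = l' + 1 + m' := by omega
      rw [treeRes_comp_corolla_mid hm rfl h a1 h₁ c j (by omega) j2]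
      by_cases i1 : i.1 < c.1
      · have b2 : i.1 < l' + 1 := by omega
        have b5 : c.1 - 1 < l' := by omega
        have a2 : n₂ + 1 = l' + m' := by omega
        have a3 : n₁ + 1 = l' + (m' + 1) := by omega
        rw [treeRes_comp_outer hm1 h a3 h₁ rfl c ⟨c.1 - 1, b5⟩ i ⟨i.1, b2⟩
            (Or.inl ⟨by simp only; omega, rfl, by simp only; omega⟩),
          treeRes_comp_corolla_mid hm rfl a3 a2 h₂ _ j' (by simp only; omega)
            (by simp only; omega),
          treeRes_comp_outer (by omega) a1 a2 h₂ rfl c ⟨c.1 - 1, b5⟩ i' ⟨i.1, b2⟩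
            (Or.inl ⟨by simp only; omega, by simp only; omega, by simp only; omega⟩)]
      · rw [treeRes_comp_corolla_mid hm rfl h a1 h₁ c i (by omega) (by omega)]
        by_cases hm2 : m' + 1 = 2
        · obtain rfl : m' = 1 := by omega
          obtain rfl : n₁ = l' + 1 := by omega
          rw [corollaRes_two, treeComp_one_right, Fin.ext (show i'.1 = j'.1 by omega)]
        · rw [corollaRes_of_ne hm2]; simp only [map_zero]
    · have a3 : n₁ + 1 = l' + (m' + 1) := by omega
      have b1 : j.1 - m' < l' + 1 := by omega
      have b7 : c.1 < l' := by omega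
      rw [treeRes_comp_outer hm1 h a3 h₁ rfl c ⟨c.1, b7⟩ j ⟨j.1 - m', b1⟩
            (Or.inr ⟨by simp only; omega, by simp only; omega, rfl⟩)]
      by_cases i1 : i.1 < c.1
      · obtain ⟨l'', rfl⟩ : ∃ l'', l' = l'' + 1 := ⟨l' - 1, by omega⟩
        have b2 : i.1 < l'' + 1 + 1 := by omega
        have b3 : j.1 - m' - 1 < l'' + 1 := by omega
        have b4 : i'.1 < l'' + 1 := by omega
        have b5 : c.1 - 1 < l'' + 1 := by omega
        have b6 : c.1 - 1 < l'' := by omega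
        have a2 : n₂ + 1 = l'' + (m' + 1) := by omega
        rw [treeRes_comp_outer hm1 h a3 h₁ rfl c ⟨c.1 - 1, b5⟩ i ⟨i.1, b2⟩
            (Or.inl ⟨i1, rfl, by simp only; omega⟩),
          treeRes_comp_outer hm1 a3 a2 h₂ rfl ⟨c.1 - 1, b5⟩ ⟨c.1 - 1, b6⟩ j' ⟨j.1 - m' - 1, b3⟩
            (Or.inr ⟨by simp only; omega, by simp only; omega, rfl⟩),
          treeRes_comp_outer hm1 a3 a2 h₂ rfl ⟨c.1, b7⟩ ⟨c.1 - 1, b6⟩ i' ⟨i'.1, b4⟩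
            (Or.inl ⟨by simp only; omega, rfl, by simp only; omega⟩),
          ih rfl rfl ⟨i.1, b2⟩ ⟨j.1 - m', b1⟩ ⟨i'.1, b4⟩ ⟨j.1 - m' - 1, b3⟩ (by simp only; omega)
            hi (by simp only; omega)]
      by_cases i2 : i.1 < c.1 + (m' + 1)
      · have a1 : n₁ + 1 = l' + 1 + m' := by omega
        have a2 : n₂ + 1 = l' + m' := by omega
        rw [treeRes_comp_corolla_mid hm rfl h a1 h₁ c i (by omega) (by omega),
          treeRes_comp_corolla_mid hm rfl a3 a2 h₂ _ i' (by simp only; omega)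
            (by simp only; omega),
          treeRes_comp_outer (by omega) a1 a2 h₂ rfl c ⟨c.1, b7⟩ j' ⟨j.1 - m', b1⟩
            (Or.inr ⟨by simp only; omega, by simp only; omega, rfl⟩)]
      · obtain ⟨l'', rfl⟩ : ∃ l'', l' = l'' + 1 := ⟨l' - 1, by omega⟩
        have b2 : i.1 - m' < l'' + 1 + 1 := by omega
        have b3 : j.1 - m' - 1 < l'' + 1 := by omega
        have b4 : i.1 - m' < l'' + 1 := by omega
        have b6 : c.1 < l'' := by omega
        have a2 : n₂ + 1 = l'' + (m' + 1) := by omega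
        rw [treeRes_comp_outer hm1 h a3 h₁ rfl c ⟨c.1, b7⟩ i ⟨i.1 - m', b2⟩
            (Or.inr ⟨by simp only; omega, by simp only; omega, rfl⟩),
          treeRes_comp_outer hm1 a3 a2 h₂ rfl ⟨c.1, b7⟩ ⟨c.1, b6⟩ j' ⟨j.1 - m' - 1, b3⟩
            (Or.inr ⟨by simp only; omega, by simp only; omega, rfl⟩),
          treeRes_comp_outer hm1 a3 a2 h₂ rfl ⟨c.1, b7⟩ ⟨c.1, b6⟩ i' ⟨i.1 - m', b4⟩
            (Or.inr ⟨by simp only; omega, by simp only; omega, rfl⟩),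
          ih rfl rfl ⟨i.1 - m', b2⟩ ⟨j.1 - m', b1⟩ ⟨i.1 - m', b4⟩ ⟨j.1 - m' - 1, b3⟩
            (by simp only; omega) rfl (by simp only; omega)]

end TreeMod

end StrictUnits

namespace StrictUnits

section GradedPieces

variable {k : Type u} [Field k] {M : Type v} [AddCommGroup M] [Module k M]

theorem isInternal_of_projections (gr : ℤ → Submodule k M) (π : ℤ → M →ₗ[k] M)
    (h₁ : ∀ {p x}, x ∈ gr p → π p x = x) (h₂ : ∀ {p q x}, q ≠ p → x ∈ gr p → π q x = 0)
    (h₃ : ∀ x, x ∈ ⨆ p, gr p) : DirectSum.IsInternal gr := by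
  rw [DirectSum.isInternal_submodule_iff_iSupIndep_and_iSup_eq_top]
  refine ⟨fun p => ?_, eq_top_iff.mpr fun x _ => h₃ x⟩
  rw [Submodule.disjoint_def]
  intro x hx hx'
  have h : (⨆ j : ℤ, ⨆ _ : j ≠ p, gr j) ≤ LinearMap.ker (π p) :=
    iSup₂_le fun j hj y hy => h₂ hj.symm hy
  rw [← h₁ hx]
  exact h hx'

theorem isInternal_supported {ι : Type w} (deg : ι → ℤ) :
    DirectSum.IsInternal fun p : ℤ => Finsupp.supported k k {i | deg i = p} := by
  refine isInternal_of_projections _ (fun p => (Finsupp.supported k k {i | deg i = p}).subtype ∘ₗ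
    Finsupp.restrictDom k k {i | deg i = p}) ?_ ?_ ?_
  · intro p x hx
    exact (congrArg Subtype.val (DFunLike.congr_fun
      (Finsupp.restrictDom_comp_subtype (M := k) (R := k) {i | deg i = p}) ⟨x, hx⟩) : _)
  · intro p q x hqp hx
    simp only [LinearMap.comp_apply, Submodule.subtype_apply]
    classical
    rw [Finsupp.restrictDom_apply, Finsupp.filter_eq_zero_iff]
    intro i hi
    by_contra h
    exact hqp ((Set.mem_ofPred.mp hi).symm.trans (hx (Finsupp.mem_support_iff.mpr h)))
  · intro x
    induction x using Finsupp.induction_linear with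
    | zero => exact Submodule.zero_mem _
    | add f g hf hg => exact Submodule.add_mem _ hf hg
    | single i c =>
      exact Submodule.mem_iSup_of_mem (deg i) (Finsupp.single_mem_supported k c rfl)

theorem exists_projections {gr : ℤ → Submodule k M} (h : DirectSum.IsInternal gr) :
    ∃ π : ℤ → M →ₗ[k] M, (∀ {p x}, x ∈ gr p → π p x = x) ∧
      (∀ {p q x}, q ≠ p → x ∈ gr p → π q x = 0) ∧ ∀ p x, π p x ∈ gr p := by
  let e := LinearEquiv.ofBijective (DirectSum.coeLinearMap gr) h
  have he : ∀ p (x : gr p), e.symm x.1 = DirectSum.lof k ℤ (fun p => gr p) p x := fun p x => by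
    rw [LinearEquiv.symm_apply_eq]
    exact (DirectSum.coeLinearMap_lof gr p x).symm
  refine ⟨fun p => (gr p).subtype ∘ₗ DirectSum.component k ℤ _ p ∘ₗ e.symm.toLinearMap,
    ?_, ?_, fun p x => Subtype.prop _⟩
  · intro p x hx
    have := he p ⟨x, hx⟩
    simp only at this
    simp only [LinearMap.comp_apply, LinearEquiv.coe_coe, this, DirectSum.component.lof_self,
      Submodule.subtype_apply]
  · intro p q x hqp hx
    have := he p ⟨x, hx⟩
    simp only at this
    simp only [LinearMap.comp_apply, LinearEquiv.coe_coe, this, DirectSum.component.of,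
      Submodule.subtype_apply]
    rw [dif_neg hqp.symm]; rfl

theorem mem_iSup_of_isInternal {gr : ℤ → Submodule k M} (h : DirectSum.IsInternal gr) (x : M) :
    x ∈ ⨆ p, gr p := by
  rw [h.submodule_iSup_eq_top]; exact Submodule.mem_top

/-- Induction on the homogeneous components of an element. -/
theorem homogeneous_induction {gr : ℤ → Submodule k M} (h : DirectSum.IsInternal gr)
    {C : M → Prop} (mem : ∀ p x, x ∈ gr p → C x) (add : ∀ x y, C x → C y → C (x + y)) (x : M) :
    C x :=
  Submodule.iSup_induction gr (motive := C) (mem_iSup_of_isInternal h x) mem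
    (mem 0 0 (Submodule.zero_mem _)) add

/-- The homogeneous pieces of the finitely supported families of elements. -/
def finsuppGr (ι : Type w) (gr : ℤ → Submodule k M) (p : ℤ) : Submodule k (ι →₀ M) where
  carrier := {f | ∀ i, f i ∈ gr p}
  zero_mem' _ := Submodule.zero_mem _
  add_mem' hf hg i := Submodule.add_mem _ (hf i) (hg i)
  smul_mem' c _ hf i := Submodule.smul_mem _ c (hf i)

theorem single_mem_finsuppGr {ι : Type w} {gr : ℤ → Submodule k M} {p : ℤ} (i : ι) {x : M}
    (hx : x ∈ gr p) : Finsupp.single i x ∈ finsuppGr ι gr p := by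
  classical
  intro j
  rw [Finsupp.single_apply]
  split_ifs
  · exact hx
  · exact Submodule.zero_mem _

theorem isInternal_finsuppGr (ι : Type w) {gr : ℤ → Submodule k M} (h : DirectSum.IsInternal gr) :
    DirectSum.IsInternal (finsuppGr ι gr) := by
  obtain ⟨π, h₁, h₂, _⟩ := exists_projections h
  refine isInternal_of_projections _ (fun p => Finsupp.mapRange.linearMap (π p)) ?_ ?_ ?_
  · intro p x hx
    exact Finsupp.ext fun i => h₁ (hx i)
  · intro p q x hqp hx
    exact Finsupp.ext fun i => h₂ hqp (hx i)
  · intro x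
    induction x using Finsupp.induction_linear with
    | zero => exact Submodule.zero_mem _
    | add f g hf hg => exact Submodule.add_mem _ hf hg
    | single i x =>
      refine homogeneous_induction h (C := fun x => Finsupp.single i x ∈ ⨆ p, finsuppGr ι gr p)
        ?_ ?_ x
      · intro p x hx
        exact Submodule.mem_iSup_of_mem p (single_mem_finsuppGr i hx)
      · intro x y hx hy
        rw [Finsupp.single_add]
        exact Submodule.add_mem _ hx hy

/-- Induction on homogeneous families. -/
@[elab_as_elim]
theorem finsuppGr_induction {ι : Type w} {gr : ℤ → Submodule k M} {p : ℤ} {C : (ι →₀ M) → Prop}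
    {f : ι →₀ M} (hf : f ∈ finsuppGr ι gr p) (zero : C 0)
    (add : ∀ f g, C f → C g → C (f + g)) (single : ∀ i x, x ∈ gr p → C (Finsupp.single i x)) :
    C f := by
  classical
  rw [← Finsupp.sum_single f, Finsupp.sum]
  exact Finset.sum_induction _ C add zero fun i _ => single i _ (hf i)

end GradedPieces

end StrictUnits

namespace StrictUnits

/-- A unitary dg operad without symmetric group actions. -/
structure PlanarOperad (k : Type u) [Field k] where
  obj : ℕ → DGMod.{u, u} k
  comp : ∀ {l m n : ℕ}, n + 1 = l + m → Fin l → (obj l →ₗ[k] obj m →ₗ[k] obj n)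
  comp_mem : ∀ {l m n : ℕ} (h : n + 1 = l + m) (i : Fin l) {p q : ℤ} {x : obj l} {y : obj m},
    x ∈ (obj l).gr p → y ∈ (obj m).gr q → comp h i x y ∈ (obj n).gr (p + q)
  comp_d : ∀ {l m n : ℕ} (h : n + 1 = l + m) (i : Fin l) {p : ℤ} {x : obj l} (y : obj m),
    x ∈ (obj l).gr p →
      (obj n).d (comp h i x y) = comp h i ((obj l).d x) y + p.negOnePow • comp h i x ((obj m).d y)
  one : obj 1
  one_mem : one ∈ (obj 1).gr 0
  one_d : (obj 1).d one = 0
  one_comp : ∀ {n : ℕ} (h : n + 1 = 1 + n) (x : obj n), comp h 0 one x = x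
  comp_one : ∀ {n : ℕ} (h : n + 1 = n + 1) (i : Fin n) (x : obj n), comp h i x one = x
  assoc_seq : ∀ {l m r n s t : ℕ} (h₁ : n + 1 = l + m) (h₂ : t + 1 = n + r)
    (h₃ : s + 1 = m + r) (h₄ : t + 1 = l + s) (i : Fin l) (j : Fin m)
    (x : obj l) (y : obj m) (z : obj r),
      comp h₂ (inner h₁ i j) (comp h₁ i x y) z = comp h₄ i x (comp h₃ j y z)
  assoc_par : ∀ {l m r n s t : ℕ} (h₁ : n + 1 = l + m) (h₂ : t + 1 = n + r)
    (h₃ : s + 1 = l + r) (h₄ : t + 1 = s + m) (i c : Fin l) (hci : c ≠ i) {p q : ℤ}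
    (x : obj l) {y : obj m} {z : obj r}, y ∈ (obj m).gr p → z ∈ (obj r).gr q →
      comp h₂ (outer h₁ i c hci) (comp h₁ i x y) z
        = (p * q).negOnePow • comp h₄ (outer h₃ c i hci.symm) (comp h₃ c x z) y
  unit : obj 0
  unit_mem : unit ∈ (obj 0).gr 0
  unit_basis : Function.Bijective (fun c : k => c • unit)

section Symmetrization

variable {k : Type u} [Field k]

namespace PlanarOperad

variable (P : PlanarOperad.{u} k)

/-- The free symmetric sequence on a planar operad: families of operations, indexed by the
permutations of the inputs. -/
noncomputable def symmObj (n : ℕ) : DGMod.{u, u} k where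
  carrier := Perm (Fin n) →₀ P.obj n
  gr := finsuppGr _ (P.obj n).gr
  isInternal := isInternal_finsuppGr _ (P.obj n).isInternal
  d := Finsupp.mapRange.linearMap (P.obj n).d
  d_mem hx σ := (P.obj n).d_mem (hx σ)
  d_d x := Finsupp.ext fun σ => (P.obj n).d_d (x σ)

/-- The operation `x`, with its inputs permuted by `σ`. -/
noncomputable def tens {n : ℕ} (σ : Perm (Fin n)) : P.obj n →ₗ[k] P.symmObj n :=
  Finsupp.lsingle σ

theorem tens_mem {n : ℕ} (σ : Perm (Fin n)) {p : ℤ} {x : P.obj n} (hx : x ∈ (P.obj n).gr p) :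
    P.tens σ x ∈ (P.symmObj n).gr p :=
  single_mem_finsuppGr σ hx

theorem d_tens {n : ℕ} (σ : Perm (Fin n)) (x : P.obj n) :
    (P.symmObj n).d (P.tens σ x) = P.tens σ ((P.obj n).d x) :=
  Finsupp.mapRange_single (hf := map_zero _)

variable {P}

@[elab_as_elim]
theorem symm_induction {n : ℕ} {C : P.symmObj n → Prop} (x : P.symmObj n) (zero : C 0)
    (add : ∀ x y, C x → C y → C (x + y)) (tens : ∀ σ x, C (P.tens σ x)) : C x :=
  Finsupp.induction_linear x zero add tens

@[elab_as_elim]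
theorem symm_homogeneous_induction {n : ℕ} {p : ℤ}
    {C : ∀ x : P.symmObj n, x ∈ (P.symmObj n).gr p → Prop} {x : P.symmObj n}
    (hx : x ∈ (P.symmObj n).gr p) (zero : C 0 (Submodule.zero_mem _))
    (add : ∀ x y hx hy, C x hx → C y hy → C (x + y) (Submodule.add_mem _ hx hy))
    (tens : ∀ σ x hx, C (P.tens σ x) (P.tens_mem σ hx)) : C x hx := by
  suffices h : ∃ h, C x h from h.2
  exact finsuppGr_induction (C := fun x => ∃ h, C x h) hx ⟨_, zero⟩
    (fun x y hx hy => ⟨_, add x y _ _ hx.2 hy.2⟩) fun σ x hx => ⟨_, tens σ x hx⟩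

variable (P)

/-- The right action of the symmetric group. -/
noncomputable def symmAct (n : ℕ) (π : Perm (Fin n)) : P.symmObj n →ₗ[k] P.symmObj n :=
  Finsupp.lmapDomain (P.obj n) k fun σ => σ * π

theorem symmAct_tens {n : ℕ} (π σ : Perm (Fin n)) (x : P.obj n) :
    P.symmAct n π (P.tens σ x) = P.tens (σ * π) x :=
  Finsupp.mapDomain_single

/-- A linear map on families, given by its values on each member. -/
noncomputable def symmLift {n : ℕ} {N : Type w} [AddCommGroup N] [Module k N]
    (f : Perm (Fin n) → (P.obj n →ₗ[k] N)) : P.symmObj n →ₗ[k] N :=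
  Finsupp.lsum k f

theorem symmLift_tens {n : ℕ} {N : Type w} [AddCommGroup N] [Module k N]
    (f : Perm (Fin n) → (P.obj n →ₗ[k] N)) (σ : Perm (Fin n)) (x : P.obj n) :
    P.symmLift f (P.tens σ x) = f σ x :=
  Finsupp.lsum_single k f σ x

noncomputable def symmComp {l m n : ℕ} (h : n + 1 = l + m) (i : Fin l) :
    P.symmObj l →ₗ[k] P.symmObj m →ₗ[k] P.symmObj n :=
  P.symmLift fun σ => (P.symmLift fun τ =>
    ((P.comp h (σ i)).compr₂ (P.tens (blockPerm h i σ τ))).flip).flip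

theorem symmComp_tens {l m n : ℕ} (h : n + 1 = l + m) (i : Fin l) (σ : Perm (Fin l))
    (τ : Perm (Fin m)) (x : P.obj l) (y : P.obj m) :
    P.symmComp h i (P.tens σ x) (P.tens τ y) = P.tens (blockPerm h i σ τ) (P.comp h (σ i) x y) := by
  rw [symmComp, symmLift_tens, LinearMap.flip_apply, symmLift_tens, LinearMap.flip_apply,
    LinearMap.compr₂_apply]

theorem comp_congr {l m n : ℕ} (h : n + 1 = l + m) {i j : Fin l} (hij : i = j) :
    P.comp h i = P.comp h j := by rw [hij]

/-- The symmetrization of a planar operad. -/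
noncomputable def symm : UOperad.{u} k where
  obj := P.symmObj
  act := P.symmAct
  act_one n x := by
    induction x using symm_induction with
    | zero => exact map_zero _
    | add x y hx hy => rw [map_add, hx, hy]
    | tens σ x => rw [symmAct_tens, mul_one]
  act_mul n σ τ x := by
    induction x using symm_induction with
    | zero => simp only [map_zero]
    | add x y hx hy => simp only [map_add, hx, hy]
    | tens π x => simp only [symmAct_tens, mul_assoc]
  act_mem n σ {p x} hx := by
    induction hx using symm_homogeneous_induction with
    | zero => rw [map_zero]; exact Submodule.zero_mem _
    | add x y _ _ hx hy => rw [map_add]; exact Submodule.add_mem _ hx hy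
    | tens π x hx => rw [symmAct_tens]; exact P.tens_mem _ hx
  act_d n σ x := by
    induction x using symm_induction with
    | zero => simp only [map_zero]
    | add x y hx hy => simp only [map_add, hx, hy]
    | tens π x => simp only [symmAct_tens, d_tens]
  comp := P.symmComp
  comp_mem {l m n} h i p q x y hx hy := by
    induction hx using symm_homogeneous_induction with
    | zero => rw [map_zero]; exact Submodule.zero_mem _
    | add x y _ _ hx hy => rw [map_add]; exact Submodule.add_mem _ hx hy
    | tens σ x hx =>
      induction hy using symm_homogeneous_induction with
      | zero => rw [map_zero]; exact Submodule.zero_mem _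
      | add x y _ _ hx hy => rw [map_add]; exact Submodule.add_mem _ hx hy
      | tens τ y hy => rw [symmComp_tens]; exact P.tens_mem _ (P.comp_mem h _ hx hy)
  comp_d {l m n} h i p x y hx := by
    induction hx using symm_homogeneous_induction with
    | zero => simp only [map_zero, LinearMap.zero_apply, smul_zero, add_zero]
    | add x y _ _ hx hy => simp only [map_add, LinearMap.add_apply, hx, hy, smul_add]; abel
    | tens σ x hx =>
      induction y using symm_induction with
      | zero => simp only [map_zero, smul_zero, add_zero]
      | add x y hx hy => simp only [map_add, hx, hy, smul_add]; abel
      | tens τ y => simp only [symmComp_tens, d_tens, P.comp_d h _ _ hx, map_add, map_sign]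
  one := P.tens 1 P.one
  one_mem := P.tens_mem _ P.one_mem
  one_d := by rw [d_tens, P.one_d, map_zero]
  one_comp {n} h x := by
    induction x using symm_induction with
    | zero => exact map_zero _
    | add x y hx hy => rw [map_add, hx, hy]
    | tens σ x => rw [symmComp_tens, blockPerm_one_left, Perm.one_apply, P.one_comp]
  comp_one {n} h i x := by
    induction x using symm_induction with
    | zero => rw [map_zero, LinearMap.zero_apply]
    | add x y hx hy => rw [map_add, LinearMap.add_apply, hx, hy]
    | tens σ x => rw [symmComp_tens, blockPerm_one_right, P.comp_one]
  assoc_seq {l m r n s t} h₁ h₂ h₃ h₄ i j x y z := by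
    induction x using symm_induction with
    | zero => simp only [map_zero, LinearMap.zero_apply]
    | add f g hf hg => simp only [map_add, LinearMap.add_apply, hf, hg]
    | tens σ x =>
      induction y using symm_induction with
      | zero => simp only [map_zero, LinearMap.zero_apply]
      | add f g hf hg => simp only [map_add, LinearMap.add_apply, hf, hg]
      | tens τ y =>
        induction z using symm_induction with
        | zero => simp only [map_zero]
        | add f g hf hg => simp only [map_add, hf, hg]
        | tens υ z =>
          rw [symmComp_tens, symmComp_tens, symmComp_tens, symmComp_tens,
            blockPerm_assoc_seq h₁ h₂ h₃ h₄, ← P.assoc_seq h₁ h₂ h₃ h₄,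
            P.comp_congr h₂ (blockPerm_inner h₁ i σ τ j)]
  assoc_par {l m r n s t} h₁ h₂ h₃ h₄ i c hci p q x y z hy hz := by
    induction x using symm_induction with
    | zero => simp only [map_zero, LinearMap.zero_apply, smul_zero]
    | add f g hf hg => simp only [map_add, LinearMap.add_apply, hf, hg, smul_add]
    | tens σ x =>
      induction hy using symm_homogeneous_induction with
      | zero => simp only [map_zero, LinearMap.zero_apply, smul_zero]
      | add f g _ _ hf hg => simp only [map_add, LinearMap.add_apply, hf, hg, smul_add]
      | tens τ y hy =>
        induction hz using symm_homogeneous_induction with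
        | zero => simp only [map_zero, LinearMap.zero_apply, smul_zero]
        | add f g _ _ hf hg => simp only [map_add, LinearMap.add_apply, hf, hg, smul_add]
        | tens υ z hz =>
          rw [symmComp_tens, symmComp_tens, symmComp_tens, symmComp_tens,
            blockPerm_assoc_par h₁ h₂ h₃ h₄, P.comp_congr h₂ (blockPerm_outer h₁ i σ τ c hci),
            P.assoc_par h₁ h₂ h₃ h₄ _ _ _ _ hy hz, map_sign,
            P.comp_congr h₄ (blockPerm_outer h₃ c σ υ i hci.symm)]
  equivariance {l m n} h i σ τ x y := by
    induction x using symm_induction with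
    | zero => simp only [map_zero, LinearMap.zero_apply]
    | add f g hf hg => simp only [map_add, LinearMap.add_apply, hf, hg]
    | tens σ' x =>
      induction y using symm_induction with
      | zero => simp only [map_zero]
      | add f g hf hg => simp only [map_add, hf, hg]
      | tens τ' y =>
        rw [symmAct_tens, symmAct_tens, symmComp_tens, symmComp_tens, symmAct_tens, blockPerm_mul]
        rfl
  unit := P.tens 1 P.unit
  unit_mem := P.tens_mem _ P.unit_mem
  unit_basis := by
    constructor
    · intro a b hab
      have := DFunLike.congr_fun (F := Perm (Fin 0) →₀ P.obj 0)
        ((P.tens 1).map_smul a P.unit |>.trans (hab.trans ((P.tens 1).map_smul b P.unit).symm)) 1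
      refine P.unit_basis.1 ?_
      exact (Finsupp.single_eq_same (M := P.obj 0)).symm.trans
        (this.trans (Finsupp.single_eq_same (M := P.obj 0)))
    · intro x
      induction x using symm_induction with
      | zero => exact ⟨0, zero_smul _ _⟩
      | add x y hx hy =>
        obtain ⟨a, rfl⟩ := hx
        obtain ⟨b, rfl⟩ := hy
        exact ⟨a + b, add_smul _ _ _⟩
      | tens σ x =>
        obtain ⟨a, rfl⟩ := P.unit_basis.2 x
        refine ⟨a, ?_⟩
        rw [Subsingleton.elim σ 1]
        exact ((P.tens 1).map_smul a P.unit).symm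

end PlanarOperad

end Symmetrization

end StrictUnits

namespace StrictUnits

section TreeOperad

variable {k : Type u} [Field k]

theorem treeMod_zero_eq (x : TreeMod k 0) : ∃ c : k, x = c • tree k 0 ∅ := by
  induction x using treeMod_induction with
  | zero => exact ⟨0, by simp⟩
  | add f g hf hg =>
    obtain ⟨c, rfl⟩ := hf
    obtain ⟨d, rfl⟩ := hg
    exact ⟨c + d, (add_smul _ _ _).symm⟩
  | smul c f hf =>
    obtain ⟨d, rfl⟩ := hf
    exact ⟨c * d, (mul_smul _ _ _).symm⟩
  | basis S hS => exact ⟨1, by rw [hS.eq_empty (Nat.zero_le 1), one_smul]⟩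

/-- The coefficient of an element of arity `0`. -/
noncomputable def treeCoeff (k : Type u) [Field k] : TreeMod k 0 →ₗ[k] k :=
  Finsupp.lapply ⟨∅, isTree_empty (Nat.zero_le 1)⟩

theorem treeCoeff_tree : treeCoeff k (tree k 0 ∅) = 1 := by
  rw [tree_of (isTree_empty (Nat.zero_le 1))]
  exact Finsupp.single_eq_same

theorem treeMod_zero_mem {p : ℤ} {x : TreeMod k 0} (hx : x ∈ treeGr k 0 p) : p = 0 ∨ x = 0 := by
  by_cases hp : p = 0
  · exact Or.inl hp
  · right
    obtain ⟨c, rfl⟩ := treeMod_zero_eq x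
    by_contra h0
    have hc : c ≠ 0 := by rintro rfl; exact h0 (zero_smul _ _)
    rw [tree_of (isTree_empty (Nat.zero_le 1)), Finsupp.smul_single, smul_eq_mul, mul_one] at hx
    have := hx (Finsupp.mem_support_iff.mpr (by rwa [Finsupp.single_eq_same]))
    exact hp (Eq.trans (Eq.symm this) (by simp [treeDeg]))

/-- The partial compositions of the operad of trees, including those with the unit. -/
noncomputable def nsComp {l m n : ℕ} (h : n + 1 = l + m) (i : Fin l) :
    TreeMod k l →ₗ[k] TreeMod k m →ₗ[k] TreeMod k n :=
  match m, h with
  | 0, h => (LinearMap.lsmul k (TreeMod k n) ∘ₗ treeCoeff k).flip ∘ₗ treeRes h i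
  | _ + 1, h => treeComp h i

theorem nsComp_of_pos {l m n : ℕ} (hm : 1 ≤ m) (h : n + 1 = l + m) (i : Fin l) :
    nsComp (k := k) h i = treeComp h i := by
  obtain ⟨m, rfl⟩ : ∃ m', m = m' + 1 := ⟨m - 1, by omega⟩
  rfl

theorem nsComp_unit {l n : ℕ} (h : n + 1 = l + 0) (i : Fin l) (x : TreeMod k l) :
    nsComp h i x (tree k 0 ∅) = treeRes h i x := by
  change treeCoeff k (tree k 0 ∅) • treeRes h i x = _
  rw [treeCoeff_tree, one_smul]

theorem nsComp_mem {l m n : ℕ} (h : n + 1 = l + m) (i : Fin l) {p q : ℤ} {x : TreeMod k l}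
    {y : TreeMod k m} (hx : x ∈ treeGr k l p) (hy : y ∈ treeGr k m q) :
    nsComp h i x y ∈ treeGr k n (p + q) := by
  rcases Nat.eq_zero_or_pos m with rfl | hm
  · rcases treeMod_zero_mem hy with rfl | rfl
    · obtain ⟨c, rfl⟩ := treeMod_zero_eq y
      rw [map_smul, nsComp_unit, add_zero]
      exact Submodule.smul_mem _ c (treeRes_mem _ _ hx)
    · rw [map_zero]; exact Submodule.zero_mem _
  · rw [nsComp_of_pos hm]
    exact treeComp_mem h hm i hx hy

theorem treeD_nsComp {l m n : ℕ} (h : n + 1 = l + m) (i : Fin l) {p : ℤ} {x : TreeMod k l}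
    (y : TreeMod k m) (hx : x ∈ treeGr k l p) :
    treeD k n (nsComp h i x y)
      = nsComp h i (treeD k l x) y + p.negOnePow • nsComp h i x (treeD k m y) := by
  rcases Nat.eq_zero_or_pos m with rfl | hm
  · obtain ⟨c, rfl⟩ := treeMod_zero_eq y
    rw [treeD_zero, map_zero, smul_zero, add_zero, map_smul, map_smul, map_smul, nsComp_unit,
      nsComp_unit, treeD_treeRes]
    rfl
  · rw [nsComp_of_pos hm]
    exact treeD_treeComp h hm i y hx

theorem nsComp_one_left {n : ℕ} (h : n + 1 = 1 + n) (x : TreeMod k n) :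
    nsComp h 0 (tree k 1 ∅) x = x := by
  rcases Nat.eq_zero_or_pos n with rfl | hn
  · obtain ⟨c, rfl⟩ := treeMod_zero_eq x
    rw [map_smul, nsComp_unit, treeRes_one]
  · rw [nsComp_of_pos hn]
    exact treeComp_one_left h x

theorem nsComp_one_right {n : ℕ} (h : n + 1 = n + 1) (i : Fin n) (x : TreeMod k n) :
    nsComp h i x (tree k 1 ∅) = x := by
  rw [nsComp_of_pos le_rfl]
  exact treeComp_one_right h i x

theorem nsComp_assoc_seq {l m r n s t : ℕ} (h₁ : n + 1 = l + m) (h₂ : t + 1 = n + r)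
    (h₃ : s + 1 = m + r) (h₄ : t + 1 = l + s) (i : Fin l) (j : Fin m)
    (x : TreeMod k l) (y : TreeMod k m) (z : TreeMod k r) :
    nsComp h₂ (inner h₁ i j) (nsComp h₁ i x y) z = nsComp h₄ i x (nsComp h₃ j y z) := by
  have hj := j.2
  have hm : 1 ≤ m := by omega
  rw [nsComp_of_pos hm]
  rcases Nat.eq_zero_or_pos r with rfl | hr
  · obtain ⟨c, rfl⟩ := treeMod_zero_eq z
    rw [map_smul, map_smul, map_smul, nsComp_unit, nsComp_unit]
    congr 1
    rcases Nat.eq_zero_or_pos s with rfl | hs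
    · obtain rfl : m = 1 := by omega
      obtain rfl : n = l := by omega
      obtain ⟨c, rfl⟩ := treeMod_one_eq y
      rw [map_smul, map_smul, map_smul, map_smul, treeRes_one, nsComp_unit, treeComp_one_right]
      have e : inner h₁ i j = i := Fin.ext (by rw [inner_val]; omega)
      rw [e]
    · rw [nsComp_of_pos hs, treeRes_comp_inner hs h₃ h₁ h₄ h₂ i j _ (inner_val _ _ _)]
  · rw [nsComp_of_pos hr, nsComp_of_pos hr, nsComp_of_pos (show 1 ≤ s by omega),
      treeComp_assoc_seq h₁ h₂ h₃ h₄ hr]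

theorem nsComp_assoc_par_unit {l m n s t : ℕ} (h₁ : n + 1 = l + m) (h₂ : t + 1 = n + 0)
    (h₃ : s + 1 = l + 0) (h₄ : t + 1 = s + m) (hm : 1 ≤ m) (i c : Fin l) (hci : c ≠ i)
    (x : TreeMod k l) (y : TreeMod k m) :
    treeRes h₂ (outer h₁ i c hci) (treeComp h₁ i x y)
      = treeComp h₄ (outer h₃ c i hci.symm) (treeRes h₃ c x) y := by
  have h := val_ne hci
  have hc := c.2
  have hi := i.2
  refine treeRes_comp_outer hm h₁ h₄ h₂ h₃ i _ _ c ?_ x y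
  rw [outer_val, outer_val]
  split_ifs <;> omega

theorem nsComp_assoc_par {l m r n s t : ℕ} (h₁ : n + 1 = l + m) (h₂ : t + 1 = n + r)
    (h₃ : s + 1 = l + r) (h₄ : t + 1 = s + m) (i c : Fin l) (hci : c ≠ i) {p q : ℤ}
    (x : TreeMod k l) {y : TreeMod k m} {z : TreeMod k r} (hy : y ∈ treeGr k m p)
    (hz : z ∈ treeGr k r q) :
    nsComp h₂ (outer h₁ i c hci) (nsComp h₁ i x y) z
      = (p * q).negOnePow • nsComp h₄ (outer h₃ c i hci.symm) (nsComp h₃ c x z) y := by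
  have h := val_ne hci
  rcases Nat.eq_zero_or_pos m with rfl | hm
  · rcases treeMod_zero_mem hy with rfl | rfl
    swap
    · simp only [map_zero, LinearMap.zero_apply, smul_zero]
    obtain ⟨a, rfl⟩ := treeMod_zero_eq y
    rw [zero_mul, Int.negOnePow_zero, one_smul]
    simp only [map_smul, LinearMap.smul_apply]
    congr 1
    rw [nsComp_unit, nsComp_unit]
    rcases Nat.eq_zero_or_pos r with rfl | hr
    · obtain ⟨b, rfl⟩ := treeMod_zero_eq z
      simp only [map_smul]
      congr 1
      rw [nsComp_unit, nsComp_unit]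
      obtain rfl : s = n := by omega
      rcases Nat.lt_or_gt_of_ne h with h' | h'
      · refine (treeRes_treeRes h₃ h₄ c i _ _ h' ?_ ?_ x) <;> rw [outer_val]
        · rw [if_pos h']
        · rw [if_neg (by omega)]; omega
      · refine (treeRes_treeRes h₃ h₄ i c _ _ h' ?_ ?_ x).symm <;> rw [outer_val]
        · rw [if_pos h']
        · rw [if_neg (by omega)]; omega
    · rw [nsComp_of_pos hr, nsComp_of_pos hr]
      exact (nsComp_assoc_par_unit h₃ h₄ h₁ h₂ hr c i hci.symm x z).symm
  · rw [nsComp_of_pos hm, nsComp_of_pos hm]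
    rcases Nat.eq_zero_or_pos r with rfl | hr
    · rcases treeMod_zero_mem hz with rfl | rfl
      swap
      · simp only [map_zero, LinearMap.zero_apply, smul_zero]
      obtain ⟨a, rfl⟩ := treeMod_zero_eq z
      rw [mul_zero, Int.negOnePow_zero, one_smul]
      simp only [map_smul, LinearMap.smul_apply]
      congr 1
      rw [nsComp_unit, nsComp_unit]
      exact nsComp_assoc_par_unit h₁ h₂ h₃ h₄ hm i c hci x y
    · rw [nsComp_of_pos hr, nsComp_of_pos hr]
      exact treeComp_assoc_par h₁ h₂ h₃ h₄ hm hr i c hci x hy hz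

theorem treeUnit_basis : Function.Bijective (fun c : k => c • tree k 0 ∅) := by
  constructor
  · intro a b hab
    have := congrArg (treeCoeff k) hab
    simpa only [map_smul, treeCoeff_tree, smul_eq_mul, mul_one] using this
  · intro x
    obtain ⟨c, rfl⟩ := treeMod_zero_eq x
    exact ⟨c, rfl⟩

theorem Splitting.sign_eq {n : ℕ} (s : Splitting n) (i : Fin s.1.1) :
    s.sign i = (twist s.1.1 s.1.2 i 1 + 1).negOnePow := by
  have h1 := i.2
  have h2 : s.sign i = ((s.1.2 * (s.1.1 - 1 - i.1) + i.1 + 1 : ℕ) : ℤ).negOnePow := by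
    rw [Splitting.sign, Int.negOnePow_def, zpow_natCast]
  rw [h2]
  apply negOnePow_congr
  have h3 : ((s.1.1 - 1 - i.1 : ℕ) : ZMod 2) + 1 + (i.1 : ZMod 2) = (s.1.1 : ZMod 2) := by
    exact_mod_cast congrArg (Nat.cast (R := ZMod 2)) (show s.1.1 - 1 - i.1 + 1 + i.1 = s.1.1 by omega)
  unfold twist
  push_cast
  rw [← h3]
  have hz : ∀ a b c : ZMod 2, b * a + c + 1 = (a + 1 + c + 1) * 1 + (a + 1 + c + 1 + c) * (b + 1) + 1 := by
    decide
  exact hz _ _ _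

theorem treeD_corolla {n : ℕ} (hn : 2 ≤ n) :
    treeD k n (corolla k n)
      = ∑ s : Splitting n, ∑ i : Fin s.1.1,
          s.sign i • treeComp s.eq i (corolla k s.1.1) (corolla k s.1.2) := by
  have h1 : ∀ (s : Splitting n) (i : Fin s.1.1),
      s.sign i • treeComp s.eq i (corolla k s.1.1) (corolla k s.1.2)
        = treeInsert k n (i.1, s.1.2 + i.1) {(0, n)} := fun s i => by
    rw [treeInsert_corolla s.eq s.le_left s.le_right, s.sign_eq]
  simp only [h1]
  rw [corolla, treeD_tree (isTree_corolla hn), ← Finset.sum_erase (a := (0, n)) (intervals n),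
    ← Fintype.sum_sigma' fun (s : Splitting n) (i : Fin s.1.1) =>
      treeInsert k n (i.1, s.1.2 + i.1) {(0, n)}]
  · refine (Finset.sum_bij (fun x _ => (x.2.1, x.1.1.2 + x.2.1)) ?_ ?_ ?_ ?_).symm
    · rintro ⟨s, i⟩ _
      have := s.eq; have := s.le_left; have := s.le_right; have := i.2
      rw [Finset.mem_erase, mem_intervals]
      simp only [ne_eq, Prod.mk.injEq]
      omega
    · rintro ⟨s, i⟩ _ ⟨s', i'⟩ _ h
      have e1 := s.eq
      have e2 := s'.eq
      simp only [Prod.mk.injEq] at h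
      obtain rfl : s = s' := Subtype.ext (Prod.ext (by omega) (by omega))
      obtain rfl : i = i' := Fin.ext h.1
      rfl
    · intro I hI
      obtain ⟨hne, hI⟩ := Finset.mem_erase.mp hI
      obtain ⟨a, b, p, h, ha, hb, rfl⟩ := interval_eq hI hne
      exact ⟨⟨⟨(a, b), Finset.mem_filter.mpr
        ⟨Finset.HasAntidiagonal.mem_antidiagonal.mpr h.symm, ha, hb⟩⟩, p⟩, Finset.mem_univ _, rfl⟩
    · intro x _; rfl
  · rw [treeInsert, if_pos (Finset.mem_singleton_self _)]

variable (k) [CharZero k]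

noncomputable def treeObj (n : ℕ) : DGMod.{u, u} k where
  carrier := TreeMod k n
  gr := treeGr k n
  isInternal := isInternal_supported fun S : Tree n => treeDeg (n := n) S.1
  d := treeD k n
  d_mem := treeD_mem
  d_d := treeD_treeD

/-- The planar dg operad of trees. -/
noncomputable def treeOperad : PlanarOperad.{u} k where
  obj := treeObj k
  comp := nsComp
  comp_mem := nsComp_mem
  comp_d := treeD_nsComp
  one := tree k 1 ∅
  one_mem := tree_mem fun _ => by simp [treeDeg]
  one_d := treeD_one
  one_comp := nsComp_one_left
  comp_one := nsComp_one_right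
  assoc_seq := nsComp_assoc_seq
  assoc_par := nsComp_assoc_par
  unit := tree k 0 ∅
  unit_mem := tree_mem fun _ => by simp [treeDeg]
  unit_basis := treeUnit_basis

/-- The operad of strictly unital `A_∞`-algebras. -/
noncomputable def ainfOperad : UOperad.{u} k := (treeOperad k).symm

variable {k}

/-- The operation `x`, with its inputs permuted by `σ`. -/
noncomputable def ainfTens {n : ℕ} (σ : Perm (Fin n)) : TreeMod k n →ₗ[k] (ainfOperad k).obj n :=
  (treeOperad k).tens σ

variable (k) in
/-- The generating operations. -/
noncomputable def ainfMu (n : ℕ) : (ainfOperad k).obj n := ainfTens 1 (corolla k n)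

theorem ainfComp_tens {l m n : ℕ} (h : n + 1 = l + m) (i : Fin l) (σ : Perm (Fin l))
    (τ : Perm (Fin m)) (x : TreeMod k l) (y : TreeMod k m) :
    (ainfOperad k).comp h i (ainfTens σ x) (ainfTens τ y)
      = ainfTens (blockPerm h i σ τ) (nsComp h (σ i) x y) :=
  (treeOperad k).symmComp_tens h i σ τ x y

theorem ainfD_tens {n : ℕ} (σ : Perm (Fin n)) (x : TreeMod k n) :
    ((ainfOperad k).obj n).d (ainfTens σ x) = ainfTens σ (treeD k n x) :=
  (treeOperad k).d_tens σ x

theorem ainfAct_tens {n : ℕ} (π σ : Perm (Fin n)) (x : TreeMod k n) :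
    (ainfOperad k).act n π (ainfTens σ x) = ainfTens (σ * π) x :=
  (treeOperad k).symmAct_tens π σ x

theorem ainfTens_mem {n : ℕ} (σ : Perm (Fin n)) {p : ℤ} {x : TreeMod k n} (hx : x ∈ treeGr k n p) :
    ainfTens σ x ∈ ((ainfOperad k).obj n).gr p :=
  (treeOperad k).tens_mem σ hx

theorem ainfOne_eq : (ainfOperad k).one = ainfTens 1 (tree k 1 ∅) := rfl

theorem ainfUnit_eq : (ainfOperad k).unit = ainfTens 1 (tree k 0 ∅) := rfl

@[elab_as_elim]
theorem ainf_induction {n : ℕ} {C : (ainfOperad k).obj n → Prop} (x : (ainfOperad k).obj n)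
    (zero : C 0) (add : ∀ x y, C x → C y → C (x + y)) (tens : ∀ σ x, C (ainfTens σ x)) : C x :=
  PlanarOperad.symm_induction x zero add tens

@[elab_as_elim]
theorem ainf_homogeneous_induction {n : ℕ} {p : ℤ}
    {C : ∀ x : (ainfOperad k).obj n, x ∈ ((ainfOperad k).obj n).gr p → Prop}
    {x : (ainfOperad k).obj n}
    (hx : x ∈ ((ainfOperad k).obj n).gr p) (zero : C 0 (Submodule.zero_mem _))
    (add : ∀ x y hx hy, C x hx → C y hy → C (x + y) (Submodule.add_mem _ hx hy))
    (tens : ∀ σ x hx, C (ainfTens σ x) (ainfTens_mem σ hx)) : C x hx :=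
  PlanarOperad.symm_homogeneous_induction hx zero add tens

theorem ainfRes_tens {m n : ℕ} (h : m + 1 = n) (i : Fin n) (σ : Perm (Fin n)) (x : TreeMod k n) :
    (ainfOperad k).res h i (ainfTens σ x)
      = ainfTens (blockPerm (l := n) (m := 0) (by omega) i σ 1) (treeRes h (σ i) x) := by
  rw [UOperad.res, ainfUnit_eq, ainfComp_tens, nsComp_unit]

theorem blockPerm_one {l m n : ℕ} (h : n + 1 = l + m) (i : Fin l) :
    blockPerm h i 1 1 = 1 := by
  ext x
  rcases slot_cases h i x with ⟨c, hc, rfl⟩ | ⟨b, rfl⟩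
  · rw [blockPerm_outer]; rfl
  · rw [blockPerm_inner]; rfl

theorem ainfComp_tens_one {l m n : ℕ} (h : n + 1 = l + m) (i : Fin l)
    (x : TreeMod k l) (y : TreeMod k m) :
    (ainfOperad k).comp h i (ainfTens 1 x) (ainfTens 1 y) = ainfTens 1 (nsComp h i x y) := by
  rw [ainfComp_tens, blockPerm_one, Perm.one_apply]

theorem ainfRes_tens_one {m n : ℕ} (h : m + 1 = n) (i : Fin n) (x : TreeMod k n) :
    (ainfOperad k).res h i (ainfTens 1 x) = ainfTens 1 (treeRes h i x) := by
  rw [ainfRes_tens, blockPerm_one, Perm.one_apply]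

theorem ainfMu_mem {n : ℕ} (hn : 2 ≤ n) : ainfMu k n ∈ ((ainfOperad k).obj n).gr (2 - n) :=
  ainfTens_mem 1 (corolla_mem hn)

theorem ainfRes_mu_two (i : Fin 2) : (ainfOperad k).res rfl i (ainfMu k 2) = (ainfOperad k).one := by
  rw [ainfMu, ainfRes_tens_one, treeRes_corolla le_rfl, corollaRes_two]; rfl

theorem ainfRes_mu {n : ℕ} (hn : 2 ≤ n) (i : Fin (n + 1)) :
    (ainfOperad k).res rfl i (ainfMu k (n + 1)) = 0 := by
  rw [ainfMu, ainfRes_tens_one, treeRes_corolla (by omega), corollaRes_of_ne (by omega), map_zero]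

theorem ainfD_mu {n : ℕ} (hn : 2 ≤ n) :
    ((ainfOperad k).obj n).d (ainfMu k n)
      = ∑ s : Splitting n, ∑ i : Fin s.1.1,
          s.sign i • (ainfOperad k).comp s.eq i (ainfMu k s.1.1) (ainfMu k s.1.2) := by
  rw [ainfMu, ainfD_tens, treeD_corolla hn, map_sum]
  refine Finset.sum_congr rfl fun s _ => ?_
  rw [map_sum]
  refine Finset.sum_congr rfl fun i _ => ?_
  rw [map_sign, ainfMu, ainfMu, ainfComp_tens_one, nsComp_of_pos (by have := s.le_right; omega)]

end TreeOperad

end StrictUnits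

namespace StrictUnits

/-- The structure carried by the operations on a dg vector space, in a form that allows signs to
be inserted: compositions take the degree of the right factor as an argument, and the differential
takes the degree of the operation as an argument. -/
structure SignedOperad (k : Type u) [Field k] where
  X : ℕ → Type w
  [addCommGroup : ∀ n, AddCommGroup (X n)]
  [module : ∀ n, Module k (X n)]
  gr : ∀ n, ℤ → Submodule k (X n)
  act : ∀ n, Perm (Fin n) → (X n →ₗ[k] X n)
  act_one : ∀ n (x : X n), act n 1 x = x
  act_mul : ∀ n (σ τ : Perm (Fin n)) (x : X n), act n (σ * τ) x = act n τ (act n σ x)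
  act_mem : ∀ n (σ : Perm (Fin n)) {p : ℤ} {x : X n}, x ∈ gr n p → act n σ x ∈ gr n p
  comp : ∀ {l m n : ℕ}, n + 1 = l + m → Fin l → ℤ → (X l →ₗ[k] X m →ₗ[k] X n)
  comp_mem : ∀ {l m n : ℕ} (h : n + 1 = l + m) (i : Fin l) {p q : ℤ} {x : X l} {y : X m},
    x ∈ gr l p → y ∈ gr m q → comp h i q x y ∈ gr n (p + q)
  one : X 1
  one_mem : one ∈ gr 1 0
  one_comp : ∀ {n : ℕ} (h : n + 1 = 1 + n) (q : ℤ) (x : X n), comp h 0 q one x = x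
  comp_one : ∀ {n : ℕ} (h : n + 1 = n + 1) (i : Fin n) (x : X n), comp h i 0 x one = x
  assoc_seq : ∀ {l m r n s t : ℕ} (h₁ : n + 1 = l + m) (h₂ : t + 1 = n + r)
    (h₃ : s + 1 = m + r) (h₄ : t + 1 = l + s) (i : Fin l) (j : Fin m) {p q : ℤ}
    (x : X l) {y : X m} {z : X r}, y ∈ gr m p → z ∈ gr r q →
      comp h₂ (inner h₁ i j) q (comp h₁ i p x y) z = comp h₄ i (p + q) x (comp h₃ j q y z)
  assoc_par : ∀ {l m r n s t : ℕ} (h₁ : n + 1 = l + m) (h₂ : t + 1 = n + r)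
    (h₃ : s + 1 = l + r) (h₄ : t + 1 = s + m) (i c : Fin l) (hci : c ≠ i) {p q : ℤ}
    (x : X l) {y : X m} {z : X r}, y ∈ gr m p → z ∈ gr r q →
      comp h₂ (outer h₁ i c hci) q (comp h₁ i p x y) z
        = (p * q).negOnePow • comp h₄ (outer h₃ c i hci.symm) p (comp h₃ c q x z) y
  equivariance : ∀ {l m n : ℕ} (h : n + 1 = l + m) (i : Fin l) (σ : Perm (Fin l))
    (τ : Perm (Fin m)) {q : ℤ} (x : X l) {y : X m}, y ∈ gr m q →
      comp h i q (act l σ x) (act m τ y) = act n (blockPerm h i σ τ) (comp h (σ i) q x y)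
  d : ∀ n, ℤ → (X n →ₗ[k] X n)
  act_d : ∀ n (σ : Perm (Fin n)) {p : ℤ} {x : X n}, x ∈ gr n p →
    act n σ (d n p x) = d n p (act n σ x)
  d_one : d 1 0 one = 0
  comp_d : ∀ {l m n : ℕ} (h : n + 1 = l + m) (i : Fin l) {p q : ℤ} {x : X l} {y : X m},
    x ∈ gr l p → y ∈ gr m q →
      d n (p + q) (comp h i q x y)
        = comp h i q (d l p x) y + p.negOnePow • comp h i (q + 1) x (d m q y)

attribute [instance] SignedOperad.addCommGroup SignedOperad.module

/-- A unit and operations of degree `2 - n` that satisfy the unit relations. -/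
structure SignedOperad.UnitalOps {k : Type u} [Field k] (T : SignedOperad.{u, w} k) where
  unit : T.X 0
  unit_mem : unit ∈ T.gr 0 0
  mu : ∀ n, T.X n
  mu_mem : ∀ {n : ℕ}, 2 ≤ n → mu n ∈ T.gr n (2 - n)
  mu_two_unit : ∀ i : Fin 2, T.comp (n := 1) (m := 0) rfl i 0 (mu 2) unit = T.one
  mu_unit : ∀ {n : ℕ}, 2 ≤ n → ∀ i : Fin (n + 1),
    T.comp (n := n) (m := 0) rfl i 0 (mu (n + 1)) unit = 0

/-- A unit and operations of degree `2 - n` that satisfy the unit relations and the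
`A_∞`-relations. -/
structure SignedOperad.UnitalAInf {k : Type u} [Field k] (T : SignedOperad.{u, w} k) extends
    T.UnitalOps where
  d_unit : T.d 0 0 unit = 0
  d_mu : ∀ {n : ℕ}, 2 ≤ n → T.d n (2 - n) (mu n)
    = ∑ s : Splitting n, ∑ i : Fin s.1.1,
        s.sign i • T.comp s.eq i (2 - s.1.2) (mu s.1.1) (mu s.1.2)

namespace SignedOperad.UnitalOps

variable {k : Type u} [Field k] {T : SignedOperad.{u, w} k} (U : T.UnitalOps)

/-- The word module that evaluates trees. -/
noncomputable def wordModule : WordModule.{u, w} k where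
  X := T.X
  one := T.one
  op {_ m _} _ h c := (T.comp h c (2 - m)).flip (U.mu m)
  exchange hm hr h₁ h₂ h₃ h₄ i c hci _ x :=
    T.assoc_par h₁ h₂ h₃ h₄ i c hci x (U.mu_mem hm) (U.mu_mem hr)

/-- The evaluation of trees. -/
noncomputable def evalTree : ∀ n, TreeMod k n →ₗ[k] T.X n
  | 0 => (treeCoeff k).smulRight U.unit
  | n + 1 => U.wordModule.lift (n + 1)

theorem evalTree_of_pos {n : ℕ} (hn : 1 ≤ n) : U.evalTree n = U.wordModule.lift n := by
  obtain ⟨n, rfl⟩ : ∃ n', n = n' + 1 := ⟨n - 1, by omega⟩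
  rfl

theorem evalTree_zero : U.evalTree 0 (tree k 0 ∅) = U.unit := by
  rw [evalTree, LinearMap.smulRight_apply, treeCoeff_tree, one_smul]

theorem evalTree_one : U.evalTree 1 (tree k 1 ∅) = T.one := U.wordModule.lift_one

theorem evalTree_comp_corolla {l m n : ℕ} (hm : 2 ≤ m) (h : n + 1 = l + m) (c : Fin l)
    (x : TreeMod k l) :
    U.evalTree n (treeComp h c x (corolla k m)) = T.comp h c (2 - m) (U.evalTree l x) (U.mu m) := by
  have hc := c.2
  rw [U.evalTree_of_pos (n := n) (by omega), U.evalTree_of_pos (n := l) (by omega)]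
  exact U.wordModule.lift_comp hm h c x

theorem evalTree_corolla {m : ℕ} (hm : 2 ≤ m) : U.evalTree m (corolla k m) = U.mu m := by
  have h := U.evalTree_comp_corolla hm (Nat.add_comm m 1) 0 (tree k 1 ∅)
  rwa [treeComp_one_left, evalTree_one, T.one_comp] at h

theorem evalTree_corollaRes {m' : ℕ} (hm : 2 ≤ m' + 1) (j : Fin (m' + 1)) :
    U.evalTree m' (corollaRes k (m' + 1) m')
      = T.comp (n := m') (m := 0) rfl j 0 (U.mu (m' + 1)) U.unit := by
  rcases Nat.lt_or_ge m' 2 with h | h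
  · obtain rfl : m' = 1 := by omega
    rw [corollaRes_two, evalTree_one, U.mu_two_unit]
  · rw [corollaRes_of_ne (by omega), map_zero, U.mu_unit h]

theorem evalTree_res {n n' : ℕ} (hn : n' + 1 = n) (i : Fin n) (x : TreeMod k n) :
    U.evalTree n' (treeRes hn i x)
      = T.comp (l := n) (m := 0) hn i 0 (U.evalTree n x) U.unit := by
  have hn1 : 1 ≤ n := by omega
  induction hn1, x using word_induction generalizing n' with
  | zero n => simp only [map_zero, LinearMap.zero_apply]
  | add n _ x y hx hy => simp only [map_add, LinearMap.add_apply, hx hn i, hy hn i]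
  | smul n _ c x hx => simp only [map_smul, LinearMap.smul_apply, hx hn i]
  | one =>
    obtain rfl : n' = 0 := by omega
    rw [treeRes_one, evalTree_zero, evalTree_one, Subsingleton.elim i 0, T.one_comp]
  | @comp l m n hm h c hl _ p x hx ih =>
    have hc := c.2
    have hi := i.2
    have hm1 : 1 ≤ m := by omega
    obtain ⟨l', rfl⟩ : ∃ l', l = l' + 1 := ⟨l - 1, by omega⟩
    obtain ⟨m', rfl⟩ : ∃ m', m = m' + 1 := ⟨m - 1, by omega⟩
    rw [evalTree_comp_corolla U hm]
    by_cases i2 : c.1 ≤ i.1 ∧ i.1 < c.1 + (m' + 1)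
    · have b1 : i.1 - c.1 < m' + 1 := by omega
      have h' : n' + 1 = l' + 1 + m' := by omega
      have e : i = inner h c ⟨i.1 - c.1, b1⟩ := Fin.ext (by rw [inner_val]; simp only; omega)
      conv_rhs => rw [e]
      rw [treeRes_comp_corolla_mid hm rfl h h' hn c i i2.1 i2.2,
        T.assoc_seq (r := 0) h hn rfl h' c _ _ (U.mu_mem hm) U.unit_mem, ← U.evalTree_corollaRes hm]
      rcases Nat.lt_or_ge m' 2 with h2 | h2
      · obtain rfl : m' = 1 := by omega
        obtain rfl : n' = l' + 1 := by omega
        rw [corollaRes_two, evalTree_one, treeComp_one_right]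
        exact (T.comp_one _ _ _).symm
      · rw [corollaRes_of_ne (by omega)]
        simp only [map_zero]
    · have h' : n' + 1 = l' + (m' + 1) := by omega
      obtain ⟨b, c', hb⟩ : ∃ (b : Fin (l' + 1)) (c' : Fin l'),
          b.1 < c.1 ∧ i.1 = b.1 ∧ c'.1 + 1 = c.1 ∨
            c.1 < b.1 ∧ i.1 + 1 = b.1 + (m' + 1) ∧ c'.1 = c.1 := by
        by_cases i1 : i.1 < c.1
        · exact ⟨⟨i.1, by omega⟩, ⟨c.1 - 1, by omega⟩, Or.inl ⟨i1, rfl, by simp only; omega⟩⟩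
        · exact ⟨⟨i.1 - m', by omega⟩, ⟨c.1, by omega⟩,
            Or.inr ⟨by simp only; omega, by simp only; omega, rfl⟩⟩
      have hbc : b ≠ c := by rintro rfl; omega
      have e : i = outer h c b hbc := Fin.ext (by rw [outer_val]; split_ifs <;> omega)
      have e' : c' = outer (n := l') (m := 0) rfl b c hbc.symm :=
        Fin.ext (by rw [outer_val]; split_ifs <;> omega)
      rw [treeRes_comp_outer hm1 h h' hn rfl c c' i b hb, evalTree_comp_corolla U hm, ih rfl b, e,
        T.assoc_par (r := 0) h hn rfl h' c b hbc _ (U.mu_mem hm) U.unit_mem, mul_zero,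
        Int.negOnePow_zero, one_smul, e']

theorem evalTree_mem {n : ℕ} {p : ℤ} {x : TreeMod k n} (hx : x ∈ treeGr k n p) :
    U.evalTree n x ∈ T.gr n p := by
  rcases Nat.eq_zero_or_pos n with rfl | hn
  · rcases treeMod_zero_mem hx with rfl | rfl
    · obtain ⟨c, rfl⟩ := treeMod_zero_eq x
      rw [map_smul, evalTree_zero]
      exact Submodule.smul_mem _ c U.unit_mem
    · rw [map_zero]; exact Submodule.zero_mem _
  refine homogeneous_word_induction (C := fun n p x => U.evalTree n x ∈ T.gr n p)
    ?_ ?_ ?_ ?_ ?_ hn hx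
  · intros; rw [map_zero]; exact Submodule.zero_mem _
  · intro n p x y hx hy; rw [map_add]; exact Submodule.add_mem _ hx hy
  · intro n p c x hx; rw [map_smul]; exact Submodule.smul_mem _ c hx
  · rw [evalTree_one]; exact T.one_mem
  · intro l m n hm h c p x _ hx
    rw [evalTree_comp_corolla U hm]
    exact T.comp_mem h c hx (U.mu_mem hm)

theorem evalTree_comp {l m n : ℕ} (h : n + 1 = l + m) (i : Fin l) {q : ℤ} (x : TreeMod k l)
    {y : TreeMod k m} (hy : y ∈ treeGr k m q) :
    U.evalTree n (nsComp h i x y) = T.comp h i q (U.evalTree l x) (U.evalTree m y) := by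
  rcases Nat.eq_zero_or_pos m with rfl | hm
  · rcases treeMod_zero_mem hy with rfl | rfl
    · obtain ⟨c, rfl⟩ := treeMod_zero_eq y
      simp only [map_smul]
      rw [nsComp_unit, evalTree_res, evalTree_zero]
      rfl
    · simp only [map_zero]
  rw [nsComp_of_pos hm]
  refine homogeneous_word_induction (C := fun m q y => ∀ (n : ℕ) (h : n + 1 = l + m),
    U.evalTree n (treeComp h i x y) = T.comp h i q (U.evalTree l x) (U.evalTree m y))
    ?_ ?_ ?_ ?_ ?_ hm hy n h
  · intros; simp only [map_zero]
  · intro m q y z hy hz n h; simp only [map_add, hy n h, hz n h]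
  · intro m q c y hy n h; simp only [map_smul, hy n h]
  · intro n h
    obtain rfl : n = l := by omega
    rw [treeComp_one_right, evalTree_one, T.comp_one]
  · intro m r s hr h₃ c q y hy ih n h
    have hc := c.2
    have hi := i.2
    obtain ⟨N, hN⟩ : ∃ N, N + 1 = l + m := ⟨l + m - 1, by omega⟩
    have h₂ : n + 1 = N + r := by omega
    rw [← treeComp_assoc_seq hN h₂ h₃ h (by omega), evalTree_comp_corolla U hr, ih N hN,
      T.assoc_seq hN h₂ h₃ h _ _ _ (U.evalTree_mem hy) (U.mu_mem hr), evalTree_comp_corolla U hr]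

variable [CharZero k]

/-- The evaluation of the operations of the operad of strictly unital `A_∞`-algebras. -/
noncomputable def eval (n : ℕ) : (ainfOperad k).obj n →ₗ[k] T.X n :=
  (treeOperad k).symmLift fun σ => T.act n σ ∘ₗ U.evalTree n

theorem eval_tens {n : ℕ} (σ : Perm (Fin n)) (x : TreeMod k n) :
    U.eval n (ainfTens σ x) = T.act n σ (U.evalTree n x) :=
  (treeOperad k).symmLift_tens _ σ x

theorem eval_mem {n : ℕ} {p : ℤ} {x : (ainfOperad k).obj n} (hx : x ∈ ((ainfOperad k).obj n).gr p) :
    U.eval n x ∈ T.gr n p := by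
  induction hx using ainf_homogeneous_induction with
  | zero => rw [map_zero]; exact Submodule.zero_mem _
  | add x y _ _ hx hy => rw [map_add]; exact Submodule.add_mem _ hx hy
  | tens σ x hx => rw [eval_tens]; exact T.act_mem _ _ (U.evalTree_mem hx)

theorem eval_act {n : ℕ} (σ : Perm (Fin n)) (x : (ainfOperad k).obj n) :
    U.eval n ((ainfOperad k).act n σ x) = T.act n σ (U.eval n x) := by
  induction x using ainf_induction with
  | zero => simp only [map_zero]
  | add x y hx hy => simp only [map_add, hx, hy]
  | tens τ x => rw [ainfAct_tens, eval_tens, eval_tens, T.act_mul]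

theorem eval_comp {l m n : ℕ} (h : n + 1 = l + m) (i : Fin l) {q : ℤ} (x : (ainfOperad k).obj l)
    {y : (ainfOperad k).obj m} (hy : y ∈ ((ainfOperad k).obj m).gr q) :
    U.eval n ((ainfOperad k).comp h i x y) = T.comp h i q (U.eval l x) (U.eval m y) := by
  induction x using ainf_induction with
  | zero => simp only [map_zero, LinearMap.zero_apply]
  | add x y hx hy => simp only [map_add, LinearMap.add_apply, hx, hy]
  | tens σ x =>
    induction hy using ainf_homogeneous_induction with
    | zero => simp only [map_zero]
    | add x y _ _ hx hy => simp only [map_add, hx, hy]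
    | tens τ y hy =>
      rw [ainfComp_tens, eval_tens, eval_tens, eval_tens, T.equivariance h i σ τ _ (U.evalTree_mem hy),
        U.evalTree_comp h _ _ hy]

theorem eval_one : U.eval 1 (ainfOperad k).one = T.one := by
  rw [ainfOne_eq, eval_tens, evalTree_one, T.act_one]

theorem eval_unit : U.eval 0 (ainfOperad k).unit = U.unit := by
  rw [ainfUnit_eq, eval_tens, evalTree_zero, T.act_one]

theorem eval_mu {n : ℕ} (hn : 2 ≤ n) : U.eval n (ainfMu k n) = U.mu n := by
  rw [ainfMu, eval_tens, evalTree_corolla U hn, T.act_one]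

end SignedOperad.UnitalOps

namespace SignedOperad.UnitalAInf

variable {k : Type u} [Field k] {T : SignedOperad.{u, w} k} (U : T.UnitalAInf)

theorem evalTree_d_corolla {n : ℕ} (hn : 2 ≤ n) :
    U.evalTree n (treeD k n (corolla k n)) = T.d n (2 - n) (U.mu n) := by
  rw [treeD_corolla hn, map_sum, U.d_mu hn]
  refine Finset.sum_congr rfl fun s _ => ?_
  rw [map_sum]
  refine Finset.sum_congr rfl fun i _ => ?_
  rw [map_sign, U.evalTree_comp_corolla s.le_right, U.evalTree_corolla s.le_left]

theorem evalTree_d {n : ℕ} {p : ℤ} {x : TreeMod k n} (hx : x ∈ treeGr k n p) :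
    U.evalTree n (treeD k n x) = T.d n p (U.evalTree n x) := by
  rcases Nat.eq_zero_or_pos n with rfl | hn
  · rcases treeMod_zero_mem hx with rfl | rfl
    · obtain ⟨c, rfl⟩ := treeMod_zero_eq x
      rw [treeD_zero, map_zero, map_smul, map_smul, U.evalTree_zero, U.d_unit, smul_zero]
    · simp only [map_zero]
  refine homogeneous_word_induction (C := fun n p x => 
    U.evalTree n (treeD k n x) = T.d n p (U.evalTree n x)) ?_ ?_ ?_ ?_ ?_ hn hx
  · intros; simp only [map_zero]
  · intro n p x y hx hy; simp only [map_add, hx, hy]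
  · intro n p c x hx; simp only [map_smul, hx]
  · rw [treeD_one, map_zero, U.evalTree_one, T.d_one]
  · intro l m n hm h c p x hx ih
    rw [treeD_treeComp h (by omega) c _ hx, map_add, map_sign, U.evalTree_comp_corolla hm, ih,
      U.evalTree_comp_corolla hm, T.comp_d h c (U.evalTree_mem hx) (U.mu_mem hm),
      ← nsComp_of_pos (by omega), U.evalTree_comp h c x (treeD_mem (corolla_mem hm)),
      U.evalTree_d_corolla hm]

variable [CharZero k]

theorem eval_d {n : ℕ} {p : ℤ} {x : (ainfOperad k).obj n} (hx : x ∈ ((ainfOperad k).obj n).gr p) :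
    U.eval n (((ainfOperad k).obj n).d x) = T.d n p (U.eval n x) := by
  induction hx using ainf_homogeneous_induction with
  | zero => simp only [map_zero]
  | add x y _ _ hx hy => simp only [map_add, hx, hy]
  | tens σ x hx =>
    rw [ainfD_tens, U.eval_tens, U.eval_tens, ← T.act_d _ _ (U.evalTree_mem hx), U.evalTree_d hx]

end SignedOperad.UnitalAInf

section Generation

variable {k : Type u} [Field k] [CharZero k]

/-- Every operation is obtained from the unit, the identity and the generating operations. -/
theorem ainf_word_induction {C : ∀ n, (ainfOperad k).obj n → Prop} (zero : ∀ n, C n 0)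
    (add : ∀ n x y, C n x → C n y → C n (x + y)) (smul : ∀ n (c : k) x, C n x → C n (c • x))
    (act : ∀ n σ x, C n x → C n ((ainfOperad k).act n σ x)) (one : C 1 (ainfOperad k).one)
    (unit : C 0 (ainfOperad k).unit)
    (comp : ∀ {l m n : ℕ} (_ : 2 ≤ m) (h : n + 1 = l + m) (c : Fin l) (x : (ainfOperad k).obj l),
      C l x → C n ((ainfOperad k).comp h c x (ainfMu k m)))
    {n : ℕ} (x : (ainfOperad k).obj n) : C n x := by
  induction x using ainf_induction with
  | zero => exact zero n
  | add x y hx hy => exact add n x y hx hy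
  | tens σ x =>
    have e : ainfTens σ x = (ainfOperad k).act n σ (ainfTens 1 x) := by
      rw [ainfAct_tens, one_mul]
    rw [e]
    refine act n σ _ ?_
    clear e σ
    rcases Nat.eq_zero_or_pos n with rfl | hn
    · obtain ⟨c, rfl⟩ := treeMod_zero_eq x
      rw [map_smul]; exact smul 0 c _ unit
    induction hn, x using word_induction with
    | zero n => rw [map_zero]; exact zero n
    | add n _ x y hx hy => rw [map_add]; exact add n _ _ hx hy
    | smul n _ c x hx => rw [map_smul]; exact smul n c _ hx
    | one => exact one
    | @comp l m n hm h c hl hn p x hx ih =>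
      have := comp hm h c _ ih
      rwa [ainfMu, ainfComp_tens_one, nsComp_of_pos (by omega)] at this

end Generation

end StrictUnits

namespace StrictUnits

section Acyclic

variable {k : Type u} [Field k]

/-- The first child of the root of the tree `S` has at least `q` leaves. -/
def FirstChild (n q : ℕ) (S : Finset (ℕ × ℕ)) : Prop := q = 1 ∨ ∃ b, q ≤ b ∧ b < n ∧ (0, b) ∈ S

/-- The span of the trees whose first child of the root has at least `q` leaves. -/
noncomputable def firstChildSpan (k : Type u) [Field k] (n q : ℕ) : Submodule k (TreeMod k n) :=
  Submodule.span k {x | ∃ S, IsTree n S ∧ FirstChild n q S ∧ x = tree k n S}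

/-- Removal of the interval `J`. -/
noncomputable def treeRemove (k : Type u) [Field k] (n : ℕ) (J : ℕ × ℕ) :
    TreeMod k n →ₗ[k] TreeMod k n :=
  treeLift fun S => if J ∈ S.1 then
    (inversions {J} (S.1.erase J)).negOnePow • tree k n (S.1.erase J) else 0

theorem treeRemove_of_notMem {n : ℕ} {J : ℕ × ℕ} {S : Finset (ℕ × ℕ)} (h : J ∉ S) :
    treeRemove k n J (tree k n S) = 0 := by
  by_cases hS : IsTree n S
  · rw [treeRemove, treeLift_tree _ hS, if_neg h]
  · rw [tree_of_not hS, map_zero]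

theorem treeRemove_insert {n : ℕ} {J : ℕ × ℕ} {S : Finset (ℕ × ℕ)} (h : J ∉ S)
    (hS : IsTree n (insert J S)) :
    treeRemove k n J (tree k n (insert J S)) = (inversions {J} S).negOnePow • tree k n S := by
  rw [treeRemove, treeLift_tree _ hS, if_pos (Finset.mem_insert_self _ _), Finset.erase_insert h]

theorem FirstChild.of_not_isTree {n q : ℕ} (hqn : q + 1 < n) {S : Finset (ℕ × ℕ)}
    (hS : IsTree n S) (h : FirstChild n q S) (hJ : ¬IsTree n (insert (q, n) S)) :
    FirstChild n (q + 1) S := by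
  by_contra hcon
  refine hJ ⟨?_, fun hn => Finset.mem_insert_of_mem (hS.root hn), ?_⟩
  · intro I hI
    rcases Finset.mem_insert.mp hI with rfl | hI
    · exact ⟨by simp only; omega, le_rfl⟩
    · exact hS.bounds I hI
  · have key : ∀ I ∈ S, NonCrossing (q, n) I := by
      intro I hI
      have h1 := hS.bounds I hI
      have h2 : ¬(I.1 = 0 ∧ q + 1 ≤ I.2 ∧ I.2 < n) := fun e => hcon
        (Or.inr ⟨I.2, e.2.1, e.2.2, by rw [← e.1]; exact hI⟩)
      unfold NonCrossing
      simp only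
      rcases h with rfl | ⟨b, hb, hbn, hbS⟩
      · omega
      · have h3 := hS.nonCrossing _ hbS I hI
        have h4 : ¬ q + 1 ≤ b := fun e => hcon (Or.inr ⟨b, e, hbn, hbS⟩)
        unfold NonCrossing at h3
        simp only at h3
        omega
    intro I hI J hJ
    rcases Finset.mem_insert.mp hI with rfl | hI' <;> rcases Finset.mem_insert.mp hJ with rfl | hJ'
    · unfold NonCrossing; simp
    · exact key J hJ'
    · exact nonCrossing_symm (key I hI')
    · exact hS.nonCrossing I hI' J hJ'

theorem tree_mem_firstChildSpan {n q : ℕ} {S : Finset (ℕ × ℕ)}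
    (h : IsTree n S → FirstChild n q S) : tree k n S ∈ firstChildSpan k n q := by
  by_cases hS : IsTree n S
  · exact Submodule.subset_span ⟨S, hS, h hS, rfl⟩
  · rw [tree_of_not hS]; exact Submodule.zero_mem _

theorem homotopy_mem_tree {n q : ℕ} (hq : 1 ≤ q) (hqn : q + 1 < n) {S : Finset (ℕ × ℕ)}
    (hS : IsTree n S) (h : FirstChild n q S) :
    tree k n S - treeD k n (treeRemove k n (q, n) (tree k n S))
      - treeRemove k n (q, n) (treeD k n (tree k n S)) ∈ firstChildSpan k n (q + 1) := by
  have hJn : (q, n) ∈ intervals n := by rw [mem_intervals]; simp only; omega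
  by_cases hJ : (q, n) ∈ S
  · obtain ⟨T, hJT, rfl⟩ : ∃ T, (q, n) ∉ T ∧ S = insert (q, n) T :=
      ⟨S.erase (q, n), Finset.notMem_erase _ _, (Finset.insert_erase hJ).symm⟩
    have hT : IsTree n T := hS.of_subset (Finset.subset_insert _ _) fun hn => by
      rcases Finset.mem_insert.mp (hS.root hn) with e | e
      · simp only [Prod.mk.injEq] at e; omega
      · exact e
    have hTq : FirstChild n q T := by
      rcases h with h | ⟨b, hb, hbn, hbS⟩
      · exact Or.inl h
      · rcases Finset.mem_insert.mp hbS with e | e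
        · simp only [Prod.mk.injEq] at e; omega
        · exact Or.inr ⟨b, hb, hbn, e⟩
    rw [treeRemove_insert hJT hS, map_sign, treeD_tree hT, treeD_tree hS, map_sum,
      ← Finset.add_sum_erase _ _ hJn, ← Finset.add_sum_erase _ _ hJn, smul_add,
      treeInsert_of_notMem hJT, sign_self_smul, treeInsert,
      if_pos (Finset.mem_insert_self _ _), map_zero, zero_add, Finset.smul_sum]
    have e : ∀ a b c : TreeMod k n, a - (a + b) - c = -(b + c) := fun a b c => by abel
    rw [e, ← Finset.sum_add_distrib]
    refine Submodule.neg_mem _ (Submodule.sum_mem _ fun I hI => ?_)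
    have hIJ := Finset.ne_of_mem_erase hI
    by_cases hIT : I ∈ T
    · rw [treeInsert, if_pos hIT, treeInsert, if_pos (Finset.mem_insert_of_mem hIT), map_zero,
        smul_zero, add_zero]
      exact Submodule.zero_mem _
    have hIS : I ∉ insert (q, n) T := fun e => (Finset.mem_insert.mp e).elim hIJ hIT
    have hJI : (q, n) ∉ insert I T := fun e => (Finset.mem_insert.mp e).elim hIJ.symm hJT
    rw [treeInsert_of_notMem hIT, treeInsert_of_notMem hIS, map_sign, Finset.insert_comm]
    by_cases hU : IsTree n (insert (q, n) (insert I T))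
    · rw [treeRemove_insert hJI hU, smul_smul, smul_smul, ← Int.negOnePow_add,
        ← Int.negOnePow_add, inversions_insert_right _ hJT, inversions_insert_right _ hIT]
      have h1 : (inversions {I} {(q, n)} + inversions {I} T
          + (inversions {(q, n)} {I} + inversions {(q, n)} T)).negOnePow
            = (inversions {(q, n)} T + inversions {I} T + 1).negOnePow := by
        have := inversions_singleton_swap hIJ
        congr 1
        omega
      rw [h1, neg_negOnePow_smul, add_neg_cancel]
      exact Submodule.zero_mem _
    · rw [tree_of_not hU, map_zero, smul_zero, add_zero]
      refine sign_smul_mem _ _ (sign_smul_mem _ _ (tree_mem_firstChildSpan fun hU' =>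
        FirstChild.of_not_isTree hqn hU' ?_ hU))
      rcases hTq with h | ⟨b, hb, hbn, hbS⟩
      · exact Or.inl h
      · exact Or.inr ⟨b, hb, hbn, Finset.mem_insert_of_mem hbS⟩
  · rw [treeRemove_of_notMem hJ, map_zero, sub_zero, treeD_tree hS, map_sum,
      Finset.sum_eq_single_of_mem _ hJn]
    · by_cases hU : IsTree n (insert (q, n) S)
      · rw [treeInsert_of_notMem hJ, map_sign, treeRemove_insert hJ hU, sign_self_smul, sub_self]
        exact Submodule.zero_mem _
      · rw [treeInsert_of_not hU, map_zero, sub_zero]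
        exact tree_mem_firstChildSpan fun _ => h.of_not_isTree hqn hS hU
    · intro I _ hIJ
      unfold treeInsert
      split_ifs with hI
      · exact map_zero _
      · rw [map_sign, treeRemove_of_notMem, smul_zero]
        exact fun e => (Finset.mem_insert.mp e).elim hIJ.symm hJ

theorem homotopy_mem {n q : ℕ} (hq : 1 ≤ q) (hqn : q + 1 < n) {x : TreeMod k n}
    (hx : x ∈ firstChildSpan k n q) :
    x - treeD k n (treeRemove k n (q, n) x) - treeRemove k n (q, n) (treeD k n x)
      ∈ firstChildSpan k n (q + 1) := by
  induction hx using Submodule.span_induction with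
  | mem x hx =>
    obtain ⟨S, hS, h, rfl⟩ := hx
    exact homotopy_mem_tree hq hqn hS h
  | zero => simp only [map_zero, sub_zero]; exact Submodule.zero_mem _
  | add x y _ _ hx hy =>
    simp only [map_add]
    convert Submodule.add_mem _ hx hy using 1
    abel
  | smul c x _ hx =>
    simp only [map_smul, ← smul_sub]
    exact Submodule.smul_mem _ c hx

theorem exists_mem_firstChildSpan [CharZero k] {n : ℕ} (q : ℕ) (hq : 1 ≤ q) (hqn : q + 1 ≤ n)
    {x : TreeMod k n} (hx : treeD k n x = 0) :
    ∃ z, x - treeD k n z ∈ firstChildSpan k n q := by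
  induction q, hq using Nat.le_induction with
  | base =>
    refine ⟨0, ?_⟩
    rw [map_zero, sub_zero]
    clear hx
    induction x using treeMod_induction with
    | zero => exact Submodule.zero_mem _
    | add x y hx hy => exact Submodule.add_mem _ hx hy
    | smul c x hx => exact Submodule.smul_mem _ c hx
    | basis S hS => exact tree_mem_firstChildSpan fun _ => Or.inl rfl
  | succ q hq ih =>
    obtain ⟨z, hz⟩ := ih (by omega)
    have h := homotopy_mem hq (by omega) hz
    rw [map_sub (treeD k n) x, hx, treeD_treeD, sub_zero, map_zero, sub_zero, sub_sub,
      ← map_add] at h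
    exact ⟨_, h⟩

theorem exists_product {n : ℕ} (h : n + 2 + 1 = 2 + (n + 1)) {x : TreeMod k (n + 2)}
    (hx : x ∈ firstChildSpan k (n + 2) (n + 1)) :
    ∃ y, x = treeComp h 0 (corolla k 2) y := by
  induction hx using Submodule.span_induction with
  | zero => exact ⟨0, (map_zero _).symm⟩
  | add x y _ _ hx hy =>
    obtain ⟨x, rfl⟩ := hx
    obtain ⟨y, rfl⟩ := hy
    exact ⟨x + y, (map_add _ _ _).symm⟩
  | smul c x _ hx =>
    obtain ⟨x, rfl⟩ := hx
    exact ⟨c • x, (map_smul _ _ _).symm⟩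
  | mem x hx =>
    obtain ⟨S, hS, hq, rfl⟩ := hx
    have hroot := hS.root (by omega)
    have hT : IsTree (n + 1) (S.erase (0, n + 2)) := by
      refine ⟨fun I hI => ?_, fun hn => ?_, fun I hI J hJ =>
        hS.nonCrossing I (Finset.mem_of_mem_erase hI) J (Finset.mem_of_mem_erase hJ)⟩
      · obtain ⟨hne, hI⟩ := Finset.mem_erase.mp hI
        have h1 := hS.bounds I hI
        have h2 : ¬(I.1 = 0 ∧ I.2 = n + 2) := fun e => hne (Prod.ext e.1 e.2)
        rcases hq with hq | ⟨b, hb, hbn, hbS⟩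
        · omega
        · have h3 := hS.nonCrossing I hI _ hbS
          unfold NonCrossing at h3
          simp only at h3
          omega
      · rcases hq with hq | ⟨b, hb, hbn, hbS⟩
        · omega
        · obtain rfl : b = n + 1 := by omega
          exact Finset.mem_erase.mpr ⟨by simp, hbS⟩
    have e1 : expand 0 (n + 1) {(0, 2)} = {(0, n + 2)} := by
      simp only [expand, Finset.image_singleton, Prod.map, stretch]
      congr 2
      simp only [if_neg (show ¬2 ≤ 0 by omega)]
      omega
    have e2 : shift 0 (S.erase (0, n + 2)) = S.erase (0, n + 2) := by
      unfold shift
      conv_rhs => rw [← Finset.image_id (s := S.erase (0, n + 2))]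
      rfl
    have e3 : graft 0 (n + 1) {(0, 2)} (S.erase (0, n + 2)) = S := by
      rw [graft, e1, e2, ← Finset.insert_eq, Finset.insert_erase hroot]
    have h1 := treeComp_tree (k := k) h 0 (isTree_corolla le_rfl) hT
    rw [Fin.val_zero, e3] at h1
    refine ⟨(twist 2 (n + 1) 0 ((S.erase (0, n + 2)).card) + inversions (expand 0 (n + 1) {(0, 2)})
      (shift 0 (S.erase (0, n + 2)))).negOnePow • tree k (n + 1) (S.erase (0, n + 2)), ?_⟩
    rw [map_sign, corolla, h1, sign_self_smul]

/-- The iterated product. -/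
noncomputable def comb (k : Type u) [Field k] : ∀ n, TreeMod k n
  | 0 => tree k 0 ∅
  | 1 => tree k 1 ∅
  | n + 2 => treeComp (show n + 2 + 1 = 2 + (n + 1) by omega) 0 (corolla k 2) (comb k (n + 1))

theorem treeD_product {n : ℕ} (hn : 1 ≤ n) (h : n + 1 + 1 = 2 + n) (x : TreeMod k n) :
    treeD k (n + 1) (treeComp h 0 (corolla k 2) x) = treeComp h 0 (corolla k 2) (treeD k n x) := by
  rw [treeD_treeComp h hn 0 x (corolla_mem le_rfl), treeD_corolla_two, map_zero,
    LinearMap.zero_apply, zero_add]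
  simp

theorem treeD_comb (n : ℕ) : treeD k n (comb k n) = 0 := by
  induction n with
  | zero => exact treeD_zero _
  | succ n ih =>
    cases n with
    | zero => exact treeD_one
    | succ n => rw [comb, treeD_product (by omega), ih, map_zero]

theorem product_injective {n : ℕ} (hn : 1 ≤ n) (h : n + 1 + 1 = 2 + n) {x : TreeMod k n}
    (hx : treeComp h 0 (corolla k 2) x = 0) : x = 0 := by
  have h1 := treeRes_comp_outer (l' := 1) hn h (by omega) rfl rfl 0 0 (Fin.last n) 1
    (Or.inr ⟨by simp, by simp; omega, rfl⟩) (corolla k 2) x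
  rw [hx, map_zero, treeRes_corolla le_rfl rfl, corollaRes_two, treeComp_one_left] at h1
  exact h1.symm

/-- The cohomology of the complex of trees is spanned by the class of the iterated product. -/
theorem exists_comb_add_boundary [CharZero k] {n : ℕ} {x : TreeMod k n} (hx : treeD k n x = 0) :
    ∃ (c : k) (z : TreeMod k n), x = c • comb k n + treeD k n z := by
  induction n with
  | zero =>
    obtain ⟨c, rfl⟩ := treeMod_zero_eq x
    exact ⟨c, 0, by rw [map_zero, add_zero]; rfl⟩
  | succ n ih =>
    cases n with
    | zero =>
      obtain ⟨c, rfl⟩ := treeMod_one_eq x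
      exact ⟨c, 0, by rw [map_zero, add_zero]; rfl⟩
    | succ n =>
      obtain ⟨z, hz⟩ := exists_mem_firstChildSpan (n + 1) (by omega) le_rfl hx
      have h : n + 2 + 1 = 2 + (n + 1) := by omega
      obtain ⟨y, hy⟩ := exists_product h hz
      have hy0 : treeD k (n + 1) y = 0 := by
        refine product_injective (by omega) h ?_
        rw [← treeD_product (by omega), ← hy, map_sub, hx, treeD_treeD, sub_zero]
      obtain ⟨c, w, rfl⟩ := ih hy0
      refine ⟨c, treeComp h 0 (corolla k 2) w + z, ?_⟩
      rw [map_add, treeD_product (by omega), ← add_assoc, comb, ← map_smul, ← map_add, ← hy,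
        sub_add_cancel]

end Acyclic

section SignedOperads

variable {k : Type u} [Field k]

/-- A dg operad, seen as a signed operad. -/
def DGOperad.toSigned (Q : DGOperad.{u} k) : SignedOperad.{u, u} k where
  X n := Q.obj n
  gr n := (Q.obj n).gr
  act := Q.act
  act_one := Q.act_one
  act_mul := Q.act_mul
  act_mem := Q.act_mem
  comp h i _ := Q.comp h i
  comp_mem := Q.comp_mem
  one := Q.one
  one_mem := Q.one_mem
  one_comp h _ x := Q.one_comp h x
  comp_one := Q.comp_one
  assoc_seq h₁ h₂ h₃ h₄ i j _ _ x y z _ _ := Q.assoc_seq h₁ h₂ h₃ h₄ i j x y z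
  assoc_par := Q.assoc_par
  equivariance h i σ τ _ x _ _ := Q.equivariance h i σ τ x _
  d n _ := (Q.obj n).d
  act_d n σ _ x _ := Q.act_d n σ x
  d_one := Q.one_d
  comp_d h i _ _ _ y hx _ := Q.comp_d h i y hx

theorem UOperad.d_unit (Q : UOperad.{u} k) : (Q.obj 0).d Q.unit = 0 := by
  obtain ⟨π, h₁, h₂, _⟩ := exists_projections (Q.obj 0).isInternal
  obtain ⟨c, hc⟩ := Q.unit_basis.2 ((Q.obj 0).d Q.unit)
  have h := h₂ (q := 0) (by omega) ((Q.obj 0).d_mem Q.unit_mem)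
  simp only at hc
  rw [← hc, map_smul, h₁ Q.unit_mem, hc] at h
  exact h

/-- Operations of a unitary operad that satisfy the relations of a strictly unital
`A_∞`-algebra. -/
structure UnitalMu (Q : UOperad.{u} k) where
  mu : ∀ n, Q.obj n
  mu_mem : ∀ {n : ℕ}, 2 ≤ n → mu n ∈ (Q.obj n).gr (2 - n)
  mu_two_unit : ∀ i : Fin 2, Q.res rfl i (mu 2) = Q.one
  mu_unit : ∀ {n : ℕ}, 2 ≤ n → ∀ i : Fin (n + 1), Q.res rfl i (mu (n + 1)) = 0
  d_mu : ∀ {n : ℕ}, 2 ≤ n → (Q.obj n).d (mu n)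
    = ∑ s : Splitting n, ∑ i : Fin s.1.1, s.sign i • Q.comp s.eq i (mu s.1.1) (mu s.1.2)

/-- Unital operations of an operad, in the sense of signed operads. -/
def UnitalMu.toUnitalAInf {Q : UOperad.{u} k} (U : UnitalMu Q) :
    Q.toDGOperad.toSigned.UnitalAInf where
  unit := Q.unit
  unit_mem := Q.unit_mem
  d_unit := Q.d_unit
  mu := U.mu
  mu_mem := U.mu_mem
  mu_two_unit := U.mu_two_unit
  mu_unit := U.mu_unit
  d_mu := U.d_mu

variable [CharZero k]

/-- The morphism from the operad of strictly unital `A_∞`-algebras given by operations. -/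
noncomputable def UnitalMu.hom {Q : UOperad.{u} k} (U : UnitalMu Q) : UHom (ainfOperad k) Q where
  toFun := U.toUnitalAInf.eval
  map_mem _ _ _ hx := U.toUnitalAInf.eval_mem hx
  map_d n x := by
    refine homogeneous_induction ((ainfOperad k).obj n).isInternal
      (C := fun x => U.toUnitalAInf.eval n (((ainfOperad k).obj n).d x)
        = (Q.obj n).d (U.toUnitalAInf.eval n x)) ?_ ?_ x
    · intro p x hx; exact U.toUnitalAInf.eval_d hx
    · intro x y hx hy; simp only [map_add]; rw [hx, hy]; exact (map_add _ _ _).symm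
  map_act _ σ x := U.toUnitalAInf.eval_act σ x
  map_comp {l m n} h i x y := by
    refine homogeneous_induction ((ainfOperad k).obj m).isInternal
      (C := fun y => U.toUnitalAInf.eval n ((ainfOperad k).comp h i x y)
        = Q.comp h i (U.toUnitalAInf.eval l x) (U.toUnitalAInf.eval m y)) ?_ ?_ y
    · intro p y hy; exact U.toUnitalAInf.eval_comp h i x hy
    · intro x y hx hy; simp only [map_add]; rw [hx, hy]; exact (map_add _ _ _).symm
  map_one := U.toUnitalAInf.eval_one
  map_unit := U.toUnitalAInf.eval_unit

theorem UnitalMu.hom_mu {Q : UOperad.{u} k} (U : UnitalMu Q) {n : ℕ} (hn : 2 ≤ n) :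
    U.hom.toFun n (ainfMu k n) = U.mu n := U.toUnitalAInf.eval_mu hn

/-- Morphisms of unitary operads are determined by the images of the generating operations. -/
theorem ainf_hom_ext {Q : UOperad.{u} k} {f g : UHom (ainfOperad k) Q}
    (h : ∀ n, 2 ≤ n → f.toFun n (ainfMu k n) = g.toFun n (ainfMu k n)) {n : ℕ}
    (x : (ainfOperad k).obj n) : f.toFun n x = g.toFun n x := by
  refine ainf_word_induction (C := fun n x => f.toFun n x = g.toFun n x)
    ?_ ?_ ?_ ?_ ?_ ?_ ?_ x
  · intro n; simp only [map_zero]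
  · intro n x y hx hy; simp only [map_add, hx, hy]
  · intro n c x hx; simp only [map_smul, hx]
  · intro n σ x hx; simp only [UHom.map_act, hx]
  · rw [f.map_one, g.map_one]
  · rw [f.map_unit, g.map_unit]
  · intro l m n hm e c x hx; simp only [UHom.map_comp, hx, h m hm]

end SignedOperads

end StrictUnits

namespace StrictUnits

section Augmentation

variable {k : Type u} [Field k]

variable (k) in
noncomputable def assMu (n : ℕ) : (assPlus k).obj n :=
  match n with
  | 2 => assMul k
  | _ => 0

theorem assMu_of_ne {n : ℕ} (hn : n ≠ 2) : assMu k n = 0 := by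
  unfold assMu
  split
  · exact absurd rfl hn
  · rfl

theorem assComp_one {l m n : ℕ} (h : n + 1 = l + m) (i : Fin l) :
    assComp k h i (Finsupp.single 1 1) (Finsupp.single 1 1) = Finsupp.single 1 1 := by
  rw [assComp_single, blockPerm_one, mul_one]

theorem ass_relation {n : ℕ} :
    ∑ s : Splitting n, ∑ i : Fin s.1.1,
      s.sign i • (assPlus k).comp s.eq i (assMu k s.1.1) (assMu k s.1.2) = 0 := by
  have h0 : ∀ s : Splitting n, s.1 ≠ (2, 2) → ∀ i : Fin s.1.1,
      s.sign i • (assPlus k).comp s.eq i (assMu k s.1.1) (assMu k s.1.2) = 0 := by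
    intro s hs i
    by_cases h1 : s.1.1 = 2
    · have h2 : s.1.2 ≠ 2 := fun e => hs (Prod.ext h1 e)
      rw [assMu_of_ne h2, map_zero, smul_zero]
    · rw [assMu_of_ne h1, map_zero, LinearMap.zero_apply, smul_zero]
  by_cases hn : n = 3
  · subst hn
    let s₀ : Splitting 3 := ⟨(2, 2), by decide⟩
    rw [Fintype.sum_eq_single s₀ fun s hs => Finset.sum_eq_zero fun i _ =>
      h0 s (fun e => hs (Subtype.ext e)) i]
    have h1 : ∀ i : Fin 2, (assPlus k).comp (n := 3) s₀.eq i (assMul k) (assMul k)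
        = (show (assPlus k).obj 3 from (Finsupp.single 1 1 : Perm (Fin 3) →₀ k)) :=
      fun i => assComp_one _ i
    change ∑ i : Fin 2, s₀.sign i • (assPlus k).comp (n := 3) s₀.eq i (assMul k) (assMul k) = 0
    rw [Fin.sum_univ_two, h1, h1, show s₀.sign (0 : Fin 2) = -1 by decide,
      show s₀.sign (1 : Fin 2) = 1 by decide, Units.neg_smul, one_smul, neg_add_cancel]
  · refine Finset.sum_eq_zero fun s _ => Finset.sum_eq_zero fun i _ => h0 s ?_ i
    intro e
    have := s.eq
    rw [e] at this
    exact hn (by simpa using this)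

variable (k) in
/-- The associative product, as a strictly unital `A_∞`-structure. -/
noncomputable def assUnital : UnitalMu (assPlus k) where
  mu := assMu k
  mu_mem {n} hn := by
    by_cases h : n = 2
    · subst h
      exact mem_ass_zero k _
    · rw [assMu_of_ne h]; exact Submodule.zero_mem _
  mu_two_unit i := by
    refine (assComp_one (k := k) (n := 1) (m := 0) rfl i).trans ?_
    rfl
  mu_unit {n} hn i := by
    rw [assMu_of_ne (by omega), UOperad.res, map_zero, LinearMap.zero_apply]
  d_mu {n} _ := ass_relation.symm

theorem comb_mem (n : ℕ) : comb k n ∈ treeGr k n 0 := by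
  induction n with
  | zero => exact tree_mem fun _ => by simp [treeDeg]
  | succ n ih =>
    cases n with
    | zero => exact tree_mem fun _ => by simp [treeDeg]
    | succ n =>
      have := treeComp_mem (show n + 2 + 1 = 2 + (n + 1) by omega) (by omega) 0
        (corolla_mem (k := k) le_rfl) ih
      rwa [show (2 - (2 : ℕ) + 0 : ℤ) = 0 by norm_num] at this

theorem assEval_comb (n : ℕ) :
    (assUnital k).toUnitalAInf.toUnitalOps.evalTree n (comb k n) = (Finsupp.single 1 1 : Perm (Fin n) →₀ k) := by
  induction n with
  | zero => exact SignedOperad.UnitalOps.evalTree_zero _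
  | succ n ih =>
    cases n with
    | zero => exact SignedOperad.UnitalOps.evalTree_one _
    | succ n =>
      rw [comb, ← nsComp_of_pos (by omega), SignedOperad.UnitalOps.evalTree_comp _ _ _ _ (comb_mem _),
        ih, SignedOperad.UnitalOps.evalTree_corolla _ le_rfl]
      exact assComp_one _ _

/-- A permutation, as an element of the associative operad. -/
noncomputable def assPerm {n : ℕ} (σ : Perm (Fin n)) : (assPlus k).obj n :=
  (Finsupp.single σ 1 : Perm (Fin n) →₀ k)

@[elab_as_elim]
theorem ass_induction {n : ℕ} {C : (assPlus k).obj n → Prop} (s : (assPlus k).obj n) (zero : C 0)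
    (add : ∀ f g, C f → C g → C (f + g)) (single : ∀ σ (c : k), C (c • assPerm σ)) : C s :=
  Finsupp.induction_linear (motive := C) s zero add fun σ c => by
    have := single σ c
    have e : c • (Finsupp.single σ 1 : Perm (Fin n) →₀ k) = Finsupp.single σ c :=
      (Finsupp.smul_single c σ (1 : k)).trans (by rw [smul_eq_mul, mul_one])
    exact e ▸ this

variable [CharZero k]

variable (k) in
/-- The augmentation of the operad of strictly unital `A_∞`-algebras. -/
noncomputable def ainfAug : UHom (ainfOperad k) (assPlus k) := (assUnital k).hom

theorem ainfAug_comb {n : ℕ} (σ : Perm (Fin n)) :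
    (ainfAug k).toFun n (ainfTens σ (comb k n)) = (Finsupp.single σ 1 : Perm (Fin n) →₀ k) := by
  refine ((assUnital k).toUnitalAInf.eval_tens σ _).trans ?_
  rw [assEval_comb]
  exact (assAct_single k n σ 1 1).trans (by rw [one_mul])

/-- The cocycle that represents an element of the associative operad. -/
noncomputable def combLift (n : ℕ) : (assPlus k).obj n →ₗ[k] (ainfOperad k).obj n :=
  (Finsupp.linearCombination k fun σ => ainfTens σ (comb k n) : (Perm (Fin n) →₀ k) →ₗ[k] _)

theorem combLift_perm {n : ℕ} (σ : Perm (Fin n)) :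
    combLift n (assPerm σ) = ainfTens σ (comb k n) :=
  (Finsupp.linearCombination_single k 1 σ).trans (one_smul k _)

theorem ainfD_combLift {n : ℕ} (s : (assPlus k).obj n) :
    ((ainfOperad k).obj n).d (combLift n s) = 0 := by
  induction s using ass_induction with
  | zero => simp only [map_zero]
  | add f g hf hg => simp only [map_add, hf, hg, add_zero]
  | single σ c => rw [map_smul, combLift_perm, map_smul, ainfD_tens, treeD_comb, map_zero, smul_zero]

theorem ainfAug_combLift {n : ℕ} (s : (assPlus k).obj n) :
    (ainfAug k).toFun n (combLift n s) = s := by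
  induction s using ass_induction with
  | zero => simp only [map_zero]
  | add f g hf hg => simp only [map_add, hf, hg]
  | single σ c => rw [map_smul, combLift_perm, map_smul]; exact congrArg _ (ainfAug_comb σ)

theorem ainf_eq_sum {n : ℕ} (x : Perm (Fin n) →₀ TreeMod k n) :
    (show (ainfOperad k).obj n from x) = ∑ σ, ainfTens σ (x σ) :=
  (Finsupp.univ_sum_single x).symm

theorem ainf_cocycle_eq {n : ℕ} {x : (ainfOperad k).obj n}
    (hx : ((ainfOperad k).obj n).d x = 0) :
    ∃ s w, x = combLift n s + ((ainfOperad k).obj n).d w := by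
  have h1 : ∀ σ : Perm (Fin n), treeD k n ((show Perm (Fin n) →₀ TreeMod k n from x) σ) = 0 :=
    fun σ => DFunLike.congr_fun (F := Perm (Fin n) →₀ TreeMod k n) hx σ
  choose c z hz using fun σ => exists_comb_add_boundary (h1 σ)
  refine ⟨∑ σ, c σ • assPerm σ, ∑ σ, ainfTens σ (z σ), ?_⟩
  refine (ainf_eq_sum x).trans ?_
  rw [map_sum, map_sum, ← Finset.sum_add_distrib]
  refine Finset.sum_congr rfl fun σ _ => ?_
  rw [map_smul, combLift_perm, ainfD_tens, ← map_smul, ← map_add, ← hz σ]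

theorem ainfAug_isQuasiIso : (ainfAug k).IsQuasiIso := by
  intro n
  constructor
  · intro y _
    refine ⟨combLift n y, ainfD_combLift y, 0, ?_⟩
    rw [ainfAug_combLift, map_zero, add_zero]
  · rintro x hx ⟨z, hz⟩
    obtain ⟨s, w, rfl⟩ := ainf_cocycle_eq hx
    refine ⟨w, ?_⟩
    rw [map_add, ainfAug_combLift, (ainfAug k).map_d] at hz
    have hs : s = 0 := by
      have h2 : ∀ y, ((assPlus k).obj n).d y = 0 := fun _ => rfl
      rw [h2, h2, add_zero] at hz
      exact hz
    rw [hs, map_zero, zero_add]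

end Augmentation

end StrictUnits

namespace StrictUnits

section Projections

variable {k : Type u} [Field k]

/-- The projection onto a homogeneous piece. -/
noncomputable def GrMod.proj (A : GrMod.{u, v} k) (p : ℤ) : A →ₗ[k] A :=
  (exists_projections A.isInternal).choose p

theorem GrMod.proj_of_mem (A : GrMod.{u, v} k) {p : ℤ} {x : A} (hx : x ∈ A.gr p) :
    A.proj p x = x :=
  (exists_projections A.isInternal).choose_spec.1 hx

theorem GrMod.proj_of_ne (A : GrMod.{u, v} k) {p q : ℤ} {x : A} (h : q ≠ p) (hx : x ∈ A.gr p) :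
    A.proj q x = 0 :=
  (exists_projections A.isInternal).choose_spec.2.1 h hx

theorem GrMod.proj_mem (A : GrMod.{u, v} k) (p : ℤ) (x : A) : A.proj p x ∈ A.gr p :=
  (exists_projections A.isInternal).choose_spec.2.2 p x

theorem GrMod.induction (A : GrMod.{u, v} k) {C : A → Prop} (mem : ∀ p x, x ∈ A.gr p → C x)
    (add : ∀ x y, C x → C y → C (x + y)) (x : A) : C x :=
  homogeneous_induction A.isInternal mem add x

theorem GrMod.mem_of_proj_mem (A : GrMod.{u, v} k) (N : Submodule k A) {x : A}
    (h : ∀ p, A.proj p x ∈ N) : x ∈ N := by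
  obtain ⟨s, _, hs⟩ : ∃ s : Finset ℤ, (∀ p, p ∉ s → A.proj p x = 0) ∧ x = ∑ p ∈ s, A.proj p x := by
    clear h
    classical
    induction x using A.induction with
    | mem p x hx =>
      exact ⟨{p}, fun q hq => A.proj_of_ne (by simpa using hq) hx,
        by rw [Finset.sum_singleton, A.proj_of_mem hx]⟩
    | add x y hx hy =>
      obtain ⟨s, hs, hx⟩ := hx
      obtain ⟨t, ht, hy⟩ := hy
      refine ⟨s ∪ t, fun p hp => ?_, ?_⟩
      · rw [Finset.mem_union, not_or] at hp
        rw [map_add, hs p hp.1, ht p hp.2, add_zero]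
      · simp only [map_add, Finset.sum_add_distrib]
        rw [← Finset.sum_subset Finset.subset_union_left fun p _ => hs p,
          ← Finset.sum_subset Finset.subset_union_right fun p _ => ht p, ← hx, ← hy]
  rw [hs]
  exact Submodule.sum_mem _ fun p _ => h p

theorem GrMod.map_proj (A : GrMod.{u, v} k) (B : GrMod.{u, w} k) {r : ℤ} (f : A →ₗ[k] B)
    (hf : ∀ {p x}, x ∈ A.gr p → f x ∈ B.gr (p + r)) (p : ℤ) (x : A) :
    B.proj (p + r) (f x) = f (A.proj p x) := by
  induction x using A.induction with
  | mem q x hx =>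
    by_cases h : p = q
    · rw [h, A.proj_of_mem hx, B.proj_of_mem (hf hx)]
    · rw [A.proj_of_ne h hx, map_zero, B.proj_of_ne (by omega) (hf hx)]
  | add x y hx hy => simp only [map_add, hx, hy]

theorem GrMod.map_proj_zero (A : GrMod.{u, v} k) (B : GrMod.{u, w} k) (f : A →ₗ[k] B)
    (hf : ∀ {p x}, x ∈ A.gr p → f x ∈ B.gr p) (p : ℤ) (x : A) :
    B.proj p (f x) = f (A.proj p x) := by
  have := A.map_proj B (r := 0) f (fun hx => by rw [add_zero]; exact hf hx) p x
  rwa [add_zero] at this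

/-- A linear map given by its values on the homogeneous pieces. -/
theorem GrMod.exists_lift (A : GrMod.{u, v} k) {N : Type w} [AddCommGroup N] [Module k N]
    (f : ∀ p, A.gr p →ₗ[k] N) : ∃ g : A →ₗ[k] N, ∀ p (x : A.gr p), g x = f p x := by
  let e := LinearEquiv.ofBijective (DirectSum.coeLinearMap A.gr) A.isInternal
  refine ⟨DirectSum.toModule k ℤ N f ∘ₗ e.symm.toLinearMap, fun p x => ?_⟩
  have he : e.symm x.1 = DirectSum.lof k ℤ (fun p => A.gr p) p x := by
    rw [LinearEquiv.symm_apply_eq]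
    exact (DirectSum.coeLinearMap_lof A.gr p x).symm
  rw [LinearMap.comp_apply, LinearEquiv.coe_coe, he, DirectSum.toModule_lof]

end Projections

namespace UOperad

variable {k : Type u} [Field k] (P : UOperad.{u} k)

/-- The restriction operation, as a linear map. -/
def resMap {m n : ℕ} (h : m + 1 = n) (i : Fin n) : P.obj n →ₗ[k] P.obj m :=
  (P.comp (l := n) (m := 0) h i).flip P.unit

theorem res_eq {m n : ℕ} (h : m + 1 = n) (i : Fin n) (x : P.obj n) :
    P.res h i x = P.resMap h i x := rfl

theorem resMap_apply {m n : ℕ} (h : m + 1 = n) (i : Fin n) (x : P.obj n) :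
    P.resMap h i x = P.comp (l := n) (m := 0) h i x P.unit := rfl

theorem resMap_mem {m n : ℕ} (h : m + 1 = n) (i : Fin n) {p : ℤ} {x : P.obj n}
    (hx : x ∈ (P.obj n).gr p) : P.resMap h i x ∈ (P.obj m).gr p := by
  have := P.comp_mem (l := n) (m := 0) h i hx P.unit_mem
  rwa [add_zero] at this

theorem d_resMap {m n : ℕ} (h : m + 1 = n) (i : Fin n) (x : P.obj n) :
    (P.obj m).d (P.resMap h i x) = P.resMap h i ((P.obj n).d x) := by
  induction x using (P.obj n).induction with
  | mem p x hx =>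
    rw [resMap_apply, P.comp_d (l := n) (m := 0) h i _ hx, P.d_unit, map_zero, smul_zero, add_zero,
      resMap_apply]
  | add x y hx hy => simp only [map_add, hx, hy]

theorem act_zero (σ : Perm (Fin 0)) (x : P.obj 0) : P.act 0 σ x = x := by
  rw [Subsingleton.elim σ 1, P.act_one]

theorem resMap_act {m n : ℕ} (h : m + 1 = n) (i : Fin n) (σ : Perm (Fin n)) (x : P.obj n) :
    P.resMap h i (P.act n σ x)
      = P.act m (blockPerm (l := n) (m := 0) h i σ 1) (P.resMap h (σ i) x) := by
  have := P.equivariance (l := n) (m := 0) h i σ 1 x P.unit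
  rwa [act_zero] at this

theorem resMap_resMap {n n₁ n₂ : ℕ} (h₁ : n₁ + 1 = n) (h₂ : n₂ + 1 = n₁) (i j : Fin n)
    (i' j' : Fin n₁) (hij : i.1 < j.1) (hi : i'.1 = i.1) (hj : j'.1 + 1 = j.1) (x : P.obj n) :
    P.resMap h₂ i' (P.resMap h₁ j x) = P.resMap h₂ j' (P.resMap h₁ i x) := by
  have hne : j ≠ i := fun e => by rw [e] at hij; omega
  have := P.assoc_par (l := n) (m := 0) (r := 0) h₁ h₂ h₁ h₂ i j hne x P.unit_mem P.unit_mem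
  rw [mul_zero, Int.negOnePow_zero, one_smul] at this
  have e1 : j' = outer (l := n) (m := 0) h₁ i j hne := Fin.ext (by
    rw [outer_val, if_neg (by omega)]; omega)
  have e2 : i' = outer (l := n) (m := 0) h₁ j i hne.symm := Fin.ext (by
    rw [outer_val, if_pos hij]; omega)
  rw [e1, e2]
  exact this.symm

theorem resMap_comp_inner {l m n n' s : ℕ} (h₁ : n + 1 = l + m) (h₂ : n' + 1 = n)
    (h₃ : s + 1 = m) (h₄ : n' + 1 = l + s) (i : Fin l) (j : Fin m) (x : P.obj l) (y : P.obj m) :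
    P.resMap h₂ (inner h₁ i j) (P.comp h₁ i x y) = P.comp h₄ i x (P.resMap h₃ j y) :=
  P.assoc_seq (r := 0) h₁ h₂ h₃ h₄ i j x y P.unit

theorem resMap_comp_outer {l m n n' s : ℕ} (h₁ : n + 1 = l + m) (h₂ : n' + 1 = n)
    (h₃ : s + 1 = l) (h₄ : n' + 1 = s + m) (i c : Fin l) (hci : c ≠ i) (x : P.obj l)
    (y : P.obj m) :
    P.resMap h₂ (outer h₁ i c hci) (P.comp h₁ i x y)
      = P.comp h₄ (outer (l := l) (m := 0) h₃ c i hci.symm) (P.resMap h₃ c x) y := by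
  induction y using (P.obj m).induction with
  | mem p y hy =>
    have := P.assoc_par (r := 0) h₁ h₂ h₃ h₄ i c hci x hy P.unit_mem
    rwa [mul_zero, Int.negOnePow_zero, one_smul] at this
  | add y z hy hz => simp only [map_add, hy, hz]

theorem comp_zero_eq {l n : ℕ} (h : n + 1 = l + 0) (i : Fin l) (x : P.obj l) (y : P.obj 0) :
    ∃ c : k, P.comp h i x y = c • P.resMap h i x := by
  obtain ⟨c, rfl⟩ := P.unit_basis.2 y
  exact ⟨c, map_smul _ _ _⟩

end UOperad

theorem UHom.map_res {k : Type u} [Field k] {P Q : UOperad.{u} k} (f : UHom P Q) {m n : ℕ}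
    (h : m + 1 = n) (i : Fin n) (x : P.obj n) :
    f.toFun m (P.resMap h i x) = Q.resMap h i (f.toFun n x) := by
  rw [UOperad.resMap_apply, f.map_comp, f.map_unit]; rfl

theorem UHom.map_proj {k : Type u} [Field k] {P Q : UOperad.{u} k} (f : UHom P Q) {n : ℕ} (p : ℤ)
    (x : P.obj n) : (Q.obj n).proj p (f.toFun n x) = f.toFun n ((P.obj n).proj p x) :=
  (P.obj n).map_proj_zero (Q.obj n).toGrMod (f.toFun n) (f.map_mem n) p x

/-- The composite of two morphisms of unitary operads. -/
def UHom.trans {k : Type u} [Field k] {P Q R : UOperad.{u} k} (f : UHom P Q) (g : UHom Q R) :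
    UHom P R where
  toFun n := g.toFun n ∘ₗ f.toFun n
  map_mem n _ _ hx := g.map_mem n (f.map_mem n hx)
  map_d n x := (congrArg (g.toFun n) (f.map_d n x)).trans (g.map_d n _)
  map_act n σ x := (congrArg (g.toFun n) (f.map_act n σ x)).trans (g.map_act n σ _)
  map_comp {_ _ n} h i x y := (congrArg (g.toFun n) (f.map_comp h i x y)).trans (g.map_comp h i _ _)
  map_one := (congrArg (g.toFun 1) f.map_one).trans g.map_one
  map_unit := (congrArg (g.toFun 0) f.map_unit).trans g.map_unit

theorem UHom.trans_apply {k : Type u} [Field k] {P Q R : UOperad.{u} k} (f : UHom P Q)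
    (g : UHom Q R) {n : ℕ} (x : P.obj n) : (f.trans g).toFun n x = g.toFun n (f.toFun n x) := rfl

/-- The identity morphism. -/
def UHom.id {k : Type u} [Field k] (P : UOperad.{u} k) : UHom P P where
  toFun _ := LinearMap.id
  map_mem _ _ _ hx := hx
  map_d _ _ := rfl
  map_act _ _ _ := rfl
  map_comp _ _ _ _ := rfl
  map_one := rfl
  map_unit := rfl

/-- A unitary suboperad. -/
structure Suboperad {k : Type u} [Field k] (P : UOperad.{u} k) where
  carrier : ∀ n, Submodule k (P.obj n)
  proj_mem : ∀ {n : ℕ} {x : P.obj n} (p : ℤ), x ∈ carrier n → (P.obj n).proj p x ∈ carrier n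
  d_mem : ∀ {n : ℕ} {x : P.obj n}, x ∈ carrier n → (P.obj n).d x ∈ carrier n
  act_mem : ∀ {n : ℕ} {x : P.obj n} (σ : Perm (Fin n)), x ∈ carrier n → P.act n σ x ∈ carrier n
  comp_mem : ∀ {l m n : ℕ} (h : n + 1 = l + m) (i : Fin l) {x : P.obj l} {y : P.obj m},
    x ∈ carrier l → y ∈ carrier m → P.comp h i x y ∈ carrier n
  one_mem : P.one ∈ carrier 1
  unit_mem : P.unit ∈ carrier 0

namespace Suboperad

variable {k : Type u} [Field k] {P : UOperad.{u} k} (S : Suboperad P)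

/-- A suboperad in some arity. -/
def obj (n : ℕ) : DGMod.{u, u} k where
  carrier := S.carrier n
  gr p := ((P.obj n).gr p).comap (S.carrier n).subtype
  isInternal := by
    refine isInternal_of_projections _
      (fun p => ((P.obj n).proj p).restrict fun x hx => S.proj_mem p hx) ?_ ?_ ?_
    · intro p x hx
      exact Subtype.ext ((P.obj n).proj_of_mem hx)
    · intro p q x hqp hx
      exact Subtype.ext ((P.obj n).proj_of_ne hqp hx)
    · intro x
      have h : ((⨆ p, ((P.obj n).gr p).comap (S.carrier n).subtype).map (S.carrier n).subtype)
          = ⨆ p, S.carrier n ⊓ (P.obj n).gr p := by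
        rw [Submodule.map_iSup]
        simp only [Submodule.map_comap_subtype]
      have hx : x.1 ∈ ⨆ p, S.carrier n ⊓ (P.obj n).gr p :=
        (P.obj n).mem_of_proj_mem _ fun p => Submodule.mem_iSup_of_mem p
          ⟨S.proj_mem p x.2, (P.obj n).proj_mem p x.1⟩
      rw [← h] at hx
      obtain ⟨y, hy, hyx⟩ := hx
      rwa [← Subtype.ext hyx]
  d := (P.obj n).d.restrict fun _ hx => S.d_mem hx
  d_mem hx := (P.obj n).d_mem hx
  d_d x := Subtype.ext ((P.obj n).d_d x.1)

/-- The inclusion of a suboperad in some arity. -/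
def incl (n : ℕ) : S.obj n →ₗ[k] P.obj n := (S.carrier n).subtype

theorem incl_injective {n : ℕ} {x y : S.obj n} (h : S.incl n x = S.incl n y) : x = y :=
  Subtype.ext h

/-- An element of a suboperad. -/
def of {n : ℕ} (x : P.obj n) (hx : x ∈ S.carrier n) : S.obj n := ⟨x, hx⟩

theorem incl_mem {n : ℕ} (x : S.obj n) : S.incl n x ∈ S.carrier n := Subtype.prop x

/-- The composition of a suboperad. -/
def comp {l m n : ℕ} (h : n + 1 = l + m) (i : Fin l) :
    S.obj l →ₗ[k] S.obj m →ₗ[k] S.obj n :=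
  LinearMap.mk₂ k (fun x y => S.of _ (S.comp_mem h i (S.incl_mem x) (S.incl_mem y)))
    (fun _ _ _ => S.incl_injective (LinearMap.map_add₂ (P.comp h i) _ _ _))
    (fun _ _ _ => S.incl_injective (LinearMap.map_smul₂ (P.comp h i) _ _ _))
    (fun x _ _ => S.incl_injective (map_add (P.comp h i (S.incl l x)) _ _))
    (fun _ x _ => S.incl_injective (map_smul (P.comp h i (S.incl l x)) _ _))

/-- A suboperad as an operad. -/
def toUOperad : UOperad.{u} k where
  obj := S.obj
  act n σ := (P.act n σ).restrict fun _ hx => S.act_mem σ hx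
  act_one n x := S.incl_injective (P.act_one n _)
  act_mul n σ τ x := S.incl_injective (P.act_mul n σ τ _)
  act_mem n σ _ _ hx := P.act_mem n σ hx
  act_d n σ x := S.incl_injective (P.act_d n σ _)
  comp := S.comp
  comp_mem h i _ _ _ _ hx hy := P.comp_mem h i hx hy
  comp_d {_ m _} h i _ _ y hx := S.incl_injective (by
    rw [map_add, map_sign]
    exact P.comp_d h i (S.incl m y) hx)
  one := S.of P.one S.one_mem
  one_mem := P.one_mem
  one_d := S.incl_injective P.one_d
  one_comp h x := S.incl_injective (P.one_comp h _)
  comp_one h i x := S.incl_injective (P.comp_one h i _)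
  assoc_seq h₁ h₂ h₃ h₄ i j x y z := S.incl_injective (P.assoc_seq h₁ h₂ h₃ h₄ i j _ _ _)
  assoc_par {l _ _ _ _ _} h₁ h₂ h₃ h₄ i c hci _ _ x _ _ hy hz := S.incl_injective (by
    rw [map_sign]
    exact P.assoc_par h₁ h₂ h₃ h₄ i c hci (S.incl l x) hy hz)
  equivariance {l m _} h i σ τ x y :=
    S.incl_injective (P.equivariance h i σ τ (S.incl l x) (S.incl m y))
  unit := S.of P.unit S.unit_mem
  unit_mem := P.unit_mem
  unit_basis := by
    constructor
    · intro a b hab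
      exact P.unit_basis.1 (congrArg (S.incl 0) hab)
    · intro x
      obtain ⟨c, hc⟩ := P.unit_basis.2 (S.incl 0 x)
      exact ⟨c, S.incl_injective hc⟩

/-- The inclusion of a suboperad. -/
def inclusion : UHom S.toUOperad P where
  toFun := S.incl
  map_mem _ _ _ hx := hx
  map_d _ _ := rfl
  map_act _ _ _ := rfl
  map_comp _ _ _ _ := rfl
  map_one := rfl
  map_unit := rfl

/-- The factorization of a morphism through a suboperad. -/
def codRestrict {Q : UOperad.{u} k} (f : UHom Q P) (hf : ∀ n x, f.toFun n x ∈ S.carrier n) :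
    UHom Q S.toUOperad where
  toFun n := (f.toFun n).codRestrict (S.carrier n) (hf n)
  map_mem n _ _ hx := f.map_mem n hx
  map_d n x := S.incl_injective (f.map_d n x)
  map_act n σ x := S.incl_injective (f.map_act n σ x)
  map_comp h i x y := S.incl_injective (f.map_comp h i x y)
  map_one := S.incl_injective f.map_one
  map_unit := S.incl_injective f.map_unit

end Suboperad

end StrictUnits

namespace StrictUnits

section Extend

variable {k : Type u} [Field k] {P : UOperad.{u} k}

/-- The operations of arity at most `n` that lie in `B`, and the operations of higher arity all of
whose iterated restrictions of arity `n` lie in `B`. -/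
def extendCarrier (n : ℕ) (B : ∀ j, Submodule k (P.obj j)) : ∀ j, Submodule k (P.obj j)
  | 0 => B 0
  | j + 1 => if j + 1 ≤ n then B (j + 1)
      else ⨅ i : Fin (j + 1), (extendCarrier n B j).comap (P.resMap rfl i)

theorem extendCarrier_of_le {n : ℕ} {B : ∀ j, Submodule k (P.obj j)} {j : ℕ} (h : j ≤ n) :
    extendCarrier n B j = B j := by
  cases j with
  | zero => rfl
  | succ j => rw [extendCarrier, if_pos h]

theorem mem_extendCarrier {n : ℕ} {B : ∀ j, Submodule k (P.obj j)} {j : ℕ} (h : n ≤ j)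
    {x : P.obj (j + 1)} :
    x ∈ extendCarrier n B (j + 1) ↔ ∀ i, P.resMap rfl i x ∈ extendCarrier n B j := by
  rw [extendCarrier, if_neg (by omega), Submodule.mem_iInf]
  rfl

theorem extendCarrier_res {n : ℕ} {B : ∀ j, Submodule k (P.obj j)}
    (hres : ∀ {j} (i : Fin (j + 1)) {x}, j + 1 ≤ n → x ∈ B (j + 1) → P.resMap rfl i x ∈ B j)
    {j j' : ℕ} (h : j' + 1 = j) (i : Fin j) {x : P.obj j} (hx : x ∈ extendCarrier n B j) :
    P.resMap h i x ∈ extendCarrier n B j' := by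
  subst h
  by_cases h : j' + 1 ≤ n
  · rw [extendCarrier_of_le h] at hx
    rw [extendCarrier_of_le (by omega)]
    exact hres i h hx
  · exact (mem_extendCarrier (by omega)).mp hx i

/-- The largest suboperad with prescribed operations of small arity. -/
def extendSuboperad {n : ℕ} (hn : 1 ≤ n) (B : ∀ j, Submodule k (P.obj j))
    (hres : ∀ {j} (i : Fin (j + 1)) {x}, j + 1 ≤ n → x ∈ B (j + 1) → P.resMap rfl i x ∈ B j)
    (hcomp : ∀ {l m N : ℕ} (h : N + 1 = l + m) (i : Fin l) {x y}, 1 ≤ m → N ≤ n → x ∈ B l →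
      y ∈ B m → P.comp h i x y ∈ B N)
    (hproj : ∀ {j x} (p : ℤ), j ≤ n → x ∈ B j → (P.obj j).proj p x ∈ B j)
    (hd : ∀ {j x}, j ≤ n → x ∈ B j → (P.obj j).d x ∈ B j)
    (hact : ∀ {j x} (σ : Perm (Fin j)), j ≤ n → x ∈ B j → P.act j σ x ∈ B j)
    (hone : P.one ∈ B 1) (hunit : P.unit ∈ B 0) : Suboperad P where
  carrier := extendCarrier n B
  proj_mem {j x} p hx := by
    induction j with
    | zero => exact hproj p (Nat.zero_le _) hx
    | succ j ih =>
      by_cases h : j + 1 ≤ n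
      · rw [extendCarrier_of_le h] at hx ⊢; exact hproj p h hx
      · rw [mem_extendCarrier (by omega)] at hx ⊢
        intro i
        rw [← (P.obj (j + 1)).map_proj_zero (P.obj j).toGrMod _ (P.resMap_mem rfl i)]
        exact ih (hx i)
  d_mem {j x} hx := by
    induction j with
    | zero => exact hd (Nat.zero_le _) hx
    | succ j ih =>
      by_cases h : j + 1 ≤ n
      · rw [extendCarrier_of_le h] at hx ⊢; exact hd h hx
      · rw [mem_extendCarrier (by omega)] at hx ⊢
        intro i
        rw [← P.d_resMap]
        exact ih (hx i)
  act_mem {j x} σ hx := by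
    induction j with
    | zero => exact hact σ (Nat.zero_le _) hx
    | succ j ih =>
      by_cases h : j + 1 ≤ n
      · rw [extendCarrier_of_le h] at hx ⊢; exact hact σ h hx
      · rw [mem_extendCarrier (by omega)] at hx ⊢
        intro i
        rw [P.resMap_act]
        exact ih _ (hx _)
  comp_mem {l m N} h i x y hx hy := by
    induction N generalizing l m with
    | zero =>
      rcases Nat.eq_zero_or_pos m with rfl | hm
      · obtain ⟨c, hc⟩ := P.comp_zero_eq h i x y
        rw [hc]
        exact Submodule.smul_mem _ c (extendCarrier_res hres _ i hx)
      · have := i.2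
        rw [extendCarrier_of_le (by omega)] at hx hy ⊢
        exact hcomp h i hm (Nat.zero_le _) hx hy
    | succ N ih =>
      rcases Nat.eq_zero_or_pos m with rfl | hm
      · obtain ⟨c, hc⟩ := P.comp_zero_eq h i x y
        rw [hc]
        exact Submodule.smul_mem _ c (extendCarrier_res hres _ i hx)
      · have := i.2
        by_cases hN : N + 1 ≤ n
        · rw [extendCarrier_of_le (by omega)] at hx hy ⊢
          exact hcomp h i hm hN hx hy
        · rw [mem_extendCarrier (by omega)]
          intro i'
          obtain ⟨l, rfl⟩ : ∃ l', l = l' + 1 := ⟨l - 1, by omega⟩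
          obtain ⟨m, rfl⟩ : ∃ m', m = m' + 1 := ⟨m - 1, by omega⟩
          rcases slot_cases h i i' with ⟨c, hc, rfl⟩ | ⟨b, rfl⟩
          · rw [P.resMap_comp_outer h rfl rfl (by omega)]
            exact ih _ _ _ _ (extendCarrier_res hres rfl c hx) hy
          · rw [P.resMap_comp_inner h rfl rfl (by omega)]
            exact ih _ _ _ _ hx (extendCarrier_res hres rfl b hy)
  one_mem := by rw [extendCarrier_of_le hn]; exact hone
  unit_mem := hunit

end Extend

section Towers

variable {k : Type u} [Field k]

theorem Suboperad.mem_of_initial {I : UOperad.{u} k} (hI : ∀ Q : UOperad.{u} k, ∃! _φ : UHom I Q, True)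
    (S : Suboperad I) {n : ℕ} (x : I.obj n) : x ∈ S.carrier n := by
  obtain ⟨ψ, -, -⟩ := hI S.toUOperad
  have h : ψ.trans S.inclusion = UHom.id I := (hI I).unique trivial trivial
  have h1 : S.incl n (ψ.toFun n x) = x := congrArg (fun f : UHom I I => f.toFun n x) h
  rw [← h1]
  exact S.incl_mem _

theorem UHom.proj_eq {P : UOperad.{u} k} {E : GrMod.{u, u} k} {n : ℕ} {j : E →ₗ[k] P.obj n}
    (hj : ∀ {p : ℤ} {e : E}, e ∈ E.gr p → j e ∈ (P.obj n).gr p) (p : ℤ) (e : E) :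
    (P.obj n).proj p (j e) = j (E.proj p e) :=
  E.map_proj_zero (P.obj n).toGrMod j hj p e

theorem Suboperad.mem_of_isPrincipalExtension {P P' : UOperad.{u} k} {ι : UHom P P'} {m : ℕ}
    {E : SigmaMod.{u} k (m + 1)} {a : AttachData P m E} {j : E →ₗ[k] P'.obj (m + 1)}
    (hext : IsPrincipalExtension ι a j) (S : Suboperad P')
    (hι : ∀ n x, ι.toFun n x ∈ S.carrier n) (hj : ∀ e, j e ∈ S.carrier (m + 1)) {n : ℕ}
    (x : P'.obj n) : x ∈ S.carrier n := by
  have hc := hext.compatible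
  have hcS : a.Compatible (S.codRestrict ι hι) (j.codRestrict (S.carrier (m + 1)) hj) :=
    { mem := fun he => hc.mem he
      act := fun σ e => S.incl_injective (hc.act σ e)
      d := fun e => S.incl_injective (hc.d e)
      res := fun i e => S.incl_injective (hc.res i e) }
  obtain ⟨ψ, ⟨h1, h2⟩, -⟩ := hext.universal _ _ _ hcS
  have h : ψ.trans S.inclusion = UHom.id P' :=
    (hext.universal P' ι j hc).unique
      ⟨fun n x => congrArg (S.incl n) (h1 n x), fun e => congrArg (S.incl (m + 1)) (h2 e)⟩
      ⟨fun _ _ => rfl, fun _ => rfl⟩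
  have h3 : S.incl n (ψ.toFun n x) = x := congrArg (fun f : UHom P' P' => f.toFun n x) h
  rw [← h3]
  exact S.incl_mem _

/-- The operad has only the multiples of the identity in arity `1`. -/
def UOperad.IsReduced (P : UOperad.{u} k) : Prop := ∀ x : P.obj 1, ∃ c : k, x = c • P.one

theorem UOperad.proj_one_mem (P : UOperad.{u} k) (p : ℤ) :
    (P.obj 1).proj p P.one ∈ Submodule.span k {P.one} := by
  by_cases h : p = 0
  · subst h
    rw [GrMod.proj_of_mem _ P.one_mem]
    exact Submodule.mem_span_singleton_self _
  · rw [GrMod.proj_of_ne _ h P.one_mem]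
    exact Submodule.zero_mem _

theorem UOperad.act_arity_one (P : UOperad.{u} k) (σ : Perm (Fin 1)) (x : P.obj 1) :
    P.act 1 σ x = x := by
  rw [Subsingleton.elim σ 1, P.act_one]

theorem isReduced_of_initial {I : UOperad.{u} k}
    (hI : ∀ Q : UOperad.{u} k, ∃! _φ : UHom I Q, True) : I.IsReduced := by
  let B : ∀ j, Submodule k (I.obj j) := fun j => match j with
    | 1 => Submodule.span k {I.one}
    | _ => ⊤
  have hB : ∀ {x : I.obj 1}, x ∈ B 1 → ∃ c : k, x = c • I.one := fun {x} hx => by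
    obtain ⟨c, hc⟩ := Submodule.mem_span_singleton.mp hx
    exact ⟨c, hc.symm⟩
  have hB1 : I.one ∈ B 1 := Submodule.mem_span_singleton_self _
  let S : Suboperad I := extendSuboperad (n := 1) le_rfl B
    (fun {j} i x hj _ => by
      obtain rfl : j = 0 := by omega
      exact Submodule.mem_top)
    (fun {l m N} h i x y hm hN hx hy => by
      have := i.2
      obtain rfl : m = 1 := by omega
      rcases Nat.eq_zero_or_pos N with rfl | hN0
      · omega
      obtain rfl : N = 1 := by omega
      obtain rfl : l = 1 := by omega
      obtain ⟨c, rfl⟩ := hB hy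
      rw [map_smul, I.comp_one]
      exact Submodule.smul_mem _ c hx)
    (fun {j x} p hj hx => by
      rcases Nat.eq_zero_or_pos j with rfl | hj0
      · exact Submodule.mem_top
      obtain rfl : j = 1 := by omega
      obtain ⟨c, rfl⟩ := hB hx
      rw [map_smul]
      exact Submodule.smul_mem _ c (I.proj_one_mem p))
    (fun {j x} hj hx => by
      rcases Nat.eq_zero_or_pos j with rfl | hj0
      · exact Submodule.mem_top
      obtain rfl : j = 1 := by omega
      obtain ⟨c, rfl⟩ := hB hx
      rw [map_smul, I.one_d, smul_zero]
      exact Submodule.zero_mem _)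
    (fun {j x} σ hj hx => by
      rcases Nat.eq_zero_or_pos j with rfl | hj0
      · exact Submodule.mem_top
      obtain rfl : j = 1 := by omega
      rw [I.act_arity_one]
      exact hx)
    hB1 Submodule.mem_top
  intro x
  have h : x ∈ extendCarrier 1 B 1 := S.mem_of_initial hI x
  rw [extendCarrier_of_le le_rfl] at h
  exact hB h

open Classical in
/-- The generators of an extension, seen in arity `j`. -/
noncomputable def extGen {P' : UOperad.{u} k} {m : ℕ} {E : SigmaMod.{u} k (m + 1)}
    (j : E →ₗ[k] P'.obj (m + 1)) (n : ℕ) : E →ₗ[k] P'.obj n :=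
  if h : m + 1 = n then h ▸ j else 0

theorem extGen_self {P' : UOperad.{u} k} {m : ℕ} {E : SigmaMod.{u} k (m + 1)}
    (j : E →ₗ[k] P'.obj (m + 1)) : extGen j (m + 1) = j := dif_pos rfl

theorem extGen_of_ne {P' : UOperad.{u} k} {m : ℕ} {E : SigmaMod.{u} k (m + 1)}
    (j : E →ₗ[k] P'.obj (m + 1)) {n : ℕ} (h : m + 1 ≠ n) : extGen j n = 0 := dif_neg h

/-- In arities up to that of the generators, a principal extension adds only the generators. -/
theorem IsPrincipalExtension.exists_eq {P P' : UOperad.{u} k} {ι : UHom P P'} {m : ℕ}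
    {E : SigmaMod.{u} k (m + 1)} {a : AttachData P m E} {j : E →ₗ[k] P'.obj (m + 1)}
    (hext : IsPrincipalExtension ι a j) (hm : 1 ≤ m) (hP : P.IsReduced) {n : ℕ} (hn : n ≤ m + 1)
    (x : P'.obj n) : ∃ s e, x = ι.toFun n s + extGen j n e := by
  have hc := hext.compatible
  let B : ∀ j, Submodule k (P'.obj j) := fun n =>
    LinearMap.range (ι.toFun n) ⊔ LinearMap.range (extGen j n)
  have hB : ∀ {n} {x : P'.obj n}, x ∈ B n ↔ ∃ s e, x = ι.toFun n s + extGen j n e := by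
    intro n x
    simp only [B, Submodule.mem_sup, LinearMap.mem_range, exists_exists_eq_and]
    exact ⟨fun ⟨s, e, h⟩ => ⟨s, e, h.symm⟩, fun ⟨s, e, h⟩ => ⟨s, e, h.symm⟩⟩
  have hι : ∀ {n} (s : P.obj n), ι.toFun n s ∈ B n := fun s =>
    Submodule.mem_sup_left (LinearMap.mem_range_self _ s)
  have hE : ∀ e, j e ∈ B (m + 1) := fun e => Submodule.mem_sup_right ⟨e, by rw [extGen_self]⟩
  have hlt : ∀ {n} {x : P'.obj n}, n ≠ m + 1 → x ∈ B n → ∃ s, x = ι.toFun n s := by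
    intro n x hn hx
    obtain ⟨s, e, rfl⟩ := hB.mp hx
    exact ⟨s, by rw [extGen_of_ne j hn.symm, LinearMap.zero_apply, add_zero]⟩
  have hB1 : ∀ {x : P'.obj 1}, x ∈ B 1 → ∃ c : k, x = c • P'.one := by
    intro x hx
    obtain ⟨s, rfl⟩ := hlt (by omega) hx
    obtain ⟨c, rfl⟩ := hP s
    exact ⟨c, by rw [map_smul, ι.map_one]⟩
  let S : Suboperad P' := extendSuboperad (n := m + 1) (by omega) B
    (fun {n} i x hn hx => by
      by_cases h : n = m
      · subst h
        obtain ⟨s, e, rfl⟩ := hB.mp hx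
        rw [extGen_self, map_add, ← ι.map_res]
        refine Submodule.add_mem _ (hι _) ?_
        rw [← UOperad.res_eq, hc.res]
        exact hι _
      · obtain ⟨s, rfl⟩ := hlt (by omega) hx
        rw [← ι.map_res]
        exact hι _)
    (fun {l q N} h i x y hq hN hx hy => by
      have hi := i.2
      by_cases hl : l = m + 1
      · obtain rfl : q = 1 := by omega
        obtain rfl : N = l := by omega
        obtain ⟨c, rfl⟩ := hB1 hy
        rw [map_smul, P'.comp_one]
        exact Submodule.smul_mem _ c hx
      by_cases hq' : q = m + 1
      · obtain rfl : l = 1 := by omega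
        obtain rfl : N = q := by omega
        obtain ⟨c, rfl⟩ := hB1 hx
        rw [map_smul, LinearMap.smul_apply, Subsingleton.elim i 0, P'.one_comp]
        exact Submodule.smul_mem _ c hy
      obtain ⟨s, rfl⟩ := hlt hl hx
      obtain ⟨t, rfl⟩ := hlt hq' hy
      rw [← ι.map_comp]
      exact hι _)
    (fun {n x} p hn hx => by
      obtain ⟨s, e, rfl⟩ := hB.mp hx
      rw [map_add, ι.map_proj]
      refine Submodule.add_mem _ (hι _) ?_
      by_cases h : n = m + 1
      · subst h
        rw [extGen_self, UHom.proj_eq hc.mem]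
        exact hE _
      · rw [extGen_of_ne j (Ne.symm h), LinearMap.zero_apply, map_zero]
        exact Submodule.zero_mem _)
    (fun {n x} hn hx => by
      obtain ⟨s, e, rfl⟩ := hB.mp hx
      rw [map_add, ← ι.map_d]
      refine Submodule.add_mem _ (hι _) ?_
      by_cases h : n = m + 1
      · subst h
        rw [extGen_self, hc.d]
        exact hι _
      · rw [extGen_of_ne j (Ne.symm h), LinearMap.zero_apply, map_zero]
        exact Submodule.zero_mem _)
    (fun {n x} σ hn hx => by
      obtain ⟨s, e, rfl⟩ := hB.mp hx
      rw [map_add, ← ι.map_act]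
      refine Submodule.add_mem _ (hι _) ?_
      by_cases h : n = m + 1
      · subst h
        rw [extGen_self, ← hc.act]
        exact hE _
      · rw [extGen_of_ne j (Ne.symm h), LinearMap.zero_apply, map_zero]
        exact Submodule.zero_mem _)
    (ι.map_one ▸ hι P.one) (ι.map_unit ▸ hι P.unit)
  have hS : ∀ {n}, n ≤ m + 1 → S.carrier n = B n := fun h => extendCarrier_of_le h
  have hιS : ∀ n s, ι.toFun n s ∈ S.carrier n := by
    intro n s
    induction n with
    | zero => rw [hS (Nat.zero_le _)]; exact hι _
    | succ n ih =>
      by_cases h : n + 1 ≤ m + 1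
      · rw [hS h]; exact hι _
      · refine (mem_extendCarrier (by omega)).mpr fun i => ?_
        rw [← ι.map_res]
        exact ih _
  have h := S.mem_of_isPrincipalExtension hext hιS (fun e => by rw [hS le_rfl]; exact hE e) x
  rw [hS hn] at h
  exact hB.mp h

/-- The data of a Sullivan minimal operad. -/
structure SullivanTower (P : UOperad.{u} k) where
  stage : ℕ → UOperad.{u} k
  ι : ∀ r, UHom (stage r) (stage (r + 1))
  κ : ∀ r, UHom (stage r) P
  initial : ∀ Q : UOperad.{u} k, ∃! _φ : UHom (stage 0) Q, True
  E : ∀ r, SigmaMod.{u} k (r + 1 + 1)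
  a : ∀ r, AttachData (stage r) (r + 1) (E r)
  j : ∀ r, E r →ₗ[k] (stage (r + 1)).obj (r + 1 + 1)
  ext : ∀ r, IsPrincipalExtension (ι r) (a r) (j r)
  κ_ι : ∀ r n x, (κ (r + 1)).toFun n ((ι r).toFun n x) = (κ r).toFun n x
  colimit : ∀ (Q : UOperad.{u} k) (g : ∀ r, UHom (stage r) Q),
    (∀ r n x, (g (r + 1)).toFun n ((ι r).toFun n x) = (g r).toFun n x) →
      ∃! ψ : UHom P Q, ∀ r n x, ψ.toFun n ((κ r).toFun n x) = (g r).toFun n x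

theorem IsSullivanMinimal.nonempty_tower {P : UOperad.{u} k} (h : IsSullivanMinimal P) :
    Nonempty (SullivanTower P) := by
  obtain ⟨stage, ι, κ, h0, h1, h2, h3⟩ := h
  choose E a j h1 using h1
  exact ⟨⟨stage, ι, κ, h0, E, a, j, h1, h2, h3⟩⟩

namespace SullivanTower

variable {P : UOperad.{u} k} (T : SullivanTower P)

theorem isReduced_stage (r : ℕ) : (T.stage r).IsReduced := by
  induction r with
  | zero => exact isReduced_of_initial T.initial
  | succ r ih =>
    intro x
    obtain ⟨s, e, rfl⟩ := (T.ext r).exists_eq (by omega) ih (by omega) x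
    obtain ⟨c, rfl⟩ := ih s
    exact ⟨c, by rw [extGen_of_ne _ (by omega), LinearMap.zero_apply, add_zero, map_smul,
      (T.ι r).map_one]⟩

theorem exists_ι_eq {r n : ℕ} (hn : n < r + 2) (x : (T.stage (r + 1)).obj n) :
    ∃ s, x = (T.ι r).toFun n s := by
  obtain ⟨s, e, rfl⟩ := (T.ext r).exists_eq (by omega) (T.isReduced_stage r) (by omega) x
  exact ⟨s, by rw [extGen_of_ne _ (by omega), LinearMap.zero_apply, add_zero]⟩

theorem exists_ι_add_j_eq {r : ℕ} (x : (T.stage (r + 1)).obj (r + 1 + 1)) :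
    ∃ s e, x = (T.ι r).toFun (r + 1 + 1) s + T.j r e := by
  obtain ⟨s, e, h⟩ := (T.ext r).exists_eq (by omega) (T.isReduced_stage r) le_rfl x
  rw [extGen_self] at h
  exact ⟨s, e, h⟩

theorem range_κ_mono {r r' : ℕ} (h : r ≤ r') {n : ℕ} {x : P.obj n}
    (hx : ∃ s, (T.κ r).toFun n s = x) : ∃ s, (T.κ r').toFun n s = x := by
  induction r', h using Nat.le_induction with
  | base => exact hx
  | succ r' _ ih =>
    obtain ⟨s, hs⟩ := ih
    exact ⟨(T.ι r').toFun n s, by rw [T.κ_ι, hs]⟩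

/-- The union of the images of the stages. -/
def unionSuboperad : Suboperad P where
  carrier n :=
    { carrier := {x | ∃ r s, (T.κ r).toFun n s = x}
      zero_mem' := ⟨0, 0, map_zero _⟩
      add_mem' := by
        rintro x y ⟨r, s, hs⟩ ⟨r', s', hs'⟩
        obtain ⟨t, ht⟩ := T.range_κ_mono (le_max_left r r') ⟨s, hs⟩
        obtain ⟨t', ht'⟩ := T.range_κ_mono (le_max_right r r') ⟨s', hs'⟩
        exact ⟨max r r', t + t', by rw [map_add, ht, ht']⟩
      smul_mem' := by
        rintro c x ⟨r, s, hs⟩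
        exact ⟨r, c • s, by rw [map_smul, hs]⟩ }
  proj_mem := by
    rintro n x p ⟨r, s, rfl⟩
    exact ⟨r, ((T.stage r).obj n).proj p s, by rw [UHom.map_proj]⟩
  d_mem := by
    rintro n x ⟨r, s, rfl⟩
    exact ⟨r, ((T.stage r).obj n).d s, by rw [UHom.map_d]⟩
  act_mem := by
    rintro n x σ ⟨r, s, rfl⟩
    exact ⟨r, (T.stage r).act n σ s, by rw [UHom.map_act]⟩
  comp_mem := by
    rintro l m n h i x y ⟨r, s, hs⟩ ⟨r', s', hs'⟩
    obtain ⟨t, ht⟩ := T.range_κ_mono (le_max_left r r') ⟨s, hs⟩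
    obtain ⟨t', ht'⟩ := T.range_κ_mono (le_max_right r r') ⟨s', hs'⟩
    exact ⟨max r r', (T.stage _).comp h i t t', by rw [UHom.map_comp, ht, ht']⟩
  one_mem := ⟨0, _, (T.κ 0).map_one⟩
  unit_mem := ⟨0, _, (T.κ 0).map_unit⟩

theorem hom_ext {Q : UOperad.{u} k} {f g : UHom P Q}
    (h : ∀ r n x, f.toFun n ((T.κ r).toFun n x) = g.toFun n ((T.κ r).toFun n x)) : f = g := by
  refine (T.colimit Q (fun r => (T.κ r).trans g) fun r n x => ?_).unique h fun _ _ _ => rfl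
  exact congrArg (g.toFun n) (T.κ_ι r n x)

theorem exists_κ_eq {r n : ℕ} (hn : n ≤ r + 1) (x : P.obj n) : ∃ s, (T.κ r).toFun n s = x := by
  have hx : x ∈ T.unionSuboperad.carrier n := by
    have hκ : ∀ r n s, (T.κ r).toFun n s ∈ T.unionSuboperad.carrier n := fun r n s => ⟨r, s, rfl⟩
    obtain ⟨ψ, hψ, -⟩ := T.colimit T.unionSuboperad.toUOperad
      (fun r => T.unionSuboperad.codRestrict (T.κ r) (hκ r))
      fun r n x => T.unionSuboperad.incl_injective (T.κ_ι r n x)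
    have h : ψ.trans T.unionSuboperad.inclusion = UHom.id P :=
      T.hom_ext fun r n x => congrArg (T.unionSuboperad.incl n) (hψ r n x)
    have h1 : T.unionSuboperad.incl n (ψ.toFun n x) = x :=
      congrArg (fun f : UHom P P => f.toFun n x) h
    rw [← h1]
    exact T.unionSuboperad.incl_mem _
  obtain ⟨r', s₀, hs₀⟩ := hx
  obtain ⟨s, hs⟩ := T.range_κ_mono (r' := r + r') (Nat.le_add_left r' r) ⟨s₀, hs₀⟩
  clear hs₀ s₀
  induction r' with
  | zero => exact ⟨s, hs⟩
  | succ d ih =>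
    obtain ⟨t, rfl⟩ := T.exists_ι_eq (r := r + d) (by omega) s
    refine ih t ?_
    rw [← hs]
    exact (T.κ_ι (r + d) n t).symm

theorem isReduced {P : UOperad.{u} k} (T : SullivanTower P) : P.IsReduced := by
  intro x
  obtain ⟨s, rfl⟩ := T.exists_κ_eq (r := 0) le_rfl x
  obtain ⟨c, rfl⟩ := T.isReduced_stage 0 s
  exact ⟨c, by rw [map_smul, (T.κ 0).map_one]⟩

end SullivanTower

end Towers

end StrictUnits

namespace StrictUnits

section Fillers

variable {k : Type u} [Field k]

/-- A degree `0` cocycle of arity `2` for which the unit of the operad is a two-sided unit. -/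
structure IsUnitalProduct (Q : UOperad.{u} k) (m : Q.obj 2) : Prop where
  mem : m ∈ (Q.obj 2).gr 0
  d : (Q.obj 2).d m = 0
  res : ∀ i : Fin 2, Q.resMap rfl i m = Q.one

/-- Composition with a unital product, doubling the input `j` for `j < n`, and adding a last input
for `j = n`. -/
noncomputable def degeneracy (Q : UOperad.{u} k) (m : Q.obj 2) {n : ℕ} (j : Fin (n + 1)) :
    Q.obj n →ₗ[k] Q.obj (n + 1) :=
  if h : j.1 < n then (Q.comp (l := n) (m := 2) (n := n + 1) rfl ⟨j, h⟩).flip m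
  else Q.comp (l := 2) (m := n) (n := n + 1) (by omega) 0 m

theorem degeneracy_of_lt {Q : UOperad.{u} k} {m : Q.obj 2} {n : ℕ} {j : Fin (n + 1)} (h : j.1 < n)
    (t : Q.obj n) :
    degeneracy Q m j t = Q.comp (l := n) (m := 2) (n := n + 1) rfl ⟨j, h⟩ t m := by
  rw [degeneracy, dif_pos h]; rfl

theorem degeneracy_of_not_lt {Q : UOperad.{u} k} {m : Q.obj 2} {n : ℕ} {j : Fin (n + 1)}
    (h : ¬j.1 < n) (t : Q.obj n) :
    degeneracy Q m j t = Q.comp (l := 2) (m := n) (n := n + 1) (by omega) 0 m t := by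
  rw [degeneracy, dif_neg h]

theorem res_degeneracy {Q : UOperad.{u} k} {m : Q.obj 2} {s : ℕ} {i j : Fin (s + 1 + 1)} (hij : i.1 < j.1) {t : Q.obj (s + 1)}
    (ht : Q.resMap rfl ⟨i.1, by omega⟩ t = 0) :
    Q.resMap rfl i (degeneracy Q m j t) = 0 := by
  by_cases h : j.1 < s + 1
  · rw [degeneracy_of_lt h]
    have hne : (⟨i.1, by omega⟩ : Fin (s + 1)) ≠ ⟨j.1, h⟩ := fun e => by
      rw [Fin.mk.injEq] at e; omega
    have e := Q.resMap_comp_outer (l := s + 1) (m := 2) (n := s + 1 + 1) (n' := s + 1) (s := s) rfl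
      rfl rfl rfl ⟨j, h⟩ ⟨i.1, by omega⟩ hne t m
    have hi : outer (l := s + 1) (m := 2) (n := s + 1 + 1) rfl ⟨j, h⟩ ⟨i.1, by omega⟩ hne = i :=
      Fin.ext (by rw [outer_val, if_pos hij])
    rw [ht, map_zero, LinearMap.zero_apply, hi] at e
    exact e
  · rw [degeneracy_of_not_lt h]
    have e := Q.resMap_comp_inner (l := 2) (m := s + 1) (n := s + 1 + 1) (n' := s + 1) (s := s)
      (by omega) rfl rfl (by omega) 0 ⟨i.1, by omega⟩ m t
    have hi : inner (l := 2) (m := s + 1) (n := s + 1 + 1) (by omega) 0 ⟨i.1, by omega⟩ = i :=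
      Fin.ext (by rw [inner_val]; simp)
    rw [ht, map_zero, hi] at e
    exact e

theorem UHom.map_degeneracy {Q Q' : UOperad.{u} k} (f : UHom Q Q') (m : Q.obj 2) {n : ℕ}
    (j : Fin (n + 1)) (t : Q.obj n) :
    f.toFun (n + 1) (degeneracy Q m j t) = degeneracy Q' (f.toFun 2 m) j (f.toFun n t) := by
  by_cases h : j.1 < n
  · rw [degeneracy_of_lt h, degeneracy_of_lt h, f.map_comp]
  · rw [degeneracy_of_not_lt h, degeneracy_of_not_lt h, f.map_comp]

namespace IsUnitalProduct

variable {Q : UOperad.{u} k} {m : Q.obj 2} (hm : IsUnitalProduct Q m) {n : ℕ}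

include hm

theorem degeneracy_mem (j : Fin (n + 1)) {p : ℤ} {t : Q.obj n} (ht : t ∈ (Q.obj n).gr p) :
    degeneracy Q m j t ∈ (Q.obj (n + 1)).gr p := by
  by_cases h : j.1 < n
  · rw [degeneracy_of_lt h]
    have := Q.comp_mem (l := n) (m := 2) (n := n + 1) rfl ⟨j, h⟩ ht hm.mem
    rwa [add_zero] at this
  · rw [degeneracy_of_not_lt h]
    have := Q.comp_mem (l := 2) (m := n) (n := n + 1) (by omega) 0 hm.mem ht
    rwa [zero_add] at this

theorem d_degeneracy (j : Fin (n + 1)) (t : Q.obj n) :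
    (Q.obj (n + 1)).d (degeneracy Q m j t) = degeneracy Q m j ((Q.obj n).d t) := by
  by_cases h : j.1 < n
  · rw [degeneracy_of_lt h, degeneracy_of_lt h]
    induction t using (Q.obj n).induction with
    | mem p t ht => rw [Q.comp_d _ _ _ ht, hm.d, map_zero, smul_zero, add_zero]
    | add s t hs ht => simp only [map_add, LinearMap.add_apply, hs, ht]
  · rw [degeneracy_of_not_lt h, degeneracy_of_not_lt h, Q.comp_d _ _ _ hm.mem, hm.d, map_zero,
      LinearMap.zero_apply, zero_add, Int.negOnePow_zero, one_smul]

theorem res_degeneracy_self (j : Fin (n + 1)) (t : Q.obj n) :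
    Q.resMap rfl j (degeneracy Q m j t) = t := by
  by_cases h : j.1 < n
  · rw [degeneracy_of_lt h]
    have e := Q.resMap_comp_inner (l := n) (m := 2) (n := n + 1) (n' := n) (s := 1) rfl rfl rfl rfl
      ⟨j, h⟩ 0 t m
    rw [hm.res, Q.comp_one] at e
    exact e
  · rw [degeneracy_of_not_lt h]
    have e := Q.resMap_comp_outer (l := 2) (m := n) (n := n + 1) (n' := n) (s := 1) (by omega) rfl
      rfl (by omega) 0 1 (by decide) m t
    have hj : outer (l := 2) (m := n) (n := n + 1) (by omega) 0 1 (by decide) = j :=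
      Fin.ext (by rw [outer_val, if_neg (by decide)]; simp; omega)
    rw [hm.res, hj, Subsingleton.elim (outer _ _ _ _) (0 : Fin 1), Q.one_comp] at e
    exact e

/-- Compatible cocycles are the restrictions of a cocycle. -/
theorem exists_res_eq {R : UOperad.{u} k} (β : UHom Q R) {s : ℕ} {p : ℤ}
    (v : Fin (s + 1 + 1) → Q.obj (s + 1)) (hv : ∀ i, v i ∈ (Q.obj (s + 1)).gr p)
    (hdv : ∀ i, (Q.obj (s + 1)).d (v i) = 0) (hβv : ∀ i, β.toFun (s + 1) (v i) = 0)
    (hvv : ∀ (i j : Fin (s + 1 + 1)) (hij : i.1 < j.1),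
      Q.resMap rfl ⟨i.1, by omega⟩ (v j) = Q.resMap rfl ⟨j.1 - 1, by omega⟩ (v i)) :
    ∃ c ∈ (Q.obj (s + 1 + 1)).gr p, (Q.obj (s + 1 + 1)).d c = 0 ∧ β.toFun (s + 1 + 1) c = 0 ∧
      ∀ i, Q.resMap rfl i c = v i := by
  have key : ∀ a ≤ s + 1 + 1, ∃ c ∈ (Q.obj (s + 1 + 1)).gr p, (Q.obj (s + 1 + 1)).d c = 0 ∧
      β.toFun (s + 1 + 1) c = 0 ∧ ∀ i : Fin (s + 1 + 1), i.1 < a → Q.resMap rfl i c = v i := by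
    intro a
    induction a with
    | zero =>
      intro _
      exact ⟨0, Submodule.zero_mem _, map_zero _, map_zero _, fun i hi => absurd hi (by omega)⟩
    | succ a ih =>
      intro ha
      obtain ⟨c, hc, hdc, hβc, hres⟩ := ih (by omega)
      let j : Fin (s + 1 + 1) := ⟨a, by omega⟩
      let t := v j - Q.resMap rfl j c
      have ht : ∀ i : Fin (s + 1 + 1), ∀ hi : i.1 < a, Q.resMap rfl ⟨i.1, by omega⟩ t = 0 := by
        intro i hi
        have e := Q.resMap_resMap (n := s + 1 + 1) (n₁ := s + 1) (n₂ := s) rfl rfl i j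
          ⟨i.1, by omega⟩ ⟨j.1 - 1, by omega⟩ hi rfl
          (by have : i.1 < j.1 := hi; simp only; omega) c
        rw [map_sub, hvv i j hi, e, hres i hi, sub_self]
      refine ⟨c + degeneracy Q m j t, Submodule.add_mem _ hc
        (hm.degeneracy_mem j (Submodule.sub_mem _ (hv j) (Q.resMap_mem rfl j hc))), ?_, ?_, ?_⟩
      · rw [map_add, hdc, hm.d_degeneracy, map_sub, Q.d_resMap, hdv, hdc, map_zero, sub_zero,
          map_zero, add_zero]
      · rw [map_add, hβc, β.map_degeneracy, map_sub, β.map_res, hβv, hβc, map_zero, sub_zero,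
          map_zero, add_zero]
      · intro i hi
        rw [map_add]
        rcases Nat.lt_or_ge i.1 a with h | h
        · rw [hres i h, res_degeneracy (j := j) h (ht i h), add_zero]
        · obtain rfl : i = j := Fin.ext (show i.1 = a by omega)
          rw [hm.res_degeneracy_self, add_sub_cancel]
  obtain ⟨c, hc, hdc, hβc, hres⟩ := key _ le_rfl
  exact ⟨c, hc, hdc, hβc, fun i => hres i i.2⟩

/-- Lifting of elements with prescribed boundary and restrictions. -/
theorem exists_filler {β : UHom Q (assPlus k)} (hβ : β.IsQuasiIso) {s : ℕ} {p : ℤ}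
    {z : Q.obj (s + 1 + 1)} (hz : z ∈ (Q.obj (s + 1 + 1)).gr (p + 1))
    (hdz : (Q.obj (s + 1 + 1)).d z = 0) (hβz : β.toFun (s + 1 + 1) z = 0)
    (v : Fin (s + 1 + 1) → Q.obj (s + 1)) (hv : ∀ i, v i ∈ (Q.obj (s + 1)).gr p)
    (hvv : ∀ (i j : Fin (s + 1 + 1)) (hij : i.1 < j.1),
      Q.resMap rfl ⟨i.1, by omega⟩ (v j) = Q.resMap rfl ⟨j.1 - 1, by omega⟩ (v i))
    (hzv : ∀ i, (Q.obj (s + 1)).d (v i) = Q.resMap rfl i z)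
    {y : (assPlus k).obj (s + 1 + 1)} (hy : y ∈ ((assPlus k).obj (s + 1 + 1)).gr p)
    (hyv : ∀ i, (assPlus k).resMap rfl i y = β.toFun (s + 1) (v i)) :
    ∃ w ∈ (Q.obj (s + 1 + 1)).gr p, (Q.obj (s + 1 + 1)).d w = z ∧
      (∀ i, Q.resMap rfl i w = v i) ∧ β.toFun (s + 1 + 1) w = y := by
  have hAss : ∀ {n} (y : (assPlus k).obj n), ((assPlus k).obj n).d y = 0 := fun _ => rfl
  obtain ⟨w', hw'⟩ := (hβ _).2 z hdz ⟨0, by rw [hβz, map_zero]⟩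
  obtain ⟨x, hx, z', hxz⟩ := (hβ _).1 (y - β.toFun _ w') (hAss _)
  rw [hAss, add_zero] at hxz
  obtain ⟨w₀, hw₀, hdw₀, hβw₀⟩ : ∃ w₀ ∈ (Q.obj (s + 1 + 1)).gr p,
      (Q.obj (s + 1 + 1)).d w₀ = z ∧ β.toFun (s + 1 + 1) w₀ = y := by
    refine ⟨(Q.obj (s + 1 + 1)).proj p (w' + x), GrMod.proj_mem _ _ _, ?_, ?_⟩
    · rw [← GrMod.map_proj _ _ (Q.obj (s + 1 + 1)).d (Q.obj (s + 1 + 1)).d_mem, map_add, ← hw', hx,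
        add_zero, GrMod.proj_of_mem _ hz]
    · rw [← β.map_proj, map_add, ← hxz, add_sub_cancel, GrMod.proj_of_mem _ hy]
  obtain ⟨c, hc, hdc, hβc, hres⟩ := hm.exists_res_eq β (p := p)
    (fun i => v i - Q.resMap rfl i w₀)
    (fun i => Submodule.sub_mem _ (hv i) (Q.resMap_mem rfl i hw₀))
    (fun i => by rw [map_sub, hzv, Q.d_resMap, hdw₀, sub_self])
    (fun i => by rw [map_sub, β.map_res, hβw₀, hyv, sub_self])
    (fun i j hij => by
      have e := Q.resMap_resMap (n := s + 1 + 1) (n₁ := s + 1) (n₂ := s) rfl rfl i j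
        ⟨i.1, by omega⟩ ⟨j.1 - 1, by omega⟩ hij rfl (by simp only; omega) w₀
      rw [map_sub, map_sub, hvv i j hij, e])
  refine ⟨w₀ + c, Submodule.add_mem _ hw₀ hc, ?_, fun i => ?_, ?_⟩
  · rw [map_add, hdw₀, hdc, add_zero]
  · rw [map_add, hres, add_sub_cancel]
  · rw [map_add, hβw₀, hβc, add_zero]

end IsUnitalProduct

end Fillers

section Averaging

variable {k : Type u} [Field k] {Q : UOperad.{u} k} {n : ℕ} {E : SigmaMod.{u} k n}

theorem SigmaMod.act_inv_act (E : SigmaMod.{u} k n) (σ : Perm (Fin n)) (e : E) :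
    E.act σ⁻¹ (E.act σ e) = e := by
  rw [← E.act_mul, mul_inv_cancel, E.act_one]

/-- The equivariant average of a linear map. -/
noncomputable def average (f : E →ₗ[k] Q.obj n) : E →ₗ[k] Q.obj n :=
  (Fintype.card (Perm (Fin n)) : k)⁻¹ •
    ∑ σ : Perm (Fin n), Q.act n σ⁻¹ ∘ₗ f ∘ₗ E.act σ

theorem average_apply (f : E →ₗ[k] Q.obj n) (e : E) :
    average f e = (Fintype.card (Perm (Fin n)) : k)⁻¹ •
      ∑ σ : Perm (Fin n), Q.act n σ⁻¹ (f (E.act σ e)) := by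
  rw [average, LinearMap.smul_apply, LinearMap.sum_apply]
  rfl

theorem average_act (f : E →ₗ[k] Q.obj n) (τ : Perm (Fin n)) (e : E) :
    average f (E.act τ e) = Q.act n τ (average f e) := by
  rw [average_apply, average_apply, map_smul, map_sum]
  congr 1
  refine Fintype.sum_equiv (Equiv.mulLeft τ) _ _ fun σ => ?_
  rw [Equiv.coe_mulLeft, ← E.act_mul, ← Q.act_mul, mul_inv_rev, mul_assoc, inv_mul_cancel, mul_one]

/-- A linear condition that holds for all conjugates of a map holds for its average. -/
theorem average_eq [CharZero k] {N : Type*} [AddCommGroup N] [Module k N] (f : E →ₗ[k] Q.obj n)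
    (g : Q.obj n →ₗ[k] N) {e : E} {b : N}
    (h : ∀ σ : Perm (Fin n), g (Q.act n σ⁻¹ (f (E.act σ e))) = b) : g (average f e) = b := by
  rw [average_apply, map_smul, map_sum, Finset.sum_congr rfl fun σ _ => h σ, Finset.sum_const,
    Finset.card_univ, ← Nat.cast_smul_eq_nsmul k, smul_smul, inv_mul_cancel₀, one_smul]
  exact Nat.cast_ne_zero.mpr Fintype.card_ne_zero

theorem average_mem (f : E →ₗ[k] Q.obj n) {p : ℤ}
    (h : ∀ e, e ∈ E.gr p → f e ∈ (Q.obj n).gr p) {e : E} (he : e ∈ E.gr p) :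
    average f e ∈ (Q.obj n).gr p := by
  rw [average_apply]
  exact Submodule.smul_mem _ _ (Submodule.sum_mem _ fun σ _ =>
    Q.act_mem n _ (h _ (E.act_mem σ he)))

end Averaging

section Lifting

variable {k : Type u} [Field k]

theorem res_assMul (i : Fin 2) : (assPlus k).resMap rfl i (assMul k) = (assPlus k).one :=
  (assUnital k).mu_two_unit i

/-- A quasi-isomorphism from a reduced operad to the associative operad detects a unital product. -/
theorem UOperad.IsReduced.exists_isUnitalProduct {P : UOperad.{u} k} (hP : P.IsReduced)
    {ρ : UHom P (assPlus k)} (hρ : ρ.IsQuasiIso) : ∃ m, IsUnitalProduct P m := by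
  obtain ⟨x, hx, z, hz⟩ := (hρ 2).1 (assMul k) rfl
  have hz' : assMul k = ρ.toFun 2 x := hz.trans (add_zero _)
  have hm : ρ.toFun 2 ((P.obj 2).proj 0 x) = assMul k := by
    rw [← ρ.map_proj, ← hz']
    exact ((assPlus k).obj 2).proj_of_mem (mem_ass_zero k _)
  refine ⟨(P.obj 2).proj 0 x, GrMod.proj_mem _ _ _, ?_, fun i => ?_⟩
  · have := (P.obj 2).map_proj (P.obj 2).toGrMod (P.obj 2).d (P.obj 2).d_mem 0 x
    rw [← this, hx, map_zero]
  · obtain ⟨c, hc⟩ := hP (P.resMap rfl i ((P.obj 2).proj 0 x))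
    have h1 := congrArg (ρ.toFun 1) hc
    rw [ρ.map_res, hm, res_assMul, map_smul, ρ.map_one] at h1
    have h2 : (1 : k) = c := by
      have := DFunLike.congr_fun (show (Finsupp.single 1 1 : Perm (Fin 1) →₀ k)
        = c • (Finsupp.single 1 1 : Perm (Fin 1) →₀ k) from h1) 1
      simpa using this
    rw [hc, ← h2, one_smul]

/-- Linear choice of solutions of linear equations, from a choice for each vector. -/
theorem exists_linear_choice {V M N : Type*} [AddCommGroup V] [Module k V] [AddCommGroup M]
    [Module k M] [AddCommGroup N] [Module k N] (S : Submodule k M) (g : M →ₗ[k] N) (b : V →ₗ[k] N)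
    (h : ∀ v, ∃ x ∈ S, g x = b v) : ∃ f : V →ₗ[k] M, ∀ v, f v ∈ S ∧ g (f v) = b v := by
  let B := Module.Basis.ofVectorSpace k V
  choose x hx hg using fun i => h (B i)
  let f : V →ₗ[k] M := B.constr k x
  have hf : ∀ i, f (B i) = x i := fun i => B.constr_basis k x i
  have h1 : g ∘ₗ f = b := B.ext fun i => by rw [LinearMap.comp_apply, hf, hg]
  refine ⟨f, fun v => ⟨?_, congrArg (fun l => l v) h1⟩⟩
  have h2 : LinearMap.range f ≤ S := by
    rw [LinearMap.range_eq_map, ← B.span_eq, Submodule.map_span, Submodule.span_le]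
    rintro _ ⟨_, ⟨i, rfl⟩, rfl⟩
    rw [hf]
    exact hx i
  exact h2 ⟨v, rfl⟩

variable [CharZero k]

/-- Extension of a lift over a principal extension. -/
theorem exists_lift_extension {Q : UOperad.{u} k} {m : Q.obj 2} (hm : IsUnitalProduct Q m)
    {β : UHom Q (assPlus k)} (hβ : β.IsQuasiIso) {P P' : UOperad.{u} k} {ι : UHom P P'} {s : ℕ}
    {E : SigmaMod.{u} k (s + 1 + 1)} {a : AttachData P (s + 1) E}
    {j : E →ₗ[k] P'.obj (s + 1 + 1)} (hext : IsPrincipalExtension ι a j)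
    (α : UHom P' (assPlus k)) (ψ : UHom P Q)
    (hψ : ∀ n x, β.toFun n (ψ.toFun n x) = α.toFun n (ι.toFun n x)) :
    ∃ ψ' : UHom P' Q, (∀ n x, ψ'.toFun n (ι.toFun n x) = ψ.toFun n x) ∧
      ∀ n x, β.toFun n (ψ'.toFun n x) = α.toFun n x := by
  have hc := hext.compatible
  let N : ℕ := s + 1 + 1
  let G : Q.obj (s + 1 + 1) →ₗ[k] Q.obj (s + 1 + 1) × (Fin (s + 1 + 1) → Q.obj (s + 1)) ×
      (assPlus k).obj (s + 1 + 1) :=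
    (Q.obj (s + 1 + 1)).d.prod ((LinearMap.pi fun i => Q.resMap rfl i).prod (β.toFun (s + 1 + 1)))
  let H : E →ₗ[k] Q.obj (s + 1 + 1) × (Fin (s + 1 + 1) → Q.obj (s + 1)) ×
      (assPlus k).obj (s + 1 + 1) :=
    (ψ.toFun (s + 1 + 1) ∘ₗ a.d).prod ((LinearMap.pi fun i => ψ.toFun (s + 1) ∘ₗ a.δ i).prod
      (α.toFun (s + 1 + 1) ∘ₗ j))
  have hG : ∀ (x : Q.obj (s + 1 + 1)) (e : E), G x = H e ↔
      (Q.obj (s + 1 + 1)).d x = ψ.toFun _ (a.d e) ∧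
      (∀ i, Q.resMap rfl i x = ψ.toFun _ (a.δ i e)) ∧ β.toFun _ x = α.toFun _ (j e) := by
    intro x e
    refine ⟨fun h => ⟨congrArg Prod.fst h, fun i => congrFun (congrArg (fun z => z.2.1) h) i,
      congrArg (fun z => z.2.2) h⟩, fun h => Prod.ext h.1 (Prod.ext (funext h.2.1) h.2.2)⟩
  have hex : ∀ p (e : E.gr p), ∃ x ∈ (Q.obj (s + 1 + 1)).gr p, G x = H e := by
    intro p ⟨e, he⟩
    have hβd : β.toFun _ (ψ.toFun _ (a.d e)) = 0 := by
      rw [hψ, ← hc.d, α.map_d]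
      rfl
    obtain ⟨w, hw, h1, h2, h3⟩ := hm.exists_filler hβ (ψ.map_mem _ (a.d_mem he))
      (by rw [← ψ.map_d, a.d_cocycle, map_zero]) hβd (fun i => ψ.toFun _ (a.δ i e))
      (fun i => ψ.map_mem _ (a.δ_mem i he))
      (fun i j hij => by
        rw [← ψ.map_res, ← ψ.map_res]
        exact congrArg _ (a.δ_δ rfl i j hij e))
      (fun i => by
        rw [← ψ.map_d, a.δ_d, ← ψ.map_res]; rfl)
      (α.map_mem _ (hc.mem he))
      (fun i => by
        rw [hψ, ← hc.res, UOperad.res_eq, α.map_res])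
    exact ⟨w, hw, (hG w e).mpr ⟨h1, h2, h3⟩⟩
  have hlin : ∀ p, ∃ f : E.gr p →ₗ[k] Q.obj (s + 1 + 1), ∀ e, f e ∈ (Q.obj (s + 1 + 1)).gr p ∧
      G (f e) = H e := fun p =>
    exists_linear_choice ((Q.obj (s + 1 + 1)).gr p) G (H ∘ₗ (E.gr p).subtype) (hex p)
  choose F hF using hlin
  obtain ⟨g, hg⟩ := E.exists_lift F
  have hgG : ∀ e : E, G (g e) = H e := by
    intro e
    induction e using E.induction with
    | mem p e he => rw [hg p ⟨e, he⟩]; exact (hF p ⟨e, he⟩).2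
    | add x y hx hy => rw [map_add, map_add, map_add, hx, hy]
  have hg' := fun e => (hG _ e).mp (hgG e)
  let f := average g
  have hd : ∀ e, (Q.obj (s + 1 + 1)).d (f e) = ψ.toFun _ (a.d e) := fun e =>
    average_eq g (Q.obj (s + 1 + 1)).d fun σ => by
      rw [← Q.act_d, (hg' _).1, ← ψ.map_act, ← a.d_act, E.act_inv_act]
  have hres : ∀ i e, Q.resMap rfl i (f e) = ψ.toFun _ (a.δ i e) := fun i e =>
    average_eq g (Q.resMap rfl i) fun σ => by
      rw [Q.resMap_act, (hg' _).2.1, ← ψ.map_act, ← a.δ_act, E.act_inv_act]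
  have hβf : ∀ e, β.toFun _ (f e) = α.toFun _ (j e) := fun e =>
    average_eq g (β.toFun _) fun σ => by
      rw [β.map_act, (hg' _).2.2, ← α.map_act, ← hc.act, E.act_inv_act]
  have hf : a.Compatible ψ f :=
    { mem := fun {p} e he => average_mem g (fun e he => by
        rw [hg p ⟨e, he⟩]; exact (hF p ⟨e, he⟩).1) he
      act := fun σ e => average_act g σ e
      d := hd
      res := hres }
  obtain ⟨ψ', ⟨h1, h2⟩, -⟩ := hext.universal Q ψ f hf
  have hαc : a.Compatible (ι.trans α) (α.toFun (s + 1 + 1) ∘ₗ j) :=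
    { mem := fun he => α.map_mem _ (hc.mem he)
      act := fun σ e => (congrArg _ (hc.act σ e)).trans (α.map_act _ _ _)
      d := fun e => (α.map_d _ _).symm.trans (congrArg _ (hc.d e))
      res := fun i e => (α.map_res rfl i _).symm.trans (congrArg _ (hc.res i e)) }
  have h : ψ'.trans β = α := (hext.universal _ _ _ hαc).unique
    ⟨fun n x => by rw [UHom.trans_apply, h1, hψ]; rfl,
      fun e => by rw [UHom.trans_apply, h2, hβf]; rfl⟩
    ⟨fun _ _ => rfl, fun _ => rfl⟩
  exact ⟨ψ', h1, fun n x => congrArg (fun f : UHom P' (assPlus k) => f.toFun n x) h⟩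

/-- Sullivan minimal operads lift against quasi-isomorphisms onto the associative operad. -/
theorem SullivanTower.exists_lift {P : UOperad.{u} k} (T : SullivanTower P) {Q : UOperad.{u} k}
    {m : Q.obj 2} (hm : IsUnitalProduct Q m) {β : UHom Q (assPlus k)} (hβ : β.IsQuasiIso)
    (α : UHom P (assPlus k)) :
    ∃ ψ : UHom P Q, ∀ n x, β.toFun n (ψ.toFun n x) = α.toFun n x := by
  let D : ℕ → Type u := fun r =>
    {ψ : UHom (T.stage r) Q // ∀ n x, β.toFun n (ψ.toFun n x) = α.toFun n ((T.κ r).toFun n x)}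
  have h0 : Nonempty (D 0) := by
    obtain ⟨ψ, -, -⟩ := T.initial Q
    have h : ψ.trans β = (T.κ 0).trans α := (T.initial _).unique trivial trivial
    exact ⟨⟨ψ, fun n x => congrArg (fun f : UHom _ (assPlus k) => f.toFun n x) h⟩⟩
  have hstep : ∀ r (ψ : D r), ∃ ψ' : D (r + 1),
      ∀ n x, ψ'.1.toFun n ((T.ι r).toFun n x) = ψ.1.toFun n x := by
    intro r ψ
    obtain ⟨ψ', h1, h2⟩ := exists_lift_extension hm hβ (T.ext r) ((T.κ (r + 1)).trans α) ψ.1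
      fun n x => by rw [ψ.2, UHom.trans_apply, T.κ_ι]
    exact ⟨⟨ψ', h2⟩, h1⟩
  choose next hnext using hstep
  let g : ∀ r, D r := fun r => Nat.rec (Classical.choice h0) (fun r ψ => next r ψ) r
  obtain ⟨ψ, hψ, -⟩ := T.colimit Q (fun r => (g r).1) fun r n x => hnext r (g r) n x
  have h : ψ.trans β = α := T.hom_ext fun r n x => by
    rw [UHom.trans_apply, hψ, (g r).2]
  exact ⟨ψ, fun n x => congrArg (fun f : UHom P (assPlus k) => f.toFun n x) h⟩

end Lifting

end StrictUnits

namespace StrictUnits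

section GradedMorphisms

variable {k : Type u} [Field k]

/-- A morphism of unitary operads that need not commute with the differentials. -/
structure GrHom (P Q : UOperad.{u} k) where
  toFun : ∀ n, P.obj n →ₗ[k] Q.obj n
  map_mem : ∀ n {p : ℤ} {x : P.obj n}, x ∈ (P.obj n).gr p → toFun n x ∈ (Q.obj n).gr p
  map_act : ∀ n (σ : Perm (Fin n)) (x : P.obj n), toFun n (P.act n σ x) = Q.act n σ (toFun n x)
  map_comp : ∀ {l m n : ℕ} (h : n + 1 = l + m) (i : Fin l) (x : P.obj l) (y : P.obj m),
    toFun n (P.comp h i x y) = Q.comp h i (toFun l x) (toFun m y)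
  map_one : toFun 1 P.one = Q.one
  map_unit : toFun 0 P.unit = Q.unit

/-- The underlying graded morphism. -/
def UHom.toGrHom {P Q : UOperad.{u} k} (f : UHom P Q) : GrHom P Q where
  toFun := f.toFun
  map_mem := f.map_mem
  map_act := f.map_act
  map_comp := f.map_comp
  map_one := f.map_one
  map_unit := f.map_unit

theorem UHom.ext {P Q : UOperad.{u} k} {f g : UHom P Q}
    (h : ∀ n x, f.toFun n x = g.toFun n x) : f = g := by
  cases f; cases g
  congr 1
  exact funext fun n => LinearMap.ext (h n)

theorem GrHom.map_proj {P Q : UOperad.{u} k} (f : GrHom P Q) {n : ℕ} (p : ℤ) (x : P.obj n) :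
    (Q.obj n).proj p (f.toFun n x) = f.toFun n ((P.obj n).proj p x) :=
  (P.obj n).map_proj_zero (Q.obj n).toGrMod (f.toFun n) (f.map_mem n) p x

theorem UOperad.proj_d (P : UOperad.{u} k) {n : ℕ} (p : ℤ) (x : P.obj n) :
    (P.obj n).d ((P.obj n).proj p x) = (P.obj n).proj (p + 1) ((P.obj n).d x) :=
  ((P.obj n).map_proj (P.obj n).toGrMod (P.obj n).d (P.obj n).d_mem p x).symm

theorem GrHom.map_d_of_proj {P Q : UOperad.{u} k} (f : GrHom P Q) {n : ℕ} {x : P.obj n}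
    (h : f.toFun n ((P.obj n).d x) = (Q.obj n).d (f.toFun n x)) (p : ℤ) :
    f.toFun n ((P.obj n).d ((P.obj n).proj p x))
      = (Q.obj n).d (f.toFun n ((P.obj n).proj p x)) := by
  rw [P.proj_d, ← f.map_proj, h, ← f.map_proj, Q.proj_d]

/-- The operations on which a graded morphism commutes with the differentials. -/
noncomputable def GrHom.dLocus {P Q : UOperad.{u} k} (f : GrHom P Q) : Suboperad P where
  carrier n := LinearMap.eqLocus (f.toFun n ∘ₗ (P.obj n).d) ((Q.obj n).d ∘ₗ f.toFun n)
  proj_mem p hx := f.map_d_of_proj hx p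
  d_mem {n x} hx := by
    change f.toFun n ((P.obj n).d ((P.obj n).d x)) = (Q.obj n).d (f.toFun n ((P.obj n).d x))
    have h : f.toFun n ((P.obj n).d x) = (Q.obj n).d (f.toFun n x) := hx
    rw [h, DGMod.d_d, DGMod.d_d, map_zero]
  act_mem {n x} σ hx := by
    change f.toFun n ((P.obj n).d (P.act n σ x)) = (Q.obj n).d (f.toFun n (P.act n σ x))
    have h : f.toFun n ((P.obj n).d x) = (Q.obj n).d (f.toFun n x) := hx
    rw [← P.act_d, f.map_act, f.map_act, h, Q.act_d]
  comp_mem {l m n} h i x y hx hy := by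
    change x ∈ (LinearMap.eqLocus (f.toFun n ∘ₗ (P.obj n).d) ((Q.obj n).d ∘ₗ f.toFun n)).comap
      ((P.comp h i).flip y)
    refine (P.obj l).mem_of_proj_mem _ fun p => ?_
    have hy' : f.toFun m ((P.obj m).d y) = (Q.obj m).d (f.toFun m y) := hy
    have hx' := f.map_d_of_proj hx p
    have hp := (P.obj l).proj_mem p x
    change f.toFun n ((P.obj n).d (P.comp h i ((P.obj l).proj p x) y))
      = (Q.obj n).d (f.toFun n (P.comp h i ((P.obj l).proj p x) y))
    rw [P.comp_d h i y hp, map_add, map_sign, f.map_comp, f.map_comp, f.map_comp, hx', hy',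
      Q.comp_d h i _ (f.map_mem _ hp)]
  one_mem := by
    change f.toFun 1 ((P.obj 1).d P.one) = (Q.obj 1).d (f.toFun 1 P.one)
    rw [f.map_one, P.one_d, Q.one_d, map_zero]
  unit_mem := by
    change f.toFun 0 ((P.obj 0).d P.unit) = (Q.obj 0).d (f.toFun 0 P.unit)
    rw [f.map_unit, P.d_unit, Q.d_unit, map_zero]

theorem GrHom.mem_dLocus {P Q : UOperad.{u} k} (f : GrHom P Q) {n : ℕ} {x : P.obj n} :
    x ∈ f.dLocus.carrier n ↔ f.toFun n ((P.obj n).d x) = (Q.obj n).d (f.toFun n x) := Iff.rfl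

/-- The operations on which two graded morphisms agree, together with their boundaries. -/
noncomputable def GrHom.equalizer {P Q : UOperad.{u} k} (f g : GrHom P Q) : Suboperad P where
  carrier n := LinearMap.eqLocus (f.toFun n) (g.toFun n) ⊓
    LinearMap.eqLocus (f.toFun n ∘ₗ (P.obj n).d) (g.toFun n ∘ₗ (P.obj n).d)
  proj_mem {n x} p hx := by
    have h1 : f.toFun n x = g.toFun n x := hx.1
    have h2 : f.toFun n ((P.obj n).d x) = g.toFun n ((P.obj n).d x) := hx.2
    refine ⟨?_, ?_⟩
    · change f.toFun n ((P.obj n).proj p x) = g.toFun n ((P.obj n).proj p x)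
      rw [← f.map_proj, ← g.map_proj, h1]
    · change f.toFun n ((P.obj n).d ((P.obj n).proj p x))
        = g.toFun n ((P.obj n).d ((P.obj n).proj p x))
      rw [P.proj_d, ← f.map_proj, ← g.map_proj, h2]
  d_mem {n x} hx := by
    refine ⟨hx.2, ?_⟩
    change f.toFun n ((P.obj n).d ((P.obj n).d x)) = g.toFun n ((P.obj n).d ((P.obj n).d x))
    rw [DGMod.d_d, map_zero, map_zero]
  act_mem {n x} σ hx := by
    have h1 : f.toFun n x = g.toFun n x := hx.1
    have h2 : f.toFun n ((P.obj n).d x) = g.toFun n ((P.obj n).d x) := hx.2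
    refine ⟨?_, ?_⟩
    · change f.toFun n (P.act n σ x) = g.toFun n (P.act n σ x)
      rw [f.map_act, g.map_act, h1]
    · change f.toFun n ((P.obj n).d (P.act n σ x)) = g.toFun n ((P.obj n).d (P.act n σ x))
      rw [← P.act_d, f.map_act, g.map_act, h2]
  comp_mem {l m n} h i x y hx hy := by
    have h1 : f.toFun l x = g.toFun l x := hx.1
    have h2 : f.toFun l ((P.obj l).d x) = g.toFun l ((P.obj l).d x) := hx.2
    have h3 : f.toFun m y = g.toFun m y := hy.1
    have h4 : f.toFun m ((P.obj m).d y) = g.toFun m ((P.obj m).d y) := hy.2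
    refine ⟨?_, ?_⟩
    · change f.toFun n (P.comp h i x y) = g.toFun n (P.comp h i x y)
      rw [f.map_comp, g.map_comp, h1, h3]
    · change x ∈ (LinearMap.eqLocus (f.toFun n ∘ₗ (P.obj n).d) (g.toFun n ∘ₗ (P.obj n).d)).comap
        ((P.comp h i).flip y)
      refine (P.obj l).mem_of_proj_mem _ fun p => ?_
      have hp := (P.obj l).proj_mem p x
      change f.toFun n ((P.obj n).d (P.comp h i ((P.obj l).proj p x) y))
        = g.toFun n ((P.obj n).d (P.comp h i ((P.obj l).proj p x) y))
      rw [P.comp_d h i y hp, map_add, map_add, map_sign, map_sign, f.map_comp, f.map_comp,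
        g.map_comp, g.map_comp, h3, h4, P.proj_d, ← f.map_proj, ← f.map_proj, ← g.map_proj,
        ← g.map_proj, h1, h2]
  one_mem := by
    refine ⟨f.map_one.trans g.map_one.symm, ?_⟩
    change f.toFun 1 ((P.obj 1).d P.one) = g.toFun 1 ((P.obj 1).d P.one)
    rw [P.one_d, map_zero, map_zero]
  unit_mem := by
    refine ⟨f.map_unit.trans g.map_unit.symm, ?_⟩
    change f.toFun 0 ((P.obj 0).d P.unit) = g.toFun 0 ((P.obj 0).d P.unit)
    rw [P.d_unit, map_zero, map_zero]

theorem GrHom.mem_equalizer {P Q : UOperad.{u} k} (f g : GrHom P Q) {n : ℕ} {x : P.obj n} :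
    x ∈ (f.equalizer g).carrier n ↔ f.toFun n x = g.toFun n x ∧
      f.toFun n ((P.obj n).d x) = g.toFun n ((P.obj n).d x) := Iff.rfl

/-- The image of a suboperad of a suboperad. -/
def Suboperad.map {P : UOperad.{u} k} (S : Suboperad P) (S' : Suboperad S.toUOperad) :
    Suboperad P where
  carrier n := (S'.carrier n).map (S.incl n)
  proj_mem := by
    rintro n _ p ⟨y, hy, rfl⟩
    exact ⟨_, S'.proj_mem p hy, (S.inclusion.map_proj p y).symm⟩
  d_mem := by
    rintro n _ ⟨y, hy, rfl⟩
    exact ⟨_, S'.d_mem hy, rfl⟩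
  act_mem := by
    rintro n _ σ ⟨y, hy, rfl⟩
    exact ⟨_, S'.act_mem σ hy, rfl⟩
  comp_mem := by
    rintro l m n h i _ _ ⟨x, hx, rfl⟩ ⟨y, hy, rfl⟩
    exact ⟨_, S'.comp_mem h i hx hy, rfl⟩
  one_mem := ⟨_, S'.one_mem, rfl⟩
  unit_mem := ⟨_, S'.unit_mem, rfl⟩

/-- The intersection of suboperads. -/
def Suboperad.sInf {P : UOperad.{u} k} (C : Set (Suboperad P)) : Suboperad P where
  carrier n := ⨅ S ∈ C, S.carrier n
  proj_mem p hx := by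
    simp only [Submodule.mem_iInf] at hx ⊢
    exact fun S hS => S.proj_mem p (hx S hS)
  d_mem hx := by
    simp only [Submodule.mem_iInf] at hx ⊢
    exact fun S hS => S.d_mem (hx S hS)
  act_mem σ hx := by
    simp only [Submodule.mem_iInf] at hx ⊢
    exact fun S hS => S.act_mem σ (hx S hS)
  comp_mem h i _ _ hx hy := by
    simp only [Submodule.mem_iInf] at hx hy ⊢
    exact fun S hS => S.comp_mem h i (hx S hS) (hy S hS)
  one_mem := by
    simp only [Submodule.mem_iInf]
    exact fun S _ => S.one_mem
  unit_mem := by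
    simp only [Submodule.mem_iInf]
    exact fun S _ => S.unit_mem

theorem Suboperad.mem_sInf {P : UOperad.{u} k} {C : Set (Suboperad P)} {n : ℕ} {x : P.obj n} :
    x ∈ (Suboperad.sInf C).carrier n ↔ ∀ S ∈ C, x ∈ S.carrier n := by
  simp only [Suboperad.sInf, Submodule.mem_iInf]

/-- The inclusion between two suboperads. -/
def Suboperad.inclusionOfLE {P : UOperad.{u} k} {S S' : Suboperad P}
    (h : ∀ n x, x ∈ S.carrier n → x ∈ S'.carrier n) : UHom S.toUOperad S'.toUOperad :=
  S'.codRestrict S.inclusion fun n x => h n _ (S.incl_mem x)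

/-- The suboperad of the multiples of the unit and of the identity. -/
def trivialSuboperad (P : UOperad.{u} k) : Suboperad P where
  carrier n := match n with
    | 0 => ⊤
    | 1 => Submodule.span k {P.one}
    | _ => ⊥
  proj_mem {n x} p hx := by
    match n with
    | 0 => exact Submodule.mem_top
    | 1 =>
      obtain ⟨c, rfl⟩ := Submodule.mem_span_singleton.mp hx
      rw [map_smul]
      exact Submodule.smul_mem _ c (P.proj_one_mem p)
    | n + 2 =>
      rw [(Submodule.mem_bot k).mp hx, map_zero]
      exact Submodule.zero_mem _
  d_mem {n x} hx := by
    match n with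
    | 0 => exact Submodule.mem_top
    | 1 =>
      obtain ⟨c, rfl⟩ := Submodule.mem_span_singleton.mp hx
      rw [map_smul, P.one_d, smul_zero]
      exact Submodule.zero_mem _
    | n + 2 =>
      rw [(Submodule.mem_bot k).mp hx, map_zero]
      exact Submodule.zero_mem _
  act_mem {n x} σ hx := by
    match n with
    | 0 => exact Submodule.mem_top
    | 1 => rw [P.act_arity_one]; exact hx
    | n + 2 =>
      rw [(Submodule.mem_bot k).mp hx, map_zero]
      exact Submodule.zero_mem _
  comp_mem {l m n} h i x y hx hy := by
    match l with
    | 0 => exact i.elim0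
    | 1 =>
      obtain rfl : n = m := by omega
      obtain ⟨c, rfl⟩ := Submodule.mem_span_singleton.mp hx
      rw [map_smul, LinearMap.smul_apply, Subsingleton.elim i 0, P.one_comp]
      exact Submodule.smul_mem _ c hy
    | l + 2 =>
      rw [(Submodule.mem_bot k).mp hx, map_zero, LinearMap.zero_apply]
      exact Submodule.zero_mem _
  one_mem := Submodule.mem_span_singleton_self _
  unit_mem := Submodule.mem_top

/-- An operad with only the multiples of the unit and of the identity is initial. -/
theorem isInitial_of_trivial {P : UOperad.{u} k} (h1 : P.one ≠ 0)
    (hP : ∀ {n} (x : P.obj n), x ∈ (trivialSuboperad P).carrier n) (Q : UOperad.{u} k) :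
    ∃! _φ : UHom P Q, True := by
  have h0 : P.unit ≠ 0 := fun e => one_ne_zero (α := k) (P.unit_basis.1 (by simp [e]))
  have hc0 : ∀ x : P.obj 0, ∃ c : k, x = c • P.unit := fun x => by
    obtain ⟨c, hc⟩ := P.unit_basis.2 x
    exact ⟨c, hc.symm⟩
  have hc1 : ∀ x : P.obj 1, ∃ c : k, x = c • P.one := fun x => by
    obtain ⟨c, hc⟩ := Submodule.mem_span_singleton.mp (hP x)
    exact ⟨c, hc.symm⟩
  have hc2 : ∀ {n} (x : P.obj (n + 2)), x = 0 := fun x => (Submodule.mem_bot k).mp (hP x)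
  obtain ⟨u, hu⟩ := LinearMap.exists_leftInverse_of_injective
    (LinearMap.toSpanSingleton k (P.obj 0) P.unit) (LinearMap.ker_toSpanSingleton k h0)
  obtain ⟨e, he⟩ := LinearMap.exists_leftInverse_of_injective
    (LinearMap.toSpanSingleton k (P.obj 1) P.one) (LinearMap.ker_toSpanSingleton k h1)
  have hu : u P.unit = 1 := by
    have := congrArg (fun f => f (1 : k)) hu
    simpa using this
  have he : e P.one = 1 := by
    have := congrArg (fun f => f (1 : k)) he
    simpa using this
  let f : ∀ n, P.obj n →ₗ[k] Q.obj n := fun n => match n with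
    | 0 => u.smulRight Q.unit
    | 1 => e.smulRight Q.one
    | _ => 0
  have f0 : f 0 P.unit = Q.unit := by
    change u P.unit • Q.unit = _
    rw [hu, one_smul]
  have f1 : f 1 P.one = Q.one := by
    change e P.one • Q.one = _
    rw [he, one_smul]
  have hproj : ∀ {n p} {x z : P.obj n} {y : Q.obj n} (c : k), x = c • z → z ∈ (P.obj n).gr 0 →
      y ∈ (Q.obj n).gr 0 → f n z = y → x ∈ (P.obj n).gr p → f n x ∈ (Q.obj n).gr p := by
    rintro n p x z y c rfl hz hy rfl hx
    by_cases hp : p = 0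
    · subst hp
      rw [map_smul]
      exact Submodule.smul_mem _ c hy
    · rw [← (P.obj n).proj_of_mem hx, map_smul, GrMod.proj_of_ne _ hp hz, smul_zero, map_zero]
      exact Submodule.zero_mem _
  refine ⟨{
    toFun := f
    map_mem := fun n p x hx => ?_
    map_d := fun n x => ?_
    map_act := fun n σ x => ?_
    map_comp := fun {l m n} h i x y => ?_
    map_one := f1
    map_unit := f0 }, trivial, fun g _ => UHom.ext fun n x => ?_⟩
  · match n with
    | 0 =>
      obtain ⟨c, hc⟩ := hc0 x
      exact hproj c hc P.unit_mem Q.unit_mem f0 hx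
    | 1 =>
      obtain ⟨c, hc⟩ := hc1 x
      exact hproj c hc P.one_mem Q.one_mem f1 hx
    | n + 2 => exact Submodule.zero_mem _
  · match n with
    | 0 =>
      obtain ⟨c, rfl⟩ := hc0 x
      simp only [map_smul, P.d_unit, map_zero, smul_zero, f0, Q.d_unit]
    | 1 =>
      obtain ⟨c, rfl⟩ := hc1 x
      simp only [map_smul, P.one_d, map_zero, smul_zero, f1, Q.one_d]
    | n + 2 => exact (map_zero (Q.obj (n + 2)).d).symm
  · match n with
    | 0 => rw [P.act_zero, Q.act_zero]
    | 1 => rw [P.act_arity_one, Q.act_arity_one]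
    | n + 2 => exact (map_zero (Q.act (n + 2) σ)).symm
  · match l with
    | 0 => exact i.elim0
    | 1 =>
      obtain rfl : n = m := by omega
      obtain ⟨c, rfl⟩ := hc1 x
      rw [Subsingleton.elim i 0]
      simp only [map_smul, LinearMap.smul_apply, P.one_comp, f1, Q.one_comp]
    | l + 2 =>
      rw [hc2 x]
      simp only [map_zero, LinearMap.zero_apply]
  · match n with
    | 0 =>
      obtain ⟨c, rfl⟩ := hc0 x
      change _ = f 0 _
      rw [map_smul, map_smul, g.map_unit, f0]
    | 1 =>
      obtain ⟨c, rfl⟩ := hc1 x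
      change _ = f 1 _
      rw [map_smul, map_smul, g.map_one, f1]
    | n + 2 => rw [hc2 x, map_zero, map_zero]

end GradedMorphisms

end StrictUnits

namespace StrictUnits

section Generators

variable {k : Type u} [Field k]

variable (k) in
/-- The generators of arity `n`: the free module on an operation of degree `2 - n`. -/
noncomputable def genMod (n : ℕ) : SigmaMod.{u} k n where
  carrier := Perm (Fin n) →₀ k
  gr p := if p = 2 - (n : ℤ) then ⊤ else ⊥
  isInternal := by
    refine isInternal_of_projections _
      (fun p => if p = 2 - (n : ℤ) then LinearMap.id else 0) ?_ ?_ ?_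
    · intro p x hx
      by_cases h : p = 2 - (n : ℤ)
      · rw [if_pos h]; rfl
      · rw [if_neg h] at hx ⊢
        exact ((Submodule.mem_bot k).mp hx).symm
    · intro p q x hqp hx
      by_cases h : q = 2 - (n : ℤ)
      · rw [if_neg (by omega)] at hx
        rw [(Submodule.mem_bot k).mp hx, map_zero]
      · rw [if_neg h]; rfl
    · intro x
      refine Submodule.mem_iSup_of_mem (2 - (n : ℤ)) ?_
      rw [if_pos rfl]
      exact Submodule.mem_top
  act := assAct k n
  act_one := assAct_one k n
  act_mul := assAct_mul k n
  act_mem σ p x hx := by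
    split_ifs at hx ⊢
    · exact Submodule.mem_top
    · rw [(Submodule.mem_bot k).mp hx, map_zero]
      exact Submodule.zero_mem _

/-- The operations corresponding to the generators. -/
noncomputable def genMap (Q : UOperad.{u} k) {n : ℕ} (μ : Q.obj n) : genMod k n →ₗ[k] Q.obj n :=
  Finsupp.linearCombination k fun σ => Q.act n σ μ

/-- The generator of the module of generators. -/
noncomputable def genOne (n : ℕ) : genMod k n := (Finsupp.single 1 1 : Perm (Fin n) →₀ k)

theorem genMod_induction {n : ℕ} {C : genMod k n → Prop} (e : genMod k n) (zero : C 0)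
    (add : ∀ x y, C x → C y → C (x + y))
    (smul : ∀ (σ : Perm (Fin n)) (c : k), C (c • (genMod k n).act σ (genOne n))) : C e := by
  refine Finsupp.induction_linear (motive := C) e zero (fun x y hx hy => add x y hx hy) fun σ c => ?_
  have h : (Finsupp.single σ c : Perm (Fin n) →₀ k)
      = c • assAct k n σ (Finsupp.single 1 1) := by
    rw [assAct_single, one_mul, Finsupp.smul_single, smul_eq_mul, mul_one]
  have h1 := smul σ c
  exact h ▸ h1

theorem genMap_one (Q : UOperad.{u} k) {n : ℕ} (μ : Q.obj n) : genMap Q μ (genOne n) = μ := by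
  refine (Finsupp.linearCombination_single k 1 1).trans ?_
  rw [one_smul, Q.act_one]

theorem genMap_act (Q : UOperad.{u} k) {n : ℕ} (μ : Q.obj n) (τ : Perm (Fin n)) (e : genMod k n) :
    genMap Q μ ((genMod k n).act τ e) = Q.act n τ (genMap Q μ e) := by
  refine Finsupp.induction_linear (motive := fun e => genMap Q μ ((genMod k n).act τ e)
    = Q.act n τ (genMap Q μ e)) e ?_ ?_ ?_
  · have h : (0 : Perm (Fin n) →₀ k) = (0 : genMod k n) := rfl
    rw [h, map_zero, map_zero, map_zero]
  · intro x y hx hy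
    refine (congrArg (genMap Q μ) (map_add _ _ _)).trans ((map_add (genMap Q μ) _ _).trans ?_)
    rw [hx, hy]
    exact ((congrArg _ (map_add (genMap Q μ) _ _)).trans (map_add _ _ _)).symm
  · intro σ c
    refine (congrArg (genMap Q μ) (assAct_single k n τ σ c)).trans ?_
    refine (Finsupp.linearCombination_single k c (σ * τ)).trans ?_
    refine Eq.trans ?_ (congrArg _ (Finsupp.linearCombination_single k c σ).symm)
    rw [map_smul, Q.act_mul]

theorem mem_genMod {n : ℕ} {p : ℤ} {e : genMod k n} (he : e ∈ (genMod k n).gr p) :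
    p = 2 - (n : ℤ) ∨ e = 0 := by
  by_cases hp : p = 2 - (n : ℤ)
  · exact Or.inl hp
  · have h : (genMod k n).gr p = ⊥ := if_neg hp
    rw [h] at he
    exact Or.inr ((Submodule.mem_bot k).mp he)

theorem genOne_mem (n : ℕ) : (genOne n : genMod k n) ∈ (genMod k n).gr (2 - n) := by
  have h : (genMod k n).gr (2 - n) = ⊤ := if_pos rfl
  rw [h]; exact Submodule.mem_top

theorem genMap_mem (Q : UOperad.{u} k) {n : ℕ} {μ : Q.obj n} (hμ : μ ∈ (Q.obj n).gr (2 - n))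
    {p : ℤ} {e : genMod k n} (he : e ∈ (genMod k n).gr p) : genMap Q μ e ∈ (Q.obj n).gr p := by
  rcases mem_genMod he with rfl | rfl
  · clear he
    induction e using genMod_induction with
    | zero => rw [map_zero]; exact Submodule.zero_mem _
    | add x y hx hy => rw [map_add]; exact Submodule.add_mem _ hx hy
    | smul σ c =>
      rw [map_smul, genMap_act, genMap_one]
      exact Submodule.smul_mem _ c (Q.act_mem n σ hμ)
  · rw [map_zero]; exact Submodule.zero_mem _

/-- Equivariant maps out of the module of generators are determined by the generator. -/
theorem genMod_hom_ext {n : ℕ} {M : Type*} [AddCommGroup M] [Module k M]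
    (act : Perm (Fin n) → (M →ₗ[k] M)) {f g : genMod k n →ₗ[k] M}
    (hf : ∀ σ e, f ((genMod k n).act σ e) = act σ (f e))
    (hg : ∀ σ e, g ((genMod k n).act σ e) = act σ (g e)) (h : f (genOne n) = g (genOne n))
    (e : genMod k n) : f e = g e := by
  induction e using genMod_induction with
  | zero => rw [map_zero, map_zero]
  | add x y hx hy => rw [map_add, map_add, hx, hy]
  | smul σ c => rw [map_smul, map_smul, hf, hg, h]

theorem genMap_mem_suboperad {Q : UOperad.{u} k} (S : Suboperad Q) {n n' : ℕ} {μ : Q.obj n}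
    (f : Q.obj n →ₗ[k] Q.obj n') (hf : ∀ σ, f (Q.act n σ μ) ∈ S.carrier n') (e : genMod k n) :
    f (genMap Q μ e) ∈ S.carrier n' := by
  induction e using genMod_induction with
  | zero => rw [map_zero, map_zero]; exact Submodule.zero_mem _
  | add x y hx hy => rw [map_add, map_add]; exact Submodule.add_mem _ hx hy
  | smul σ c =>
    rw [map_smul, map_smul, genMap_act, genMap_one]
    exact Submodule.smul_mem _ c (hf σ)

theorem UHom.map_genMap {P Q : UOperad.{u} k} (f : UHom P Q) {n : ℕ} (μ : P.obj n)
    (e : genMod k n) : f.toFun n (genMap P μ e) = genMap Q (f.toFun n μ) e :=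
  genMod_hom_ext (f := f.toFun n ∘ₗ genMap P μ) (g := genMap Q (f.toFun n μ))
    (fun σ => Q.act n σ) (fun σ e => (congrArg _ (genMap_act P μ σ e)).trans (f.map_act n σ _))
    (fun σ e => genMap_act Q _ σ e)
    ((congrArg _ (genMap_one P μ)).trans (genMap_one Q _).symm) e

end Generators

section Stages

variable {k : Type u} [Field k] [CharZero k]

/-- The evaluation of operations that satisfy only the unit relations. -/
noncomputable def UOperad.evalHom (Q : UOperad.{u} k) (U : Q.toDGOperad.toSigned.UnitalOps)
    (hU : U.unit = Q.unit) : GrHom (ainfOperad k) Q where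
  toFun := U.eval
  map_mem _ _ _ hx := U.eval_mem hx
  map_act _ σ x := U.eval_act σ x
  map_comp {l m n} h i x y := by
    refine homogeneous_induction ((ainfOperad k).obj m).isInternal
      (C := fun y => U.eval n ((ainfOperad k).comp h i x y)
        = Q.comp h i (U.eval l x) (U.eval m y)) ?_ ?_ y
    · intro p y hy; exact U.eval_comp h i x hy
    · intro x y hx hy; simp only [map_add]; rw [hx, hy]; exact (map_add _ _ _).symm
  map_one := U.eval_one
  map_unit := U.eval_unit.trans hU

variable (k) in
/-- The suboperad generated by the operations of arity at most `r + 1`. -/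
noncomputable def ainfStage (r : ℕ) : Suboperad (ainfOperad k) :=
  Suboperad.sInf {S | ∀ m, 2 ≤ m → m ≤ r + 1 → ainfMu k m ∈ S.carrier m}

theorem ainfMu_mem_stage {r m : ℕ} (hm : 2 ≤ m) (hr : m ≤ r + 1) :
    ainfMu k m ∈ (ainfStage k r).carrier m :=
  Suboperad.mem_sInf.mpr fun _ hS => hS m hm hr

theorem mem_of_mem_ainfStage {r n : ℕ} {x : (ainfOperad k).obj n}
    (hx : x ∈ (ainfStage k r).carrier n) {S : Suboperad (ainfOperad k)}
    (hS : ∀ m, 2 ≤ m → m ≤ r + 1 → ainfMu k m ∈ S.carrier m) : x ∈ S.carrier n :=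
  Suboperad.mem_sInf.mp hx S hS

theorem ainfStage_mono {r r' : ℕ} (h : r ≤ r') (n : ℕ) (x : (ainfOperad k).obj n)
    (hx : x ∈ (ainfStage k r).carrier n) : x ∈ (ainfStage k r').carrier n :=
  mem_of_mem_ainfStage hx fun _ hm hr => ainfMu_mem_stage hm (by omega)

/-- A generating operation, as an element of a stage. -/
noncomputable def stageMu {r m : ℕ} (hm : 2 ≤ m) (hr : m ≤ r + 1) :
    (ainfStage k r).toUOperad.obj m :=
  (ainfStage k r).of (ainfMu k m) (ainfMu_mem_stage hm hr)

theorem ainfStage_induction {r : ℕ} (S : Suboperad (ainfStage k r).toUOperad)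
    (hS : ∀ m (hm : 2 ≤ m) (hr : m ≤ r + 1), stageMu hm hr ∈ S.carrier m) {n : ℕ}
    (x : (ainfStage k r).toUOperad.obj n) : x ∈ S.carrier n := by
  have h := mem_of_mem_ainfStage ((ainfStage k r).incl_mem x) (S := (ainfStage k r).map S)
    fun m hm hr => ⟨_, hS m hm hr, rfl⟩
  obtain ⟨y, hy, hyx⟩ := h
  rwa [← (ainfStage k r).incl_injective hyx]

theorem ainfStage_hom_ext {r : ℕ} {Q : UOperad.{u} k} {f g : UHom (ainfStage k r).toUOperad Q}
    (h : ∀ m (hm : 2 ≤ m) (hr : m ≤ r + 1),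
      f.toFun m (stageMu hm hr) = g.toFun m (stageMu hm hr)) : f = g := by
  refine UHom.ext fun n x => (ainfStage_induction (f.toGrHom.equalizer g.toGrHom) ?_ x).1
  intro m hm hr
  refine ⟨h m hm hr, (f.map_d _ _).trans (Eq.trans ?_ (g.map_d _ _).symm)⟩
  exact congrArg _ (h m hm hr)

theorem Splitting.le_of_le {n r : ℕ} (hn : n ≤ r + 1) (s : Splitting n) :
    s.1.1 ≤ r + 1 ∧ s.1.2 ≤ r + 1 ∧ s.1.1 + 1 ≤ n ∧ s.1.2 + 1 ≤ n := by
  have h1 := s.eq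
  have h2 := s.le_left
  have h3 := s.le_right
  omega

theorem d_stageMu {r n : ℕ} (hn : 2 ≤ n) (hr : n ≤ r + 1) :
    ((ainfStage k r).toUOperad.obj n).d (stageMu hn hr)
      = ∑ s : Splitting n, ∑ i : Fin s.1.1, s.sign i • (ainfStage k r).toUOperad.comp s.eq i
          (stageMu s.le_left (s.le_of_le hr).1) (stageMu s.le_right (s.le_of_le hr).2.1) := by
  apply (ainfStage k r).incl_injective
  change (ainfStage k r).inclusion.toFun n _ = (ainfStage k r).inclusion.toFun n _
  rw [UHom.map_d]
  simp only [map_sum, map_sign, UHom.map_comp]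
  exact ainfD_mu hn

theorem ainfOne_ne_zero : (ainfOperad k).one ≠ 0 := by
  intro h
  have h1 := (ainfAug k).map_one
  rw [h, map_zero] at h1
  have := DFunLike.congr_fun (show (0 : Perm (Fin 1) →₀ k) = Finsupp.single 1 1 from h1) 1
  simp at this

theorem ainfStage_zero_initial (Q : UOperad.{u} k) :
    ∃! _φ : UHom (ainfStage k 0).toUOperad Q, True := by
  refine isInitial_of_trivial (fun e => ainfOne_ne_zero (k := k)
    ((congrArg ((ainfStage k 0).inclusion.toFun 1) e).trans (map_zero _)))
    (fun x => ainfStage_induction _ (fun m hm hr => ?_) x) Q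
  omega

theorem d_ainfMu_mem {r : ℕ} :
    ((ainfOperad k).obj (r + 1 + 1)).d (ainfMu k (r + 1 + 1))
      ∈ (ainfStage k r).carrier (r + 1 + 1) := by
  rw [ainfD_mu (by omega)]
  refine Submodule.sum_mem _ fun s _ => Submodule.sum_mem _ fun i _ => sign_smul_mem _ _ ?_
  have h := s.le_of_le (r := r + 1) le_rfl
  exact (ainfStage k r).comp_mem s.eq i (ainfMu_mem_stage s.le_left (by omega))
    (ainfMu_mem_stage s.le_right (by omega))

theorem res_ainfMu_mem {r : ℕ} (i : Fin (r + 1 + 1)) :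
    (ainfOperad k).resMap rfl i (ainfMu k (r + 1 + 1)) ∈ (ainfStage k r).carrier (r + 1) := by
  cases r with
  | zero =>
    have h : (ainfOperad k).resMap rfl i (ainfMu k (0 + 1 + 1)) = (ainfOperad k).one :=
      ainfRes_mu_two i
    rw [h]
    exact (ainfStage k 0).one_mem
  | succ r =>
    have h : (ainfOperad k).resMap rfl i (ainfMu k (r + 1 + 1 + 1)) = 0 :=
      ainfRes_mu (by omega) i
    rw [h]
    exact Submodule.zero_mem _

variable (k) in
/-- The attaching data of the generators of arity `r + 2`. -/
noncomputable def ainfAttach (r : ℕ) :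
    AttachData (ainfStage k r).toUOperad (r + 1) (genMod k (r + 1 + 1)) where
  d := (((ainfOperad k).obj (r + 1 + 1)).d ∘ₗ genMap (ainfOperad k) (ainfMu k _)).codRestrict
    ((ainfStage k r).carrier (r + 1 + 1)) (genMap_mem_suboperad _ _ fun σ => by
      rw [← (ainfOperad k).act_d]
      exact (ainfStage k r).act_mem σ d_ainfMu_mem)
  d_mem he := ((ainfOperad k).obj (r + 1 + 1)).d_mem
    (genMap_mem _ (ainfMu_mem (Nat.le_add_left 2 r)) he)
  d_cocycle e := (ainfStage k r).incl_injective (((ainfOperad k).obj (r + 1 + 1)).d_d _)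
  d_act σ e := (ainfStage k r).incl_injective
    ((congrArg _ (genMap_act (ainfOperad k) _ σ e)).trans ((ainfOperad k).act_d _ σ _).symm)
  δ i := ((ainfOperad k).resMap rfl i ∘ₗ genMap (ainfOperad k) (ainfMu k _)).codRestrict
    ((ainfStage k r).carrier (r + 1)) (genMap_mem_suboperad _ _ fun σ => by
      rw [(ainfOperad k).resMap_act]
      exact (ainfStage k r).act_mem _ (res_ainfMu_mem _))
  δ_mem i _ _ he := (ainfOperad k).resMap_mem rfl i
    (genMap_mem _ (ainfMu_mem (Nat.le_add_left 2 r)) he)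
  δ_d i e := (ainfStage k r).incl_injective ((ainfOperad k).d_resMap rfl i _)
  δ_act i σ e := (ainfStage k r).incl_injective
    ((congrArg _ (genMap_act (ainfOperad k) _ σ e)).trans ((ainfOperad k).resMap_act rfl i σ _))
  δ_δ {s} hs i j hij e := (ainfStage k r).incl_injective
    ((ainfOperad k).resMap_resMap rfl hs i j ⟨i.1, by omega⟩ ⟨j.1 - 1, by omega⟩ hij rfl
      (by simp only; omega) _)

variable (k) in
/-- The inclusion of the generators. -/
noncomputable def ainfGen (r : ℕ) :
    genMod k (r + 1 + 1) →ₗ[k] (ainfStage k (r + 1)).toUOperad.obj (r + 1 + 1) :=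
  genMap _ (stageMu (Nat.le_add_left 2 r) le_rfl)

theorem incl_ainfGen {r : ℕ} (e : genMod k (r + 1 + 1)) :
    (ainfStage k (r + 1)).inclusion.toFun _ (ainfGen k r e)
      = genMap (ainfOperad k) (ainfMu k _) e :=
  UHom.map_genMap _ _ e

variable (k) in
/-- The inclusion of a stage in the next one. -/
noncomputable def stageIncl (r : ℕ) :
    UHom (ainfStage k r).toUOperad (ainfStage k (r + 1)).toUOperad :=
  Suboperad.inclusionOfLE (ainfStage_mono (Nat.le_succ r))

theorem ainfGen_compatible (r : ℕ) : (ainfAttach k r).Compatible (stageIncl k r) (ainfGen k r) where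
  mem he := genMap_mem _ (μ := stageMu (Nat.le_add_left 2 r) le_rfl)
    (ainfMu_mem (Nat.le_add_left 2 r)) he
  act σ e := genMap_act _ _ σ e
  d e := (ainfStage k (r + 1)).incl_injective
    (congrArg ((ainfOperad k).obj (r + 1 + 1)).d (incl_ainfGen e))
  res i e := (ainfStage k (r + 1)).incl_injective
    (congrArg ((ainfOperad k).resMap rfl i) (incl_ainfGen e))

end Stages

end StrictUnits

namespace StrictUnits

/-- The composite of two graded morphisms. -/
def GrHom.trans {k : Type u} [Field k] {P Q R : UOperad.{u} k} (f : GrHom P Q) (g : GrHom Q R) :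
    GrHom P R where
  toFun n := g.toFun n ∘ₗ f.toFun n
  map_mem n _ _ hx := g.map_mem n (f.map_mem n hx)
  map_act n σ x := (congrArg (g.toFun n) (f.map_act n σ x)).trans (g.map_act n σ _)
  map_comp {_ _ n} h i x y := (congrArg (g.toFun n) (f.map_comp h i x y)).trans (g.map_comp h i _ _)
  map_one := (congrArg (g.toFun 1) f.map_one).trans g.map_one
  map_unit := (congrArg (g.toFun 0) f.map_unit).trans g.map_unit

namespace Suboperad

variable {k : Type u} [Field k] {P : UOperad.{u} k} {S S' S'' : Suboperad P}

theorem inclusion_inclusionOfLE (h : ∀ n x, x ∈ S.carrier n → x ∈ S'.carrier n) {n : ℕ}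
    (x : S.toUOperad.obj n) :
    S'.inclusion.toFun n ((inclusionOfLE h).toFun n x) = S.inclusion.toFun n x := rfl

theorem inclusionOfLE_inclusionOfLE (h : ∀ n x, x ∈ S.carrier n → x ∈ S'.carrier n)
    (h' : ∀ n x, x ∈ S'.carrier n → x ∈ S''.carrier n)
    (h'' : ∀ n x, x ∈ S.carrier n → x ∈ S''.carrier n) {n : ℕ} (x : S.toUOperad.obj n) :
    (inclusionOfLE h').toFun n ((inclusionOfLE h).toFun n x) = (inclusionOfLE h'').toFun n x := rfl

theorem inclusionOfLE_self (h : ∀ n x, x ∈ S.carrier n → x ∈ S.carrier n) {n : ℕ}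
    (x : S.toUOperad.obj n) : (inclusionOfLE h).toFun n x = x := rfl

theorem inclusionOfLE_of (h : ∀ n x, x ∈ S.carrier n → x ∈ S'.carrier n) {n : ℕ} {x : P.obj n}
    (hx : x ∈ S.carrier n) (hx' : x ∈ S'.carrier n) :
    (inclusionOfLE h).toFun n (S.of x hx) = S'.of x hx' := rfl

end Suboperad

section Minimality

variable {k : Type u} [Field k] [CharZero k]

theorem inclusion_stageMu {r m : ℕ} (hm : 2 ≤ m) (hr : m ≤ r + 1) :
    (ainfStage k r).inclusion.toFun m (stageMu hm hr) = ainfMu k m := rfl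

theorem inclusion_stageIncl {r n : ℕ} (x : (ainfStage k r).toUOperad.obj n) :
    (ainfStage k (r + 1)).inclusion.toFun n ((stageIncl k r).toFun n x)
      = (ainfStage k r).inclusion.toFun n x := Suboperad.inclusion_inclusionOfLE _ x

theorem inclusionOfLE_stageMu {r r' m : ℕ} (h : r ≤ r') (hm : 2 ≤ m) (hr : m ≤ r + 1)
    (hr' : m ≤ r' + 1) :
    (Suboperad.inclusionOfLE (ainfStage_mono (k := k) h)).toFun m (stageMu hm hr)
      = stageMu hm hr' := Suboperad.inclusionOfLE_of _ _ _

section Extension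

variable {r : ℕ} {Q : UOperad.{u} k} (φ : UHom (ainfStage k r).toUOperad Q)
  (f : genMod k (r + 1 + 1) →ₗ[k] Q.obj (r + 1 + 1))

/-- The operations given by a morphism out of a stage and the image of the next generator. -/
noncomputable def extensionMu : ∀ m, Q.obj m :=
  Function.update
    (fun m => if h : 2 ≤ m ∧ m ≤ r + 1 then φ.toFun m (stageMu h.1 h.2) else 0)
    (r + 1 + 1) (f (genOne _))

theorem extensionMu_of_le {m : ℕ} (hm : 2 ≤ m) (hr : m ≤ r + 1) :
    extensionMu φ f m = φ.toFun m (stageMu hm hr) := by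
  rw [extensionMu, Function.update_of_ne (by omega), dif_pos ⟨hm, hr⟩]

theorem extensionMu_self : extensionMu φ f (r + 1 + 1) = f (genOne _) := by
  rw [extensionMu, Function.update_self]

theorem extensionMu_of_lt {m : ℕ} (hr : r + 1 + 1 < m) : extensionMu φ f m = 0 := by
  rw [extensionMu, Function.update_of_ne (by omega), dif_neg (by omega)]

variable {φ f} (hc : (ainfAttach k r).Compatible φ f)

include hc

theorem extensionMu_mem {m : ℕ} (hm : 2 ≤ m) : extensionMu φ f m ∈ (Q.obj m).gr (2 - m) := by
  rcases Nat.lt_trichotomy m (r + 1 + 1) with h | rfl | h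
  · rw [extensionMu_of_le φ f hm (by omega)]
    exact φ.map_mem m (ainfMu_mem hm)
  · rw [extensionMu_self]
    exact hc.mem (genOne_mem _)
  · rw [extensionMu_of_lt φ f h]
    exact Submodule.zero_mem _

theorem res_extensionMu {m : ℕ} (hm : 2 ≤ m + 1) (hr : m + 1 ≤ r + 1 + 1) (i : Fin (m + 1))
    {y : (ainfStage k r).toUOperad.obj m}
    (hy : (ainfOperad k).resMap rfl i (ainfMu k (m + 1)) = (ainfStage k r).inclusion.toFun m y) :
    Q.resMap rfl i (extensionMu φ f (m + 1)) = φ.toFun m y := by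
  by_cases h : m = r + 1
  · subst h
    rw [extensionMu_self, ← UOperad.res_eq, hc.res]
    congr 1
    apply (ainfStage k r).incl_injective
    refine Eq.trans ?_ hy
    exact congrArg ((ainfOperad k).resMap rfl i) (genMap_one _ _)
  · rw [extensionMu_of_le φ f hm (by omega), ← φ.map_res]
    congr 1
    exact (ainfStage k r).incl_injective hy

/-- The operations given by a compatible pair. -/
noncomputable def extensionOps : Q.toDGOperad.toSigned.UnitalOps where
  unit := Q.unit
  unit_mem := Q.unit_mem
  mu := extensionMu φ f
  mu_mem := extensionMu_mem hc
  mu_two_unit i := (res_extensionMu hc le_rfl (by omega) i (y := (ainfStage k r).toUOperad.one)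
    (ainfRes_mu_two i)).trans φ.map_one
  mu_unit {n} hn i := by
    change Q.resMap rfl i (extensionMu φ f (n + 1)) = 0
    by_cases h : n + 1 ≤ r + 1 + 1
    · rw [res_extensionMu hc (by omega) h i (y := 0) ((ainfRes_mu hn i).trans (map_zero _).symm),
        map_zero]
    · rw [extensionMu_of_lt φ f (by omega), map_zero]

theorem exists_extension : ∃ ψ : UHom (ainfStage k (r + 1)).toUOperad Q,
    (∀ n x, ψ.toFun n ((stageIncl k r).toFun n x) = φ.toFun n x) ∧
      ∀ e, ψ.toFun (r + 1 + 1) (ainfGen k r e) = f e := by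
  obtain ⟨F, hF⟩ : ∃ F : GrHom (ainfOperad k) Q, ∀ {m}, 2 ≤ m →
      F.toFun m (ainfMu k m) = extensionMu φ f m :=
    ⟨Q.evalHom (extensionOps hc) rfl, fun hm => (extensionOps hc).eval_mu hm⟩
  obtain ⟨G, hG⟩ : ∃ G : GrHom (ainfStage k r).toUOperad Q, ∀ n x, G.toFun n x
      = F.toFun n ((ainfStage k r).inclusion.toFun n x) :=
    ⟨(ainfStage k r).inclusion.toGrHom.trans F, fun _ _ => rfl⟩
  have hmu : ∀ {m} (hm : 2 ≤ m) (hr : m ≤ r + 1),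
      G.toFun m (stageMu hm hr) = φ.toGrHom.toFun m (stageMu hm hr) := fun hm hr => by
    rw [hG, inclusion_stageMu, hF hm]
    exact extensionMu_of_le φ f hm hr
  have hφ : ∀ {n} (x : (ainfStage k r).toUOperad.obj n),
      F.toFun n ((ainfStage k r).inclusion.toFun n x) = φ.toFun n x := by
    intro n x
    rw [← hG]
    refine (ainfStage_induction (G.equalizer φ.toGrHom) (fun m hm hr => ?_) x).1
    rw [GrHom.mem_equalizer]
    refine ⟨hmu hm hr, ?_⟩
    rw [d_stageMu]
    simp only [map_sum, map_sign, GrHom.map_comp, hmu]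
  obtain ⟨H, hH⟩ : ∃ H : GrHom (ainfStage k (r + 1)).toUOperad Q, ∀ n x, H.toFun n x
      = F.toFun n ((ainfStage k (r + 1)).inclusion.toFun n x) :=
    ⟨(ainfStage k (r + 1)).inclusion.toGrHom.trans F, fun _ _ => rfl⟩
  have hι : ∀ {n} (x : (ainfStage k r).toUOperad.obj n),
      H.toFun n ((stageIncl k r).toFun n x) = φ.toFun n x := by
    intro n x
    rw [hH, ← hφ, inclusion_stageIncl]
  have hj : ∀ e, H.toFun _ (ainfGen k r e) = f e := by
    refine genMod_hom_ext (f := H.toFun _ ∘ₗ ainfGen k r) (g := f)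
      (fun σ => Q.act _ σ) (fun σ e => ?_) hc.act ?_
    · rw [LinearMap.comp_apply, LinearMap.comp_apply, ainfGen, genMap_act, H.map_act]
    · rw [LinearMap.comp_apply, ainfGen, genMap_one, hH, inclusion_stageMu, hF (by omega),
        extensionMu_self]
  have hd : ∀ {n} (x : (ainfStage k (r + 1)).toUOperad.obj n),
      H.toFun n (((ainfStage k (r + 1)).toUOperad.obj n).d x) = (Q.obj n).d (H.toFun n x) := by
    intro n x
    refine (H.mem_dLocus).mp (ainfStage_induction H.dLocus (fun m hm hr => ?_) x)
    rw [H.mem_dLocus]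
    by_cases h : m = r + 1 + 1
    · subst h
      have e : stageMu hm hr = ainfGen k r (genOne _) := (genMap_one _ _).symm
      rw [e, hj, hc.d, (ainfGen_compatible r).d, hι]
    · have e : stageMu hm hr = (stageIncl k r).toFun m (stageMu hm (by omega)) :=
        (inclusionOfLE_stageMu (Nat.le_succ r) hm (by omega) hr).symm
      rw [e, hι, ← φ.map_d, ← UHom.map_d, hι]
  exact ⟨{
    toFun := H.toFun
    map_mem := H.map_mem
    map_d := fun n x => hd x
    map_act := H.map_act
    map_comp := H.map_comp
    map_one := H.map_one
    map_unit := H.map_unit }, fun n x => hι x, hj⟩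

end Extension

theorem ainfStage_isPrincipalExtension (r : ℕ) :
    IsPrincipalExtension (stageIncl k r) (ainfAttach k r) (ainfGen k r) where
  compatible := ainfGen_compatible r
  universal Q φ f hc := by
    obtain ⟨ψ, h1, h2⟩ := exists_extension hc
    refine ⟨ψ, ⟨h1, h2⟩, fun ψ' h' => ainfStage_hom_ext fun m hm hr => ?_⟩
    by_cases h : m = r + 1 + 1
    · subst h
      have e : stageMu hm hr = ainfGen k r (genOne _) := (genMap_one _ _).symm
      rw [e, h2, h'.2]
    · exact (h'.1 m (stageMu hm (by omega))).trans (h1 m (stageMu hm (by omega))).symm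

section Colimit

variable {Q : UOperad.{u} k} {g : ∀ r, UHom (ainfStage k r).toUOperad Q}
  (hg : ∀ r n x, (g (r + 1)).toFun n ((stageIncl k r).toFun n x) = (g r).toFun n x)

include hg

theorem stage_compatible {r r' : ℕ} (h : r ≤ r') {n : ℕ} (x : (ainfStage k r).toUOperad.obj n) :
    (g r').toFun n ((Suboperad.inclusionOfLE (ainfStage_mono h)).toFun n x) = (g r).toFun n x := by
  induction r', h using Nat.le_induction with
  | base => rw [Suboperad.inclusionOfLE_self]
  | succ r' h ih =>
    rw [← ih, ← hg r', stageIncl, Suboperad.inclusionOfLE_inclusionOfLE]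

theorem stage_compatible_mu {r r' m : ℕ} (hm : 2 ≤ m) (hr : m ≤ r + 1) (hr' : m ≤ r' + 1) :
    (g r).toFun m (stageMu hm hr) = (g r').toFun m (stageMu hm hr') := by
  rcases Nat.le_total r r' with h | h
  · rw [← stage_compatible hg h, inclusionOfLE_stageMu h]
  · rw [← stage_compatible hg h (stageMu hm hr'), inclusionOfLE_stageMu h]

/-- The operations given by compatible morphisms out of the stages. -/
noncomputable def colimitMu : UnitalMu Q where
  mu m := if hm : 2 ≤ m then (g m).toFun m (stageMu hm (Nat.le_succ m)) else 0
  mu_mem {m} hm := by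
    rw [dif_pos hm]
    exact (g m).map_mem m (ainfMu_mem hm)
  mu_two_unit i := by
    rw [dif_pos le_rfl, UOperad.res_eq, ← UHom.map_res, ← (g 2).map_one]
    congr 1
    exact (ainfStage k 2).incl_injective (ainfRes_mu_two i)
  mu_unit {n} hn i := by
    rw [dif_pos (by omega), UOperad.res_eq, ← UHom.map_res, ← map_zero ((g (n + 1)).toFun n)]
    congr 1
    exact (ainfStage k (n + 1)).incl_injective (ainfRes_mu hn i)
  d_mu {n} hn := by
    rw [dif_pos hn, ← UHom.map_d, d_stageMu]
    simp only [map_sum, map_sign, UHom.map_comp]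
    refine Finset.sum_congr rfl fun s _ => Finset.sum_congr rfl fun i _ => ?_
    rw [dif_pos s.le_left, dif_pos s.le_right, stage_compatible_mu hg s.le_left _ (Nat.le_succ _),
      stage_compatible_mu hg s.le_right _ (Nat.le_succ _)]

theorem colimitMu_mu {r m : ℕ} (hm : 2 ≤ m) (hr : m ≤ r + 1) :
    (colimitMu hg).mu m = (g r).toFun m (stageMu hm hr) :=
  (dif_pos hm).trans (stage_compatible_mu hg hm _ hr)

end Colimit

/-- The operad of strictly unital `A_∞`-algebras is a Sullivan minimal operad. -/
theorem ainfOperad_isSullivanMinimal : IsSullivanMinimal (ainfOperad k) := by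
  refine ⟨fun r => (ainfStage k r).toUOperad, stageIncl k, fun r => (ainfStage k r).inclusion,
    ainfStage_zero_initial, fun r => ⟨_, _, _, ainfStage_isPrincipalExtension r⟩,
    fun r n x => inclusion_stageIncl x, fun Q g hg => ?_⟩
  obtain ⟨h, hh⟩ : ∃ h : UHom (ainfOperad k) Q, ∀ r m (hm : 2 ≤ m) (hr : m ≤ r + 1),
      h.toFun m (ainfMu k m) = (g r).toFun m (stageMu hm hr) :=
    ⟨(colimitMu hg).hom, fun r m hm hr => by
      rw [UnitalMu.hom_mu _ hm, colimitMu_mu hg hm hr]⟩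
  refine ⟨h, fun r n x => ?_, fun ψ hψ => ?_⟩
  · have e : (ainfStage k r).inclusion.trans h = g r := ainfStage_hom_ext fun m hm hr => by
      rw [UHom.trans_apply, inclusion_stageMu, hh r m hm hr]
    rw [← e, UHom.trans_apply]
  · refine UHom.ext fun n x => ainf_hom_ext (fun m hm => ?_) x
    rw [hh m m hm (Nat.le_succ m), ← hψ, inclusion_stageMu]

theorem ainfAug_isMinimalModel : IsMinimalModel (ainfAug k) :=
  ⟨ainfOperad_isSullivanMinimal, ainfAug_isQuasiIso⟩

theorem ainf_eq_zero_of_lt {n : ℕ} (hn : 2 ≤ n) {p : ℤ} (hp : p < 2 - n)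
    {x : (ainfOperad k).obj n} (hx : x ∈ ((ainfOperad k).obj n).gr p) : x = 0 := by
  induction hx using ainf_homogeneous_induction with
  | zero => rfl
  | add x y _ _ hx hy => rw [hx, hy, add_zero]
  | tens σ x hx =>
    induction hx using treeGr_induction with
    | zero => exact map_zero _
    | add x y _ _ hx hy => rw [map_add, hx, hy, add_zero]
    | smul c x _ hx => rw [map_smul, hx, smul_zero]
    | basis S hS hdeg =>
      have h1 : 0 < S.card := Finset.card_pos.mpr ⟨_, hS.root hn⟩
      rw [treeDeg_of_pos (by omega)] at hdeg
      omega

/-- Any Sullivan minimal model of the associative operad is isomorphic to the operad of strictly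
unital `A_∞`-algebras. -/
theorem IsMinimalModel.exists_iso {P : UOperad.{u} k} {ρ : UHom P (assPlus k)}
    (hρ : IsMinimalModel ρ) :
    ∃ (φ : UHom (ainfOperad k) P) (ψ : UHom P (ainfOperad k)),
      (∀ n x, ψ.toFun n (φ.toFun n x) = x) ∧ (∀ n x, φ.toFun n (ψ.toFun n x) = x) ∧
        ∀ n x, ρ.toFun n (φ.toFun n x) = (ainfAug k).toFun n x := by
  obtain ⟨hP, hρ⟩ := hρ
  obtain ⟨T⟩ := hP.nonempty_tower
  obtain ⟨TM⟩ := (ainfOperad_isSullivanMinimal (k := k)).nonempty_tower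
  obtain ⟨mP, hmP⟩ := T.isReduced.exists_isUnitalProduct hρ
  obtain ⟨mM, hmM⟩ := TM.isReduced.exists_isUnitalProduct (ainfAug_isQuasiIso)
  obtain ⟨φ, hφ⟩ := TM.exists_lift hmP hρ (ainfAug k)
  obtain ⟨ψ, hψ⟩ := T.exists_lift hmM (ainfAug_isQuasiIso) ρ
  have hAss : ∀ {n} (y : (assPlus k).obj n), ((assPlus k).obj n).d y = 0 := fun _ => rfl
  have hmu : ∀ n, 2 ≤ n → ψ.toFun n (φ.toFun n (ainfMu k n)) = ainfMu k n := by
    intro n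
    induction n using Nat.strong_induction_on with
    | _ n ih =>
      intro hn
      let u := ainfMu k n - ψ.toFun n (φ.toFun n (ainfMu k n))
      have hu : u ∈ ((ainfOperad k).obj n).gr (2 - n) := Submodule.sub_mem _ (ainfMu_mem hn)
        (ψ.map_mem n (φ.map_mem n (ainfMu_mem hn)))
      have hdu : ((ainfOperad k).obj n).d u = 0 := by
        rw [map_sub, ← ψ.map_d, ← φ.map_d, ainfD_mu hn, sub_eq_zero]
        simp only [map_sum, map_sign, UHom.map_comp]
        refine Finset.sum_congr rfl fun s _ => Finset.sum_congr rfl fun i _ => ?_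
        have h1 := s.eq
        have h2 := s.le_left
        have h3 := s.le_right
        rw [ih _ (by omega) h2, ih _ (by omega) h3]
      obtain ⟨v, hv⟩ := (ainfAug_isQuasiIso n).2 u hdu
        ⟨0, by rw [map_sub, hψ, hφ, sub_self, map_zero]⟩
      have h0 : u = 0 := by
        have h1 := (ainfOperad k).proj_d (2 - n - 1) v
        rw [← hv, ainf_eq_zero_of_lt hn (by omega) (GrMod.proj_mem _ _ _), map_zero,
          sub_add_cancel, GrMod.proj_of_mem _ hu] at h1
        exact h1.symm
      exact (sub_eq_zero.mp h0).symm
  have hψφ : ∀ n x, ψ.toFun n (φ.toFun n x) = x := fun n x =>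
    ainf_hom_ext (f := φ.trans ψ) (g := UHom.id _) hmu x
  have hstage : ∀ r n x, φ.toFun n (ψ.toFun n ((T.κ r).toFun n x)) = (T.κ r).toFun n x := by
    intro r
    induction r with
    | zero =>
      intro n x
      have h : ((T.κ 0).trans ψ).trans φ = T.κ 0 := (T.initial P).unique trivial trivial
      exact congrArg (fun f : UHom _ P => f.toFun n x) h
    | succ r ih =>
      have hj : ∀ e, φ.toFun _ (ψ.toFun _ ((T.κ (r + 1)).toFun _ (T.j r e)))
          = (T.κ (r + 1)).toFun _ (T.j r e) := by
        intro e
        let x := (T.κ (r + 1)).toFun _ (T.j r e)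
        have hdx : (P.obj (r + 1 + 1)).d x = (T.κ r).toFun _ ((T.a r).d e) := by
          rw [← T.κ_ι, ← (T.ext r).compatible.d, UHom.map_d]
        let u := x - φ.toFun _ (ψ.toFun _ x)
        have hdu : (P.obj (r + 1 + 1)).d u = 0 := by
          rw [map_sub, ← φ.map_d, ← ψ.map_d, hdx, ih, sub_self]
        obtain ⟨v, hv⟩ := (hρ _).2 u hdu ⟨0, by rw [map_sub, hφ, hψ, sub_self, map_zero]⟩
        obtain ⟨s, rfl⟩ := T.exists_κ_eq (r := r + 1) le_rfl v
        obtain ⟨s', e', rfl⟩ := T.exists_ι_add_j_eq s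
        rw [← UHom.map_d, map_add, ← UHom.map_d, (T.ext r).compatible.d, ← map_add, T.κ_ι] at hv
        have hu : φ.toFun _ (ψ.toFun _ u) = u := by rw [hv, ih]
        rw [map_sub, map_sub, hψφ, sub_self] at hu
        exact (sub_eq_zero.mp hu.symm).symm
      have hc := (T.ext r).compatible
      have h : ((T.κ (r + 1)).trans ψ).trans φ = T.κ (r + 1) :=
        ((T.ext r).universal P ((T.ι r).trans (T.κ (r + 1)))
          ((T.κ (r + 1)).toFun _ ∘ₗ T.j r)
          { mem := fun he => (T.κ (r + 1)).map_mem _ (hc.mem he)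
            act := fun σ e => (congrArg _ (hc.act σ e)).trans (UHom.map_act _ _ _ _)
            d := fun e => ((T.κ (r + 1)).map_d _ _).symm.trans (congrArg _ (hc.d e))
            res := fun i e => ((T.κ (r + 1)).map_res rfl i _).symm.trans
              (congrArg _ (hc.res i e)) }).unique
          ⟨fun n x => by
            rw [UHom.trans_apply, UHom.trans_apply, UHom.trans_apply, T.κ_ι, ih], hj⟩
          ⟨fun _ _ => rfl, fun _ => rfl⟩
      exact fun n x => congrArg (fun f : UHom _ P => f.toFun n x) h
  have h : ψ.trans φ = UHom.id P := T.hom_ext hstage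
  exact ⟨φ, ψ, hψφ, fun n x => congrArg (fun f : UHom P P => f.toFun n x) h, hφ⟩

end Minimality

end StrictUnits

namespace StrictUnits

section Signs

theorem negOnePow_eq_of {a b : ℤ} (w : ℤ) (h : a = b + 2 * w) : a.negOnePow = b.negOnePow := by
  rw [h, Int.negOnePow_add, Int.negOnePow_even _ (even_two_mul w), mul_one]

theorem prod_negOnePow {ι : Type*} (s : Finset ι) (f : ι → ℤ) :
    ∏ i ∈ s, (f i).negOnePow = (∑ i ∈ s, f i).negOnePow := by
  classical
  induction s using Finset.induction_on with
  | empty => simp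
  | insert a s ha ih => rw [Finset.prod_insert ha, Finset.sum_insert ha, Int.negOnePow_add, ih]

/-- Whether a permutation exchanges the order of two inputs. -/
def crossing {n : ℕ} (σ : Perm (Fin n)) (x y : Fin n) : ℤ :=
  if (x < y ∧ σ y < σ x) ∨ (y < x ∧ σ x < σ y) then 1 else 0

theorem crossing_comm {n : ℕ} (σ : Perm (Fin n)) (x y : Fin n) :
    crossing σ x y = crossing σ y x := by
  unfold crossing
  simp only [or_comm]

theorem crossing_self {n : ℕ} (σ : Perm (Fin n)) (x : Fin n) : crossing σ x x = 0 := by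
  simp [crossing]

/-- The exponent of the Koszul sign. -/
def koszulExp {n : ℕ} (σ : Perm (Fin n)) (p : Fin n → ℤ) : ℤ :=
  ∑ x, ∑ y, if x < y ∧ σ y < σ x then p x * p y else 0

theorem koszulSign_eq {n : ℕ} (σ : Perm (Fin n)) (p : Fin n → ℤ) :
    koszulSign σ p = (koszulExp σ p).negOnePow := by
  rw [koszulSign, koszulExp, ← prod_negOnePow]
  refine Finset.prod_congr rfl fun x _ => ?_
  rw [← prod_negOnePow]
  refine Finset.prod_congr rfl fun y _ => ?_
  split_ifs <;> simp

theorem two_mul_koszulExp {n : ℕ} (σ : Perm (Fin n)) (p : Fin n → ℤ) :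
    2 * koszulExp σ p = ∑ x, ∑ y, crossing σ x y * (p x * p y) := by
  have h : koszulExp σ p = ∑ x, ∑ y, if y < x ∧ σ x < σ y then p x * p y else 0 := by
    rw [koszulExp, Finset.sum_comm]
    simp only [mul_comm]
  rw [two_mul]
  nth_rewrite 2 [h]
  rw [koszulExp, ← Finset.sum_add_distrib]
  refine Finset.sum_congr rfl fun x _ => ?_
  rw [← Finset.sum_add_distrib]
  refine Finset.sum_congr rfl fun y _ => ?_
  unfold crossing
  by_cases h1 : x < y ∧ σ y < σ x
  · have h2 : ¬(y < x ∧ σ x < σ y) := fun h => absurd h.1 (not_lt.mpr h1.1.le)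
    rw [if_neg h2, if_pos h1, if_pos (Or.inl h1)]; ring
  · by_cases h2 : y < x ∧ σ x < σ y
    · rw [if_pos h2, if_neg h1, if_pos (Or.inr h2)]; ring
    · rw [if_neg h2, if_neg h1, if_neg (by tauto)]; ring

theorem exists_half_sum {n : ℕ} (G : Fin n → Fin n → ℤ) (hs : ∀ x y, G x y = G y x)
    (h0 : ∀ x, G x x = 0) : ∃ w, ∑ x, ∑ y, G x y = 2 * w := by
  refine ⟨∑ x, ∑ y, if x < y then G x y else 0, ?_⟩
  have hc : ∑ x, ∑ y, (if x < y then G x y else 0) = ∑ x, ∑ y, if y < x then G y x else 0 :=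
    Finset.sum_comm
  rw [two_mul]
  nth_rewrite 2 [hc]
  rw [← Finset.sum_add_distrib]
  refine Finset.sum_congr rfl fun x _ => ?_
  rw [← Finset.sum_add_distrib]
  refine Finset.sum_congr rfl fun y _ => ?_
  rcases lt_trichotomy x y with h | rfl | h
  · rw [if_pos h, if_neg h.asymm]; ring
  · simp [h0]
  · rw [if_neg h.asymm, if_pos h, hs]; ring

theorem koszulSign_one {n : ℕ} (p : Fin n → ℤ) : koszulSign 1 p = 1 := by
  have h : koszulExp 1 p = 0 := Finset.sum_eq_zero fun x _ => Finset.sum_eq_zero fun y _ =>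
    if_neg fun h => absurd h.1 (not_lt.mpr h.2.le)
  rw [koszulSign_eq, h, Int.negOnePow_zero]

theorem koszulSign_mul {n : ℕ} (σ τ : Perm (Fin n)) (p : Fin n → ℤ) :
    koszulSign (σ * τ) p = koszulSign τ p * koszulSign σ (fun j => p (τ.symm j)) := by
  rw [koszulSign_eq, koszulSign_eq, koszulSign_eq, ← Int.negOnePow_add]
  obtain ⟨w, hw⟩ := exists_half_sum
    (fun x y => crossing τ x y * crossing σ (τ x) (τ y) * (p x * p y))
    (fun x y => by rw [crossing_comm τ, crossing_comm σ]; ring)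
    (fun x => by rw [crossing_self]; ring)
  have h1 := two_mul_koszulExp (σ * τ) p
  have h2 := two_mul_koszulExp τ p
  have h3 : 2 * koszulExp σ (fun j => p (τ.symm j))
      = ∑ x, ∑ y, crossing σ (τ x) (τ y) * (p x * p y) := by
    rw [two_mul_koszulExp, ← Equiv.sum_comp τ]
    refine Finset.sum_congr rfl fun x _ => ?_
    rw [← Equiv.sum_comp τ]
    simp
  have h4 : ∑ x, ∑ y, crossing (σ * τ) x y * (p x * p y)
      = (∑ x, ∑ y, crossing τ x y * (p x * p y)
        + ∑ x, ∑ y, crossing σ (τ x) (τ y) * (p x * p y))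
        - 2 * ∑ x, ∑ y, crossing τ x y * crossing σ (τ x) (τ y) * (p x * p y) := by
    simp only [Finset.mul_sum, ← Finset.sum_add_distrib, ← Finset.sum_sub_distrib]
    refine Finset.sum_congr rfl fun x _ => Finset.sum_congr rfl fun y _ => ?_
    have h : crossing (σ * τ) x y = crossing τ x y + crossing σ (τ x) (τ y)
        - 2 * (crossing τ x y * crossing σ (τ x) (τ y)) := by
      rcases eq_or_ne x y with rfl | hne
      · simp [crossing_self]
      · have e1 := τ.injective.ne hne
        have e2 := σ.injective.ne e1
        simp only [crossing, Perm.mul_apply]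
        rcases lt_or_gt_of_ne hne with a | a <;> rcases lt_or_gt_of_ne e1 with b | b <;>
          rcases lt_or_gt_of_ne e2 with c | c <;>
          simp [a, b, c, a.asymm, b.asymm, c.asymm]
    rw [h]; ring
  refine negOnePow_eq_of (-w) ?_
  have h5 : 2 * koszulExp (σ * τ) p
      = 2 * (koszulExp τ p + koszulExp σ (fun j => p (τ.symm j)) + 2 * -w) := by
    rw [h1, h4, mul_add, mul_add, h2, h3, hw]; ring
  exact mul_left_cancel₀ two_ne_zero h5

/-- The change in the order of the input `c` relative to the input `i`. -/
theorem crossing_eq {n : ℕ} (σ : Perm (Fin n)) (c i : Fin n) :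
    crossing σ c i = (if σ c < σ i then 1 else 0) - (if c < i then 1 else 0)
      + 2 * (if c < i ∧ σ i < σ c then 1 else 0) := by
  rcases eq_or_ne c i with rfl | hne
  · simp [crossing_self]
  · have e := σ.injective.ne hne
    simp only [crossing]
    rcases lt_or_gt_of_ne hne with a | a <;> rcases lt_or_gt_of_ne e with b | b <;>
      simp [a, b, a.asymm, b.asymm]

theorem degBefore_perm {n : ℕ} (σ : Perm (Fin n)) (p : Fin n → ℤ) (t : ℕ) :
    degBefore (fun j => p (σ.symm j)) t = ∑ c, if (σ c).1 < t then p c else 0 := by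
  rw [degBefore, ← Equiv.sum_comp σ]
  simp

theorem koszulExp_update {n : ℕ} (σ : Perm (Fin n)) (p : Fin n → ℤ) (i : Fin n) (q : ℤ) :
    koszulExp σ (Function.update p i (p i + q))
      = koszulExp σ p + q * ∑ c, crossing σ c i * p c := by
  have h2 := two_mul_koszulExp σ p
  have h1 := two_mul_koszulExp σ (Function.update p i (p i + q))
  have h3 : ∀ x, Function.update p i (p i + q) x = p x + if x = i then q else 0 := by
    intro x
    rcases eq_or_ne x i with rfl | hx
    · rw [Function.update_self, if_pos rfl]
    · rw [Function.update_of_ne hx, if_neg hx, add_zero]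
  have h4 : ∀ x y, crossing σ x y * ((p x + if x = i then q else 0) * (p y + if y = i then q else 0))
      = crossing σ x y * (p x * p y) + (if x = i then q * (crossing σ y i * p y) else 0)
        + (if y = i then q * (crossing σ x i * p x) else 0) := by
    intro x y
    by_cases hx : x = i <;> by_cases hy : y = i
    · subst hx; subst hy; simp [crossing_self]
    · subst hx; simp only [if_true, if_neg hy]; rw [crossing_comm σ x y]; ring
    · subst hy; simp only [if_true, if_neg hx]; ring
    · simp only [if_neg hx, if_neg hy]; ring
  simp only [h3, h4, Finset.sum_add_distrib, Finset.sum_ite_eq', Finset.mem_univ, if_true] at h1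
  have h5 : ∑ x, ∑ y, (if x = i then q * (crossing σ y i * p y) else 0)
      = q * ∑ c, crossing σ c i * p c := by
    rw [Finset.sum_comm, Finset.mul_sum]
    simp
  rw [h5, ← Finset.mul_sum] at h1
  have h6 : Function.update p i (p i + q) = fun x => p x + if x = i then q else 0 := funext h3
  rw [h6] at h1 ⊢
  rw [← h2] at h1
  linarith

theorem koszulSign_update {n : ℕ} (σ : Perm (Fin n)) (p : Fin n → ℤ) (i : Fin n) :
    (degBefore p i.1).negOnePow * koszulSign σ (Function.update p i (p i + 1))
      = koszulSign σ p * (degBefore (fun j => p (σ.symm j)) (σ i).1).negOnePow := by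
  rw [koszulSign_eq, koszulSign_eq, koszulExp_update, ← Int.negOnePow_add, ← Int.negOnePow_add,
    degBefore_perm, degBefore]
  refine negOnePow_eq_of (∑ c, (if c < i ∧ σ i < σ c then 1 else 0) * p c) ?_
  simp only [crossing_eq]
  rw [one_mul, Finset.mul_sum, add_left_comm, add_assoc, add_right_inj, ← Finset.sum_add_distrib,
    ← Finset.sum_add_distrib]
  refine Finset.sum_congr rfl fun c _ => ?_
  simp only [Fin.lt_def]
  split_ifs <;> ring

section Slots

variable {l m n : ℕ} (h : n + 1 = l + m) (i : Fin l)

theorem sum_slot {M : Type*} [AddCommMonoid M] (F : Fin n → M) :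
    ∑ x, F x = ∑ c : {c : Fin l // c ≠ i}, F (outer h i c.1 c.2) + ∑ b, F (inner h i b) := by
  rw [← (slotEquiv h i).sum_comp, Fintype.sum_sum_type]
  rfl

theorem sum_ne {M : Type*} [AddCommMonoid M] (F : Fin l → M) :
    ∑ x, F x = ∑ c : {c : Fin l // c ≠ i}, F c.1 + F i := by
  rw [Fintype.sum_eq_add_sum_subtype_ne F i, add_comm]

/-- The degrees of the inputs of `x` in the evaluation of `x ∘ᵢ y`, where `y` has degree `D`. -/
def slotDeg (D : ℤ) (p : Fin n → ℤ) (c : Fin l) : ℤ :=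
  if hc : c = i then D + ∑ b, p (inner h i b) else p (outer h i c hc)

theorem slotDeg_self (D : ℤ) (p : Fin n → ℤ) :
    slotDeg h i D p i = D + ∑ b, p (inner h i b) := dif_pos rfl

theorem slotDeg_of_ne (D : ℤ) (p : Fin n → ℤ) {c : Fin l} (hc : c ≠ i) :
    slotDeg h i D p c = p (outer h i c hc) := dif_neg hc

theorem sum_slotDeg (D : ℤ) (p : Fin n → ℤ) : ∑ c, slotDeg h i D p c = D + ∑ x, p x := by
  rw [sum_slot h i p, sum_ne i (slotDeg h i D p), slotDeg_self, add_left_comm]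
  congr 2
  exact Finset.sum_congr rfl fun c _ => slotDeg_of_ne h i D p c.2

theorem degBefore_slotDeg_of_le (D : ℤ) (p : Fin n → ℤ) {t : ℕ} (ht : t ≤ i.1) :
    degBefore (slotDeg h i D p) t = degBefore p t := by
  rw [degBefore, degBefore, sum_slot h i (fun x => if x.1 < t then p x else 0),
    sum_ne i (fun c => if c.1 < t then slotDeg h i D p c else 0), if_neg (by omega), add_zero,
    Finset.sum_eq_zero (s := Finset.univ) (f := fun b : Fin m =>
      if (inner h i b).1 < t then p (inner h i b) else 0) (fun b _ => if_neg (by rw [inner_val]; omega)), add_zero]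
  refine Finset.sum_congr rfl fun c _ => ?_
  have := val_ne c.2
  rw [slotDeg_of_ne h i D p c.2]
  have e : (outer h i c.1 c.2).1 < t ↔ c.1.1 < t := by
    rw [outer_val]; split_ifs <;> omega
  simp only [e]

theorem degBefore_slotDeg_of_lt (D : ℤ) (p : Fin n → ℤ) {t t' : ℕ} (ht : i.1 < t)
    (ht' : t' + 1 = t + m) : degBefore (slotDeg h i D p) t = degBefore p t' + D := by
  rw [degBefore, degBefore, sum_slot h i (fun x => if x.1 < t' then p x else 0),
    sum_ne i (fun c => if c.1 < t then slotDeg h i D p c else 0), if_pos ht, slotDeg_self,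
    Finset.sum_congr (f := fun b => if (inner h i b).1 < t' then p (inner h i b) else 0) rfl
      (fun b _ => if_pos (by rw [inner_val]; omega)), add_comm D, ← add_assoc]
  congr 2
  refine Finset.sum_congr rfl fun c _ => ?_
  have := val_ne c.2
  rw [slotDeg_of_ne h i D p c.2]
  have e : (outer h i c.1 c.2).1 < t' ↔ c.1.1 < t := by
    rw [outer_val]; split_ifs <;> omega
  simp only [e]

theorem degBefore_inner (p : Fin n → ℤ) {t : ℕ} (ht : t ≤ m) :
    degBefore p (i.1 + t) = degBefore p i.1 + degBefore (fun b => p (inner h i b)) t := by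
  rw [degBefore, degBefore, degBefore, sum_slot h i (fun c => if c.1 < i.1 + t then p c else 0),
    sum_slot h i (fun c => if c.1 < i.1 then p c else 0),
    Finset.sum_eq_zero (s := Finset.univ) (f := fun b : Fin m =>
      if (inner h i b).1 < i.1 then p (inner h i b) else 0)
      (fun b _ => if_neg (by rw [inner_val]; omega)), add_zero]
  congr 1
  · refine Finset.sum_congr rfl fun c _ => ?_
    have := val_ne c.2
    have e : (outer h i c.1 c.2).1 < i.1 + t ↔ (outer h i c.1 c.2).1 < i.1 := by
      rw [outer_val]; split_ifs <;> omega
    simp only [e]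
  · refine Finset.sum_congr rfl fun b _ => ?_
    simp only [inner_val, add_lt_add_iff_left]

theorem degBefore_update (p : Fin n → ℤ) (c : Fin n) (t : ℕ) :
    degBefore (Function.update p c (p c + 1)) t = degBefore p t + if c.1 < t then 1 else 0 := by
  have e : ∀ x : Fin n, (if x.1 < t then Function.update p c (p c + 1) x else 0)
      = (if x.1 < t then p x else 0) + if x = c then (if c.1 < t then 1 else 0) else 0 := by
    intro x
    rcases eq_or_ne x c with rfl | hx
    · rw [Function.update_self, if_pos rfl]; split_ifs <;> ring
    · rw [Function.update_of_ne hx, if_neg hx, add_zero]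
  rw [degBefore, degBefore, Finset.sum_congr rfl fun x _ => e x, Finset.sum_add_distrib,
    Finset.sum_ite_eq' Finset.univ c, if_pos (Finset.mem_univ _)]

theorem crossing_blockPerm (σ : Perm (Fin l)) (τ : Perm (Fin m)) :
    (∀ c e hc he, crossing (blockPerm h i σ τ) (outer h i c hc) (outer h i e he) = crossing σ c e) ∧
    (∀ c hc b, crossing (blockPerm h i σ τ) (outer h i c hc) (inner h i b) = crossing σ c i) ∧
    (∀ b b', crossing (blockPerm h i σ τ) (inner h i b) (inner h i b') = crossing τ b b') := by
  have h1 : ∀ (j c e : Fin l) hc he, outer h j c hc < outer h j e he ↔ c < e := by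
    intro j c e hc he
    have := val_ne hc
    have := val_ne he
    rw [Fin.lt_def, Fin.lt_def, outer_val, outer_val]
    split_ifs <;> omega
  have h2 : ∀ (j c : Fin l) hc b, outer h j c hc < inner h j b ↔ c < j := by
    intro j c hc b
    have := val_ne hc
    rw [Fin.lt_def, Fin.lt_def, outer_val, inner_val]
    split_ifs <;> omega
  have h3 : ∀ (j c : Fin l) hc b, inner h j b < outer h j c hc ↔ j < c := by
    intro j c hc b
    have := val_ne hc
    rw [Fin.lt_def, Fin.lt_def, outer_val, inner_val]
    split_ifs <;> omega
  have h4 : ∀ (j : Fin l) (b b' : Fin m), inner h j b < inner h j b' ↔ b < b' := by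
    intro j b b'
    rw [Fin.lt_def, Fin.lt_def, inner_val, inner_val]
    omega
  refine ⟨fun c e hc he => ?_, fun c hc b => ?_, fun b b' => ?_⟩ <;>
    simp only [crossing, blockPerm_outer, blockPerm_inner, h1, h2, h3, h4]

theorem koszulSign_blockPerm (σ : Perm (Fin l)) (τ : Perm (Fin m)) (q : ℤ) (p : Fin n → ℤ) :
    (q * degBefore p i.1).negOnePow * koszulSign τ (fun b => p (inner h i b))
        * koszulSign σ (slotDeg h i q p)
      = koszulSign (blockPerm h i σ τ) p
        * (q * degBefore (fun x => p ((blockPerm h i σ τ).symm x)) (σ i).1).negOnePow := by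
  obtain ⟨c1, c2, c3⟩ := crossing_blockPerm h i σ τ
  have hbp : koszulExp (blockPerm h i σ τ) p
      = koszulExp σ (slotDeg h i 0 p) + koszulExp τ (fun b => p (inner h i b)) := by
    have e1 := two_mul_koszulExp (blockPerm h i σ τ) p
    have e2 := two_mul_koszulExp σ (slotDeg h i 0 p)
    have e3 := two_mul_koszulExp τ (fun b => p (inner h i b))
    rw [sum_slot h i] at e1
    simp only [sum_slot h i (fun y => crossing _ _ y * (_ * p y))] at e1
    rw [sum_ne i] at e2
    simp only [sum_ne i (fun y => crossing σ _ y * (_ * slotDeg h i 0 p y)), crossing_self, zero_mul,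
      add_zero] at e2
    have s1 : ∀ c : {c : Fin l // c ≠ i}, slotDeg h i 0 p c.1 = p (outer h i c.1 c.2) := fun c =>
      slotDeg_of_ne h i 0 p c.2
    simp only [c1, c2, crossing_comm _ (inner _ _ _) (outer _ _ _ _), c3,
      Finset.sum_add_distrib] at e1
    simp only [s1, slotDeg_self, zero_add, Finset.sum_add_distrib] at e2
    have s2 : ∀ c : {c : Fin l // c ≠ i}, ∑ b, crossing σ c.1 i * (p (outer h i c.1 c.2) *
        p (inner h i b)) = crossing σ c.1 i * (p (outer h i c.1 c.2) * ∑ b, p (inner h i b)) :=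
      fun c => by rw [← Finset.mul_sum, ← Finset.mul_sum]
    have s3 : ∑ b, ∑ c : {c : Fin l // c ≠ i}, crossing σ c.1 i * (p (inner h i b) *
        p (outer h i c.1 c.2)) = ∑ c : {c : Fin l // c ≠ i},
          crossing σ c.1 i * (p (outer h i c.1 c.2) * ∑ b, p (inner h i b)) := by
      rw [Finset.sum_comm]
      refine Finset.sum_congr rfl fun c _ => ?_
      rw [← s2]
      exact Finset.sum_congr rfl fun b _ => by ring
    have s4 : ∑ c : {c : Fin l // c ≠ i}, crossing σ i c.1 * ((∑ b, p (inner h i b)) *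
        p (outer h i c.1 c.2)) = ∑ c : {c : Fin l // c ≠ i},
          crossing σ c.1 i * (p (outer h i c.1 c.2) * ∑ b, p (inner h i b)) :=
      Finset.sum_congr rfl fun c _ => by rw [crossing_comm]; ring
    simp only [s2, s3] at e1
    rw [s4] at e2
    linarith
  have hσ : koszulExp σ (slotDeg h i q p) = koszulExp σ (slotDeg h i 0 p)
      + q * ∑ c : {c : Fin l // c ≠ i}, crossing σ c.1 i * p (outer h i c.1 c.2) := by
    have e : slotDeg h i q p = Function.update (slotDeg h i 0 p) i (slotDeg h i 0 p i + q) := by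
      funext c
      rcases eq_or_ne c i with rfl | hc
      · rw [Function.update_self, slotDeg_self, slotDeg_self]; ring
      · rw [Function.update_of_ne hc, slotDeg_of_ne _ _ _ _ hc, slotDeg_of_ne _ _ _ _ hc]
    rw [e, koszulExp_update, sum_ne i, crossing_self, zero_mul, add_zero]
    congr 2
    exact Finset.sum_congr rfl fun c _ => by rw [slotDeg_of_ne h i 0 p c.2]
  have hd : degBefore p i.1
      = ∑ c : {c : Fin l // c ≠ i}, if c.1 < i then p (outer h i c.1 c.2) else 0 := by
    rw [degBefore, sum_slot h i, Finset.sum_eq_zero (s := Finset.univ) (f := fun b : Fin m =>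
      if (inner h i b).1 < i.1 then p (inner h i b) else 0)
      (fun b _ => if_neg (by rw [inner_val]; omega)), add_zero]
    refine Finset.sum_congr rfl fun c _ => ?_
    have := val_ne c.2
    have e : (outer h i c.1 c.2).1 < i.1 ↔ c.1 < i := by
      rw [Fin.lt_def, outer_val]; split_ifs <;> omega
    simp only [e]
  have hd' : degBefore (fun x => p ((blockPerm h i σ τ).symm x)) (σ i).1
      = ∑ c : {c : Fin l // c ≠ i}, if σ c.1 < σ i then p (outer h i c.1 c.2) else 0 := by
    rw [degBefore_perm, sum_slot h i, Finset.sum_eq_zero (s := Finset.univ) (f := fun b : Fin m =>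
      if (blockPerm h i σ τ (inner h i b)).1 < (σ i).1 then p (inner h i b) else 0)
      (fun b _ => if_neg (by rw [blockPerm_inner, inner_val]; omega)), add_zero]
    refine Finset.sum_congr rfl fun c _ => ?_
    have := val_ne (σ.injective.ne c.2)
    have e : (blockPerm h i σ τ (outer h i c.1 c.2)).1 < (σ i).1 ↔ σ c.1 < σ i := by
      rw [blockPerm_outer, Fin.lt_def, outer_val]; split_ifs <;> omega
    simp only [e]
  rw [koszulSign_eq, koszulSign_eq, koszulSign_eq, ← Int.negOnePow_add, ← Int.negOnePow_add,
    ← Int.negOnePow_add, hbp, hσ, hd, hd']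
  refine negOnePow_eq_of (q * ∑ c : {c : Fin l // c ≠ i},
    (if c.1 < i ∧ σ i < σ c.1 then 1 else 0) * p (outer h i c.1 c.2)) ?_
  have key : ∑ c : {c : Fin l // c ≠ i}, crossing σ c.1 i * p (outer h i c.1 c.2)
      = (∑ c : {c : Fin l // c ≠ i}, if σ c.1 < σ i then p (outer h i c.1 c.2) else 0)
        - (∑ c : {c : Fin l // c ≠ i}, if c.1 < i then p (outer h i c.1 c.2) else 0)
        + 2 * ∑ c : {c : Fin l // c ≠ i},
          (if c.1 < i ∧ σ i < σ c.1 then 1 else 0) * p (outer h i c.1 c.2) := by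
    rw [Finset.mul_sum, ← Finset.sum_sub_distrib, ← Finset.sum_add_distrib]
    refine Finset.sum_congr rfl fun c _ => ?_
    rw [crossing_eq]
    split_ifs <;> ring
  rw [key]; ring

end Slots

end Signs

end StrictUnits

namespace StrictUnits

section Operations

variable {k : Type u} [Field k]

theorem multilinear_ext {A B : GrMod.{u, v} k} {n : ℕ}
    {f g : MultilinearMap k (fun _ : Fin n => A.carrier) B.carrier}
    (h : ∀ (p : Fin n → ℤ) (a : Fin n → A), (∀ i, a i ∈ A.gr (p i)) → f a = g a) : f = g := by
  suffices H : ∀ (s : Finset (Fin n)) (a : Fin n → A), (∀ i, i ∉ s → ∃ p, a i ∈ A.gr p) →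
      f a = g a from MultilinearMap.ext fun a => H Finset.univ a (by simp)
  intro s
  induction s using Finset.induction_on with
  | empty =>
    intro a ha
    choose p hp using fun i => ha i (Finset.notMem_empty i)
    exact h p a hp
  | insert j s _ ih =>
    intro a ha
    have key : ∀ x : A, f (Function.update a j x) = g (Function.update a j x) := by
      intro x
      induction x using A.induction with
      | mem p x hx =>
        refine ih _ fun i hi => ?_
        rcases eq_or_ne i j with rfl | hij
        · exact ⟨p, by rwa [Function.update_self]⟩
        · rw [Function.update_of_ne hij]
          exact ha i (by simp [hi, hij])
      | add x y hx hy => rw [f.map_update_add, g.map_update_add, hx, hy]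
    have := key (a j)
    rwa [Function.update_eq_self] at this

theorem exists_parityPart (A : GrMod.{u, v} k) (ε : ZMod 2) :
    ∃ e : A →ₗ[k] A, ∀ {p : ℤ} {x : A}, x ∈ A.gr p → e x = if (p : ZMod 2) = ε then x else 0 := by
  obtain ⟨e, he⟩ := A.exists_lift (fun p => if (p : ZMod 2) = ε then (A.gr p).subtype else 0)
  refine ⟨e, fun {p x} hx => ?_⟩
  rw [he p ⟨x, hx⟩]
  split_ifs <;> rfl

/-- The projection onto the elements of a given parity. -/
noncomputable def GrMod.parityPart (A : GrMod.{u, v} k) (ε : ZMod 2) : A →ₗ[k] A :=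
  (exists_parityPart A ε).choose

theorem GrMod.parityPart_apply (A : GrMod.{u, v} k) (ε : ZMod 2) {p : ℤ} {x : A}
    (hx : x ∈ A.gr p) : A.parityPart ε x = if (p : ZMod 2) = ε then x else 0 :=
  (exists_parityPart A ε).choose_spec hx

/-- A sign that depends only on the parities of the degrees. -/
def IsParity {n : ℕ} (χ : (Fin n → ℤ) → ℤˣ) : Prop :=
  ∀ p p' : Fin n → ℤ, (∀ i, (p i : ZMod 2) = p' i) → χ p = χ p'

theorem isParity_degBefore {n : ℕ} (D : ℤ) (t : ℕ) :
    IsParity fun p : Fin n → ℤ => (D * degBefore p t).negOnePow := by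
  intro p p' h
  refine negOnePow_congr ?_
  simp only [degBefore]
  push_cast
  simp only [h]

theorem isParity_koszulSign {n : ℕ} (σ : Perm (Fin n)) : IsParity (koszulSign σ) := by
  intro p p' h
  rw [koszulSign_eq, koszulSign_eq]
  refine negOnePow_congr ?_
  simp only [koszulExp]
  push_cast
  simp only [h]

variable (A : DGMod.{u, v} k)

/-- The multilinear operations on `A` with `n` inputs. -/
abbrev Ops (n : ℕ) : Type v := MultilinearMap k (fun _ : Fin n => A.carrier) A.carrier

variable {A} in
theorem map_update_sign {n : ℕ} (f : Ops A n) (a : Fin n → A) (i : Fin n) (e : ℤˣ) (x : A) :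
    f (Function.update a i (e • x)) = e • f (Function.update a i x) :=
  map_sign (f.toLinearMap a i) e x

/-- Multiplies a multilinear operation by a sign that depends on the degrees of the inputs. -/
noncomputable def signOp {n : ℕ} (χ : (Fin n → ℤ) → ℤˣ) : Ops A n →ₗ[k] Ops A n :=
  ∑ ε : Fin n → ZMod 2, χ (fun i => ((ε i).val : ℤ)) •
    MultilinearMap.compLinearMapₗ (fun i => A.toGrMod.parityPart (ε i))

variable {A}

theorem signOp_apply {n : ℕ} {χ : (Fin n → ℤ) → ℤˣ} (hχ : IsParity χ) (f : Ops A n)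
    {p : Fin n → ℤ} {a : Fin n → A} (ha : ∀ i, a i ∈ A.gr (p i)) : signOp A χ f a = χ p • f a := by
  have h1 : ∀ ε : Fin n → ZMod 2, (χ (fun i => ((ε i).val : ℤ)) •
      MultilinearMap.compLinearMapₗ (fun i => A.toGrMod.parityPart (ε i)) f) a
      = if ε = (fun i => (p i : ZMod 2)) then χ p • f a else 0 := by
    intro ε
    rw [Units.smul_def, smul_apply, ← Units.smul_def]
    change χ _ • f (fun i => A.toGrMod.parityPart (ε i) (a i)) = _
    split_ifs with h
    · subst h
      have e : (fun i => A.toGrMod.parityPart (p i : ZMod 2) (a i)) = a := funext fun i => by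
        rw [A.toGrMod.parityPart_apply _ (ha i), if_pos rfl]
      rw [e]
      congr 1
      refine hχ _ _ fun i => ?_
      push_cast
      exact ZMod.natCast_zmod_val _
    · obtain ⟨i, hi⟩ : ∃ i, ε i ≠ (p i : ZMod 2) := by
        by_contra hc
        push Not at hc
        exact h (funext hc)
      rw [f.map_coord_zero i, smul_zero]
      rw [A.toGrMod.parityPart_apply _ (ha i), if_neg hi.symm]
  rw [signOp, LinearMap.sum_apply, sum_apply]
  simp only [LinearMap.smul_apply, Units.smul_def] at h1 ⊢
  rw [Finset.sum_congr rfl fun ε _ => h1 ε, Finset.sum_ite_eq' Finset.univ,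
    if_pos (Finset.mem_univ _)]

section Insert

variable {l m n : ℕ} (h : n + 1 = l + m) (i : Fin l)

/-- The inputs of `x` in the evaluation of `x ∘ᵢ y`, where `v` is the value of `y`. -/
def slotArgs (a : Fin n → A) (v : A) (c : Fin l) : A :=
  if hc : c = i then v else a (outer h i c hc)

theorem slotArgs_self (a : Fin n → A) (v : A) : slotArgs h i a v i = v := dif_pos rfl

theorem slotArgs_of_ne (a : Fin n → A) (v : A) {c : Fin l} (hc : c ≠ i) :
    slotArgs h i a v c = a (outer h i c hc) := dif_neg hc

theorem slotArgs_eq_update (a : Fin n → A) (v : A) :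
    slotArgs h i a v = Function.update (slotArgs h i a 0) i v := by
  funext c
  rcases eq_or_ne c i with rfl | hc
  · rw [Function.update_self, slotArgs_self]
  · rw [Function.update_of_ne hc, slotArgs_of_ne _ _ _ _ hc, slotArgs_of_ne _ _ _ _ hc]

theorem update_slotArgs_self (a : Fin n → A) (v w : A) :
    Function.update (slotArgs h i a v) i w = slotArgs h i a w := by
  rw [slotArgs_eq_update, Function.update_idem, ← slotArgs_eq_update]

theorem slotArgs_update_outer (a : Fin n → A) (v x : A) {c : Fin l} (hc : c ≠ i) :
    slotArgs h i (Function.update a (outer h i c hc) x) v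
      = Function.update (slotArgs h i a v) c x := by
  funext e
  rcases eq_or_ne e c with rfl | hec
  · rw [Function.update_self, slotArgs_of_ne _ _ _ _ hc, Function.update_self]
  · rw [Function.update_of_ne hec]
    rcases eq_or_ne e i with rfl | hei
    · rw [slotArgs_self, slotArgs_self]
    · rw [slotArgs_of_ne _ _ _ _ hei, slotArgs_of_ne _ _ _ _ hei, Function.update_of_ne]
      exact fun z => hec (outer_injective z)

theorem slotArgs_update_inner (a : Fin n → A) (v x : A) (b : Fin m) :
    slotArgs h i (Function.update a (inner h i b) x) v = slotArgs h i a v := by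
  funext e
  rcases eq_or_ne e i with rfl | hei
  · rw [slotArgs_self, slotArgs_self]
  · rw [slotArgs_of_ne _ _ _ _ hei, slotArgs_of_ne _ _ _ _ hei, Function.update_of_ne]
    exact outer_ne_inner h i e hei b

theorem update_comp_inner_inner (a : Fin n → A) (x : A) (b : Fin m) :
    (fun b' => Function.update a (inner h i b) x (inner h i b'))
      = Function.update (fun b' => a (inner h i b')) b x := by
  funext b'
  rcases eq_or_ne b' b with rfl | hb
  · rw [Function.update_self, Function.update_self]
  · rw [Function.update_of_ne hb, Function.update_of_ne]
    intro e
    rw [Fin.ext_iff, inner_val, inner_val] at e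
    exact hb (Fin.ext (by omega))

theorem update_outer_comp_inner (a : Fin n → A) (x : A) {c : Fin l} (hc : c ≠ i) :
    (fun b' => Function.update a (outer h i c hc) x (inner h i b')) = fun b' => a (inner h i b') :=
  funext fun b' => Function.update_of_ne (outer_ne_inner h i c hc b').symm _ _

theorem slotArgs_mem {D : ℤ} {p : Fin n → ℤ} {a : Fin n → A} (ha : ∀ x, a x ∈ A.gr (p x)) {v : A}
    (hv : v ∈ A.gr (D + ∑ b, p (inner h i b))) (c : Fin l) :
    slotArgs h i a v c ∈ A.gr (slotDeg h i D p c) := by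
  rcases eq_or_ne c i with rfl | hc
  · rwa [slotArgs_self, slotDeg_self]
  · rw [slotArgs_of_ne _ _ _ _ hc, slotDeg_of_ne _ _ _ _ hc]
    exact ha _

theorem map_slotArgs_sign (f : Ops A l) (a : Fin n → A) (e : ℤˣ) (v : A) :
    f (slotArgs h i a (e • v)) = e • f (slotArgs h i a v) := by
  rw [slotArgs_eq_update, map_update_sign, ← slotArgs_eq_update]

theorem map_slotArgs_add (f : Ops A l) (a : Fin n → A) (v w : A) :
    f (slotArgs h i a (v + w)) = f (slotArgs h i a v) + f (slotArgs h i a w) := by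
  rw [slotArgs_eq_update, f.map_update_add, ← slotArgs_eq_update, ← slotArgs_eq_update]

theorem map_slotArgs_smul (f : Ops A l) (a : Fin n → A) (c : k) (v : A) :
    f (slotArgs h i a (c • v)) = c • f (slotArgs h i a v) := by
  rw [slotArgs_eq_update, f.map_update_smul, ← slotArgs_eq_update]

/-- The partial composite of multilinear operations, without signs. -/
def insertOp (f : Ops A l) (g : Ops A m) : Ops A n :=
  MultilinearMap.mk' (fun a => f (slotArgs h i a (g fun b => a (inner h i b))))
    (fun a x v w => by
      rcases slot_cases h i x with ⟨c, hc, rfl⟩ | ⟨b, rfl⟩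
      · simp only [slotArgs_update_outer, update_outer_comp_inner, f.map_update_add]
      · simp only [slotArgs_update_inner, update_comp_inner_inner, g.map_update_add,
          map_slotArgs_add])
    (fun a x e v => by
      rcases slot_cases h i x with ⟨c, hc, rfl⟩ | ⟨b, rfl⟩
      · simp only [slotArgs_update_outer, update_outer_comp_inner, f.map_update_smul]
      · simp only [slotArgs_update_inner, update_comp_inner_inner, g.map_update_smul,
          map_slotArgs_smul])

theorem insertOp_apply (f : Ops A l) (g : Ops A m) (a : Fin n → A) :
    insertOp h i f g a = f (slotArgs h i a (g fun b => a (inner h i b))) := rfl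

variable (A) in
/-- The partial composite of multilinear operations, where the second one has degree `D`. -/
noncomputable def compOp (D : ℤ) : Ops A l →ₗ[k] Ops A m →ₗ[k] Ops A n :=
  (LinearMap.mk₂ k (insertOp h i) (fun _ _ _ => rfl) (fun _ _ _ => rfl)
    (fun f _ _ => MultilinearMap.ext fun a => map_slotArgs_add h i f a _ _)
    (fun c f g => MultilinearMap.ext fun a => by
      rw [smul_apply, insertOp_apply, insertOp_apply, smul_apply, map_slotArgs_smul])).compr₂
    (signOp A fun p => (D * degBefore p i.1).negOnePow)

theorem compOp_apply (D : ℤ) (f : Ops A l) (g : Ops A m) {p : Fin n → ℤ} {a : Fin n → A}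
    (ha : ∀ x, a x ∈ A.gr (p x)) : compOp A h i D f g a
      = (D * degBefore p i.1).negOnePow • f (slotArgs h i a (g fun b => a (inner h i b))) :=
  signOp_apply (isParity_degBefore D i.1) _ ha

theorem compOp_zero (f : Ops A l) (g : Ops A m) : compOp A h i 0 f g = insertOp h i f g := by
  refine multilinear_ext (A := A.toGrMod) (B := A.toGrMod) fun p a ha => ?_
  rw [compOp_apply h i 0 f g ha, zero_mul, Int.negOnePow_zero, one_smul, insertOp_apply]

end Insert

variable (A) in
/-- The action of permutations on multilinear operations. -/
noncomputable def actOp (n : ℕ) (σ : Perm (Fin n)) : Ops A n →ₗ[k] Ops A n :=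
  signOp A (koszulSign σ) ∘ₗ
    (MultilinearMap.domDomCongrLinearEquiv k k A.carrier A.carrier σ.symm).toLinearMap

theorem actOp_apply {n : ℕ} (σ : Perm (Fin n)) (f : Ops A n) {p : Fin n → ℤ} {a : Fin n → A}
    (ha : ∀ x, a x ∈ A.gr (p x)) :
    actOp A n σ f a = koszulSign σ p • f (fun j => a (σ.symm j)) :=
  signOp_apply (isParity_koszulSign σ) _ ha

variable (A) in
/-- The differential of multilinear operations of degree `D`. -/
noncomputable def dOp (n : ℕ) (D : ℤ) : Ops A n →ₗ[k] Ops A n :=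
  LinearMap.compMultilinearMapₗ k A.d - D.negOnePow • ∑ i : Fin n,
    signOp A (fun p => (1 * degBefore p i.1).negOnePow) ∘ₗ
      MultilinearMap.compLinearMapₗ (Function.update (fun _ => LinearMap.id) i A.d)

theorem dOp_apply {n : ℕ} (D : ℤ) (f : Ops A n) {p : Fin n → ℤ} {a : Fin n → A}
    (ha : ∀ x, a x ∈ A.gr (p x)) : dOp A n D f a = evalDiff A f D p a := by
  have e : ∀ i : Fin n, (fun x => Function.update (fun _ => LinearMap.id) i A.d x (a x))
      = Function.update a i (A.d (a i)) := by
    intro i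
    funext x
    rcases eq_or_ne x i with rfl | hx
    · rw [Function.update_self, Function.update_self]
    · rw [Function.update_of_ne hx, Function.update_of_ne hx, LinearMap.id_apply]
  have key : (∑ i : Fin n, signOp A (fun p => (1 * degBefore p i.1).negOnePow) ∘ₗ
      MultilinearMap.compLinearMapₗ (Function.update (fun _ => LinearMap.id) i A.d)) f a
      = ∑ i : Fin n, (degBefore p i.1).negOnePow • f (Function.update a i (A.d (a i))) := by
    rw [LinearMap.sum_apply, sum_apply]
    refine Finset.sum_congr rfl fun i _ => ?_
    rw [LinearMap.comp_apply, signOp_apply (isParity_degBefore 1 i.1) _ ha, one_mul, ← e i]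
    rfl
  rw [evalDiff, ← key]
  rfl

variable (A) in
/-- The operations of degree `D`. -/
def opGr (n : ℕ) (D : ℤ) : Submodule k (Ops A n) where
  carrier := {f | ∀ (p : Fin n → ℤ) (a : Fin n → A), (∀ i, a i ∈ A.gr (p i)) →
    f a ∈ A.gr (D + ∑ i, p i)}
  add_mem' hf hg p a ha := Submodule.add_mem _ (hf p a ha) (hg p a ha)
  zero_mem' _ _ _ := Submodule.zero_mem _
  smul_mem' c _ hf p a ha := Submodule.smul_mem _ c (hf p a ha)

end Operations

end StrictUnits

namespace StrictUnits

section EndOperad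

variable {k : Type u} [Field k] {A : DGMod.{u, v} k}

theorem ops_ext {n : ℕ} {f g : Ops A n}
    (h : ∀ (p : Fin n → ℤ) (a : Fin n → A), (∀ i, a i ∈ A.gr (p i)) → f a = g a) : f = g :=
  multilinear_ext (A := A.toGrMod) (B := A.toGrMod) h

theorem actOp_one (n : ℕ) (f : Ops A n) : actOp A n 1 f = f := by
  refine ops_ext fun p a ha => ?_
  rw [actOp_apply 1 f ha, koszulSign_one, one_smul]
  rfl

theorem actOp_mul (n : ℕ) (σ τ : Perm (Fin n)) (f : Ops A n) :
    actOp A n (σ * τ) f = actOp A n τ (actOp A n σ f) := by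
  refine ops_ext fun p a ha => ?_
  rw [actOp_apply _ _ ha, actOp_apply _ _ ha,
    actOp_apply (p := fun j => p (τ.symm j)) _ _ (fun j => ha _), smul_smul, koszulSign_mul]
  rfl

theorem actOp_mem (n : ℕ) (σ : Perm (Fin n)) {D : ℤ} {f : Ops A n} (hf : f ∈ opGr A n D) :
    actOp A n σ f ∈ opGr A n D := by
  intro p a ha
  rw [actOp_apply _ _ ha]
  have h := hf (fun j => p (σ.symm j)) (fun j => a (σ.symm j)) fun j => ha _
  rw [Equiv.sum_comp σ.symm p] at h
  exact sign_smul_mem _ _ h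

theorem slotArgs_ops_mem {l m n : ℕ} (h : n + 1 = l + m) (i : Fin l) {q : ℤ} {g : Ops A m}
    (hg : g ∈ opGr A m q) {p : Fin n → ℤ} {a : Fin n → A} (ha : ∀ x, a x ∈ A.gr (p x)) (c : Fin l) :
    slotArgs h i a (g fun b => a (inner h i b)) c ∈ A.gr (slotDeg h i q p c) :=
  slotArgs_mem h i ha (hg (fun b => p (inner h i b)) _ fun _ => ha _) c

theorem compOp_mem {l m n : ℕ} (h : n + 1 = l + m) (i : Fin l) {p q : ℤ} {f : Ops A l}
    {g : Ops A m} (hf : f ∈ opGr A l p) (hg : g ∈ opGr A m q) :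
    compOp A h i q f g ∈ opGr A n (p + q) := by
  intro r a ha
  rw [compOp_apply h i q f g ha]
  have h1 := hf _ _ (slotArgs_ops_mem h i hg ha)
  rw [sum_slotDeg, ← add_assoc] at h1
  exact sign_smul_mem _ _ h1

variable (A) in
/-- The identity operation. -/
def oneOp : Ops A 1 := MultilinearMap.ofSubsingleton k A.carrier A.carrier 0 LinearMap.id

theorem oneOp_apply (a : Fin 1 → A) : oneOp A a = a 0 := rfl

theorem oneOp_mem : oneOp A ∈ opGr A 1 0 := by
  intro p a ha
  rw [oneOp_apply, Fin.sum_univ_one, zero_add]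
  exact ha 0

theorem degBefore_zero {n : ℕ} (p : Fin n → ℤ) : degBefore p 0 = 0 :=
  Finset.sum_eq_zero fun _ _ => if_neg (Nat.not_lt_zero _)

theorem compOp_one_left {n : ℕ} (h : n + 1 = 1 + n) (q : ℤ) (f : Ops A n) :
    compOp A h 0 q (oneOp A) f = f := by
  refine ops_ext fun p a ha => ?_
  have e : (fun b => a (inner h 0 b)) = a :=
    funext fun b => congrArg a (Fin.ext (by rw [inner_val]; exact Nat.zero_add _))
  rw [compOp_apply h 0 q _ _ ha, oneOp_apply, slotArgs_self, e]
  rw [show ((0 : Fin 1).1) = 0 from rfl, degBefore_zero, mul_zero, Int.negOnePow_zero, one_smul]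

theorem compOp_one_right {n : ℕ} (h : n + 1 = n + 1) (i : Fin n) (f : Ops A n) :
    compOp A h i 0 f (oneOp A) = f := by
  rw [compOp_zero]
  refine MultilinearMap.ext fun a => ?_
  rw [insertOp_apply, oneOp_apply]
  congr 1
  funext c
  rcases eq_or_ne c i with rfl | hc
  · rw [slotArgs_self]
    exact congrArg a (Fin.ext (by rw [inner_val]; rfl))
  · rw [slotArgs_of_ne _ _ _ _ hc]
    refine congrArg a (Fin.ext ?_)
    have := val_ne hc
    rw [outer_val]
    split_ifs <;> omega

section Assoc

variable {l m r n s t : ℕ} (h₁ : n + 1 = l + m) (h₂ : t + 1 = n + r)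

theorem compOp_assoc_seq (h₃ : s + 1 = m + r) (h₄ : t + 1 = l + s) (i : Fin l) (j : Fin m) {p q : ℤ}
    (x : Ops A l) {y : Ops A m} {z : Ops A r} (hz : z ∈ opGr A r q) :
    compOp A h₂ (inner h₁ i j) q (compOp A h₁ i p x y) z
      = compOp A h₄ i (p + q) x (compOp A h₃ j q y z) := by
  have hj := j.2
  refine ops_ext fun P a ha => ?_
  rw [compOp_apply h₂ _ q _ _ ha, compOp_apply h₁ i p _ _ (slotArgs_ops_mem h₂ _ hz ha),
    compOp_apply h₄ i _ _ _ ha,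
    compOp_apply (p := fun b => P (inner h₄ i b)) h₃ j q _ _ (fun b => ha _), map_slotArgs_sign,
    smul_smul, smul_smul, ← Int.negOnePow_add, ← Int.negOnePow_add,
    degBefore_slotDeg_of_le h₂ _ q P (by rw [inner_val]; omega), inner_val,
    degBefore_inner h₄ i P (t := j.1) (by omega)]
  congr 2
  · ring
  · have e1 : ∀ b, slotArgs h₂ (inner h₁ i j) a (z fun b => a (inner h₂ (inner h₁ i j) b))
        (inner h₁ i b) = slotArgs h₃ j (fun b => a (inner h₄ i b))
          (z fun b => a (inner h₄ i (inner h₃ j b))) b := by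
      intro b
      rcases eq_or_ne b j with rfl | hb
      · rw [slotArgs_self, slotArgs_self]
        exact congrArg z (funext fun b' => congrArg a (inner_inner h₁ h₂ h₃ h₄ i b b'))
      · have hb' : inner h₁ i b ≠ inner h₁ i j := by
          intro e
          rw [Fin.ext_iff, inner_val, inner_val] at e
          exact hb (Fin.ext (by omega))
        rw [slotArgs_of_ne _ _ _ _ hb, slotArgs_of_ne _ _ _ _ hb',
          outer_inner_inner h₁ h₂ h₃ h₄ i j b hb]
    funext c
    rcases eq_or_ne c i with rfl | hc
    · rw [slotArgs_self, slotArgs_self]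
      exact congrArg y (funext e1)
    · have hc' := outer_ne_inner h₁ i c hc j
      rw [slotArgs_of_ne _ _ _ _ hc, slotArgs_of_ne _ _ _ _ hc, slotArgs_of_ne _ _ _ _ hc',
        outer_inner_outer h₁ h₂ h₃ h₄]

theorem compOp_assoc_par_of_lt (h₃ : s + 1 = l + r) (h₄ : t + 1 = s + m) {i c : Fin l} (hci : c ≠ i)
    (hlt : i.1 < c.1) {p q : ℤ} (x : Ops A l) {y : Ops A m} {z : Ops A r} (hy : y ∈ opGr A m p)
    (hz : z ∈ opGr A r q) :
    compOp A h₂ (outer h₁ i c hci) q (compOp A h₁ i p x y) z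
      = (p * q).negOnePow • compOp A h₄ (outer h₃ c i hci.symm) p (compOp A h₃ c q x z) y := by
  refine ops_ext fun P a ha => ?_
  have o1 : (outer h₁ i c hci).1 + 1 = c.1 + m := by
    rw [outer_val, if_neg (by omega)]; omega
  have o2 : (outer h₃ c i hci.symm).1 = i.1 := by
    rw [outer_val, if_pos hlt]
  rw [Units.smul_def, smul_apply, ← Units.smul_def]
  rw [compOp_apply h₂ _ q _ _ ha, compOp_apply h₁ i p _ _ (slotArgs_ops_mem h₂ _ hz ha),
    compOp_apply h₄ _ p _ _ ha, compOp_apply h₃ c q _ _ (slotArgs_ops_mem h₄ _ hy ha),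
    smul_smul, smul_smul, smul_smul, ← Int.negOnePow_add, ← Int.negOnePow_add, ← Int.negOnePow_add,
    degBefore_slotDeg_of_le h₂ _ q P (by omega),
    degBefore_slotDeg_of_lt h₄ _ p P (t := c.1) (by omega) o1, o2]
  congr 1
  · exact negOnePow_eq_of (-(p * q)) (by ring)
  · congr 1
    funext e
    rcases eq_or_ne e i with rfl | hei
    · rw [slotArgs_self, slotArgs_of_ne _ _ _ _ hci.symm, slotArgs_self]
      refine congrArg y (funext fun b => ?_)
      rw [slotArgs_of_ne _ _ _ _ (outer_ne_inner h₁ e c hci b).symm,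
        outer_outer_inner h₁ h₂ h₃ h₄]
    · rw [slotArgs_of_ne _ _ _ _ hei]
      rcases eq_or_ne e c with rfl | hec
      · rw [slotArgs_self, slotArgs_self]
        refine congrArg z (funext fun b => ?_)
        rw [slotArgs_of_ne _ _ _ _ (outer_ne_inner h₃ e i hci.symm b).symm,
          inner_outer h₁ h₂ h₃ h₄]
      · have h5 : outer h₁ i e hei ≠ outer h₁ i c hci := fun z => hec (outer_injective z)
        have h6 : outer h₃ c e hec ≠ outer h₃ c i hci.symm := fun z => hei (outer_injective z)
        rw [slotArgs_of_ne _ _ _ _ hec, slotArgs_of_ne _ _ _ _ h5, slotArgs_of_ne _ _ _ _ h6,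
          outer_outer_outer h₁ h₂ h₃ h₄ i c e hci hei hec]

theorem compOp_assoc_par (h₃ : s + 1 = l + r) (h₄ : t + 1 = s + m) (i c : Fin l) (hci : c ≠ i)
    {p q : ℤ} (x : Ops A l) {y : Ops A m} {z : Ops A r} (hy : y ∈ opGr A m p)
    (hz : z ∈ opGr A r q) :
    compOp A h₂ (outer h₁ i c hci) q (compOp A h₁ i p x y) z
      = (p * q).negOnePow • compOp A h₄ (outer h₃ c i hci.symm) p (compOp A h₃ c q x z) y := by
  rcases lt_or_gt_of_ne (val_ne hci) with h | h
  · rw [compOp_assoc_par_of_lt h₃ h₄ h₁ h₂ hci.symm h x hz hy, mul_comm q p, sign_self_smul]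
  · exact compOp_assoc_par_of_lt h₁ h₂ h₃ h₄ hci h x hy hz

end Assoc

theorem compOp_equivariance {l m n : ℕ} (h : n + 1 = l + m) (i : Fin l) (σ : Perm (Fin l))
    (τ : Perm (Fin m)) {q : ℤ} (x : Ops A l) {y : Ops A m} (hy : y ∈ opGr A m q) :
    compOp A h i q (actOp A l σ x) (actOp A m τ y)
      = actOp A n (blockPerm h i σ τ) (compOp A h (σ i) q x y) := by
  refine ops_ext fun P a ha => ?_
  rw [compOp_apply h i q _ _ ha, actOp_apply σ x (slotArgs_ops_mem h i (actOp_mem m τ hy) ha),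
    actOp_apply (blockPerm h i σ τ) _ ha,
    compOp_apply (p := fun j => P ((blockPerm h i σ τ).symm j)) h (σ i) q _ _ (fun j => ha _),
    actOp_apply (p := fun b => P (inner h i b)) τ y (fun b => ha _)]
  have e1 : ∀ b, (blockPerm h i σ τ).symm (inner h (σ i) b) = inner h i (τ.symm b) := by
    intro b
    rw [Equiv.symm_apply_eq, blockPerm_inner, Equiv.apply_symm_apply]
  have e2 : (fun j => slotArgs h i a (koszulSign τ (fun b => P (inner h i b)) •
        y fun j => a (inner h i (τ.symm j))) (σ.symm j))
      = slotArgs h (σ i) (fun j => a ((blockPerm h i σ τ).symm j))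
        (koszulSign τ (fun b => P (inner h i b)) • y fun j => a (inner h i (τ.symm j))) := by
    funext c
    obtain ⟨c, rfl⟩ := σ.surjective c
    rw [Equiv.symm_apply_apply]
    rcases eq_or_ne c i with rfl | hc
    · rw [slotArgs_self, slotArgs_self]
    · rw [slotArgs_of_ne _ _ _ _ hc, slotArgs_of_ne _ _ _ _ (σ.injective.ne hc)]
      congr 1
      rw [Equiv.eq_symm_apply, blockPerm_outer]
  rw [e2, map_slotArgs_sign]
  simp only [e1, smul_smul]
  congr 1
  rw [← koszulSign_blockPerm, mul_right_comm, mul_assoc]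

theorem update_mem {n : ℕ} {p : Fin n → ℤ} {a : Fin n → A} (ha : ∀ x, a x ∈ A.gr (p x)) (i x : Fin n) :
    Function.update a i (A.d (a i)) x ∈ A.gr (Function.update p i (p i + 1) x) := by
  rcases eq_or_ne x i with rfl | hx
  · rw [Function.update_self, Function.update_self]
    exact A.d_mem (ha x)
  · rw [Function.update_of_ne hx, Function.update_of_ne hx]
    exact ha x

theorem actOp_d (n : ℕ) (σ : Perm (Fin n)) (p : ℤ) (x : Ops A n) :
    actOp A n σ (dOp A n p x) = dOp A n p (actOp A n σ x) := by
  refine ops_ext fun P a ha => ?_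
  rw [actOp_apply σ _ ha, dOp_apply (p := fun j => P (σ.symm j)) p x (fun j => ha _),
    dOp_apply p _ ha, evalDiff, evalDiff, smul_sub, actOp_apply σ x ha, map_sign]
  congr 1
  rw [sign_smul_comm, ← Equiv.sum_comp σ, Finset.smul_sum]
  congr 1
  refine Finset.sum_congr rfl fun i _ => ?_
  rw [actOp_apply σ x (update_mem ha i), smul_smul, smul_smul, koszulSign_update]
  congr 2
  funext j
  obtain ⟨j, rfl⟩ := σ.surjective j
  rw [Equiv.symm_apply_apply]
  rcases eq_or_ne j i with rfl | hj
  · rw [Function.update_self, Equiv.symm_apply_apply, Function.update_self]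
  · rw [Function.update_of_ne (σ.injective.ne hj), Equiv.symm_apply_apply,
      Function.update_of_ne hj]

theorem dOp_one : dOp A 1 0 (oneOp A) = 0 := by
  refine ops_ext fun P a ha => ?_
  rw [dOp_apply 0 _ ha, evalDiff, Fin.sum_univ_one, oneOp_apply, oneOp_apply, Function.update_self,
    Int.negOnePow_zero, one_smul, show ((0 : Fin 1).1) = 0 from rfl, degBefore_zero,
    Int.negOnePow_zero, one_smul, sub_self]
  rfl

theorem compOp_d {l m n : ℕ} (h : n + 1 = l + m) (i : Fin l) {p q : ℤ} (x : Ops A l)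
    {y : Ops A m} (hy : y ∈ opGr A m q) :
    dOp A n (p + q) (compOp A h i q x y) = compOp A h i q (dOp A l p x) y
      + p.negOnePow • compOp A h i (q + 1) x (dOp A m q y) := by
  refine ops_ext fun P a ha => ?_
  obtain ⟨v, hv⟩ : ∃ v, v = y fun b => a (inner h i b) := ⟨_, rfl⟩
  obtain ⟨Y, hY⟩ : ∃ Y : Fin m → A, ∀ b, Y b
    = y (Function.update (fun b' => a (inner h i b')) b (A.d (a (inner h i b)))) := ⟨_, fun _ => rfl⟩
  have L : dOp A n (p + q) (compOp A h i q x y) a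
      = (q * degBefore P i.1).negOnePow • A.d (x (slotArgs h i a v))
        - (p + q).negOnePow • (∑ c : {c : Fin l // c ≠ i},
            (degBefore P (outer h i c.1 c.2).1
              + q * (degBefore P i.1 + if c.1.1 < i.1 then 1 else 0)).negOnePow •
              x (Function.update (slotArgs h i a v) c.1 (A.d (a (outer h i c.1 c.2))))
          + ∑ b, (degBefore P i.1 + degBefore (fun b => P (inner h i b)) b.1
              + q * degBefore P i.1).negOnePow • x (slotArgs h i a (Y b))) := by
    rw [dOp_apply (p + q) _ ha, evalDiff, sum_slot h i (fun t => (degBefore P t.1).negOnePow •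
      compOp A h i q x y (Function.update a t (A.d (a t)))), compOp_apply h i q _ _ ha, map_sign, hv]
    congr 3
    · refine Finset.sum_congr rfl fun c _ => ?_
      have := val_ne c.2
      have e : (outer h i c.1 c.2).1 < i.1 ↔ c.1.1 < i.1 := by
        rw [outer_val]; split_ifs <;> omega
      rw [compOp_apply h i q _ _ (update_mem ha _), smul_smul, ← Int.negOnePow_add,
        degBefore_update, slotArgs_update_outer, update_outer_comp_inner]
      simp only [e]
    · refine Finset.sum_congr rfl fun b _ => ?_
      rw [compOp_apply h i q _ _ (update_mem ha _), smul_smul, ← Int.negOnePow_add,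
        degBefore_update, slotArgs_update_inner, update_comp_inner_inner, hY, inner_val,
        degBefore_inner h i P b.2.le, if_neg (by omega), add_zero]
  have R1 : compOp A h i q (dOp A l p x) y a
      = (q * degBefore P i.1).negOnePow • A.d (x (slotArgs h i a v))
        - (q * degBefore P i.1 + p).negOnePow • (∑ c : {c : Fin l // c ≠ i},
            (degBefore (slotDeg h i q P) c.1.1).negOnePow •
              x (Function.update (slotArgs h i a v) c.1 (A.d (a (outer h i c.1 c.2))))
          + (degBefore P i.1).negOnePow • x (slotArgs h i a (A.d v))) := by
    rw [compOp_apply h i q _ _ ha, dOp_apply p x (slotArgs_ops_mem h i hy ha), evalDiff, ← hv,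
      sum_ne i (fun t => (degBefore (slotDeg h i q P) t.1).negOnePow •
        x (Function.update (slotArgs h i a v) t (A.d (slotArgs h i a v t)))),
      smul_sub, smul_smul, ← Int.negOnePow_add, slotArgs_self, update_slotArgs_self,
      degBefore_slotDeg_of_le h i q P le_rfl]
    congr 3
    refine Finset.sum_congr rfl fun c _ => ?_
    rw [slotArgs_of_ne h i a v c.2]
  have R2 : compOp A h i (q + 1) x (dOp A m q y) a
      = ((q + 1) * degBefore P i.1).negOnePow • (x (slotArgs h i a (A.d v))
        - q.negOnePow • ∑ b, (degBefore (fun b => P (inner h i b)) b.1).negOnePow •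
            x (slotArgs h i a (Y b))) := by
    rw [compOp_apply h i (q + 1) _ _ ha,
      dOp_apply (p := fun b => P (inner h i b)) q y (fun b => ha _), evalDiff, ← hv]
    simp only [← hY]
    congr 1
    have lin : ∀ w, x (slotArgs h i a w) = x.toLinearMap (slotArgs h i a 0) i w := fun w =>
      congrArg x (slotArgs_eq_update h i a w)
    simp only [lin, map_sub, map_sign, map_sum]
  have K : ∀ c : {c : Fin l // c ≠ i}, (p + q + (degBefore P (outer h i c.1 c.2).1
      + q * (degBefore P i.1 + if c.1.1 < i.1 then 1 else 0))).negOnePow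
      = (q * degBefore P i.1 + p + degBefore (slotDeg h i q P) c.1.1).negOnePow := by
    intro c
    rcases lt_or_gt_of_ne (val_ne c.2) with hc | hc
    · have o : (outer h i c.1 c.2).1 = c.1.1 := by rw [outer_val, if_pos hc]
      rw [degBefore_slotDeg_of_le h i q P hc.le, if_pos hc, o]
      exact negOnePow_eq_of q (by ring)
    · have o : (outer h i c.1 c.2).1 + 1 = c.1.1 + m := by
        rw [outer_val, if_neg (by omega)]; omega
      rw [degBefore_slotDeg_of_lt h i q P hc o, if_neg (by omega)]
      congr 1
      ring
  rw [L, add_apply, Units.smul_def, smul_apply, ← Units.smul_def, R1, R2]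
  simp only [smul_add, smul_sub, Finset.smul_sum, smul_smul, ← Int.negOnePow_add, K]
  have e1 : (q * degBefore P i.1 + p + degBefore P i.1).negOnePow
      = (p + (q + 1) * degBefore P i.1).negOnePow := congrArg _ (by ring)
  have e2 : ∀ b : Fin m, (p + q + (degBefore P i.1 + degBefore (fun b => P (inner h i b)) b.1
      + q * degBefore P i.1)).negOnePow = (p + ((q + 1) * degBefore P i.1 + (q
        + degBefore (fun b => P (inner h i b)) b.1))).negOnePow := fun b => congrArg _ (by ring)
  simp only [e1, e2]
  abel

variable (A) in
/-- The endomorphism operad of a dg vector space. -/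
noncomputable def endOperad : SignedOperad.{u, v} k where
  X := Ops A
  gr := opGr A
  act := actOp A
  act_one := actOp_one
  act_mul := actOp_mul
  act_mem := actOp_mem
  comp h i D := compOp A h i D
  comp_mem := compOp_mem
  one := oneOp A
  one_mem := oneOp_mem
  one_comp := compOp_one_left
  comp_one := compOp_one_right
  assoc_seq h₁ h₂ h₃ h₄ i j _ _ x _ _ _ hz := compOp_assoc_seq h₁ h₂ h₃ h₄ i j x hz
  assoc_par h₁ h₂ h₃ h₄ i c hci _ _ x _ _ hy hz := compOp_assoc_par h₁ h₂ h₃ h₄ i c hci x hy hz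
  equivariance h i σ τ _ x _ hy := compOp_equivariance h i σ τ x hy
  d := dOp A
  act_d n σ p x _ := actOp_d n σ p x
  d_one := dOp_one
  comp_d h i _ _ x _ _ hy := compOp_d h i x hy

end EndOperad

end StrictUnits

namespace StrictUnits

section Algebras

variable {k : Type u} [Field k]

/-- The operations of the operad of strictly unital `A_∞`-algebras. -/
noncomputable def ainfUnital [CharZero k] : UnitalMu (ainfOperad k) where
  mu := ainfMu k
  mu_mem := ainfMu_mem
  mu_two_unit := ainfRes_mu_two
  mu_unit := ainfRes_mu
  d_mu := ainfD_mu

/-- The image of unital operations under a morphism of operads. -/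
def UnitalMu.map {P Q : UOperad.{u} k} (U : UnitalMu P) (f : UHom P Q) : UnitalMu Q where
  mu n := f.toFun n (U.mu n)
  mu_mem hn := f.map_mem _ (U.mu_mem hn)
  mu_two_unit i := by
    have h := f.map_comp (l := 2) (m := 0) (n := 1) rfl i (U.mu 2) P.unit
    rw [f.map_unit] at h
    exact h.symm.trans ((congrArg (f.toFun 1) (U.mu_two_unit i)).trans f.map_one)
  mu_unit {n} hn i := by
    have h := f.map_comp (l := n + 1) (m := 0) (n := n) rfl i (U.mu (n + 1)) P.unit
    rw [f.map_unit] at h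
    exact h.symm.trans ((congrArg (f.toFun n) (U.mu_unit hn i)).trans (map_zero _))
  d_mu {n} hn := by
    rw [← f.map_d, U.d_mu hn, map_sum]
    refine Finset.sum_congr rfl fun s _ => ?_
    rw [map_sum]
    exact Finset.sum_congr rfl fun i _ => (map_sign _ _ _).trans (congrArg _ (f.map_comp _ _ _ _))

/-- Restriction of an algebra structure along a morphism of operads. -/
def OperadAlgebra.comap {P Q : UOperad.{u} k} {A : DGMod.{u, v} k}
    (α : OperadAlgebra Q.toDGOperad A) (f : UHom P Q) : OperadAlgebra P.toDGOperad A where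
  θ n := α.θ n ∘ₗ f.toFun n
  θ_mem n _ _ p a hx ha := α.θ_mem n p a (f.map_mem n hx) ha
  θ_d n _ x p a hx ha := by
    rw [LinearMap.comp_apply, f.map_d]
    exact α.θ_d n p a (f.map_mem n hx) ha
  θ_act n σ x p a ha := by
    rw [LinearMap.comp_apply, f.map_act]
    exact α.θ_act n σ _ p a ha
  θ_comp {_ m n} h i _ x y p a hy ha := by
    rw [LinearMap.comp_apply, f.map_comp]
    exact α.θ_comp h i _ p a (f.map_mem m hy) ha
  θ_one a := by
    rw [LinearMap.comp_apply, f.map_one]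
    exact α.θ_one a

variable {A B : DGMod.{u, v} k}

section ToAInfinity

variable {P : UOperad.{u} k} (α : OperadAlgebra P.toDGOperad A)

theorem OperadAlgebra.θ_res {m n : ℕ} (h : m + 1 = n) (i : Fin n) (x : P.obj n) :
    α.θ m (P.res h i x) = insertOp (m := 0) h i (α.θ n x) (α.θ 0 P.unit) := by
  refine ops_ext fun p a ha => ?_
  have e := α.θ_comp (l := n) (m := 0) (n := m) h i x p a P.unit_mem ha
  rw [evalComp, zero_mul, Int.negOnePow_zero, one_smul] at e
  exact e

theorem OperadAlgebra.θ_unit (a : Fin 0 → A) : α.θ 0 P.unit a = α.θ 0 P.unit ![] :=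
  congrArg _ (Subsingleton.elim _ _)

/-- The strictly unital `A_∞`-algebra of an algebra over an operad with unital operations. -/
def OperadAlgebra.toAInfinity (V : UnitalMu P) : StrictlyUnitalAInfinity A where
  μ n _ := α.θ n (V.mu n)
  μ_mem n hn p a ha := α.θ_mem n p a (V.mu_mem hn) ha
  relation n hn p a ha := by
    rw [← α.θ_d n p a (V.mu_mem hn) ha, V.d_mu hn, map_sum, sum_apply]
    refine Finset.sum_congr rfl fun s _ => ?_
    rw [map_sum, sum_apply]
    refine Finset.sum_congr rfl fun i _ => ?_
    rw [map_sign, Units.smul_def, smul_apply, ← Units.smul_def,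
      α.θ_comp s.eq i _ p a (V.mu_mem s.le_right) ha]
  unit := α.θ 0 P.unit ![]
  unit_mem := by
    have h := α.θ_mem 0 (fun _ => 0) ![] P.unit_mem (fun i => i.elim0)
    rwa [Finset.sum_const_zero, add_zero] at h
  d_unit := by
    have h := α.θ_d 0 (fun _ => 0) ![] P.unit_mem (fun i => i.elim0)
    rw [P.d_unit, map_zero, evalDiff, Finset.univ_eq_empty, Finset.sum_empty, smul_zero,
      sub_zero] at h
    exact h.symm
  unit_left a := by
    have h := congrArg (fun f : Ops A 1 => f ![a]) (α.θ_res (m := 1) rfl 0 (V.mu 2))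
    simp only [V.mu_two_unit, α.θ_one, insertOp_apply, α.θ_unit] at h
    refine Eq.trans (congrArg _ ?_) h.symm
    funext c
    fin_cases c <;> rfl
  unit_right a := by
    have h := congrArg (fun f : Ops A 1 => f ![a]) (α.θ_res (m := 1) rfl 1 (V.mu 2))
    simp only [V.mu_two_unit, α.θ_one, insertOp_apply, α.θ_unit] at h
    refine Eq.trans (congrArg _ ?_) h.symm
    funext c
    fin_cases c <;> rfl
  unit_higher n hn a i ha := by
    obtain ⟨n, rfl⟩ : ∃ n', n = n' + 1 := ⟨n - 1, by omega⟩
    have h := congrArg (fun f : Ops A n => f fun j => a (i.succAbove j))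
      (α.θ_res (m := n) rfl i (V.mu (n + 1)))
    simp only [V.mu_unit (show 2 ≤ n by omega), map_zero, insertOp_apply, α.θ_unit] at h
    refine Eq.trans (congrArg _ ?_) h.symm
    funext c
    rcases eq_or_ne c i with rfl | hc
    · rw [slotArgs_self, ha]
    · rw [slotArgs_of_ne _ _ _ _ hc]
      refine congrArg a (Fin.ext ?_)
      have := val_ne hc
      by_cases hlt : c.1 < i.1
      · have o : (outer (l := n + 1) (m := 0) (n := n) rfl i c hc).1 = c.1 := by
          rw [outer_val, if_pos hlt]
        rw [Fin.succAbove_of_castSucc_lt _ _ (by rw [Fin.lt_def, Fin.val_castSucc, o]; exact hlt),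
          Fin.val_castSucc, o]
      · have o : (outer (l := n + 1) (m := 0) (n := n) rfl i c hc).1 = c.1 - 1 := by
          rw [outer_val, if_neg hlt]; omega
        rw [Fin.succAbove_of_le_castSucc _ _ (by rw [Fin.le_def, Fin.val_castSucc, o]; omega),
          Fin.val_succ, o]
        omega

end ToAInfinity

theorem isStrictHom_of_isAlgebraHom {P : UOperad.{u} k} (V : UnitalMu P)
    (α : OperadAlgebra P.toDGOperad A) (β : OperadAlgebra P.toDGOperad B) (f : DGHom A B)
    (hf : IsAlgebraHom α β f) : IsStrictHom (α.toAInfinity V) (β.toAInfinity V) f :=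
  ⟨(hf 0 P.unit ![]).trans (β.θ_unit _), fun n _ a => hf n (V.mu n) a⟩

/-- The unit of a strictly unital `A_∞`-algebra, as an operation. -/
def StrictlyUnitalAInfinity.unitOp (S : StrictlyUnitalAInfinity A) : Ops A 0 :=
  MultilinearMap.constOfIsEmpty k (fun _ : Fin 0 => A.carrier) S.unit

/-- The operations of a strictly unital `A_∞`-algebra, extended by zero to all arities. -/
def StrictlyUnitalAInfinity.muOp (S : StrictlyUnitalAInfinity A) (n : ℕ) : Ops A n :=
  if hn : 2 ≤ n then S.μ n hn else 0

theorem StrictlyUnitalAInfinity.muOp_eq (S : StrictlyUnitalAInfinity A) {n : ℕ} (hn : 2 ≤ n) :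
    S.muOp n = S.μ n hn := dif_pos hn

theorem StrictlyUnitalAInfinity.compOp_two_unit (S : StrictlyUnitalAInfinity A) (i : Fin 2) :
    compOp A (n := 1) (m := 0) rfl i 0 (S.muOp 2) S.unitOp = oneOp A := by
  rw [compOp_zero]
  refine MultilinearMap.ext fun a => ?_
  rw [insertOp_apply, S.muOp_eq le_rfl, oneOp_apply]
  fin_cases i
  · refine Eq.trans (congrArg _ ?_) (S.unit_left (a 0))
    funext c
    fin_cases c <;> rfl
  · refine Eq.trans (congrArg _ ?_) (S.unit_right (a 0))
    funext c
    fin_cases c <;> rfl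

theorem StrictlyUnitalAInfinity.compOp_unit (S : StrictlyUnitalAInfinity A) {n : ℕ} (hn : 2 ≤ n)
    (i : Fin (n + 1)) : compOp A (n := n) (m := 0) rfl i 0 (S.muOp (n + 1)) S.unitOp = 0 := by
  rw [compOp_zero]
  refine MultilinearMap.ext fun a => ?_
  rw [insertOp_apply, S.muOp_eq (show 2 ≤ n + 1 by omega)]
  exact S.unit_higher (n + 1) (by omega) _ i (slotArgs_self _ _ _ _)

theorem StrictlyUnitalAInfinity.dOp_unitOp (S : StrictlyUnitalAInfinity A) :
    dOp A 0 0 S.unitOp = 0 := by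
  refine ops_ext fun p a ha => ?_
  rw [dOp_apply 0 _ ha, evalDiff, Finset.univ_eq_empty, Finset.sum_empty, smul_zero, sub_zero]
  exact S.d_unit

theorem StrictlyUnitalAInfinity.dOp_muOp (S : StrictlyUnitalAInfinity A) {n : ℕ} (hn : 2 ≤ n) :
    dOp A n (2 - n) (S.muOp n) = ∑ s : Splitting n, ∑ i : Fin s.1.1,
      s.sign i • compOp A s.eq i (2 - s.1.2) (S.muOp s.1.1) (S.muOp s.1.2) := by
  refine ops_ext fun p a ha => ?_
  rw [dOp_apply _ _ ha, S.muOp_eq hn, S.relation n hn p a ha, sum_apply]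
  refine Finset.sum_congr rfl fun s _ => ?_
  rw [sum_apply]
  refine Finset.sum_congr rfl fun i _ => ?_
  rw [Units.smul_def, smul_apply, ← Units.smul_def, compOp_apply s.eq i _ _ _ ha,
    S.muOp_eq s.le_left, S.muOp_eq s.le_right]
  rfl

/-- The operations of a strictly unital `A_∞`-algebra, in its endomorphism operad. -/
def StrictlyUnitalAInfinity.ops (S : StrictlyUnitalAInfinity A) : (endOperad A).UnitalAInf where
  unit := S.unitOp
  unit_mem p a _ := by
    rw [Finset.univ_eq_empty, Finset.sum_empty, add_zero]
    exact S.unit_mem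
  mu := S.muOp
  mu_mem {n} hn p a ha := by
    rw [S.muOp_eq hn]
    exact S.μ_mem n hn p a ha
  mu_two_unit := S.compOp_two_unit
  mu_unit := S.compOp_unit
  d_unit := S.dOp_unitOp
  d_mu := S.dOp_muOp

theorem StrictlyUnitalAInfinity.ext {S S' : StrictlyUnitalAInfinity A}
    (hμ : ∀ n hn, S.μ n hn = S'.μ n hn) (hu : S.unit = S'.unit) : S = S' := by
  obtain ⟨μ, _, _, unit, _, _, _, _, _⟩ := S
  obtain ⟨μ', _, _, unit', _, _, _, _, _⟩ := S'
  obtain rfl : μ = μ' := funext fun n => funext fun hn => hμ n hn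
  obtain rfl : unit = unit' := hu
  rfl

variable [CharZero k]

/-- The algebra over the operad of strictly unital `A_∞`-algebras. -/
noncomputable def StrictlyUnitalAInfinity.algebra (S : StrictlyUnitalAInfinity A) :
    OperadAlgebra (ainfOperad k).toDGOperad A where
  θ n := S.ops.eval n
  θ_mem _ _ _ p a hx ha := S.ops.eval_mem hx p a ha
  θ_d _ _ _ _ _ hx ha := (congrArg (fun f : Ops A _ => f _) (S.ops.eval_d hx)).trans
    (dOp_apply (A := A) _ _ ha)
  θ_act _ σ x _ _ ha := (congrArg (fun f : Ops A _ => f _) (S.ops.eval_act σ x)).trans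
    (actOp_apply (A := A) σ _ ha)
  θ_comp h i _ x _ _ _ hy ha := (congrArg (fun f : Ops A _ => f _) (S.ops.eval_comp h i x hy)).trans
    (compOp_apply (A := A) h i _ _ _ ha)
  θ_one a := (congrArg (fun f : Ops A _ => f _) S.ops.eval_one).trans (oneOp_apply a)

theorem StrictlyUnitalAInfinity.algebra_mu (S : StrictlyUnitalAInfinity A) {n : ℕ} (hn : 2 ≤ n) :
    S.algebra.θ n (ainfMu k n) = S.μ n hn := (S.ops.eval_mu hn).trans (dif_pos hn)

theorem StrictlyUnitalAInfinity.algebra_unit (S : StrictlyUnitalAInfinity A) :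
    S.algebra.θ 0 (ainfOperad k).unit ![] = S.unit :=
  congrArg (fun f : Ops A 0 => f ![]) S.ops.eval_unit

theorem isAlgebraHom_of_isStrictHom {P : UOperad.{u} k} (V : UnitalMu P)
    (hV : ∀ n (x : P.obj n), ∃ y, V.hom.toFun n y = x) (α : OperadAlgebra P.toDGOperad A)
    (β : OperadAlgebra P.toDGOperad B) (f : DGHom A B)
    (hf : IsStrictHom (α.toAInfinity V) (β.toAInfinity V) f) : IsAlgebraHom α β f := by
  obtain ⟨F, hF⟩ : ∃ F, F = V.hom := ⟨_, rfl⟩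
  have hmu : ∀ n, 2 ≤ n → F.toFun n (ainfMu k n) = V.mu n := fun n hn => by rw [hF, V.hom_mu hn]
  rw [← hF] at hV
  have key : ∀ {n : ℕ} (y : (ainfOperad k).obj n), ∀ a : Fin n → A,
      f.toFun (α.θ n (F.toFun n y) a) = β.θ n (F.toFun n y) fun i => f.toFun (a i) := by
    have of_homogeneous : ∀ n (x : P.obj n), (∀ (p : Fin n → ℤ) (a : Fin n → A),
        (∀ i, a i ∈ A.gr (p i)) → f.toFun (α.θ n x a) = β.θ n x fun i => f.toFun (a i)) →
        ∀ a, f.toFun (α.θ n x a) = β.θ n x fun i => f.toFun (a i) := by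
      intro n x h a
      exact congrArg (fun g : MultilinearMap k (fun _ : Fin n => A.carrier) B.carrier => g a)
        (multilinear_ext (A := A.toGrMod) (B := B.toGrMod)
          (f := f.toFun.compMultilinearMap (α.θ n x))
          (g := (β.θ n x).compLinearMap fun _ => f.toFun) h)
    intro n y
    induction y using ainf_word_induction with
    | zero n =>
      intro a
      rw [map_zero, map_zero, map_zero]
      exact map_zero f.toFun
    | add n x y hx hy =>
      intro a
      rw [map_add, map_add, map_add, add_apply, add_apply, map_add, hx, hy]
    | smul n c x hx =>
      intro a
      rw [map_smul, map_smul, map_smul, smul_apply, smul_apply, map_smul, hx]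
    | act n σ x hx =>
      rw [F.map_act]
      refine of_homogeneous _ _ fun p a ha => ?_
      rw [α.θ_act n σ _ p a ha, β.θ_act n σ _ p _ fun i => f.map_mem (ha i), map_sign, hx]
    | one =>
      intro a
      rw [F.map_one, α.θ_one, β.θ_one]
    | unit =>
      intro a
      rw [F.map_unit, α.θ_unit, β.θ_unit]
      exact hf.1
    | @comp l m n hm h c x hx =>
      rw [F.map_comp, hmu m hm]
      refine of_homogeneous _ _ fun p a ha => ?_
      rw [α.θ_comp h c _ p a (V.mu_mem hm) ha,
        β.θ_comp h c _ p _ (V.mu_mem hm) fun i => f.map_mem (ha i), evalComp, evalComp, map_sign, hx]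
      congr 2
      funext e
      split_ifs with he
      · exact hf.2 m hm _
      · rfl
  intro n x a
  obtain ⟨y, rfl⟩ := hV n x
  exact key y a

theorem OperadAlgebra.ext_of_toAInfinity {P : UOperad.{u} k} (V : UnitalMu P)
    (hV : ∀ n (x : P.obj n), ∃ y, V.hom.toFun n y = x) {α β : OperadAlgebra P.toDGOperad A}
    (h : α.toAInfinity V = β.toAInfinity V) : α = β := by
  have hf : IsAlgebraHom α β ⟨LinearMap.id, fun hx => hx, fun _ => rfl⟩ :=
    isAlgebraHom_of_isStrictHom V hV α β _ (by rw [h]; exact ⟨rfl, fun _ _ _ => rfl⟩)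
  have e : α.θ = β.θ := funext fun n => LinearMap.ext fun x => MultilinearMap.ext fun a => hf n x a
  obtain ⟨θ, _, _, _, _, _⟩ := α
  obtain ⟨θ', _, _, _, _, _⟩ := β
  obtain rfl : θ = θ' := e
  rfl

/-- Algebras over an operad isomorphic to that of strictly unital `A_∞`-algebras are strictly
unital `A_∞`-algebras. -/
noncomputable def operadAlgebraEquiv {P : UOperad.{u} k} (V : UnitalMu P) (ψ : UHom P (ainfOperad k))
    (h : ∀ n x, ψ.toFun n (V.hom.toFun n x) = x) (h' : ∀ n x, V.hom.toFun n (ψ.toFun n x) = x)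
    (A : DGMod.{u, v} k) : OperadAlgebra P.toDGOperad A ≃ StrictlyUnitalAInfinity A :=
  have right (S : StrictlyUnitalAInfinity A) : (S.algebra.comap ψ).toAInfinity V = S :=
    StrictlyUnitalAInfinity.ext
      (fun n hn => (congrArg (S.algebra.θ n) ((congrArg (ψ.toFun n) (V.hom_mu hn).symm).trans
        (h n _))).trans (S.algebra_mu hn))
      ((congrArg (fun x => S.algebra.θ 0 x ![]) ψ.map_unit).trans S.algebra_unit)
  { toFun α := α.toAInfinity V
    invFun S := S.algebra.comap ψ
    left_inv _ := OperadAlgebra.ext_of_toAInfinity V (fun n x => ⟨_, h' n x⟩) (right _)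
    right_inv := right }

end Algebras

end StrictUnits

theorem mainTheorem7 {k : Type u} [Field k] [CharZero k] :
    (∃ (P : StrictUnits.UOperad.{u} k) (ρ : StrictUnits.UHom P (StrictUnits.assPlus k)),
      StrictUnits.IsMinimalModel ρ) ∧
    ∀ (P : StrictUnits.UOperad.{u} k) (ρ : StrictUnits.UHom P (StrictUnits.assPlus k)),
      StrictUnits.IsMinimalModel ρ →
      ∃ μ : ∀ n : ℕ, P.obj n,
        (∀ n : ℕ, 2 ≤ n → μ n ∈ (P.obj n).gr (2 - (n : ℤ))) ∧
        ρ.toFun 2 (μ 2) = StrictUnits.assMul k ∧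
        (∀ n : ℕ, 2 ≤ n → (P.obj n).d (μ n)
          = ∑ s : StrictUnits.Splitting n, ∑ i : Fin s.1.1,
              s.sign i • P.comp s.eq i (μ s.1.1) (μ s.1.2)) ∧
        (∀ i : Fin 2, P.res rfl i (μ 2) = P.one) ∧
        (∀ n : ℕ, 2 ≤ n → ∀ i : Fin (n + 1), P.res rfl i (μ (n + 1)) = 0) ∧
        ∃ Φ : ∀ A : StrictUnits.DGMod.{u, v} k,
            StrictUnits.OperadAlgebra P.toDGOperad A ≃ StrictUnits.StrictlyUnitalAInfinity A,
          (∀ (A : StrictUnits.DGMod.{u, v} k)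
            (α : StrictUnits.OperadAlgebra P.toDGOperad A),
              (Φ A α).unit = α.θ 0 P.unit ![] ∧
              ∀ (n : ℕ) (hn : 2 ≤ n), (Φ A α).μ n hn = α.θ n (μ n)) ∧
          (∀ (A B : StrictUnits.DGMod.{u, v} k)
            (α : StrictUnits.OperadAlgebra P.toDGOperad A)
            (β : StrictUnits.OperadAlgebra P.toDGOperad B) (f : StrictUnits.DGHom A B),
              StrictUnits.IsAlgebraHom α β f ↔ StrictUnits.IsStrictHom (Φ A α) (Φ B β) f) := by
  refine ⟨⟨_, _, StrictUnits.ainfAug_isMinimalModel⟩, fun P ρ hρ => ?_⟩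
  obtain ⟨φ, ψ, h, h', hφ⟩ := hρ.exists_iso
  obtain ⟨V, hV⟩ : ∃ V : StrictUnits.UnitalMu P,
      ∀ n, V.mu n = φ.toFun n (StrictUnits.ainfMu k n) :=
    ⟨StrictUnits.ainfUnital.map φ, fun _ => rfl⟩
  have e : ∀ n x, V.hom.toFun n x = φ.toFun n x := fun n x =>
    StrictUnits.ainf_hom_ext (fun m hm => (V.hom_mu hm).trans (hV m)) x
  have hl : ∀ n x, ψ.toFun n (V.hom.toFun n x) = x := fun n x =>
    (congrArg _ (e n x)).trans (h n x)
  have hr : ∀ n x, V.hom.toFun n (ψ.toFun n x) = x := fun n x => (e n _).trans (h' n x)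
  refine ⟨V.mu, fun _ => V.mu_mem, ?_, fun _ => V.d_mu, V.mu_two_unit, fun _ => V.mu_unit,
    StrictUnits.operadAlgebraEquiv V ψ hl hr, fun A α => ⟨rfl, fun _ _ => rfl⟩,
    fun A B α β f => ⟨StrictUnits.isStrictHom_of_isAlgebraHom V α β f,
      StrictUnits.isAlgebraHom_of_isStrictHom V (fun n x => ⟨_, hr n x⟩) α β f⟩⟩
  rw [hV, hφ]
  exact (StrictUnits.assUnital k).hom_mu le_rfl
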